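/- Write $\langle\xi\rangle=(1+|\xi|^2)^{1/2}$. A function $a\in C^\infty(\mathbb R^n\times\mathbb R^n;\mathbb C)$ belongs to $S^m_{1,0}$ if for all multi-indices $\beta,\gamma$ there is a constant $C_{\beta,\gamma}$ with $|\partial_\xi^\gamma\partial_x^\beta a(x,\xi)|\le C_{\beta,\gamma}\langle\xi\rangle^{m-|\gamma|}$ for all $(x,\xi)$; a family $(a_t)_{t\in(0,1)}$ is in $S^m_{1,0}$ uniformly in $t$ if the constants can be chosen independent of $t$. Let $\widehat f(\xi)=\int f(x)e^{-ix\cdot\xi}\,dx$. Theorem. Let $m\le 0$, $\varepsilon\in(0,1/2)$ and $\Omega=\mathbb R^n\times\{|\xi|>1\}$. Suppose that $a_t\in S^m_{1,0}$ uniformly in $t\in(0,1)$, that each $a_t$ has its support in $\Omega$, that $\rho=\rho(\xi)\in S^0_{1,0}$, and that $\varphi\in C^\infty(\Omega)$ is real-valued and such that (i) for some constants $C_1,C_2>0$, $C_1|\xi|\le|\nabla_x\varphi(x,\xi)|\le C_2|\xi|$ for all $(x,\xi)\in\Omega$; (ii) for all $|\alpha|,|\beta|\ge1$, $|\partial_x^\alpha\varphi(x,\xi)|\lesssim\langle\xi\rangle$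 and $|\partial_\xi^\alpha\partial_x^\beta\varphi(x,\xi)|\lesssim|\xi|^{1-|\alpha|}$ for all $(x,\xi)\in\Omega$. For Schwartz $f$ put $T^\varphi_{a_t}f(x)=(2\pi)^{-n}\int a_t(x,\xi)\widehat f(\xi)e^{i\varphi(x,\xi)}\,d\xi$, and let $\rho(tD)$ be the Fourier multiplier with symbol $\rho(t\xi)$, acting on tempered distributions (in particular on bounded functions). Then for all $t\in(0,1)$ and $x,\xi\in\mathbb R^n$ the oscillatory integral $$\sigma_t(x,\xi)=(2\pi)^{-n}\iint a_t(y,\xi)\,\rho(t\eta)\,e^{i(x-y)\cdot\eta+i\varphi(y,\xi)-i\varphi(x,\xi)}\,d\eta\,dy$$ exists (as the limit for $\delta\to0^+$ of the integrals with the cut-off $\kappa(\delta y,\delta\eta)$, for every Schwartz function $\kappa$ with $\kappa(0)=1$; for $|\xi|\le 1$ the integrand is $0$), and $\rho(tD)T^\varphi_{a_t}f=T^\varphi_{\sigma_t}f$ for every Schwartz function $f$, both $T^\varphi_{a_t}f$ and $T^\varphi_{\sigma_t}f$ being bounded functions. Moreover there are functions $\sigma_\alpha(t,x,\xi)$, $|\alpha|\geq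 1$, smooth in $(x,\xi)\in\mathbb R^n\times\mathbb R^n$, such that for every integer $M\ge1$ $$\sigma_t(x,\xi)=\rho(t\nabla_x\varphi(x,\xi))\,a_t(x,\xi)+\sum_{0<|\alpha|<M}\frac{t^{|\alpha|}}{\alpha!}\,\sigma_\alpha(t,x,\xi)+t^{M\varepsilon}r(t,x,\xi),\qquad t\in(0,1),\ x,\xi\in\mathbb R^n,$$ for some $r=r_M$ (the first term being $0$ where $|\xi|\le1$). Here, for all multi-indices $\beta,\gamma$, with constants independent of $t\in(0,1)$ and $x,\xi\in\mathbb R^n$, $$|\partial_\xi^\gamma\partial_x^\beta\sigma_\alpha(t,x,\xi)|\lesssim t^{|\alpha|(\varepsilon-1)}\langle\xi\rangle^{m-|\alpha|(\frac12-\varepsilon)-|\gamma|}\qquad(|\alpha|\ge 1),$$ and $r(t,\cdot,\cdot)\in S^{m-M(1/2-\varepsilon)}_{1,0}$ uniformly in $t\in(0,1)$, that is, $$\sup_{t\in(0,1)}|\partial_\xi^\gamma\partial_x^\beta r(t,x,\xi)|\lesssim\langle\xi\rangle^{m-M(\frac12-\varepsilon)-|\gamma|}.$$ -/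

import Mathlib

open scoped SchwartzMap ContDiff Topology

noncomputable section

namespace FourierIntOp

/-- The Euclidean space `ℝⁿ`. -/
abbrev E (n : ℕ) := EuclideanSpace ℝ (Fin n)

/-- The Japanese bracket `⟨ξ⟩ = (1 + |ξ|²)^{1/2}`. -/
def bracket {n : ℕ} (ξ : E n) : ℝ := Real.sqrt (1 + ‖ξ‖ ^ 2)

/-- The order `|α|` of a multi-index. -/
def order {n : ℕ} (α : Fin n → ℕ) : ℕ := ∑ i, α i

/-- The factorial `α!` of a multi-index. -/
def multiFactorial {n : ℕ} (α : Fin n → ℕ) : ℕ := ∏ i, Nat.factorial (α i)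

/-- The first order partial derivative `∂ᵢ g`. -/
def partialDeriv {n : ℕ} {F : Type*} [NormedAddCommGroup F] [NormedSpace ℝ F]
    (i : Fin n) (g : E n → F) : E n → F :=
  fun x => fderiv ℝ g x (EuclideanSpace.single i 1)

/-- The partial derivative `∂^α g = ∂₁^{α₁} ⋯ ∂ₙ^{αₙ} g`. -/
def multiDeriv {n : ℕ} {F : Type*} [NormedAddCommGroup F] [NormedSpace ℝ F]
    (α : Fin n → ℕ) (g : E n → F) : E n → F :=
  (List.finRange n).foldr (fun i h => (partialDeriv i)^[α i] h) g

/-- The mixed partial derivative `∂_ξ^γ ∂_x^β a (x, ξ)`. -/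
def mixedDeriv {n : ℕ} {F : Type*} [NormedAddCommGroup F] [NormedSpace ℝ F]
    (γ β : Fin n → ℕ) (a : E n → E n → F) (x ξ : E n) : F :=
  multiDeriv γ (fun η => multiDeriv β (fun y => a y η) x) ξ

/-- `a` is a symbol in the Hörmander class `S^m_{rho, del}(n, 1)`. -/
structure IsSymbol {n : ℕ} (m rho del : ℝ) (a : E n → E n → ℂ) : Prop where
  smooth : ContDiff ℝ ∞ (fun p : E n × E n => a p.1 p.2)
  bound : ∀ γ β : Fin n → ℕ, ∃ C : ℝ, ∀ x ξ : E n,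
    ‖mixedDeriv γ β a x ξ‖ ≤ C * bracket ξ ^ (m - rho * (order γ : ℝ) + del * (order β : ℝ))

/-- `a_t` belongs to `S^m_{rho, del}(n, 1)` uniformly in `t ∈ (0, 1)`: the constants in the symbol
estimates do not depend on `t`. -/
structure IsUniformSymbol {n : ℕ} (m rho del : ℝ) (a : ℝ → E n → E n → ℂ) : Prop where
  smooth : ∀ t ∈ Set.Ioo (0 : ℝ) 1, ContDiff ℝ ∞ (fun p : E n × E n => a t p.1 p.2)
  bound : ∀ γ β : Fin n → ℕ, ∃ C : ℝ, ∀ t ∈ Set.Ioo (0 : ℝ) 1, ∀ x ξ : E n,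
    ‖mixedDeriv γ β (a t) x ξ‖ ≤ C * bracket ξ ^ (m - rho * (order γ : ℝ) + del * (order β : ℝ))

/-- The region `ℝⁿ × {|ξ| > 1}`. -/
def highFreq (n : ℕ) : Set (E n × E n) := {p | 1 < ‖p.2‖}

/-- The Fourier transform `∫ f(x) e^{-i x·ξ} dx`. -/
def fourierT {n : ℕ} (f : E n → ℂ) (ξ : E n) : ℂ :=
  ∫ x, f x * Complex.exp (-Complex.I * (inner ℝ x ξ : ℝ))

/-- The Fourier integral operator with phase `φ` and amplitude `a`,
`(2π)^{-n} ∫ a(x, ξ) f̂(ξ) e^{iφ(x, ξ)} dξ`. -/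
def fio {n : ℕ} (φ : E n → E n → ℝ) (a : E n → E n → ℂ) (f : E n → ℂ) (x : E n) : ℂ :=
  ((2 * Real.pi : ℝ) : ℂ)⁻¹ ^ n *
    ∫ ξ, a x ξ * fourierT f ξ * Complex.exp (Complex.I * (φ x ξ : ℝ))

/-- `p(D) g = h` for bounded functions `g` and `h`, where `p(D)` is the Fourier multiplier with
symbol `p`, acting on tempered distributions. Mathlib's Fourier transform uses the kernel
`e^{-2π i x·ξ}`, whence the factor `2π`. -/
def MultiplierEq {n : ℕ} (p : E n → ℂ) (g h : E n → ℂ) : Prop :=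
  ∃ (hg : MeasureTheory.MemLp g ⊤ MeasureTheory.volume)
    (hh : MeasureTheory.MemLp h ⊤ MeasureTheory.volume),
    TemperedDistribution.fourierMultiplierCLM ℂ (fun ξ : E n => p ((2 * Real.pi) • ξ))
        (MeasureTheory.Lp.toTemperedDistribution (hg.toLp g)) =
      MeasureTheory.Lp.toTemperedDistribution (hh.toLp h)

/-- The oscillatory integral `∬ F(y, η) dy dη` exists and equals `c`: for every Schwartz cut-off
`κ` with `κ(0) = 1`, the integrals `∬ κ(δy, δη) F(y, η) dy dη` are absolutely convergent for
`δ > 0` and tend to `c` as `δ → 0⁺`. -/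
def HasOscIntegral {n : ℕ} (F : E n → E n → ℂ) (c : ℂ) : Prop :=
  ∀ κ : 𝓢(E n × E n, ℂ), κ 0 = 1 →
    (∀ δ : ℝ, 0 < δ →
      MeasureTheory.Integrable (fun p : E n × E n => κ (δ • p) * F p.1 p.2)) ∧
    Filter.Tendsto (fun δ : ℝ => ∫ p : E n × E n, κ (δ • p) * F p.1 p.2) (𝓝[>] 0) (𝓝 c)

/-- The integrand `(2π)^{-n} a(y, ξ) ρ(tη) e^{i(x-y)·η + iφ(y, ξ) - iφ(x, ξ)}` of the amplitude of
the composition `ρ(tD) T_a^φ`. -/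
def compositionIntegrand {n : ℕ} (φ : E n → E n → ℝ) (a : E n → E n → ℂ) (ρ : E n → ℂ)
    (t : ℝ) (x ξ y η : E n) : ℂ :=
  ((2 * Real.pi : ℝ) : ℂ)⁻¹ ^ n * (a y ξ * ρ (t • η) *
    Complex.exp (Complex.I * ((inner ℝ (x - y) η + φ y ξ - φ x ξ : ℝ) : ℂ)))

end FourierIntOp

end

/-! Write `λ = ⟨ξ⟩` and `z = y - x`. Factoring out the phase, `σ_t(x, ξ)` is `e^{-iφ(x,ξ)}` times
`ρ(tD)` applied to `a_t(·, ξ)e^{iφ(·,ξ)}` at `x`, hence the pairing of the multiplier with the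
Fourier transform in `z` of `fullAmp`, the amplitude `a_t(x+z, ξ)e^{i(φ(x+z,ξ)-φ(x,ξ))}`. The
pairing `opT` is made absolutely convergent by integration by parts. `tendsto_osc` shows that it is
the limit of the cut-off integrals, and `integral_mul_fourier_eq_opT` proves the operator identity
by duality.

Removing the linear part of the phase translates the multiplier to `t∇_xφ(x, ξ)` and leaves
`redAmp`, whose phase is `O(λ|z|²)`. Each derivative of `redAmp` at `z = 0` therefore costs
`λ^{1/2}` (`Admissible.germ_redAmp_zero`). Taylor's formula for `ρ` at `t∇_xφ` gives the expansion:
its `k`-th term is made of products `t^k ∂^kρ(t∇_xφ) ∂_z^k redAmp(0)`. Since `|∇_xφ|` is comparable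
to `λ`, the factor `∂^kρ` is at most a multiple of `(tλ)^{-k(1-ε)}`, so the term has size
`t^{kε}λ^{m-k(1/2-ε)}` (`Admissible.germ_expTerm`).

The remainder of order `N` is first bounded in sup norm by any power of `t/λ`, for `N` large
(`Admissible.norm_expRem_le`). If `tλ⁴ ≤ 1`, the plain Taylor remainder gains `tλ²` per order, which
suffices. If `tλ⁴ > 1`, powers of `λ⁻¹` are enough. The multiplier is then cut at the frequency
`λ^{3/4}`: the low part is negligible by nonstationary phase, because the phase has gradient of size
`λ`, while for the high part a derivative of the multiplier gains `λ^{-3/4}` against the loss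
`λ^{1/2}` from `redAmp`.

For the derivatives of the remainder there are a priori bounds with a polynomial loss in `λ` that
does not depend on `N` (`Admissible.germ_expRem`). Interpolating between them and the sup bound
gives every derivative any power of `t/λ`. The remainder of a prescribed order `M` is the one of a
much larger order plus finitely many terms that already have the required size
(`Admissible.germ_expRem_rescale`).

All estimates are uniform in `t, x, ξ, z`. This is organised by `GermBound`, where the parameters
form the index type and only derivatives at one point per index are recorded. Symbol estimates
become bounds at unit scale once the frequency is divided by `λ`. -/

noncomputable section
namespace FourierIntOp

/-! ### Calculus of uniform derivative bounds for families of germs. -/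

section GermFamily

variable {ι κ V V' F G H : Type*} [NormedAddCommGroup V] [NormedSpace ℝ V]
  [NormedAddCommGroup V'] [NormedSpace ℝ V']
  [NormedAddCommGroup F] [NormedSpace ℝ F] [NormedAddCommGroup G] [NormedSpace ℝ G]
  [NormedAddCommGroup H] [NormedSpace ℝ H]

theorem _root_.ContDiffAt.exists_contDiffOn_isOpen {f : V → F} {x : V}
    (h : ContDiffAt ℝ ∞ f x) (n : ℕ) : ∃ u, IsOpen u ∧ x ∈ u ∧ ContDiffOn ℝ n f u := by
  obtain ⟨u, hu, hxu, hfu⟩ := ContDiffWithinAt.contDiffOn' (m := (n : ℕ∞ω)) (n := ∞) (s := Set.univ)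
    (by exact_mod_cast le_top) (by simp) h
  exact ⟨u, hu, hxu, by simpa using hfu⟩

/-- The derivatives of a family of functions `f p` at the points `z p` are bounded by the weight
`W p`, each derivative costing a factor `s p`. -/
def GermBound (z : ι → V) (s W : ι → ℝ) (f : ι → V → F) : Prop :=
  (∀ p, ContDiffAt ℝ ∞ (f p) (z p)) ∧
    ∀ i : ℕ, ∃ C : ℝ, ∀ p, ‖iteratedFDeriv ℝ i (f p) (z p)‖ ≤ C * (W p * s p ^ i)

variable {z : ι → V} {s s' W W' : ι → ℝ} {f : ι → V → F}

/-- Finitely many constants are merged into one, taken at least 1 so that it is also nonnegative;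
the signs of the scales and weights allow the passage to absolute values. -/
theorem GermBound.bound (h : GermBound z s W f) (hs : ∀ p, 0 ≤ s p) (hW : ∀ p, 0 ≤ W p) (n : ℕ) :
    ∃ C : ℝ, 1 ≤ C ∧ ∀ i ≤ n, ∀ p, ‖iteratedFDeriv ℝ i (f p) (z p)‖ ≤ C * (W p * s p ^ i) := by
  choose C hC using h.2
  refine ⟨1 + ∑ i ∈ Finset.range (n + 1), |C i|, ?_, fun i hi p => (hC i p).trans ?_⟩
  · have : 0 ≤ ∑ i ∈ Finset.range (n + 1), |C i| := Finset.sum_nonneg fun _ _ => abs_nonneg _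
    linarith
  · have h1 : |C i| ≤ ∑ i ∈ Finset.range (n + 1), |C i| :=
      Finset.single_le_sum (f := fun i => |C i|) (fun _ _ => abs_nonneg _)
        (Finset.mem_range.2 (by omega))
    have := hW p
    have := hs p
    gcongr
    linarith [le_abs_self (C i)]

theorem GermBound.congr {g : ι → V → F} (h : GermBound z s W f) (hfg : ∀ p, g p =ᶠ[𝓝 (z p)] f p) :
    GermBound z s W g := by
  refine ⟨fun p => (h.1 p).congr_of_eventuallyEq (hfg p), fun i => ?_⟩
  obtain ⟨C, hC⟩ := h.2 i
  exact ⟨C, fun p => by rw [((hfg p).iteratedFDeriv ℝ i).eq_of_nhds]; exact hC p⟩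

theorem GermBound.mono (h : GermBound z s W f) (hs : ∀ p, 0 ≤ s p) (hW : ∀ p, 0 ≤ W p)
    (c d : ℝ) (hWW : ∀ p, W p ≤ c * W' p) (hss : ∀ p, s p ≤ d * s' p) :
    GermBound z s' W' f := by
  refine ⟨h.1, fun i => ?_⟩
  obtain ⟨C, hC, hCb⟩ := h.bound hs hW i
  refine ⟨C * (c * d ^ i), fun p => (hCb i le_rfl p).trans ?_⟩
  calc C * (W p * s p ^ i) ≤ C * ((c * W' p) * (d * s' p) ^ i) := by
        have := hs p
        have := hW p
        have h1 := (hW p).trans (hWW p)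
        gcongr
        · exact hWW p
        · exact hss p
    _ = _ := by ring

/-- Uniformity in new parameters is obtained by pulling back along a map of index types, with
unchanged constants. Moving the base point of an estimate is done in the same way. -/
theorem GermBound.reindex (h : GermBound z s W f) (τ : κ → ι) :
    GermBound (z ∘ τ) (s ∘ τ) (W ∘ τ) (f ∘ τ) :=
  ⟨fun p => h.1 (τ p), fun i => (h.2 i).imp fun _ hC p => hC (τ p)⟩

theorem GermBound.add {g : ι → V → F} (hf : GermBound z s W f) (hg : GermBound z s W g)  :
    GermBound z s W (fun p y => f p y + g p y) := by
  refine ⟨fun p => (hf.1 p).add (hg.1 p), fun i => ?_⟩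
  obtain ⟨C, hC⟩ := hf.2 i
  obtain ⟨D, hD⟩ := hg.2 i
  refine ⟨C + D, fun p => ?_⟩
  change ‖iteratedFDeriv ℝ i (f p + g p) (z p)‖ ≤ _
  rw [iteratedFDeriv_add_apply ((hf.1 p).of_le (by exact_mod_cast le_top))
    ((hg.1 p).of_le (by exact_mod_cast le_top)), add_mul]
  exact (norm_add_le _ _).trans (add_le_add (hC p) (hD p))

theorem GermBound.zero : GermBound z s W (fun _ _ => (0 : F)) :=
  ⟨fun _ => contDiffAt_const, fun i => ⟨0, fun p => by
    have : (fun _ : V => (0 : F)) = 0 := rfl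
    simp [this]⟩⟩

theorem GermBound.sum {J : Type*} (t : Finset J) {g : J → ι → V → F}
    (hg : ∀ j ∈ t, GermBound z s W (g j)) :
    GermBound z s W (fun p y => ∑ j ∈ t, g j p y) := by
  classical
  induction t using Finset.induction_on with
  | empty => simpa using GermBound.zero
  | insert j t hj ih =>
    simp only [Finset.sum_insert hj]
    exact (hg j (by simp)).add (ih fun k hk => hg k (by simp [hk]))

/-- Smoothness at a point gives `C^n` on an open neighbourhood, where derivatives within the set are
the full ones, so the Leibniz estimate on sets can be applied there. -/
theorem _root_.ContDiffAt.norm_iteratedFDeriv_le_of_bilinear (B : F →L[ℝ] G →L[ℝ] H) {f : V → F}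
    {g : V → G} {x : V} (hf : ContDiffAt ℝ ∞ f x) (hg : ContDiffAt ℝ ∞ g x) (n : ℕ) :
    ‖iteratedFDeriv ℝ n (fun y => B (f y) (g y)) x‖ ≤ ‖B‖ * ∑ i ∈ Finset.range (n + 1),
      (n.choose i : ℝ) * ‖iteratedFDeriv ℝ i f x‖ * ‖iteratedFDeriv ℝ (n - i) g x‖ := by
  obtain ⟨u, hu, hxu, hfu⟩ := hf.exists_contDiffOn_isOpen n
  obtain ⟨v, hv, hxv, hgv⟩ := hg.exists_contDiffOn_isOpen n
  have ho := hu.inter hv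
  have hx : x ∈ u ∩ v := ⟨hxu, hxv⟩
  have := B.norm_iteratedFDerivWithin_le_of_bilinear (hfu.mono Set.inter_subset_left)
    (hgv.mono Set.inter_subset_right) ho.uniqueDiffOn hx (n := n) le_rfl
  simpa only [iteratedFDerivWithin_of_isOpen _ ho hx] using this

theorem GermBound.bilin (B : F →L[ℝ] G →L[ℝ] H) {g : ι → V → G}
    (hf : GermBound z s W f) (hg : GermBound z s W' g) (hs : ∀ p, 0 ≤ s p)
    (hW : ∀ p, 0 ≤ W p) (hW' : ∀ p, 0 ≤ W' p) :
    GermBound z s (fun p => W p * W' p) (fun p y => B (f p y) (g p y)) := by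
  refine ⟨fun p => by
    have h1 := hf.1 p
    have h2 := hg.1 p
    exact (B.contDiff.contDiffAt.comp _ h1).clm_apply h2, fun n => ?_⟩
  obtain ⟨C, hC, hCb⟩ := hf.bound hs hW n
  obtain ⟨D, hD, hDb⟩ := hg.bound hs hW' n
  refine ⟨‖B‖ * ∑ i ∈ Finset.range (n + 1), (n.choose i : ℝ) * C * D, fun p =>
    ((hf.1 p).norm_iteratedFDeriv_le_of_bilinear B (hg.1 p) n).trans ?_⟩
  rw [mul_assoc, Finset.sum_mul]
  have := hs p
  have := hW p
  have := hW' p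
  refine mul_le_mul_of_nonneg_left (Finset.sum_le_sum fun i hi => ?_) (by positivity)
  rw [Finset.mem_range] at hi
  calc (n.choose i : ℝ) * ‖iteratedFDeriv ℝ i (f p) (z p)‖ * ‖iteratedFDeriv ℝ (n - i) (g p) (z p)‖
      ≤ (n.choose i : ℝ) * (C * (W p * s p ^ i)) * (D * (W' p * s p ^ (n - i))) := by
        gcongr
        · exact hCb i (by omega) p
        · exact hDb (n - i) (by omega) p
    _ = (n.choose i : ℝ) * C * D * (W p * W' p * (s p ^ i * s p ^ (n - i))) := by ring
    _ = _ := by rw [← pow_add]; congr 3; omega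

theorem GermBound.mul {f g : ι → V → ℂ} (hf : GermBound z s W f) (hg : GermBound z s W' g)
    (hs : ∀ p, 0 ≤ s p) (hW : ∀ p, 0 ≤ W p) (hW' : ∀ p, 0 ≤ W' p) :
    GermBound z s (fun p => W p * W' p) (fun p y => f p y * g p y) :=
  hf.bilin (ContinuousLinearMap.mul ℝ ℂ) hg hs hW hW'

theorem GermBound.clm_comp (L : ι → F →L[ℝ] G) (hf : GermBound z s W f) :
    GermBound z s (fun p => ‖L p‖ * W p) (fun p y => L p (f p y)) := by
  refine ⟨fun p => (L p).contDiff.contDiffAt.comp _ (hf.1 p), fun n => ?_⟩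
  obtain ⟨C, hC⟩ := hf.2 n
  refine ⟨C, fun p => ((L p).norm_iteratedFDeriv_comp_left (hf.1 p)
    (by exact_mod_cast le_top)).trans ?_⟩
  calc _ ≤ ‖L p‖ * (C * (W p * s p ^ n)) := by gcongr; exact hC p
    _ = _ := by ring

theorem GermBound.const_mul {f : ι → V → ℂ} (c : ι → ℂ) (hf : GermBound z s W f) :
    GermBound z s (fun p => ‖c p‖ * W p) (fun p y => c p * f p y) := by
  have := hf.clm_comp (fun p => (ContinuousLinearMap.mul ℝ ℂ (c p)))
  simpa using this

theorem GermBound.const_mul' {f : ι → V → ℂ} (c : ℂ) (hf : GermBound z s W f) :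
    GermBound z s W (fun p y => c * f p y) := by
  have := hf.const_mul (fun _ => c)
  refine ⟨this.1, fun i => ?_⟩
  obtain ⟨C, hC⟩ := this.2 i
  exact ⟨C * ‖c‖, fun p => (hC p).trans (le_of_eq (by ring))⟩

theorem GermBound.const_smul {c : ι → ℝ} (hf : GermBound z s W f) :
    GermBound z s (fun p => |c p| * W p) (fun p y => c p • f p y) := by
  refine ⟨fun p => (hf.1 p).const_smul _, fun i => ?_⟩
  obtain ⟨C, hC⟩ := hf.2 i
  refine ⟨C, fun p => ?_⟩
  change ‖iteratedFDeriv ℝ i (c p • f p) (z p)‖ ≤ _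
  rw [iteratedFDeriv_const_smul_apply ((hf.1 p).of_le (by exact_mod_cast le_top)), norm_smul]
  calc _ ≤ |c p| * (C * (W p * s p ^ i)) := by
        rw [Real.norm_eq_abs]; gcongr; exact hC p
    _ = _ := by ring

theorem GermBound.const (c : ι → F) (hs : ∀ p, 0 ≤ s p) (hW : ∀ p, 0 ≤ W p)
    (C : ℝ) (hc : ∀ p, ‖c p‖ ≤ C * W p) :
    GermBound z s W (fun p _ => c p) := by
  refine ⟨fun p => contDiffAt_const, fun i => ⟨max C 0, fun p => ?_⟩⟩
  have h0 := hs p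
  have h1 := hW p
  rcases Nat.eq_zero_or_pos i with rfl | hi
  · simp only [norm_iteratedFDeriv_zero, pow_zero, mul_one]
    exact (hc p).trans (by gcongr; exact le_max_left _ _)
  · rw [iteratedFDeriv_const_of_ne (by omega)]
    simp only [Pi.zero_apply, norm_zero]
    positivity

/-- A bounded family of affine maps. -/
theorem _root_.norm_iteratedFDeriv_clm_le (L : V →L[ℝ] F) (c : F) (x : V) (i : ℕ) (hi : 1 ≤ i) :
    ‖iteratedFDeriv ℝ i (fun y => c + L y) x‖ ≤ if i = 1 then ‖L‖ else 0 := by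
  obtain ⟨i, rfl⟩ : ∃ k, i = k + 1 := ⟨i - 1, by omega⟩
  have e : fderiv ℝ (fun y => c + L y) = fun _ => L := by
    ext1 y; simp
  rw [← norm_iteratedFDeriv_fderiv, e]
  rcases Nat.eq_zero_or_pos i with rfl | hi
  · simp
  · rw [iteratedFDeriv_const_of_ne (by omega)]; simp; split_ifs <;> simp

theorem GermBound.clm (L : ι → V →L[ℝ] F) (hs : ∀ p, 0 ≤ s p) (hW : ∀ p, 0 ≤ W p) (C : ℝ)
    (h0 : ∀ p, ‖L p (z p)‖ ≤ C * W p) (h1 : ∀ p, ‖L p‖ ≤ C * (W p * s p)) :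
    GermBound z s W (fun p y => L p y) := by
  refine ⟨fun p => (L p).contDiff.contDiffAt, fun i => ⟨max C 0, fun p => ?_⟩⟩
  have hs := hs p
  have hW := hW p
  rcases Nat.eq_zero_or_pos i with rfl | hi
  · simp only [norm_iteratedFDeriv_zero, pow_zero, mul_one]
    exact (h0 p).trans (by gcongr; exact le_max_left _ _)
  · have := norm_iteratedFDeriv_clm_le (L p) 0 (z p) i hi
    simp only [zero_add] at this
    refine this.trans ?_
    split_ifs with h
    · subst h
      rw [pow_one]
      exact (h1 p).trans (by gcongr; exact le_max_left _ _)
    · positivity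

theorem _root_.ContDiffAt.iteratedFDeriv_comp_affine {f : F → G} (c : F) (L : V →L[ℝ] F)
    {x : V} (hf : ContDiffAt ℝ ∞ f (c + L x)) (n : ℕ) :
    iteratedFDeriv ℝ n (fun y => f (c + L y)) x =
      (iteratedFDeriv ℝ n f (c + L x)).compContinuousLinearMap fun _ => L := by
  have hf' : ContDiffAt ℝ ∞ (fun y => f (c + y)) (L x) :=
    ContDiffAt.comp (L x) hf (contDiffAt_const.add contDiffAt_id)
  obtain ⟨u, hu, hxu, hfu⟩ := hf'.exists_contDiffOn_isOpen n
  have ho : IsOpen (L ⁻¹' u) := hu.preimage L.continuous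
  have := L.iteratedFDerivWithin_comp_right (f := fun y => f (c + y)) hfu hu.uniqueDiffOn
    ho.uniqueDiffOn (x := x) hxu (i := n) le_rfl
  rw [iteratedFDerivWithin_of_isOpen _ ho hxu, iteratedFDerivWithin_of_isOpen _ hu hxu] at this
  have e : (fun y => f (c + L y)) = (fun y => f (c + y)) ∘ L := rfl
  rw [e, this, iteratedFDeriv_comp_add_left' n c]

theorem _root_.ContDiffAt.norm_iteratedFDeriv_comp_affine_le {f : F → G} (c : F) (L : V →L[ℝ] F)
    {x : V} (hf : ContDiffAt ℝ ∞ f (c + L x)) (n : ℕ) :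
    ‖iteratedFDeriv ℝ n (fun y => f (c + L y)) x‖ ≤
      ‖iteratedFDeriv ℝ n f (c + L x)‖ * ‖L‖ ^ n := by
  rw [hf.iteratedFDeriv_comp_affine c L n]
  refine (ContinuousMultilinearMap.norm_compContinuousLinearMap_le _ _).trans ?_
  simp

/-- Each derivative of the composition brings one factor `‖L p‖`, so an affine substitution
multiplies the scale. All changes of scale below are made with it. -/
theorem GermBound.comp_affine {f : ι → F → G} (c : ι → F) (L : ι → V →L[ℝ] F)
    (hf : GermBound (fun p => c p + L p (z p)) s W f) :
    GermBound z (fun p => s p * ‖L p‖) W (fun p y => f p (c p + L p y)) := by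
  refine ⟨fun p => ContDiffAt.comp (z p) (hf.1 p)
    (contDiffAt_const.add (L p).contDiff.contDiffAt), fun i => ?_⟩
  obtain ⟨C, hC⟩ := hf.2 i
  refine ⟨C, fun p => ((hf.1 p).norm_iteratedFDeriv_comp_affine_le (c p) (L p) i).trans ?_⟩
  calc _ ≤ C * (W p * s p ^ i) * ‖L p‖ ^ i := by gcongr; exact hC p
    _ = _ := by ring

theorem _root_.ContDiffAt.norm_iteratedFDeriv_comp_le {g : F → G} {f : V → F} {n : ℕ} {x : V}
    (hg : ContDiffAt ℝ ∞ g (f x)) (hf : ContDiffAt ℝ ∞ f x) {C D : ℝ}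
    (hC : ∀ i, i ≤ n → ‖iteratedFDeriv ℝ i g (f x)‖ ≤ C)
    (hD : ∀ i, 1 ≤ i → i ≤ n → ‖iteratedFDeriv ℝ i f x‖ ≤ D ^ i) :
    ‖iteratedFDeriv ℝ n (fun y => g (f y)) x‖ ≤ n.factorial * C * D ^ n := by
  obtain ⟨u, hu, hxu, hgu⟩ := hg.exists_contDiffOn_isOpen n
  obtain ⟨v, hv, hxv, hfv⟩ := hf.exists_contDiffOn_isOpen n
  have ho : IsOpen (v ∩ f ⁻¹' u) := hfv.continuousOn.isOpen_inter_preimage hv hu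
  have hx : x ∈ v ∩ f ⁻¹' u := ⟨hxv, hxu⟩
  have := norm_iteratedFDerivWithin_comp_le hgu (hfv.mono Set.inter_subset_left) (n := n) le_rfl
    hu.uniqueDiffOn ho.uniqueDiffOn (fun y hy => hy.2) hx (C := C) (D := D)
  simp only [iteratedFDerivWithin_of_isOpen _ ho hx, iteratedFDerivWithin_of_isOpen _ hu hxu] at this
  exact this hC hD

/-- A Faà di Bruno estimate. Only the derivatives of order at least one of the inner family enter,
never its size. -/
theorem GermBound.comp {g : ι → F → G} (hg : GermBound (fun p => f p (z p)) (fun _ => 1) W g)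
    (hf : ∀ p, ContDiffAt ℝ ∞ (f p) (z p)) (hs : ∀ p, 0 ≤ s p) (hW : ∀ p, 0 ≤ W p)
    (hfb : ∀ i : ℕ, 1 ≤ i → ∃ C : ℝ, ∀ p, ‖iteratedFDeriv ℝ i (f p) (z p)‖ ≤ C * s p ^ i) :
    GermBound z s W (fun p y => g p (f p y)) := by
  refine ⟨fun p => ContDiffAt.comp _ (hg.1 p) (hf p), fun n => ?_⟩
  obtain ⟨C, hC, hCb⟩ := hg.bound (fun _ => zero_le_one) hW n
  have : ∃ D : ℝ, 1 ≤ D ∧ ∀ i, 1 ≤ i → i ≤ n → ∀ p,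
      ‖iteratedFDeriv ℝ i (f p) (z p)‖ ≤ D * s p ^ i := by
    choose! C hC using hfb
    refine ⟨1 + ∑ i ∈ Finset.range (n + 1), |C i|, ?_, fun i h1 hi p => (hC i h1 p).trans ?_⟩
    · have : 0 ≤ ∑ i ∈ Finset.range (n + 1), |C i| := Finset.sum_nonneg fun _ _ => abs_nonneg _
      linarith
    · have h1 : |C i| ≤ ∑ i ∈ Finset.range (n + 1), |C i| :=
        Finset.single_le_sum (f := fun i => |C i|) (fun _ _ => abs_nonneg _)
          (Finset.mem_range.2 (by omega))
      have := hs p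
      gcongr
      linarith [le_abs_self (C i)]
  obtain ⟨D, hD, hDb⟩ := this
  refine ⟨n.factorial * C * D ^ n, fun p => ?_⟩
  have := (hg.1 p).norm_iteratedFDeriv_comp_le (hf p) (n := n) (C := C * W p) (D := D * s p)
    (fun i hi => by simpa using hCb i hi p)
    (fun i h1 hi => (hDb i h1 hi p).trans (by
      rw [mul_pow]
      have := hs p
      gcongr
      exact le_self_pow₀ hD (by omega)))
  refine this.trans (le_of_eq ?_)
  rw [mul_pow]; ring

theorem GermBound.higher (h : GermBound z s W f) (i : ℕ) (hW : ∀ p, W p ≤ 1) (hW0 : ∀ p, 0 ≤ W p)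
    (hs : ∀ p, 0 ≤ s p) :
    ∃ C : ℝ, ∀ p, ‖iteratedFDeriv ℝ i (f p) (z p)‖ ≤ C * s p ^ i := by
  obtain ⟨C, h1, hC⟩ := h.bound hs hW0 i
  refine ⟨C, fun p => (hC i le_rfl p).trans ?_⟩
  have := hs p
  gcongr
  exact mul_le_of_le_one_left (by positivity) (hW p)

/-- The directional derivative. -/
def dirDeriv (v : V) (g : V → F) : V → F := fun y => fderiv ℝ g y v

theorem _root_.ContDiffAt.fderiv_infty {f : V → F} {x : V} (hf : ContDiffAt ℝ ∞ f x) :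
    ContDiffAt ℝ ∞ (fderiv ℝ f) x :=
  hf.fderiv_right (m := ∞) (by simp)

theorem _root_.ContDiffAt.dirDeriv {f : V → F} {x : V} (hf : ContDiffAt ℝ ∞ f x) (v : V) :
    ContDiffAt ℝ ∞ (dirDeriv v f) x :=
  hf.fderiv_infty.clm_apply contDiffAt_const

theorem GermBound.fderiv (hf : GermBound z s W f) :
    GermBound z s (fun p => W p * s p) (fun p => fderiv ℝ (f p)) := by
  refine ⟨fun p => (hf.1 p).fderiv_infty, fun i => ?_⟩
  obtain ⟨C, hC⟩ := hf.2 (i + 1)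
  refine ⟨C, fun p => ?_⟩
  rw [norm_iteratedFDeriv_fderiv]
  exact (hC p).trans (le_of_eq (by ring))

theorem GermBound.dirDeriv (hf : GermBound z s W f) (v : V) (hs : ∀ p, 0 ≤ s p)
    (hW : ∀ p, 0 ≤ W p) :
    GermBound z s (fun p => W p * s p) (fun p => dirDeriv v (f p)) := by
  have := hf.fderiv.clm_comp (fun _ => ContinuousLinearMap.apply ℝ F v)
  refine this.mono hs (fun p => ?_) ‖ContinuousLinearMap.apply ℝ F v‖ 1 (fun p => le_rfl)
    (fun p => by simp)
  have := hs p
  have := hW p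
  positivity

theorem iteratedDeriv_cexp_I (i : ℕ) :
    iteratedDeriv i (fun x : ℝ => Complex.exp (Complex.I * x)) =
      fun x : ℝ => Complex.I ^ i * Complex.exp (Complex.I * x) := by
  induction i with
  | zero => simp
  | succ k ih =>
    rw [iteratedDeriv_succ, ih]
    ext x
    have h : HasDerivAt (fun x : ℝ => Complex.exp (Complex.I * x))
        (Complex.exp (Complex.I * x) * (Complex.I * 1)) x :=
      ((Complex.ofRealCLM.hasDerivAt (x := x)).const_mul Complex.I).cexp
    rw [(h.const_mul _).deriv]
    ring

theorem contDiff_cexp_I : ContDiff ℝ ∞ (fun x : ℝ => Complex.exp (Complex.I * x)) :=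
  (contDiff_const.mul Complex.ofRealCLM.contDiff).cexp

/-- All derivatives of `x ↦ e^{ix}` have modulus one, so the phase may be arbitrarily large as long
as its derivatives are controlled. -/
theorem GermBound.cexp_I {h : ι → V → ℝ} (hs : ∀ p, 0 ≤ s p)
    (hc : ∀ p, ContDiffAt ℝ ∞ (h p) (z p))
    (hb : ∀ i : ℕ, 1 ≤ i → ∃ C : ℝ, ∀ p, ‖iteratedFDeriv ℝ i (h p) (z p)‖ ≤ C * s p ^ i) :
    GermBound z s (fun _ => 1) (fun p y => Complex.exp (Complex.I * (h p y : ℝ))) := by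
  refine GermBound.comp (g := fun _ x => Complex.exp (Complex.I * (x : ℝ))) ?_ hc hs
    (fun _ => zero_le_one) hb
  refine ⟨fun p => contDiff_cexp_I.contDiffAt, fun i => ⟨1, fun p => ?_⟩⟩
  rw [norm_iteratedFDeriv_eq_norm_iteratedDeriv, iteratedDeriv_cexp_I]
  simp [Complex.norm_exp]

end GermFamily

end FourierIntOp
end

noncomputable section
namespace FourierIntOp

/-! ### Iterated directional derivatives and the full iterated derivative. -/

section DirectionalDerivatives

variable {V V' F : Type*} [NormedAddCommGroup V] [NormedSpace ℝ V]
  [NormedAddCommGroup V'] [NormedSpace ℝ V'] [NormedAddCommGroup F] [NormedSpace ℝ F]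

/-- Iterated directional derivatives. -/
def dirDerivs (l : List V) (g : V → F) : V → F := l.foldr dirDeriv g

@[simp] theorem dirDerivs_nil (g : V → F) : dirDerivs [] g = g := rfl

@[simp] theorem dirDerivs_cons (v : V) (l : List V) (g : V → F) :
    dirDerivs (v :: l) g = dirDeriv v (dirDerivs l g) := rfl

theorem dirDerivs_append (l l' : List V) (g : V → F) :
    dirDerivs (l ++ l') g = dirDerivs l (dirDerivs l' g) := by
  simp [dirDerivs]

theorem dirDeriv_congr {f g : V → F} {x : V} (h : f =ᶠ[𝓝 x] g) (v : V) :
    dirDeriv v f =ᶠ[𝓝 x] dirDeriv v g :=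
  (h.fderiv (𝕜 := ℝ)).mono fun y hy => by simp [dirDeriv, hy]

theorem dirDerivs_congr {f g : V → F} {x : V} (h : f =ᶠ[𝓝 x] g) (l : List V) :
    dirDerivs l f =ᶠ[𝓝 x] dirDerivs l g := by
  induction l with
  | nil => exact h
  | cons v l ih => exact dirDeriv_congr ih v

theorem contDiffAt_dirDerivs (l : List V) {f : V → F} {x : V} {k : ℕ}
    (hf : ContDiffAt ℝ (k + l.length : ℕ) f x) : ContDiffAt ℝ k (dirDerivs l f) x := by
  induction l generalizing k with
  | nil => simpa using hf
  | cons v l ih =>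
    have h1 : ContDiffAt ℝ (k + 1 : ℕ) (dirDerivs l f) x :=
      ih (hf.of_le (by simp; norm_cast; omega))
    exact (h1.fderiv_right (m := k) (by simp)).clm_apply contDiffAt_const

theorem contDiffAt_infty_dirDerivs (l : List V) {f : V → F} {x : V}
    (hf : ContDiffAt ℝ ∞ f x) : ContDiffAt ℝ ∞ (dirDerivs l f) x := by
  induction l with
  | nil => exact hf
  | cons v l ih => exact ih.dirDeriv v

theorem _root_.ContDiffAt.eventually_nat {f : V → F} {x : V} {k : ℕ} (hf : ContDiffAt ℝ k f x) :
    ∀ᶠ y in 𝓝 x, ContDiffAt ℝ k f y :=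
  hf.eventually (by exact_mod_cast (WithTop.coe_ne_top (a := (k : ℕ))))

theorem iteratedFDeriv_eq_dirDerivs {k : ℕ} (v : Fin k → V) {f : V → F} {x : V}
    (hf : ContDiffAt ℝ k f x) : iteratedFDeriv ℝ k f x v = dirDerivs (List.ofFn v) f x := by
  induction k generalizing x with
  | zero => simp
  | succ k ih =>
    have hev : dirDerivs (List.ofFn fun i : Fin k => v i.succ) f =ᶠ[𝓝 x]
        fun y => iteratedFDeriv ℝ k f y (Fin.tail v) := by
      filter_upwards [hf.eventually_nat] with y hy
      rw [← ih (fun i => v i.succ) (hy.of_le (by norm_cast; omega))]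
      rfl
    rw [iteratedFDeriv_succ_apply_left, List.ofFn_succ, dirDerivs_cons, dirDeriv,
      hev.fderiv_eq]
    have hd : DifferentiableAt ℝ (iteratedFDeriv ℝ k f) x :=
      hf.differentiableAt_iteratedFDeriv (by norm_cast; omega)
    have := (hd.hasFDerivAt.continuousMultilinear_apply_const (Fin.tail v)).fderiv
    rw [this]
    rfl

theorem norm_dirDerivs_le (l : List V) {f : V → F} {x : V} (hf : ContDiffAt ℝ l.length f x) :
    ‖dirDerivs l f x‖ ≤ ‖iteratedFDeriv ℝ l.length f x‖ * (l.map fun v => ‖v‖).prod := by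
  have := iteratedFDeriv_eq_dirDerivs l.get hf
  rw [List.ofFn_get] at this
  rw [← this]
  refine (ContinuousMultilinearMap.le_opNorm _ _).trans (le_of_eq ?_)
  congr 1
  rw [← List.prod_ofFn]
  congr 1
  conv_rhs => rw [← List.ofFn_get l, List.map_ofFn]
  rfl

theorem dirDeriv_comm {f : V → F} {x : V} (hf : ContDiffAt ℝ 2 f x) (v w : V) :
    dirDeriv v (dirDeriv w f) x = dirDeriv w (dirDeriv v f) x := by
  have h : IsSymmSndFDerivAt ℝ f x := hf.isSymmSndFDerivAt (by simp)
  have hd : DifferentiableAt ℝ (fderiv ℝ f) x :=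
    (hf.fderiv_right (m := 1) (by norm_num)).differentiableAt (by norm_num)
  have e : ∀ v w, dirDeriv v (dirDeriv w f) x = fderiv ℝ (fderiv ℝ f) x v w := by
    intro v w
    have := (hd.hasFDerivAt.clm_apply (hasFDerivAt_const w x)).fderiv
    unfold dirDeriv
    rw [this]; simp
  rw [e, e]
  exact h v w

/-- Adjacent directions commute by symmetry of the second derivative. Under a further derivative the
equality is needed near the point, which is why smoothness is propagated to a neighbourhood. -/
theorem dirDerivs_perm {l l' : List V} (hl : l.Perm l') {f : V → F} {x : V}
    (hf : ContDiffAt ℝ l.length f x) : dirDerivs l f x = dirDerivs l' f x := by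
  induction hl generalizing x with
  | nil => rfl
  | @cons v l l' _ ih =>
    have : dirDerivs l f =ᶠ[𝓝 x] dirDerivs l' f := by
      filter_upwards [hf.eventually_nat] with y hy
      exact ih (hy.of_le (by simp))
    exact (dirDeriv_congr this v).eq_of_nhds
  | swap v w l =>
    simp only [dirDerivs_cons]
    exact dirDeriv_comm (contDiffAt_dirDerivs (k := 2) l (hf.of_le (by simp; norm_cast; omega))) _ _
  | trans h₁ _ ih₁ ih₂ =>
    rw [ih₁ hf, ih₂ (by rwa [← h₁.length_eq])]

theorem dirDerivs_comp_affine (l : List V') (L : V' →L[ℝ] V) (c : V) {f : V → F} {y : V'}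
    (hf : ContDiffAt ℝ l.length f (c + L y)) :
    dirDerivs l (fun y => f (c + L y)) y = dirDerivs (l.map L) f (c + L y) := by
  induction l generalizing y with
  | nil => rfl
  | cons v l ih =>
    have hc : ContinuousAt (fun y => c + L y) y := by fun_prop
    have : dirDerivs l (fun y => f (c + L y)) =ᶠ[𝓝 y]
        fun y => dirDerivs (l.map L) f (c + L y) := by
      filter_upwards [hc.eventually hf.eventually_nat] with z hz
      exact ih (hz.of_le (by simp))
    have h1 : DifferentiableAt ℝ (dirDerivs (l.map L) f) (c + L y) :=
      (contDiffAt_dirDerivs (k := 1) (l.map L) (hf.of_le (by simp; norm_cast; omega))).differentiableAt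
        (by norm_num)
    have h2 : HasFDerivAt (fun y => c + L y) L y := L.hasFDerivAt.const_add c
    simp only [dirDerivs_cons, List.map_cons]
    rw [(dirDeriv_congr this v).eq_of_nhds]
    unfold dirDeriv
    have := (h1.hasFDerivAt.comp y h2).fderiv
    rw [show (fun y => dirDerivs (l.map L) f (c + L y)) = dirDerivs (l.map L) f ∘ fun y => c + L y
      from rfl, this]
    rfl

end DirectionalDerivatives

/-! ### Multi-indices, and symbol estimates as bounds at unit scale. -/

section MultiIndices

variable {n : ℕ} {F : Type*} [NormedAddCommGroup F] [NormedSpace ℝ F]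

/-- The standard basis vector. -/
abbrev basisVec (i : Fin n) : E n := EuclideanSpace.single i 1

/-- The list of directions with multiplicities given by a multi-index. -/
def indexList (β : Fin n → ℕ) : List (Fin n) :=
  (List.finRange n).flatMap fun i => List.replicate (β i) i

theorem length_indexList (β : Fin n → ℕ) : (indexList β).length = order β := by
  simp [indexList, order, List.length_flatMap, ← List.ofFn_eq_map, List.sum_ofFn]

theorem multiDeriv_eq_dirDerivs (β : Fin n → ℕ) (g : E n → F) :
    multiDeriv β g = dirDerivs ((indexList β).map basisVec) g := by
  unfold multiDeriv indexList
  induction List.finRange n with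
  | nil => rfl
  | cons i l ih =>
    simp only [List.foldr_cons, ih, List.flatMap_cons, List.map_append, List.map_replicate,
      dirDerivs_append]
    generalize dirDerivs _ g = h
    induction β i with
    | zero => rfl
    | succ k ihk => rw [Function.iterate_succ_apply', ihk]; rfl

/-- Permutations of lists of directions are detected below by counting, which uses the boolean
equality of the sum type. -/
instance instLawfulBEqSum : LawfulBEq (Fin n ⊕ Fin n) where
  eq_of_beq {a b} h := by
    rcases a with a | a <;> rcases b with b | b <;> first | cases h | exact congrArg _ (eq_of_beq h)
  rfl {a} := by
    rcases a with a | a <;> exact beq_self_eq_true a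

/-- The directions in the product space. -/
def pairVec : Fin n ⊕ Fin n → E n × E n
  | .inl i => (basisVec i, 0)
  | .inr i => (0, basisVec i)

/-- The directions of a mixed derivative. -/
def mixedList (γ β : Fin n → ℕ) : List (Fin n ⊕ Fin n) :=
  (indexList γ).map .inr ++ (indexList β).map .inl

theorem length_mixedList (γ β : Fin n → ℕ) :
    (mixedList γ β).length = order γ + order β := by
  simp [mixedList, length_indexList]

theorem mixedDeriv_eq_dirDerivs (γ β : Fin n → ℕ) {a : E n → E n → F} {x ξ : E n}
    (ha : ContDiffAt ℝ (order γ + order β : ℕ) (fun p : E n × E n => a p.1 p.2) (x, ξ)) :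
    mixedDeriv γ β a x ξ =
      dirDerivs ((mixedList γ β).map pairVec) (fun p : E n × E n => a p.1 p.2) (x, ξ) := by
  have h1 : (fun η => multiDeriv β (fun y => a y η) x) =ᶠ[𝓝 ξ] fun η =>
      dirDerivs (((indexList β).map basisVec).map (ContinuousLinearMap.inl ℝ (E n) (E n)))
        (fun p : E n × E n => a p.1 p.2) (((x, 0) : E n × E n) +
          ContinuousLinearMap.inr ℝ (E n) (E n) η) := by
    have hc : Filter.Tendsto (fun η : E n => (x, η)) (𝓝 ξ) (𝓝 (x, ξ)) := by
      apply ContinuousAt.tendsto; fun_prop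
    filter_upwards [hc.eventually ha.eventually_nat] with η hη
    rw [multiDeriv_eq_dirDerivs]
    have := dirDerivs_comp_affine ((indexList β).map basisVec) (ContinuousLinearMap.inl ℝ (E n) (E n))
      ((0, η) : E n × E n) (f := fun p : E n × E n => a p.1 p.2) (y := x)
      (by simpa [length_indexList] using hη.of_le (by norm_cast; omega))
    simpa using this
  unfold mixedDeriv
  rw [multiDeriv_eq_dirDerivs, (dirDerivs_congr h1 _).eq_of_nhds, dirDerivs_comp_affine]
  · simp only [ContinuousLinearMap.inr_apply, Prod.mk_add_mk, add_zero, zero_add, mixedList,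
      List.map_append, List.map_map, dirDerivs_append]
    rfl
  · apply contDiffAt_dirDerivs
    simpa [length_indexList] using ha

theorem count_indexList (β : Fin n → ℕ) (i : Fin n) : (indexList β).count i = β i := by
  simp only [indexList, List.count_flatMap, Function.comp_def, List.count_replicate]
  rw [← List.ofFn_eq_map, List.sum_ofFn]
  simp

/-- A list of coordinate directions is determined up to order by multiplicities; together with
symmetry, every iterated derivative along them is one of the derivatives in the symbol estimates. -/
theorem perm_mixedList (l : List (Fin n ⊕ Fin n)) :
    l.Perm (mixedList (fun i => l.count (.inr i)) (fun i => l.count (.inl i))) := by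
  rw [List.perm_iff_count]
  rintro (i | i) <;>
  simp [mixedList, List.count_map_of_injective, Sum.inl_injective, Sum.inr_injective,
    count_indexList, List.count_eq_zero]

theorem dirDerivs_eq_mixedDeriv (l : List (Fin n ⊕ Fin n)) {a : E n → E n → F} {x ξ : E n}
    (ha : ContDiffAt ℝ l.length (fun p : E n × E n => a p.1 p.2) (x, ξ)) :
    dirDerivs (l.map pairVec) (fun p : E n × E n => a p.1 p.2) (x, ξ) =
      mixedDeriv (fun i => l.count (.inr i)) (fun i => l.count (.inl i)) a x ξ := by
  have hp := perm_mixedList l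
  rw [mixedDeriv_eq_dirDerivs]
  · exact dirDerivs_perm (hp.map _) (by simpa using ha)
  · rwa [← length_mixedList, ← hp.length_eq]

/-- The dilation of the frequency variable. -/
def dilate (lam : ℝ) : (E n × E n) →L[ℝ] (E n × E n) :=
  (ContinuousLinearMap.id ℝ (E n)).prodMap (lam • ContinuousLinearMap.id ℝ (E n))

@[simp] theorem dilate_apply (lam : ℝ) (q : E n × E n) : dilate lam q = (q.1, lam • q.2) := rfl

/-- In the frequency variable `lam⁻¹ξ` a `ξ`-derivative is `lam⁻¹` times a derivative at unit scale.
With `lam = ⟨ξ⟩`, this and `germBound_of_mixedDeriv` translate symbol estimates to unit scale and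
back, so the gain `⟨ξ⟩^{-|γ|}` takes care of itself. -/
theorem norm_mixedDeriv_le (γ β : Fin n → ℕ) {a : E n → E n → F} {x ξ : E n} {lam : ℝ}
    (hl : 0 < lam) (ha : ContDiffAt ℝ ∞ (fun p : E n × E n => a p.1 p.2) (x, ξ)) :
    ‖mixedDeriv γ β a x ξ‖ ≤ ‖iteratedFDeriv ℝ (order γ + order β)
      (fun q : E n × E n => a q.1 (lam • q.2)) (x, lam⁻¹ • ξ)‖ * (lam⁻¹) ^ order γ := by
  have h0 : (dilate lam : E n × E n → _) ((dilate lam⁻¹ : E n × E n → _) (x, ξ)) = (x, ξ) := by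
    simp [hl.ne']
  have hc : ContDiffAt ℝ ∞ (fun q : E n × E n => a q.1 (lam • q.2)) (dilate lam⁻¹ (x, ξ)) :=
    ContDiffAt.comp (g := fun p : E n × E n => a p.1 p.2) (f := dilate lam) _
      (by rw [h0]; exact ha) (dilate lam).contDiff.contDiffAt
  rw [mixedDeriv_eq_dirDerivs γ β (ha.of_le (by exact_mod_cast le_top))]
  have h1 := dirDerivs_comp_affine ((mixedList γ β).map pairVec) (dilate lam⁻¹) 0
    (f := fun q : E n × E n => a q.1 (lam • q.2)) (y := (x, ξ))
    (by rw [zero_add]; exact hc.of_le (by exact_mod_cast le_top))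
  have h2 : (fun y : E n × E n => (fun q : E n × E n => a q.1 (lam • q.2))
      (0 + (dilate lam⁻¹ : E n × E n → _) y)) = fun p : E n × E n => a p.1 p.2 := by
    ext y; simp [hl.ne']
  rw [h2, zero_add] at h1
  rw [h1]
  refine (norm_dirDerivs_le _ (hc.of_le (by exact_mod_cast le_top))).trans ?_
  have hlen : (((mixedList γ β).map pairVec).map
      (dilate lam⁻¹ : E n × E n → E n × E n)).length = order γ + order β := by
    simp [length_mixedList]
  rw [hlen, List.map_map, List.map_map]
  refine le_of_eq (congrArg _ ?_)
  have e1 : (((fun v => ‖v‖) ∘ (dilate lam⁻¹ : E n × E n → _)) ∘ pairVec) ∘ Sum.inr =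
      fun _ : Fin n => lam⁻¹ := by
    ext i; simp [pairVec, Prod.norm_def, norm_smul, abs_of_pos hl, hl.le]
  have e2 : (((fun v => ‖v‖) ∘ (dilate lam⁻¹ : E n × E n → _)) ∘ pairVec) ∘ Sum.inl =
      fun _ : Fin n => (1 : ℝ) := by
    ext i; simp [pairVec, Prod.norm_def]
  rw [mixedList, List.map_append, List.map_map, List.map_map, e1, e2]
  simp [length_indexList]

theorem pairVec_sum (v : E n × E n) :
    v = ∑ j : Fin n ⊕ Fin n, (Sum.elim v.1 v.2 j) • pairVec j := by
  ext i <;> simp [Fintype.sum_sum_type, pairVec, Prod.fst_sum, Prod.snd_sum, Pi.single_apply]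

/-- Expand each argument in the basis; the coordinates of a vector are bounded by its norm. -/
theorem norm_multilinear_le {k : ℕ}
    (M : ContinuousMultilinearMap ℝ (fun _ : Fin k => E n × E n) F) :
    ‖M‖ ≤ ∑ τ : Fin k → Fin n ⊕ Fin n, ‖M fun i => pairVec (τ i)‖ := by
  refine M.opNorm_le_bound (Finset.sum_nonneg fun _ _ => norm_nonneg _) fun v => ?_
  have h : v = fun i => ∑ j : Fin n ⊕ Fin n, (Sum.elim (v i).1 (v i).2 j) • pairVec j := by
    ext1 i; exact pairVec_sum _
  conv_lhs => rw [h]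
  rw [M.map_sum, Finset.sum_mul]
  refine (norm_sum_le _ _).trans (Finset.sum_le_sum fun τ _ => ?_)
  rw [M.map_smul_univ, norm_smul, mul_comm, norm_prod]
  gcongr with i
  rcases τ i with j | j
  · simp only [Sum.elim_inl]
    exact (PiLp.norm_apply_le _ _).trans (norm_fst_le _)
  · simp only [Sum.elim_inr]
    exact (PiLp.norm_apply_le _ _).trans (norm_snd_le _)

theorem germBound_of_mixedDeriv {ι : Type*} {a : ι → E n → E n → F} {x ξ : ι → E n}
    {lam W : ι → ℝ} (hl : ∀ p, 0 < lam p)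
    (ha : ∀ p, ContDiffAt ℝ ∞ (fun q : E n × E n => a p q.1 q.2) (x p, ξ p))
    (hb : ∀ γ β : Fin n → ℕ, ∃ C : ℝ, ∀ p,
      ‖mixedDeriv γ β (a p) (x p) (ξ p)‖ ≤ C * (W p * ((lam p)⁻¹) ^ order γ)) :
    GermBound (fun p => (x p, (lam p)⁻¹ • ξ p)) (fun _ => 1) W
      (fun p q => a p q.1 (lam p • q.2)) := by
  have h0 : ∀ p, (dilate (lam p) : E n × E n → _) (x p, (lam p)⁻¹ • ξ p) = (x p, ξ p) := by
    intro p; simp [(hl p).ne']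
  have hc : ∀ p, ContDiffAt ℝ ∞ (fun q : E n × E n => a p q.1 (lam p • q.2))
      (x p, (lam p)⁻¹ • ξ p) := fun p =>
    ContDiffAt.comp (g := fun q : E n × E n => a p q.1 q.2) (f := dilate (lam p)) _
      (by rw [h0]; exact ha p) (dilate (lam p)).contDiff.contDiffAt
  refine ⟨hc, fun k => ?_⟩
  choose C hC using hb
  refine ⟨∑ τ : Fin k → Fin n ⊕ Fin n, C (fun i => (List.ofFn τ).count (.inr i))
    (fun i => (List.ofFn τ).count (.inl i)), fun p => ?_⟩
  refine (norm_multilinear_le _).trans ?_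
  rw [Finset.sum_mul]
  refine Finset.sum_le_sum fun τ _ => ?_
  rw [iteratedFDeriv_eq_dirDerivs _ ((hc p).of_le (by exact_mod_cast le_top))]
  have h1 := dirDerivs_comp_affine (List.ofFn fun i => pairVec (τ i)) (dilate (lam p)) 0
    (f := fun q : E n × E n => a p q.1 q.2) (y := (x p, (lam p)⁻¹ • ξ p))
    (by rw [zero_add, h0]; exact (ha p).of_le (by exact_mod_cast le_top))
  rw [zero_add, h0] at h1
  have h2 : (fun y : E n × E n => (fun q : E n × E n => a p q.1 q.2)
      (0 + (dilate (lam p) : E n × E n → _) y)) = fun q => a p q.1 (lam p • q.2) := by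
    ext y; simp
  rw [h2] at h1
  have h3 : ∀ j : Fin n ⊕ Fin n, (dilate (lam p) : E n × E n → _) (pairVec j) =
      (Sum.elim (fun _ => 1) (fun _ => lam p) j : ℝ) • pairVec j := by
    rintro (j | j) <;> simp [pairVec]
  have h4 : (List.ofFn fun i => pairVec (τ i)).map (dilate (lam p)) =
      List.ofFn fun i => (Sum.elim (fun _ => 1) (fun _ => lam p) (τ i) : ℝ) • pairVec (τ i) := by
    rw [List.map_ofFn]; congr 1; ext1 i; exact h3 _
  rw [h1, h4, ← iteratedFDeriv_eq_dirDerivs _ ((ha p).of_le (by exact_mod_cast le_top)),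
    ContinuousMultilinearMap.map_smul_univ,
    iteratedFDeriv_eq_dirDerivs _ ((ha p).of_le (by exact_mod_cast le_top)), norm_smul]
  have h5 : (List.ofFn fun i => (pairVec (τ i) : E n × E n)) = (List.ofFn τ).map pairVec := by
    rw [List.map_ofFn]; rfl
  rw [h5, dirDerivs_eq_mixedDeriv _ ((ha p).of_le (by exact_mod_cast le_top))]
  -- The tuple contributes one factor `lam` for each frequency direction, which cancels the decay in
  -- the hypothesis.
  have h6 : ∏ i, (Sum.elim (fun _ => 1) (fun _ => lam p) (τ i) : ℝ) =
      lam p ^ order (fun i : Fin n => (List.ofFn τ).count (.inr i)) := by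
    rw [← List.prod_ofFn]
    have h7 : (List.ofFn fun i => (Sum.elim (fun _ => 1) (fun _ => lam p) (τ i) : ℝ)) =
      (List.ofFn τ).map (Sum.elim (fun _ => 1) (fun _ => lam p)) := by
      rw [List.map_ofFn]; rfl
    rw [h7, ((perm_mixedList (List.ofFn τ)).map _).prod_eq]
    simp [mixedList, Function.comp_def, length_indexList]
  have hlp := hl p
  rw [h6, Real.norm_eq_abs, abs_of_pos (by positivity)]
  refine (mul_le_mul_of_nonneg_left (hC _ _ p) (by positivity)).trans (le_of_eq ?_)
  rw [inv_pow, one_pow]; field_simp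

/-- The phase is controlled only after at least one `x`-derivative, so it enters through its first
`x`-derivatives; their mixed derivatives have to be recognised as those of the phase. -/
theorem mixedDeriv_dirDeriv (γ β : Fin n → ℕ) (i : Fin n) {a : E n → E n → F} {x ξ : E n}
    (ha : ContDiffAt ℝ ∞ (fun p : E n × E n => a p.1 p.2) (x, ξ)) :
    mixedDeriv γ β (fun x ξ => dirDeriv (basisVec i, 0) (fun p : E n × E n => a p.1 p.2) (x, ξ)) x ξ
      = mixedDeriv γ (β + Pi.single i 1) a x ξ := by
  have ha' := ha.dirDeriv ((basisVec i, 0) : E n × E n)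
  have hk : ∀ k : ℕ, ContDiffAt ℝ k (fun p : E n × E n => a p.1 p.2) (x, ξ) :=
    fun k => ha.of_le (by exact_mod_cast le_top)
  rw [mixedDeriv_eq_dirDerivs γ β (ha'.of_le (by exact_mod_cast le_top)),
    mixedDeriv_eq_dirDerivs _ _ (hk _)]
  have : dirDeriv (basisVec i, 0) (fun p : E n × E n => a p.1 p.2) =
    dirDerivs ([Sum.inl i].map pairVec) (fun p : E n × E n => a p.1 p.2) := rfl
  change dirDerivs _ (dirDeriv (basisVec i, 0) (fun p : E n × E n => a p.1 p.2)) (x, ξ) = _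
  rw [this, ← dirDerivs_append, ← List.map_append]
  refine dirDerivs_perm (List.Perm.map _ ?_) (hk _)
  rw [List.perm_iff_count]
  rintro (j | j)
  · by_cases h : j = i
    · subst h
      simp [mixedList, List.count_map_of_injective, Sum.inl_injective,
        count_indexList]
    · simp [mixedList, List.count_map_of_injective, Sum.inl_injective,
        count_indexList, h, Ne.symm h]
  · have h : ∀ l : List (Fin n), (l.map (Sum.inl (β := Fin n))).count (Sum.inr j) = 0 := by
      simp [List.count_eq_zero]
    simp [mixedList, h]

@[simp] theorem multiDeriv_zero (g : E n → F) : multiDeriv 0 g = g := by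
  rw [multiDeriv_eq_dirDerivs]
  have : indexList (0 : Fin n → ℕ) = [] := by simp [indexList]
  simp [this]

end MultiIndices

end FourierIntOp
end

noncomputable section
namespace FourierIntOp

open MeasureTheory

/-! ### Differentiation of integrals depending on parameters. -/

section ParametricIntegrals

variable {A V F : Type*} [NormedAddCommGroup V] [NormedSpace ℝ V]
  [NormedAddCommGroup F] [NormedSpace ℝ F]

theorem integral_clm_apply_of_norm_le [CompleteSpace F] [MeasurableSpace A] {μ : Measure A}
    {φ : A → V →L[ℝ] F} (hm : AEStronglyMeasurable φ μ) {g : A → ℝ} (hg : Integrable g μ)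
    (hb : ∀ᵐ a ∂μ, ‖φ a‖ ≤ g a) (v : V) : 
    Integrable (fun a => φ a v) μ ∧ (∫ a, φ a ∂μ) v = ∫ a, φ a v ∂μ :=
  have h : Integrable φ μ := hg.mono' hm hb
  ⟨h.apply_continuousLinearMap v, ContinuousLinearMap.integral_apply h v⟩

/-- At every order `k`, the bound on the derivatives of order `k + 1` near `p` is the domination
that allows one more differentiation under the integral. -/
theorem hasFTaylorSeriesUpToOn_integral [CompleteSpace F] [MeasurableSpace A] {μ : Measure A}
    {f : A → V → F} {U : Set V} (hU : IsOpen U)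
    (h1 : ∀ a, ∀ p ∈ U, ContDiffAt ℝ ∞ (f a) p)
    (h2 : ∀ k : ℕ, ∀ p ∈ U, AEStronglyMeasurable (fun a => iteratedFDeriv ℝ k (f a) p) μ)
    (h3 : ∀ k : ℕ, ∀ p ∈ U, ∃ s ∈ 𝓝 p, ∃ g : A → ℝ, Integrable g μ ∧
      ∀ᵐ a ∂μ, ∀ p' ∈ s, ‖iteratedFDeriv ℝ k (f a) p'‖ ≤ g a) :
    HasFTaylorSeriesUpToOn ∞ (fun p => ∫ a, f a p ∂μ)
      (fun p k => ∫ a, iteratedFDeriv ℝ k (f a) p ∂μ) U := by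
  have hint : ∀ k : ℕ, ∀ p ∈ U, Integrable (fun a => iteratedFDeriv ℝ k (f a) p) μ := by
    intro k p hp
    obtain ⟨s, hs, g, hg, hgb⟩ := h3 k p hp
    exact hg.mono' (h2 k p hp) (hgb.mono fun a ha => ha p (mem_of_mem_nhds hs))
  have hd : ∀ k : ℕ, ∀ p ∈ U, HasFDerivAt (fun p => ∫ a, iteratedFDeriv ℝ k (f a) p ∂μ)
      (∫ a, iteratedFDeriv ℝ (k + 1) (f a) p ∂μ).curryLeft p := by
    intro k p hp
    obtain ⟨s, hs, g, hg, hgb⟩ := h3 (k + 1) p hp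
    let J := continuousMultilinearCurryLeftEquiv ℝ (fun _ : Fin (k + 1) => V) F
    have hcurry : ∀ a, ∀ p, fderiv ℝ (iteratedFDeriv ℝ k (f a)) p =
        J (iteratedFDeriv ℝ (k + 1) (f a) p) := by
      intro a p
      rw [fderiv_iteratedFDeriv]; rfl
    have hm : AEStronglyMeasurable (fun a => fderiv ℝ (iteratedFDeriv ℝ k (f a)) p) μ := by
      simp only [hcurry]
      exact J.continuous.comp_aestronglyMeasurable (h2 (k + 1) p hp)
    have key := hasFDerivAt_integral_of_dominated_of_fderiv_le
      (μ := μ) (F := fun p a => iteratedFDeriv ℝ k (f a) p) (𝕜 := ℝ)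
      (F' := fun p a => fderiv ℝ (iteratedFDeriv ℝ k (f a)) p) (x₀ := p) (bound := g)
      (s := s ∩ U) (Filter.inter_mem hs (hU.mem_nhds hp))
      (Filter.eventually_of_mem (hU.mem_nhds hp) fun q hq => h2 k q hq) (hint k p hp) hm
      (hgb.mono fun a ha q hq => by
        rw [norm_fderiv_iteratedFDeriv]; exact ha q hq.1) hg
      (Filter.Eventually.of_forall fun a q hq =>
        ((h1 a q hq.2).differentiableAt_iteratedFDeriv (m := k)
          (by exact_mod_cast WithTop.coe_lt_top k)).hasFDerivAt)
    have e : (∫ a, fderiv ℝ (iteratedFDeriv ℝ k (f a)) p ∂μ) =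
        (∫ a, iteratedFDeriv ℝ (k + 1) (f a) p ∂μ).curryLeft := by
      have hJ := integral_clm_apply_of_norm_le hm hg (hgb.mono fun a ha => by
          rw [norm_fderiv_iteratedFDeriv]; exact ha p (mem_of_mem_nhds hs))
      ext v w
      rw [(hJ v).2, ContinuousMultilinearMap.integral_apply (hJ v).1,
        ContinuousMultilinearMap.curryLeft_apply,
        ContinuousMultilinearMap.integral_apply (hint (k + 1) p hp)]
      rfl
    rwa [e] at key
  refine ⟨fun p hp => ?_, fun k _ p hp => (hd k p hp).hasFDerivWithinAt, fun k _ p hp =>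
    (hd k p hp).continuousAt.continuousWithinAt⟩
  have := (continuousMultilinearCurryFin0 ℝ V F).toContinuousLinearEquiv.toContinuousLinearMap.integral_comp_comm
    (hint 0 p hp)
  exact this.symm

variable [NormedAddCommGroup A] [NormedSpace ℝ A]

/-- The derivatives in the second variable are the full derivatives restricted to the directions
`inr`, so joint smoothness makes them continuous in the integration variable as well. -/
theorem continuousOn_iteratedFDeriv_slice {f : A → V → F} {U : Set V} (hU : IsOpen U)
    (hf : ∀ a, ∀ p ∈ U, ContDiffAt ℝ ∞ (fun q : A × V => f q.1 q.2) (a, p)) (k : ℕ) :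
    ContinuousOn (fun q : A × V => iteratedFDeriv ℝ k (f q.1) q.2) (Set.univ ×ˢ U) := by
  have ho : IsOpen (Set.univ ×ˢ U : Set (A × V)) := isOpen_univ.prod hU
  have hc : ContDiffOn ℝ k (fun q : A × V => f q.1 q.2) (Set.univ ×ˢ U) := fun q hq =>
    ((hf q.1 q.2 hq.2).of_le (by exact_mod_cast le_top)).contDiffWithinAt
  have h1 := (hc.continuousOn_iteratedFDerivWithin (m := k) le_rfl ho.uniqueDiffOn)
  have h2 : ContinuousOn (fun q : A × V => ContinuousMultilinearMap.compContinuousLinearMapL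
      (fun _ : Fin k => ContinuousLinearMap.inr ℝ A V)
      (iteratedFDerivWithin ℝ k (fun q : A × V => f q.1 q.2) (Set.univ ×ˢ U) q)) (Set.univ ×ˢ U) :=
    (ContinuousLinearMap.continuous _).comp_continuousOn h1
  refine h2.congr fun q hq => ?_
  beta_reduce
  rw [iteratedFDerivWithin_of_isOpen _ ho hq]
  have := ContDiffAt.iteratedFDeriv_comp_affine (f := fun q : A × V => f q.1 q.2)
    (q.1, 0) (ContinuousLinearMap.inr ℝ A V) (x := q.2) (by simpa using hf q.1 q.2 hq.2) k
  simpa using this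

theorem contDiffAt_slice {f : A → V → F} {a : A} {p : V}
    (hf : ContDiffAt ℝ ∞ (fun q : A × V => f q.1 q.2) (a, p)) : ContDiffAt ℝ ∞ (f a) p :=
  ContDiffAt.comp (g := fun q : A × V => f q.1 q.2) p hf (contDiffAt_const.prodMk contDiffAt_id)

/-- Differentiation under an integral over a bounded interval. -/
theorem hasFTaylorSeriesUpToOn_integral_Icc [CompleteSpace F] [FiniteDimensional ℝ V]
    {f : ℝ → V → F} {U : Set V} (hU : IsOpen U)
    (hf : ∀ a, ∀ p ∈ U, ContDiffAt ℝ ∞ (fun q : ℝ × V => f q.1 q.2) (a, p)) :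
    HasFTaylorSeriesUpToOn ∞ (fun p => ∫ a in Set.Icc (0 : ℝ) 1, f a p)
      (fun p k => ∫ a in Set.Icc (0 : ℝ) 1, iteratedFDeriv ℝ k (f a) p) U := by
  have : ProperSpace V := FiniteDimensional.proper ℝ V
  have hc := continuousOn_iteratedFDeriv_slice hU hf
  refine hasFTaylorSeriesUpToOn_integral hU (fun a p hp => contDiffAt_slice (hf a p hp))
    (fun k p hp => ?_) (fun k p hp => ?_)
  · have : Continuous (fun a => iteratedFDeriv ℝ k (f a) p) :=
      (hc k).comp_continuous (f := fun a => (a, p)) (by fun_prop) fun a => ⟨trivial, hp⟩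
    exact this.aestronglyMeasurable
  · obtain ⟨r, hr, hrU⟩ := Metric.nhds_basis_closedBall.mem_iff.1 (hU.mem_nhds hp)
    obtain ⟨C, hC⟩ := (isCompact_Icc.prod (isCompact_closedBall p r)).exists_bound_of_continuousOn
      ((hc k).mono (Set.prod_mono (Set.subset_univ (Set.Icc (0:ℝ) 1)) hrU))
    refine ⟨_, Metric.closedBall_mem_nhds p hr, fun _ => C, ?_, ?_⟩
    · exact integrableOn_const (by simp) 
    · filter_upwards [ae_restrict_mem measurableSet_Icc] with a ha p' hp'
      exact hC (a, p') ⟨ha, hp'⟩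

end ParametricIntegrals

theorem _root_.HasFTaylorSeriesUpToOn.iteratedFDeriv_eq {V F : Type*} [NormedAddCommGroup V]
    [NormedSpace ℝ V] [NormedAddCommGroup F] [NormedSpace ℝ F] {f : V → F} {U : Set V}
    {q : V → FormalMultilinearSeries ℝ V F} (h : HasFTaylorSeriesUpToOn ∞ f q U) (hU : IsOpen U)
    {p : V} (hp : p ∈ U) (k : ℕ) : iteratedFDeriv ℝ k f p = q p k := by
  rw [← iteratedFDerivWithin_of_isOpen k hU hp]
  exact (h.eq_iteratedFDerivWithin_of_uniqueDiffOn (by exact_mod_cast le_top) hU.uniqueDiffOn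
    hp).symm

theorem _root_.HasFTaylorSeriesUpToOn.contDiffAt_infty {V F : Type*} [NormedAddCommGroup V]
    [NormedSpace ℝ V] [NormedAddCommGroup F] [NormedSpace ℝ F] {f : V → F} {U : Set V}
    {q : V → FormalMultilinearSeries ℝ V F} (h : HasFTaylorSeriesUpToOn ∞ f q U) (hU : IsOpen U)
    {p : V} (hp : p ∈ U) : ContDiffAt ℝ ∞ f p :=
  (h.contDiffOn p hp).contDiffAt (hU.mem_nhds hp)

/-- Differentiation of an integral depending on parameters, against an integrable weight. -/
theorem hasFTaylorSeriesUpToOn_integral_mul {A V : Type*} [NormedAddCommGroup A] [NormedSpace ℝ A]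
    [NormedAddCommGroup V] [NormedSpace ℝ V] [MeasurableSpace A] [BorelSpace A]
    [SecondCountableTopology A] {μ : Measure A}
    {f : A → V → ℂ} {w : A → ℂ} (hw : AEStronglyMeasurable w μ)
    (hf : ContDiff ℝ ∞ (fun q : A × V => f q.1 q.2))
    (h3 : ∀ k : ℕ, ∀ p, ∃ s ∈ 𝓝 p, ∃ g : A → ℝ, Integrable (fun a => ‖w a‖ * g a) μ ∧
      ∀ a, ∀ p' ∈ s, ‖iteratedFDeriv ℝ k (f a) p'‖ ≤ g a) :
    HasFTaylorSeriesUpToOn ∞ (fun p => ∫ a, w a * f a p ∂μ)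
      (fun p k => ∫ a, w a • iteratedFDeriv ℝ k (f a) p ∂μ) Set.univ := by
  have hc := continuousOn_iteratedFDeriv_slice isOpen_univ (fun a p _ => hf.contDiffAt (x := (a, p)))
  have hs : ∀ a p, ContDiffAt ℝ ∞ (f a) p := fun a p => contDiffAt_slice hf.contDiffAt
  have he : ∀ k a p, iteratedFDeriv ℝ k (fun p => w a * f a p) p =
      w a • iteratedFDeriv ℝ k (f a) p := by
    intro k a p
    exact iteratedFDeriv_const_smul_apply (a := w a)
      ((hs a p).of_le (by exact_mod_cast le_top))
  have := hasFTaylorSeriesUpToOn_integral (μ := μ) (f := fun a p => w a * f a p) isOpen_univ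
    (fun a p _ => contDiffAt_const.mul (hs a p)) (fun k p _ => ?_) (fun k p _ => ?_)
  · simpa only [he] using this
  · simp only [he]
    have h1 : Continuous (fun a => iteratedFDeriv ℝ k (f a) p) :=
      (hc k).comp_continuous (f := fun a => (a, p)) (by fun_prop) fun a => ⟨trivial, trivial⟩
    exact hw.smul h1.aestronglyMeasurable
  · obtain ⟨s, hs, g, hg, hgb⟩ := h3 k p
    refine ⟨s, hs, _, hg, Filter.Eventually.of_forall fun a p' hp' => ?_⟩
    rw [he, norm_smul]
    gcongr
    exact hgb a p' hp'

end FourierIntOp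
end

noncomputable section
namespace FourierIntOp

open MeasureTheory FourierTransform

/-! ### The operator `1 - Δ/4π²` used for integration by parts. -/

section BesselOperator

variable {n : ℕ} {ι V V' : Type*} [NormedAddCommGroup V] [NormedSpace ℝ V]
  [NormedAddCommGroup V'] [NormedSpace ℝ V']

/-- The operator `1 - (4π²)⁻¹ ∑ⱼ ∂ⱼ²` for the directions `e`. -/
def bessel (e : Fin n → V) (f : V → ℂ) : V → ℂ := fun z =>
  f z - (((4 * Real.pi ^ 2)⁻¹ : ℝ) : ℂ) * ∑ j, dirDeriv (e j) (dirDeriv (e j) f) z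

theorem GermBound.neg {z : ι → V} {s W : ι → ℝ} {f : ι → V → ℂ} (h : GermBound z s W f) :
    GermBound z s W (fun p y => - f p y) := by
  simpa using h.const_mul' (-1)

theorem GermBound.bessel {z : ι → V} {s W : ι → ℝ} {f : ι → V → ℂ} (e : Fin n → V)
    (h : GermBound z s W f) (hs : ∀ p, 1 ≤ s p) (hW : ∀ p, 0 ≤ W p) :
    GermBound z s (fun p => W p * s p ^ 2) (fun p => bessel e (f p)) := by
  have hs0 : ∀ p, 0 ≤ s p := fun p => zero_le_one.trans (hs p)
  have h1 : GermBound z s (fun p => W p * s p ^ 2) f :=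
    h.mono hs0 hW 1 1 (fun p => by
      rw [one_mul]; exact le_mul_of_one_le_right (hW p) (one_le_pow₀ (hs p))) (by simp)
  have h2 : ∀ j ∈ Finset.univ, GermBound z s (fun p => W p * s p ^ 2)
      (fun p => FourierIntOp.dirDeriv (e j) (FourierIntOp.dirDeriv (e j) (f p))) := fun j _ => by
    have := (h.dirDeriv (e j) hs0 hW).dirDeriv (e j) hs0 (fun p => mul_nonneg (hW p) (hs0 p))
    simpa [pow_two, mul_assoc] using this
  have := h1.add ((GermBound.sum _ h2).const_mul' (((4 * Real.pi ^ 2)⁻¹ : ℝ) : ℂ)).neg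
  simp only [← sub_eq_add_neg] at this
  exact this

theorem GermBound.bessel_iterate {z : ι → V} {s W : ι → ℝ} {f : ι → V → ℂ} (e : Fin n → V)
    (h : GermBound z s W f) (hs : ∀ p, 1 ≤ s p) (hW : ∀ p, 0 ≤ W p) (k : ℕ) :
    GermBound z s (fun p => W p * s p ^ (2 * k)) (fun p => (FourierIntOp.bessel e)^[k] (f p)) := by
  induction k with
  | zero => simpa using h
  | succ k ih =>
    have := ih.bessel e hs (fun p => by have := hW p; have := hs p; positivity)
    simp only [Function.iterate_succ_apply']
    simpa [mul_assoc, ← pow_add, mul_add] using this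

theorem contDiff_dirDeriv {F : Type*} [NormedAddCommGroup F] [NormedSpace ℝ F] {f : V → F}
    (hf : ContDiff ℝ ∞ f) (v : V) : ContDiff ℝ ∞ (dirDeriv v f) :=
  contDiff_iff_contDiffAt.2 fun _ => hf.contDiffAt.dirDeriv v

theorem contDiff_bessel {f : V → ℂ} (hf : ContDiff ℝ ∞ f) (e : Fin n → V) :
    ContDiff ℝ ∞ (bessel e f) :=
  hf.sub (contDiff_const.mul (ContDiff.sum fun j _ =>
    contDiff_dirDeriv (contDiff_dirDeriv hf (e j)) (e j)))

theorem contDiff_bessel_iterate {f : V → ℂ} (hf : ContDiff ℝ ∞ f) (e : Fin n → V) (k : ℕ) :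
    ContDiff ℝ ∞ ((bessel e)^[k] f) := by
  induction k with
  | zero => exact hf
  | succ k ih => rw [Function.iterate_succ_apply']; exact contDiff_bessel ih e

theorem bessel_comp_affine {f : V → ℂ} (hf : ContDiff ℝ ∞ f) (L : V' →L[ℝ] V) (c : V)
    (e : Fin n → V') :
    bessel e (fun y => f (c + L y)) = fun y => bessel (fun j => L (e j)) f (c + L y) := by
  ext y
  unfold bessel
  congr 2
  refine Finset.sum_congr rfl fun j _ => ?_
  exact dirDerivs_comp_affine [e j, e j] L c (hf.contDiffAt.of_le (by exact_mod_cast le_top))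

theorem bessel_iterate_comp_affine {f : V → ℂ} (hf : ContDiff ℝ ∞ f) (L : V' →L[ℝ] V) (c : V)
    (e : Fin n → V') (k : ℕ) :
    (bessel e)^[k] (fun y => f (c + L y)) =
      fun y => (bessel (fun j => L (e j)))^[k] f (c + L y) := by
  induction k with
  | zero => rfl
  | succ k ih =>
    rw [Function.iterate_succ_apply', ih,
      bessel_comp_affine (contDiff_bessel_iterate hf _ k), Function.iterate_succ_apply']

theorem bessel_congr {f g : V → ℂ} {z : V} (h : f =ᶠ[𝓝 z] g) (e : Fin n → V) :
    bessel e f =ᶠ[𝓝 z] bessel e g := by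
  have h1 : ∀ᶠ y in 𝓝 z, ∀ j, dirDeriv (e j) (dirDeriv (e j) f) y =
      dirDeriv (e j) (dirDeriv (e j) g) y :=
    Filter.eventually_all.2 fun j => dirDeriv_congr (dirDeriv_congr h (e j)) (e j)
  filter_upwards [h, h1] with y hy hy1
  simp [bessel, hy, hy1]

theorem bessel_iterate_congr {f g : V → ℂ} {z : V} (h : f =ᶠ[𝓝 z] g) (e : Fin n → V) (k : ℕ) :
    (bessel e)^[k] f =ᶠ[𝓝 z] (bessel e)^[k] g := by
  induction k with
  | zero => exact h
  | succ k ih => simp only [Function.iterate_succ_apply']; exact bessel_congr ih e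

/-- The operator `1 - (4π²)⁻¹ Δ` on Schwartz functions. -/
def besselS (e : Fin n → V) (f : 𝓢(V, ℂ)) : 𝓢(V, ℂ) :=
  f - (((4 * Real.pi ^ 2)⁻¹ : ℝ) : ℂ) • ∑ j : Fin n,
    LineDeriv.lineDerivOp (e j) (LineDeriv.lineDerivOp (e j) f)

theorem coe_lineDerivOp (f : 𝓢(V, ℂ)) (v : V) :
    ((LineDeriv.lineDerivOp v f : 𝓢(V, ℂ)) : V → ℂ) = dirDeriv v f := by
  ext z
  rw [SchwartzMap.lineDerivOp_apply_eq_fderiv]; rfl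

theorem coe_besselS (e : Fin n → V) (f : 𝓢(V, ℂ)) : (besselS e f : V → ℂ) = bessel e f := by
  ext z
  simp [besselS, bessel, coe_lineDerivOp]

/-- With the kernel `e^{-2πi x·w}` a second derivative along `e_j` becomes `-4π²w_j²`, whence the
constant in the operator. -/
theorem fourier_besselS (f : 𝓢(E n, ℂ)) (w : E n) :
    𝓕 (besselS basisVec f) w = ((1 + ‖w‖ ^ 2 : ℝ) : ℂ) * 𝓕 f w := by
  have h : ∀ j : Fin n, (inner ℝ · (basisVec j : E n)).HasTemperateGrowth := fun j => by fun_prop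
  have h1 : 𝓕 (besselS basisVec f) = 𝓕 f - (((4 * Real.pi ^ 2)⁻¹ : ℝ) : ℂ) • ∑ j : Fin n,
      𝓕 (LineDeriv.lineDerivOp (basisVec j) (LineDeriv.lineDerivOp (basisVec j) f)) := by
    change SchwartzMap.fourierTransformCLM ℂ _ = _
    simp [besselS, map_sub, map_sum]
  rw [h1, EuclideanSpace.norm_sq_eq]
  simp only [SchwartzMap.fourier_lineDerivOp_eq, sub_apply, smul_apply,
    sum_apply, SchwartzMap.smulLeftCLM_apply_apply (h _)]
  simp only [EuclideanSpace.inner_single_right, smul_eq_mul, Real.norm_eq_abs, sq_abs]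
  have hpi : (Real.pi : ℂ) ≠ 0 := by exact_mod_cast Real.pi_ne_zero
  push_cast
  rw [add_mul, one_mul, sub_eq_add_neg, Finset.sum_mul, Finset.mul_sum, ← Finset.sum_neg_distrib]
  congr 1
  refine Finset.sum_congr rfl fun j _ => ?_
  simp
  field_simp
  rw [Complex.I_sq]; ring

theorem coe_besselS_iterate (e : Fin n → V) (f : 𝓢(V, ℂ)) (k : ℕ) :
    (((besselS e)^[k] f : 𝓢(V, ℂ)) : V → ℂ) = (bessel e)^[k] f := by
  induction k with
  | zero => rfl
  | succ k ih => rw [Function.iterate_succ_apply', coe_besselS, ih, Function.iterate_succ_apply']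

theorem fourier_besselS_iterate (f : 𝓢(E n, ℂ)) (k : ℕ) (w : E n) :
    𝓕 ((besselS basisVec)^[k] f) w = ((1 + ‖w‖ ^ 2 : ℝ) : ℂ) ^ k * 𝓕 f w := by
  induction k with
  | zero => simp
  | succ k ih => rw [Function.iterate_succ_apply', fourier_besselS, ih, pow_succ]; ring

end BesselOperator

/-! ### Regularised symbols and the decay of their kernels. -/

section Kernels

variable {n : ℕ} {ι : Type*}

/-- The weight `(1 + |w|²)⁻¹`. -/
def japInv (w : E n) : ℝ := (1 + ‖w‖ ^ 2)⁻¹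

theorem japInv_pos (w : E n) : 0 < japInv w := by unfold japInv; positivity

/-- Multiplying `1 + |w|²` by the value of `japInv` at the base point normalises it to 1 there with
bounded derivatives, so the reciprocal is only ever composed at the point 1. -/
theorem germBound_japInv :
    GermBound (fun p : ι × E n => p.2) (fun _ => 1) (fun p => japInv p.2)
      (fun _ w => ((japInv w : ℝ) : ℂ)) := by
  have h0 : GermBound (fun p : ι × E n => p.2) (fun _ => 1) (fun p => 1 + ‖p.2‖)
      (fun _ w => w) := by
    have := GermBound.clm (z := fun p : ι × E n => p.2) (s := fun _ => 1)
      (W := fun p => 1 + ‖p.2‖) (fun _ => ContinuousLinearMap.id ℝ (E n)) (by simp)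
      (fun p => by positivity) 1 (fun p => by simp) (fun p => by
        simpa using (ContinuousLinearMap.norm_id_le).trans (by simp))
    simpa using this
  have h1 := h0.bilin (innerSL ℝ) h0 (by simp) (fun p => by positivity) (fun p => by positivity)
  have h2 := (h1.add (GermBound.const (fun _ => (1 : ℝ)) (by simp) (fun p => by positivity) 1
    (fun p => by simp; nlinarith [norm_nonneg p.2]))).const_smul (c := fun p => japInv p.2)
  have h3 : GermBound (fun p : ι × E n => p.2) (fun _ => 1) (fun _ => 1)
      (fun p w => japInv p.2 * (1 + ‖w‖ ^ 2)) := by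
    refine (h2.congr fun p => Filter.Eventually.of_forall fun w => ?_).mono (by simp)
      (fun p => by positivity) 2 1 (fun p => ?_) (by simp)
    · simp only [innerSL_apply_apply ℝ, real_inner_self_eq_norm_sq, smul_eq_mul]; ring
    · rw [abs_of_pos (japInv_pos _), japInv, inv_mul_le_iff₀ (by positivity)]
      nlinarith [sq_nonneg (‖p.2‖ - 1)]
  have h4 := GermBound.comp (g := fun (_ : ι × E n) (x : ℝ) => (x : ℝ)⁻¹) (W := fun _ => 1)
    (f := fun (p : ι × E n) w => japInv p.2 * (1 + ‖w‖ ^ 2)) (z := fun p => p.2)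
    (s := fun _ => 1) ?_ h3.1 (by simp) (by simp) (fun i _ => h3.higher i (by simp) (by simp) (by simp))
  · have h5 := (h4.const_smul (c := fun p => japInv p.2)).clm_comp (fun _ => Complex.ofRealCLM)
    refine (h5.congr fun p => Filter.Eventually.of_forall fun w => ?_).mono (by simp)
      (fun p => by positivity) 1 1 (fun p => ?_) (by simp)
    · have := (japInv_pos p.2).ne'
      simp only [smul_eq_mul, mul_inv, mul_inv_cancel_left₀ this, Complex.ofRealCLM_apply]
      rfl
    · simp [abs_of_pos (japInv_pos p.2)]
  · have h6 : ∀ p : ι × E n, japInv p.2 * (1 + ‖p.2‖ ^ 2) = 1 := fun p => by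
      unfold japInv; rw [inv_mul_cancel₀ (by positivity)]
    refine ⟨fun p => contDiffAt_inv ℝ (by beta_reduce; rw [h6]; norm_num), fun i =>
      ⟨‖iteratedFDeriv ℝ i (fun x : ℝ => x⁻¹) 1‖, fun p => ?_⟩⟩
    beta_reduce
    rw [h6]; simp

theorem germBound_japInv_pow (k : ℕ) :
    GermBound (fun p : ι × E n => p.2) (fun _ => 1) (fun p => japInv p.2 ^ k)
      (fun _ w => ((japInv w : ℝ) : ℂ) ^ k) := by
  induction k with
  | zero => simpa using GermBound.const (fun _ : ι × E n => (1 : ℂ)) (by simp) (by simp) 1 (by simp)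
  | succ k ih =>
    simp only [pow_succ]
    exact ih.mul germBound_japInv (by simp) (fun p => by have := japInv_pos p.2; positivity)
      (fun p => (japInv_pos p.2).le)

/-- The symbol `q(w) (1 + |w|²)^{-(n+1)}`. -/
def regSymbol (q : E n → ℂ) (w : E n) : ℂ := q w * ((japInv w : ℝ) : ℂ) ^ (n + 1)

theorem germBound_regSymbol {A : ι → ℝ} {q : ι → E n → ℂ} (hA : ∀ p, 0 ≤ A p)
    (hq : GermBound (fun p : ι × E n => p.2) (fun _ => 1) (fun p => A p.1) (fun p => q p.1)) :
    GermBound (fun p : ι × E n => p.2) (fun _ => 1) (fun p => A p.1 * japInv p.2 ^ (n + 1))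
      (fun p => regSymbol (q p.1)) :=
  hq.mul (germBound_japInv_pow (n + 1)) (by simp) (fun p => hA p.1)
    (fun p => by have := japInv_pos p.2; positivity)

theorem integrable_japInv_pow : Integrable (fun w : E n => japInv w ^ (n + 1)) := by
  have := integrable_rpow_neg_one_add_norm_sq (E := E n) (μ := volume) (r := 2 * (n + 1))
    (by simp; linarith)
  refine this.congr (Filter.Eventually.of_forall fun w => ?_)
  beta_reduce
  rw [japInv, inv_pow, show -(2 * ((n : ℝ) + 1)) / 2 = -((n + 1 : ℕ) : ℝ) by push_cast; ring,
    Real.rpow_neg (by positivity), Real.rpow_natCast]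

theorem contDiff_of_germBound {V F : Type*} [NormedAddCommGroup V] [NormedSpace ℝ V]
    [NormedAddCommGroup F] [NormedSpace ℝ F] {s W : ι × V → ℝ} {q : ι → V → F}
    (hq : GermBound (fun p : ι × V => p.2) s W (fun p => q p.1)) (p : ι) :
    ContDiff ℝ ∞ (q p) :=
  contDiff_iff_contDiffAt.2 fun w => hq.1 (p, w)

/-- The factor `⟨w⟩^{-2(n+1)}` makes the symbol integrable with all its derivatives, uniformly in
the family, and derivatives turn into powers of `z` under the Fourier transform. -/
theorem kernel_decay {A : ι → ℝ} {q : ι → E n → ℂ} (hA : ∀ p, 0 ≤ A p)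
    (hq : GermBound (fun p : ι × E n => p.2) (fun _ => 1) (fun p => A p.1) (fun p => q p.1))
    (I : ℕ) : ∃ C : ℝ, 0 ≤ C ∧ ∀ p z, (1 + ‖z‖) ^ I * ‖𝓕 (regSymbol (q p)) z‖ ≤ C * A p := by
  have hQ := germBound_regSymbol hA hq
  have hc : ∀ p, ContDiff ℝ ∞ (regSymbol (q p)) := fun p =>
    contDiff_of_germBound (q := fun p => regSymbol (q p)) hQ p
  have hJ : ∀ p : ι × E n, 0 ≤ A p.1 * japInv p.2 ^ (n + 1) := fun p => by
    have := japInv_pos p.2; have := hA p.1; positivity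
  have key : ∀ m : ℕ, ∃ C : ℝ, ∀ p z, ‖z‖ ^ m * ‖𝓕 (regSymbol (q p)) z‖ ≤ C * A p := by
    intro m
    obtain ⟨C, hC1, hC⟩ := hQ.bound (by simp) hJ m
    have hint : ∀ p, ∀ j ≤ m, Integrable (fun v => ‖v‖ ^ 0 * ‖iteratedFDeriv ℝ j (regSymbol (q p)) v‖) ∧
        ∫ v, ‖v‖ ^ 0 * ‖iteratedFDeriv ℝ j (regSymbol (q p)) v‖ ≤
          C * A p * ∫ w : E n, japInv w ^ (n + 1) := by
      intro p j hj
      have hb : ∀ v, ‖v‖ ^ 0 * ‖iteratedFDeriv ℝ j (regSymbol (q p)) v‖ ≤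
          C * A p * japInv v ^ (n + 1) := fun v => by
        have := hC j hj (p, v)
        simp only [one_pow, mul_one] at this
        simpa [mul_assoc] using this
      have hi : Integrable (fun v : E n => C * A p * japInv v ^ (n + 1)) :=
        integrable_japInv_pow.const_mul _
      have hi' : Integrable (fun v => ‖v‖ ^ 0 * ‖iteratedFDeriv ℝ j (regSymbol (q p)) v‖) := by
        refine hi.mono' (Continuous.aestronglyMeasurable ?_) (Filter.Eventually.of_forall fun v => ?_)
        · have := (hc p).continuous_iteratedFDeriv (m := j) (by exact_mod_cast le_top)
          fun_prop
        · rw [Real.norm_of_nonneg (by positivity)]; exact hb v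
      refine ⟨hi', ?_⟩
      rw [← integral_const_mul]
      exact integral_mono hi' hi hb
    refine ⟨(2 * Real.pi) ^ 0 * (2 * (0 : ℕ) + 2) ^ m *
      ∑ _p ∈ Finset.range (0 + 1) ×ˢ Finset.range (m + 1), (C * ∫ w : E n, japInv w ^ (n + 1)),
      fun p z => ?_⟩
    have := Real.pow_mul_norm_iteratedFDeriv_fourier_le (K := 0) (N := m)
      (f := regSymbol (q p)) ((hc p).of_le (by exact_mod_cast le_top))
      (fun k j hk hj => by
        have hk0 : k = 0 := by simpa using hk
        subst hk0
        exact (hint p j (by exact_mod_cast hj)).1) (k := 0) (n := m) le_rfl le_rfl z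
    rw [norm_iteratedFDeriv_zero] at this
    refine this.trans ?_
    rw [mul_assoc, mul_assoc, mul_assoc, Finset.sum_mul]
    gcongr with j hj
    obtain ⟨h1, h2⟩ := Finset.mem_product.1 hj
    have hj0 : j.1 = 0 := by simpa using h1
    rw [hj0]
    exact ((hint p j.2 (by simpa [Nat.lt_succ_iff] using h2)).2).trans (le_of_eq (by ring))
  obtain ⟨C0, h0⟩ := key 0
  obtain ⟨C1, h1⟩ := key I
  refine ⟨2 ^ I * (|C0| + |C1|), by positivity, fun p z => ?_⟩
  have hz : (1 + ‖z‖) ^ I ≤ 2 ^ I * (1 + ‖z‖ ^ I) := by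
    rcases le_total ‖z‖ 1 with h | h
    · calc (1 + ‖z‖) ^ I ≤ 2 ^ I := by gcongr; linarith
        _ ≤ _ := le_mul_of_one_le_right (by positivity) (by simp)
    · calc (1 + ‖z‖) ^ I ≤ (2 * ‖z‖) ^ I := by gcongr; linarith
        _ = 2 ^ I * ‖z‖ ^ I := by rw [mul_pow]
        _ ≤ _ := by gcongr; linarith
  calc _ ≤ 2 ^ I * (1 + ‖z‖ ^ I) * ‖𝓕 (regSymbol (q p)) z‖ := by gcongr
    _ = 2 ^ I * (‖z‖ ^ 0 * ‖𝓕 (regSymbol (q p)) z‖ + ‖z‖ ^ I * ‖𝓕 (regSymbol (q p)) z‖) := by ring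
    _ ≤ 2 ^ I * (C0 * A p + C1 * A p) :=
        mul_le_mul_of_nonneg_left (add_le_add (h0 p z) (h1 p z)) (by positivity)
    _ ≤ 2 ^ I * (|C0| * A p + |C1| * A p) :=
        mul_le_mul_of_nonneg_left (add_le_add
          (mul_le_mul_of_nonneg_right (le_abs_self _) (hA p))
          (mul_le_mul_of_nonneg_right (le_abs_self _) (hA p))) (by positivity)
    _ = _ := by ring

end Kernels
end FourierIntOp
end

noncomputable section
namespace FourierIntOp

open MeasureTheory FourierTransform

/-! ### The absolutely convergent pairing of a symbol with an amplitude. -/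

section Pairing

variable {n : ℕ} {ι : Type*}

theorem integrable_regSymbol {q : E n → ℂ} (hq : GermBound (fun w : E n => w) (fun _ => 1) (fun _ => 1) (fun _ => q)) :
    Integrable (regSymbol q) := by
  obtain ⟨C, hC⟩ := hq.2 0
  have hc : Continuous q := (contDiff_iff_contDiffAt.2 hq.1).continuous
  refine (integrable_japInv_pow.const_mul C).mono' (Continuous.aestronglyMeasurable ?_)
    (Filter.Eventually.of_forall fun w => ?_)
  · unfold regSymbol japInv
    have : ∀ w : E n, 1 + ‖w‖ ^ 2 ≠ 0 := fun w => by positivity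
    fun_prop (disch := assumption)
  · have := hC w
    simp only [norm_iteratedFDeriv_zero, pow_zero, mul_one] at this
    rw [regSymbol, norm_mul, norm_pow, Complex.norm_real, Real.norm_of_nonneg (japInv_pos w).le]
    have := japInv_pos w
    gcongr

theorem continuous_fourier {f : E n → ℂ} (hf : Integrable f) : Continuous (𝓕 f) :=
  VectorFourier.fourierIntegral_continuous Real.continuous_fourierChar
    (L := innerₗ (E n)) continuous_inner hf

theorem integrable_one_add_norm_inv : Integrable (fun z : E n => ((1 + ‖z‖) ^ (n + 1))⁻¹) := by
  have := integrable_one_add_norm (E := E n) (μ := volume) (r := n + 1) (by simp)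
  refine this.congr (Filter.Eventually.of_forall fun w => ?_)
  beta_reduce
  rw [Real.rpow_neg (by positivity)]
  norm_cast

/-- The pairing of the Fourier transform of the symbol `q` with `b`, that is `∫ q 𝓕b` in the
regularised form `∫ 𝓕(q (1 + |w|²)^{-(n+1)}) (1 - Δ/4π²)^{n+1} b`. -/
def opT (q b : E n → ℂ) : ℂ := ∫ z, 𝓕 (regSymbol q) z * (bessel basisVec)^[n + 1] b z

/-- Of the `P + (n + 1)` powers of decay of the kernel, `P` absorb the growth of the amplitude and
`n + 1` make the product integrable. -/
theorem opT_integrand_le {K L : E n → ℂ} {C B : ℝ} {P : ℕ}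
    (hK : ∀ z, (1 + ‖z‖) ^ (P + (n + 1)) * ‖K z‖ ≤ C) (hL : ∀ z, ‖L z‖ ≤ B * (1 + ‖z‖) ^ P) (z : E n) :
    ‖K z * L z‖ ≤ C * B * ((1 + ‖z‖) ^ (n + 1))⁻¹ := by
  have hz : (0 : ℝ) < 1 + ‖z‖ := by positivity
  have hB : 0 ≤ B := by
    have := (norm_nonneg _).trans (hL 0); simpa using this
  rw [norm_mul, ← div_eq_mul_inv, le_div_iff₀ (by positivity)]
  calc ‖K z‖ * ‖L z‖ * (1 + ‖z‖) ^ (n + 1)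
      ≤ ‖K z‖ * (B * (1 + ‖z‖) ^ P) * (1 + ‖z‖) ^ (n + 1) := by gcongr; exact hL z
    _ = ((1 + ‖z‖) ^ (P + (n + 1)) * ‖K z‖) * B := by rw [pow_add]; ring
    _ ≤ C * B := by gcongr; exact hK z

theorem norm_opT_le {A B : ι → ℝ} {q b : ι → E n → ℂ} (hA : ∀ p, 0 ≤ A p)
    (hq : GermBound (fun p : ι × E n => p.2) (fun _ => 1) (fun p => A p.1) (fun p => q p.1))
    (P : ℕ) (hb : ∀ p z, ‖(bessel basisVec)^[n + 1] (b p) z‖ ≤ B p * (1 + ‖z‖) ^ P) :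
    ∃ C : ℝ, 0 ≤ C ∧ ∀ p, ‖opT (q p) (b p)‖ ≤ C * (A p * B p) := by
  obtain ⟨C, hC0, hC⟩ := kernel_decay hA hq (P + (n + 1))
  refine ⟨C * ∫ z : E n, ((1 + ‖z‖) ^ (n + 1))⁻¹, mul_nonneg hC0 (integral_nonneg fun z => by positivity), fun p => ?_⟩
  refine (norm_integral_le_of_norm_le (integrable_one_add_norm_inv.const_mul (C * A p * B p))
    (Filter.Eventually.of_forall fun z => opT_integrand_le (hC p) (hb p) z)).trans (le_of_eq ?_)
  rw [integral_const_mul]; ring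

/-- Moving the Fourier transform from the symbol to the amplitude turns the Bessel operator into `(1
+ |w|²)^{n+1}`, which cancels the factor put into `regSymbol`. -/
theorem opT_schwartz {q : E n → ℂ} (hq : GermBound (fun w : E n => w) (fun _ => 1) (fun _ => 1) (fun _ => q))
    (g : 𝓢(E n, ℂ)) : opT q g = ∫ w, q w * 𝓕 (g : E n → ℂ) w := by
  have h := VectorFourier.integral_bilin_fourierIntegral_eq_flip (ContinuousLinearMap.mul ℂ ℂ)
    (L := innerₗ (E n)) (μ := volume) (ν := volume) Real.continuous_fourierChar continuous_inner
    (integrable_regSymbol hq) ((besselS basisVec)^[n + 1] g).integrable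
  unfold opT
  rw [← coe_besselS_iterate]
  refine (Eq.trans (by rfl) h).trans ?_
  refine integral_congr_ae (Filter.Eventually.of_forall fun w => ?_)
  have h1 := fourier_besselS_iterate g (n + 1) w
  rw [SchwartzMap.fourier_coe, SchwartzMap.fourier_coe] at h1
  have h2 : VectorFourier.fourierIntegral Real.fourierChar volume (innerₗ (E n)).flip
      ((besselS basisVec)^[n + 1] g) w = 𝓕 (⇑((besselS basisVec)^[n + 1] g)) w := by
    rw [show (innerₗ (E n)).flip = innerₗ (E n) by ext; simp]; rfl
  change regSymbol q w * _ = _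
  rw [h2, h1, regSymbol, japInv]
  have : ((1 + ‖w‖ ^ 2 : ℝ) : ℂ) ≠ 0 := by
    rw [Complex.ofReal_ne_zero]; positivity
  rw [Complex.ofReal_inv, inv_pow]
  field_simp

/-- A smooth cut-off function, equal to `1` on the unit ball. -/
def cutoffBump (n : ℕ) : ContDiffBump (0 : E n) := ⟨1, 2, by norm_num, by norm_num⟩

/-- The cut-off function `cutoffBump` with complex values. -/
def cutoff (z : E n) : ℂ := ((cutoffBump n z : ℝ) : ℂ)

theorem contDiff_cutoff : ContDiff ℝ ∞ (cutoff : E n → ℂ) :=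
  Complex.ofRealCLM.contDiff.comp (cutoffBump n).contDiff

theorem cutoff_eq_one {z : E n} (hz : ‖z‖ ≤ 1) : cutoff z = 1 := by
  rw [cutoff, (cutoffBump n).one_of_mem_closedBall (by simpa [cutoffBump] using hz)]; simp

theorem cutoff_eq_zero {z : E n} (hz : 2 ≤ ‖z‖) : cutoff z = 0 := by
  rw [cutoff, (cutoffBump n).zero_of_le_dist (by simpa [cutoffBump] using hz)]; simp

theorem hasCompactSupport_cutoff : HasCompactSupport (cutoff : E n → ℂ) :=
  (cutoffBump n).hasCompactSupport.comp_left (g := fun x : ℝ => (x : ℂ)) (by simp)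

theorem germBound_of_hasCompactSupport {V F : Type*} [NormedAddCommGroup V] [NormedSpace ℝ V]
    [NormedAddCommGroup F] [NormedSpace ℝ F] {f : V → F}
    (hf : ContDiff ℝ ∞ f) (hs : HasCompactSupport f) :
    GermBound (fun w : V => w) (fun _ => 1) (fun _ => 1) (fun _ => f) := by
  refine ⟨fun p => hf.contDiffAt, fun i => ?_⟩
  obtain ⟨C, hC⟩ := (hs.iteratedFDeriv (𝕜 := ℝ) i).exists_bound_of_continuous
    (hf.continuous_iteratedFDeriv (by exact_mod_cast le_top))
  exact ⟨C, fun p => by simpa using hC p⟩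

/-- Precomposition of a bounded smooth function with dilations of ratio at most one. -/
theorem GermBound.comp_dilate {V F : Type*} [NormedAddCommGroup V] [NormedSpace ℝ V]
    [NormedAddCommGroup F] [NormedSpace ℝ F] {f : V → F}
    (hf : GermBound (fun w : V => w) (fun _ => 1) (fun _ => 1) (fun _ => f))
    {δ : ι → ℝ} (hδ : ∀ p, |δ p| ≤ 1) (z : ι → V) :
    GermBound z (fun _ => 1) (fun _ => 1) (fun p w => f (δ p • w)) := by
  have h1 := (hf.reindex (fun p : ι => 0 + (δ p • ContinuousLinearMap.id ℝ V) (z p))).comp_affine (fun _ => 0)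
    (fun p => δ p • ContinuousLinearMap.id ℝ V) (z := z)
  refine (h1.congr fun p => Filter.Eventually.of_forall fun w => ?_).mono
    (fun p => by simp only [Function.comp_apply]; positivity) (fun p => by simp) 1 1
    (fun p => by simp) (fun p => ?_)
  · simp
  · simp only [Function.comp_apply, one_mul, norm_smul, Real.norm_eq_abs]
    exact mul_le_one₀ (hδ p) (norm_nonneg _) ContinuousLinearMap.norm_id_le

theorem GermBound.slice {V F : Type*} [NormedAddCommGroup V] [NormedSpace ℝ V]
    [NormedAddCommGroup F] [NormedSpace ℝ F] {A : ι → ℝ} {q : ι → V → F} (hA : ∀ p, 0 ≤ A p)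
    (hq : GermBound (fun p : ι × V => p.2) (fun _ => 1) (fun p => A p.1) (fun p => q p.1)) (p : ι) :
    GermBound (fun w : V => w) (fun _ => 1) (fun _ => 1) (fun _ => q p) :=
  (hq.reindex (fun w : V => (p, w))).mono (by simp) (fun w => hA p) (A p) 1 (by simp) (by simp)

theorem fourier_comp_inv_smul (g : E n → ℂ) {r : ℝ} (hr : 0 < r) (w : E n) :
    𝓕 (fun z => g (r⁻¹ • z)) w = ((r ^ n : ℝ) : ℂ) * 𝓕 g (r • w) := by
  rw [Real.fourier_eq, Real.fourier_eq]
  have h := Measure.integral_comp_inv_smul_of_nonneg (volume : Measure (E n))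
    (fun v => Real.fourierChar (-inner ℝ v (r • w)) • g v) hr.le
  simp only [finrank_euclideanSpace, Fintype.card_fin] at h
  rw [Complex.real_smul] at h
  rw [← h]
  refine integral_congr_ae (Filter.Eventually.of_forall fun v => ?_)
  beta_reduce
  rw [inner_smul_right, real_inner_smul_left, mul_inv_cancel_left₀ hr.ne']

theorem integral_dilate_mul_fourier (q g : E n → ℂ) {r : ℝ} (hr : 0 < r) :
    ∫ w, q (r • w) * 𝓕 (fun z => g (r⁻¹ • z)) w = ∫ w, q w * 𝓕 g w := by
  simp only [fourier_comp_inv_smul g hr]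
  have h := Measure.integral_comp_smul_of_nonneg (volume : Measure (E n))
    (fun w => q w * (((r ^ n : ℝ) : ℂ) * 𝓕 g w)) (R := r) (hR := hr.le)
  rw [h, finrank_euclideanSpace, Fintype.card_fin, Complex.real_smul, ← integral_const_mul]
  refine integral_congr_ae (Filter.Eventually.of_forall fun v => ?_)
  have : ((r ^ n : ℝ) : ℂ) ≠ 0 := by rw [Complex.ofReal_ne_zero]; positivity
  beta_reduce
  rw [Complex.ofReal_inv]
  field_simp

/-- Dilating by `Λ` brings `q` to unit scale and leaves `g` with scale `S(1+|z|)^{P'}`. The `2(n+1)`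
derivatives in the pairing cost `S^{2(n+1)}`, and the polynomial growth is absorbed by the kernel.
-/
theorem norm_integral_mul_fourier_le {Λ A B S : ι → ℝ} {q g : ι → E n → ℂ} (hΛ : ∀ p, 0 < Λ p)
    (hA : ∀ p, 0 ≤ A p) (hB : ∀ p, 0 ≤ B p) (hS : ∀ p, 1 ≤ S p) (P P' : ℕ)
    (hq : GermBound (fun p : ι × E n => p.2) (fun p => (Λ p.1)⁻¹) (fun p => A p.1) (fun p => q p.1))
    (hg : GermBound (fun p : ι × E n => p.2) (fun p => S p.1 * Λ p.1 * (1 + Λ p.1 * ‖p.2‖) ^ P')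
      (fun p => B p.1 * (1 + Λ p.1 * ‖p.2‖) ^ P) (fun p => g p.1))
    (hs : ∀ p, HasCompactSupport (g p)) :
    ∃ C : ℝ, 0 ≤ C ∧ ∀ p, ‖∫ w, q p w * 𝓕 (g p) w‖ ≤ C * (A p * B p * S p ^ (2 * (n + 1))) := by
  have hq' : GermBound (fun p : ι × E n => p.2) (fun _ => 1) (fun p => A p.1)
      (fun p w => q p.1 (Λ p.1 • w)) := by
    have := (hq.reindex (fun p : ι × E n => (p.1, 0 + (Λ p.1 • ContinuousLinearMap.id ℝ (E n)) p.2))).comp_affine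
      (fun _ => 0) (fun p => Λ p.1 • ContinuousLinearMap.id ℝ (E n)) (z := fun p : ι × E n => p.2)
    refine (this.congr fun p => Filter.Eventually.of_forall fun w => ?_).mono
      (fun p => ?_) (fun p => hA p.1) 1 1 (fun p => ?_) (fun p => ?_)
    · simp
    · have := hΛ p.1; simp only [Function.comp_apply]; positivity
    · simp
    · simp only [Function.comp_apply, norm_smul, Real.norm_of_nonneg (hΛ p.1).le]
      rw [inv_mul_cancel_left₀ (hΛ p.1).ne', one_mul]; exact ContinuousLinearMap.norm_id_le
  have hg' : GermBound (fun p : ι × E n => p.2) (fun p => S p.1 * (1 + ‖p.2‖) ^ P')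
      (fun p => B p.1 * (1 + ‖p.2‖) ^ P) (fun p z => g p.1 ((Λ p.1)⁻¹ • z)) := by
    have := (hg.reindex (fun p : ι × E n => (p.1, 0 + ((Λ p.1)⁻¹ • ContinuousLinearMap.id ℝ (E n)) p.2))).comp_affine
      (fun _ => 0) (fun p => (Λ p.1)⁻¹ • ContinuousLinearMap.id ℝ (E n)) (z := fun p : ι × E n => p.2)
    have h2 : ∀ p : ι × E n, Λ p.1 * ‖0 + ((Λ p.1)⁻¹ • ContinuousLinearMap.id ℝ (E n)) p.2‖ = ‖p.2‖ :=
      fun p => by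
        simp [norm_smul, abs_of_pos (hΛ p.1), (hΛ p.1).ne']
    refine (this.congr fun p => Filter.Eventually.of_forall fun w => ?_).mono
      (fun p => ?_) (fun p => ?_) 1 1 (fun p => ?_) (fun p => ?_)
    · simp
    · have := hΛ p.1; have := hS p.1; simp only [Function.comp_apply]; positivity
    · have := hΛ p.1; have := hB p.1; simp only [Function.comp_apply]; positivity
    · simp only [Function.comp_apply, h2, one_mul]; rfl
    · simp only [Function.comp_apply, norm_smul, h2, norm_inv, Real.norm_of_nonneg (hΛ p.1).le]
      have h3 := hΛ p.1
      have h4 := hS p.1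
      calc S p.1 * Λ p.1 * (1 + ‖p.2‖) ^ P' * ((Λ p.1)⁻¹ * ‖ContinuousLinearMap.id ℝ (E n)‖)
          = S p.1 * (1 + ‖p.2‖) ^ P' * ‖ContinuousLinearMap.id ℝ (E n)‖ := by field_simp
        _ ≤ S p.1 * (1 + ‖p.2‖) ^ P' * 1 := by gcongr; exact ContinuousLinearMap.norm_id_le
        _ = _ := by ring
  obtain ⟨C0, hC1, hC0⟩ := (hg'.bessel_iterate basisVec (fun p =>
      one_le_mul_of_one_le_of_one_le (hS p.1) (one_le_pow₀ (by simp)))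
    (fun p => by have := hB p.1; positivity) (n + 1)).bound
      (fun p => by have := hS p.1; positivity) (fun p => by
        have := hB p.1; have := hS p.1; positivity) 0
  obtain ⟨C, hC, hCb⟩ := norm_opT_le (B := fun p => C0 * (B p * S p ^ (2 * (n + 1)))) (q := fun p w => q p (Λ p • w))
    (b := fun p z => g p ((Λ p)⁻¹ • z)) hA hq' (P + P' * (2 * (n + 1))) (fun p z => by
      have := hC0 0 le_rfl (p, z)
      rw [norm_iteratedFDeriv_zero] at this
      refine this.trans (le_of_eq ?_)
      simp only [pow_zero, mul_one, pow_add, pow_mul, mul_pow]; ring)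
  refine ⟨C * C0, by positivity, fun p => ?_⟩
  have hc : ContDiff ℝ ∞ (fun z => g p ((Λ p)⁻¹ • z)) :=
    contDiff_of_germBound (q := fun p z => g p ((Λ p)⁻¹ • z)) hg' p
  have hk : HasCompactSupport (fun z => g p ((Λ p)⁻¹ • z)) :=
    (hs p).comp_smul (inv_ne_zero (hΛ p).ne')
  have h := opT_schwartz (GermBound.slice (q := fun p w => q p (Λ p • w)) hA hq' p) (hk.toSchwartzMap hc)
  rw [← integral_dilate_mul_fourier (q p) (g p) (hΛ p)]
  refine (le_of_eq (congrArg _ h.symm)).trans ((hCb p).trans (le_of_eq (by ring)))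

theorem GermBound.cutoff_mul {z : ι → E n} {s W : ι → ℝ} {b : ι → E n → ℂ}
    (hb : GermBound z s W b) (hs : ∀ p, 1 ≤ s p) (hW : ∀ p, 0 ≤ W p) {δ : ι → ℝ}
    (hδ : ∀ p, |δ p| ≤ 1) : GermBound z s W (fun p y => cutoff (δ p • y) * b p y) := by
  have h1 := ((germBound_of_hasCompactSupport (contDiff_cutoff (n := n))
    hasCompactSupport_cutoff).comp_dilate hδ z).mono (s' := s) (W' := fun _ => 1) (by simp) (by simp)
      1 1 (by simp) (by simpa using hs)
  simpa using h1.mul hb (fun p => zero_le_one.trans (hs p)) (by simp) hW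

/-- The integrands are dominated uniformly in `δ`. At each fixed `z` they are eventually equal to
their limit, because the cut-off is 1 near `z`. -/
theorem tendsto_opT_cutoff {q b : E n → ℂ}
    (hq : GermBound (fun w : E n => w) (fun _ => 1) (fun _ => 1) (fun _ => q)) {B : ℝ} {P : ℕ}
    (hb : ∀ δ ∈ Set.Ioc (0 : ℝ) 1, ∀ z,
      ‖(bessel basisVec)^[n + 1] (fun y => cutoff (δ • y) * b y) z‖ ≤ B * (1 + ‖z‖) ^ P)
    (hbc : ContDiff ℝ ∞ b) :
    Filter.Tendsto (fun δ : ℝ => opT q (fun y => cutoff (δ • y) * b y)) (𝓝[>] 0) (𝓝 (opT q b)) := by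
  obtain ⟨C, -, hC⟩ := kernel_decay (ι := Unit) (A := fun _ => 1) (q := fun _ => q) (by simp)
    (hq.reindex (fun p : Unit × E n => p.2)) (P + (n + 1))
  have hmem : ∀ᶠ δ : ℝ in 𝓝[>] 0, δ ∈ Set.Ioc (0 : ℝ) 1 := Ioc_mem_nhdsGT one_pos
  refine tendsto_integral_filter_of_dominated_convergence
    (fun z => C * 1 * B * ((1 + ‖z‖) ^ (n + 1))⁻¹) ?_ ?_ (integrable_one_add_norm_inv.const_mul _) ?_
  · filter_upwards [hmem] with δ hδ
    refine Continuous.aestronglyMeasurable ((continuous_fourier (integrable_regSymbol hq)).mul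
      (contDiff_bessel_iterate ?_ _ _).continuous)
    exact (contDiff_cutoff.comp (contDiff_const_smul δ)).mul hbc
  · filter_upwards [hmem] with δ hδ
    exact Filter.Eventually.of_forall fun z => opT_integrand_le (hC ()) (hb δ hδ) z
  · refine Filter.Eventually.of_forall fun z => ?_
    refine Filter.Tendsto.congr' ?_ tendsto_const_nhds
    have : ∀ᶠ δ : ℝ in 𝓝[>] 0, δ ∈ Set.Ioo (0 : ℝ) (1 + ‖z‖)⁻¹ := Ioo_mem_nhdsGT (by positivity)
    filter_upwards [this] with δ hδ
    congr 1
    refine (bessel_iterate_congr ?_ _ _).eq_of_nhds.symm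
    have h1 : ‖δ • z‖ < 1 := by
      rw [norm_smul, Real.norm_of_nonneg hδ.1.le]
      have h2 := hδ.2
      rw [lt_inv_comm₀ hδ.1 (by positivity), ← one_div, lt_div_iff₀ hδ.1] at h2
      nlinarith [hδ.1]
    have h3 : ∀ᶠ y in 𝓝 z, ‖δ • y‖ < 1 :=
      (continuous_const_smul δ).norm.continuousAt.eventually_lt continuousAt_const h1
    filter_upwards [h3] with y hy
    rw [cutoff_eq_one hy.le, one_mul]

end Pairing
end FourierIntOp
end

noncomputable section
namespace FourierIntOp

open MeasureTheory FourierTransform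

/-! ### Functions bounded with all derivatives, and Fourier transforms of decaying ones. -/

section BddSmooth

variable {n : ℕ} {V V' F : Type*} [NormedAddCommGroup V] [NormedSpace ℝ V]
  [NormedAddCommGroup V'] [NormedSpace ℝ V'] [NormedAddCommGroup F] [NormedSpace ℝ F]

/-- Smooth functions which are bounded together with all their derivatives. -/
abbrev BddSmooth (f : V → F) : Prop :=
  GermBound (fun w : V => w) (fun _ => 1) (fun _ => 1) (fun _ => f)

theorem BddSmooth.contDiff {f : V → F} (hf : BddSmooth f) : ContDiff ℝ ∞ f :=
  contDiff_iff_contDiffAt.2 hf.1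

theorem BddSmooth.hasTemperateGrowth {f : V → F} (hf : BddSmooth f) : f.HasTemperateGrowth :=
  ⟨hf.contDiff, fun i => (hf.2 i).elim fun C hC => ⟨0, C, fun x => by simpa using hC x⟩⟩

theorem BddSmooth.exists_norm_le {f : V → F} (hf : BddSmooth f) : ∃ C, ∀ x, ‖f x‖ ≤ C :=
  (hf.2 0).imp fun C hC x => by simpa using hC x

theorem BddSmooth.comp_affine {f : V → F} (hf : BddSmooth f) (c : V) (L : V' →L[ℝ] V) :
    BddSmooth (fun y => f (c + L y)) :=
  ((hf.reindex (fun y : V' => c + L y)).comp_affine (fun _ => c) (fun _ => L)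
    (z := fun y : V' => y)).mono (fun _ => by simp) (fun _ => by simp) 1 ‖L‖
    (fun _ => by simp) (fun _ => by simp)

theorem BddSmooth.comp_clm {f : V → F} (hf : BddSmooth f) (L : V' →L[ℝ] V) :
    BddSmooth (fun y => f (L y)) := by
  simpa using hf.comp_affine 0 L

theorem BddSmooth.mul {f g : V → ℂ} (hf : BddSmooth f) (hg : BddSmooth g) :
    BddSmooth (fun y => f y * g y) := by
  simpa using GermBound.mul hf hg (by simp) (by simp) (by simp)

theorem _root_.SchwartzMap.bddSmooth (κ : 𝓢(V, F)) : BddSmooth (κ : V → F) :=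
  ⟨fun _ => (κ.smooth ⊤).contDiffAt, fun i => (κ.decay 0 i).imp fun C hC x => by simpa using hC.2 x⟩

theorem bddSmooth_const (c : F) : BddSmooth (fun _ : V => c) :=
  GermBound.const (fun _ => c) (by simp) (by simp) ‖c‖ (by simp)

theorem japInv_le_one (w : E n) : japInv w ≤ 1 := by
  unfold japInv; apply inv_le_one_of_one_le₀; nlinarith [sq_nonneg ‖w‖]

theorem japInv_le (w : E n) : japInv w ≤ 2 * ((1 + ‖w‖) ^ 2)⁻¹ := by
  unfold japInv
  rw [← div_eq_mul_inv, inv_eq_one_div, div_le_div_iff₀ (by positivity) (by positivity)]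
  nlinarith [sq_nonneg (‖w‖ - 1)]

theorem bddSmooth_japInv_pow (k : ℕ) : BddSmooth (fun w : E n => ((japInv w : ℝ) : ℂ) ^ k) :=
  ((germBound_japInv_pow (ι := Unit) k).reindex (fun w : E n => ((), w))).mono (by simp)
    (fun w => by have := japInv_pos w; simp only [Function.comp_apply]; positivity) 1 1
    (fun w => by simpa using pow_le_one₀ (japInv_pos w).le (japInv_le_one w)) (by simp)

theorem bddSmooth_of_smul_char (x : E n) :
    BddSmooth (fun w : E n => ((Real.fourierChar (inner ℝ x w) : Circle) : ℂ)) := by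
  have h := GermBound.cexp_I (z := fun w : E n => w) (s := fun _ => 1)
    (h := fun _ w => ((2 * Real.pi) • innerSL ℝ x) w) (by simp) (fun _ => by fun_prop) (fun i hi =>
      ⟨‖(2 * Real.pi) • innerSL ℝ x‖, fun p => ?_⟩)
  · refine h.congr fun p => Filter.Eventually.of_forall fun w => ?_
    simp [Real.fourierChar_apply, mul_comm]
  · have := norm_iteratedFDeriv_clm_le ((2 * Real.pi) • innerSL ℝ x) 0 p i hi
    simp only [zero_add] at this
    rw [one_pow, mul_one]
    refine this.trans ?_
    split_ifs <;> simp

theorem integrable_of_germBound {f : E n → F} (hf : GermBound (fun w : E n => w) (fun _ => 1)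
    (fun w => japInv w ^ (n + 1)) (fun _ => f)) : Integrable f := by
  obtain ⟨C, hC⟩ := hf.2 0
  exact (integrable_japInv_pow.const_mul C).mono'
    (contDiff_iff_contDiffAt.2 hf.1).continuous.aestronglyMeasurable
    (Filter.Eventually.of_forall fun w => by simpa using hC w)

theorem fourier_dirDeriv {f : E n → ℂ} (hf : GermBound (fun w : E n => w) (fun _ => 1)
    (fun w => japInv w ^ (n + 1)) (fun _ => f)) (v z : E n) :
    𝓕 (dirDeriv v f) z = (2 * Real.pi * Complex.I) * (inner ℝ z v : ℝ) * 𝓕 f z := by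
  have h1 := hf.fderiv
  have h2 : Integrable (fderiv ℝ f) := integrable_of_germBound (by simpa using h1)
  have h3 := Real.fourier_fderiv (integrable_of_germBound hf)
    ((contDiff_iff_contDiffAt.2 hf.1).differentiable (by simp)) h2
  have h4 := Real.fourier_continuousLinearMap_apply (a := v) (v := z) h2
  rw [h3] at h4
  change 𝓕 (fun x => fderiv ℝ f x v) z = _
  rw [← h4]
  simp [VectorFourier.fourierSMulRight_apply, mul_assoc, innerSL_apply_apply ℝ]

/-- The rule of `fourier_besselS` under decay assumptions only: regularised symbols are integrable
with their derivatives but need not be Schwartz functions. -/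
theorem fourier_bessel {f : E n → ℂ} (hf : GermBound (fun w : E n => w) (fun _ => 1)
    (fun w => japInv w ^ (n + 1)) (fun _ => f)) (z : E n) :
    𝓕 (bessel basisVec f) z = ((1 + ‖z‖ ^ 2 : ℝ) : ℂ) * 𝓕 f z := by
  have hj : ∀ w : E n, 0 ≤ japInv w ^ (n + 1) := fun w => by have := japInv_pos w; positivity
  have h1 : ∀ v, GermBound (fun w : E n => w) (fun _ => 1)
    (fun w => japInv w ^ (n + 1)) (fun _ => dirDeriv v f) := fun v => by
      simpa using hf.dirDeriv v (by simp) hj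
  have h2 : ∀ v, GermBound (fun w : E n => w) (fun _ => 1)
    (fun w => japInv w ^ (n + 1)) (fun _ => dirDeriv v (dirDeriv v f)) := fun v => by
      simpa using (h1 v).dirDeriv v (by simp) hj
  have hint : ∀ {g : E n → ℂ}, Integrable g → Integrable (fun v =>
      Real.fourierChar (-inner ℝ v z) • g v) := fun hg =>
    (Real.fourierIntegral_convergent_iff z).2 hg
  have hsum : ∀ v, bessel basisVec f v = f v - (((4 * Real.pi ^ 2)⁻¹ : ℝ) : ℂ) •
      ∑ j : Fin n, dirDeriv (basisVec j) (dirDeriv (basisVec j) f) v := fun v => rfl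
  rw [Real.fourier_eq]
  simp only [hsum, smul_sub, Finset.smul_sum, smul_comm (Real.fourierChar _) (_ : ℂ)]
  have h3 : ∀ j : Fin n, Integrable (fun v => (((4 * Real.pi ^ 2)⁻¹ : ℝ) : ℂ) •
      Real.fourierChar (-inner ℝ v z) • dirDeriv (basisVec j) (dirDeriv (basisVec j) f) v) := fun j =>
    (hint (integrable_of_germBound (h2 _))).smul (((4 * Real.pi ^ 2)⁻¹ : ℝ) : ℂ)
  rw [integral_sub (hint (integrable_of_germBound hf)) (integrable_finsetSum _ fun j _ => h3 j),
    integral_finsetSum _ fun j _ => h3 j]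
  simp only [integral_smul, ← Real.fourier_eq, fourier_dirDeriv (h1 _), fourier_dirDeriv hf]
  rw [EuclideanSpace.norm_sq_eq]
  simp only [basisVec, EuclideanSpace.inner_single_right, smul_eq_mul, Real.norm_eq_abs, sq_abs]
  have hpi : (Real.pi : ℂ) ≠ 0 := by exact_mod_cast Real.pi_ne_zero
  push_cast
  rw [add_mul, one_mul, sub_eq_add_neg, Finset.sum_mul, ← Finset.sum_neg_distrib]
  congr 1
  refine Finset.sum_congr rfl fun j _ => ?_
  simp
  field_simp
  rw [Complex.I_sq]; ring

theorem fourier_bessel_iterate {f : E n → ℂ} (hf : GermBound (fun w : E n => w) (fun _ => 1)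
    (fun w => japInv w ^ (n + 1)) (fun _ => f)) (k : ℕ) (z : E n) :
    𝓕 ((bessel basisVec)^[k] f) z = ((1 + ‖z‖ ^ 2 : ℝ) : ℂ) ^ k * 𝓕 f z := by
  have hj : ∀ w : E n, 0 ≤ japInv w ^ (n + 1) := fun w => by have := japInv_pos w; positivity
  induction k with
  | zero => simp
  | succ k ih =>
    rw [Function.iterate_succ_apply', fourier_bessel, ih, pow_succ]
    · ring
    · simpa using hf.bessel_iterate basisVec (by simp) hj k

end BddSmooth

/-! ### Linearity of the Bessel operator. -/

section Linear

variable {n : ℕ} {V : Type*} [NormedAddCommGroup V] [NormedSpace ℝ V]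

theorem dirDeriv_add_const_mul {f g : V → ℂ} (hf : ContDiff ℝ ∞ f) (hg : ContDiff ℝ ∞ g) (c : ℂ)
    (v : V) : dirDeriv v (fun y => f y + c * g y) = fun y => dirDeriv v f y + c * dirDeriv v g y := by
  ext y
  have h1 := (hf.differentiable (by simp)).differentiableAt (x := y)
  have h2 := (hg.differentiable (by simp)).differentiableAt (x := y)
  simp only [dirDeriv]
  rw [fderiv_fun_add h1 (h2.const_mul c), fderiv_const_mul h2]
  simp

theorem bessel_add_const_mul {f g : V → ℂ} (hf : ContDiff ℝ ∞ f) (hg : ContDiff ℝ ∞ g) (c : ℂ)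
    (e : Fin n → V) : bessel e (fun y => f y + c * g y) = fun y => bessel e f y + c * bessel e g y := by
  ext y
  simp only [bessel, dirDeriv_add_const_mul hf hg, dirDeriv_add_const_mul
    (contDiff_dirDeriv hf _) (contDiff_dirDeriv hg _), Finset.sum_add_distrib, ← Finset.mul_sum]
  ring

theorem bessel_iterate_add_const_mul {f g : V → ℂ} (hf : ContDiff ℝ ∞ f) (hg : ContDiff ℝ ∞ g)
    (c : ℂ) (e : Fin n → V) (k : ℕ) : (bessel e)^[k] (fun y => f y + c * g y) =
      fun y => (bessel e)^[k] f y + c * (bessel e)^[k] g y := by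
  induction k with
  | zero => rfl
  | succ k ih =>
    simp only [Function.iterate_succ_apply', ih]
    exact bessel_add_const_mul (contDiff_bessel_iterate hf e k) (contDiff_bessel_iterate hg e k) c e

theorem bessel_iterate_zero (e : Fin n → V) (k : ℕ) :
    (bessel e)^[k] (fun _ => 0) = fun _ => 0 := by
  induction k with
  | zero => rfl
  | succ k ih =>
    rw [Function.iterate_succ_apply', ih]
    have h : ∀ v, dirDeriv v (fun _ : V => (0 : ℂ)) = fun _ => 0 := fun v => by
      ext y; simp [dirDeriv]
    ext y; simp [bessel, h]

theorem bessel_iterate_const_mul {g : V → ℂ} (hg : ContDiff ℝ ∞ g)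
    (c : ℂ) (e : Fin n → V) (k : ℕ) : (bessel e)^[k] (fun y => c * g y) =
      fun y => c * (bessel e)^[k] g y := by
  have := bessel_iterate_add_const_mul (f := fun _ : V => (0 : ℂ)) contDiff_const hg c e k
  simpa [bessel_iterate_zero] using this

end Linear
end FourierIntOp
end

noncomputable section
namespace FourierIntOp

open MeasureTheory FourierTransform

/-! ### Oscillatory integrals in two variables and their regularisation. -/

section Oscillatory

variable {n : ℕ}

instance : (volume : Measure (E n × E n)).HasTemperateGrowth := by
  have : (volume : Measure (E n × E n)).IsAddHaarMeasure := by
    rw [Measure.volume_eq_prod]; infer_instance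
  infer_instance

/-- The kernel `e^{-2πi z·w}`. -/
def oscChar (p : E n × E n) : ℂ := ((Real.fourierChar (-inner ℝ p.1 p.2) : Circle) : ℂ)

theorem norm_oscChar (p : E n × E n) : ‖oscChar p‖ = 1 := Circle.norm_coe _

theorem continuous_oscChar : Continuous (oscChar : E n × E n → ℂ) := by
  unfold oscChar
  exact continuous_subtype_val.comp (Real.continuous_fourierChar.comp
    (continuous_fst.inner continuous_snd).neg)

theorem integrable_oscChar_mul {f : E n × E n → ℂ} (hf : Integrable f) :
    Integrable (fun p => oscChar p * f p) :=
  hf.bdd_mul (c := 1) continuous_oscChar.aestronglyMeasurable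
    (Filter.Eventually.of_forall fun p => (norm_oscChar p).le)

/-- The integral `∬ e^{-2πi z·w} f(z, w) dz dw`. -/
def osc (f : E n × E n → ℂ) : ℂ := ∫ p, oscChar p * f p

theorem fourier_eq_integral_oscChar (f : E n → ℂ) (w : E n) : 𝓕 f w = ∫ z, oscChar (z, w) * f z :=
  rfl

theorem osc_swap (f : E n × E n → ℂ) : osc (fun p => f p.swap) = osc f := by
  unfold osc
  rw [Measure.volume_eq_prod, ← integral_prod_swap]
  simp [oscChar, real_inner_comm]

/-- The basis directions of the first factor. -/
def basisFst (j : Fin n) : E n × E n := (basisVec j, 0)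

/-- The basis directions of the second factor. -/
def basisSnd (j : Fin n) : E n × E n := (0, basisVec j)

theorem bessel_basisFst {f : E n × E n → ℂ} (hf : ContDiff ℝ ∞ f) (k : ℕ) (z w : E n) :
    (bessel basisVec)^[k] (fun y => f (y, w)) z = (bessel basisFst)^[k] f (z, w) := by
  have := congrFun (bessel_iterate_comp_affine hf (ContinuousLinearMap.inl ℝ (E n) (E n)) (0, w)
    basisVec k) z
  simpa [basisFst] using! this

theorem bessel_basisSnd {f : E n × E n → ℂ} (hf : ContDiff ℝ ∞ f) (k : ℕ) (z w : E n) :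
    (bessel basisVec)^[k] (fun y => f (z, y)) w = (bessel basisSnd)^[k] f (z, w) := by
  have := congrFun (bessel_iterate_comp_affine hf (ContinuousLinearMap.inr ℝ (E n) (E n)) (z, 0)
    basisVec k) w
  simpa [basisSnd] using! this

/-- For fixed `w` the inner integral is a Fourier transform at `w`, where the Bessel operator acts
as multiplication by `1 + |w|²`. Both double integrals converge absolutely, so Fubini's theorem
assembles the slices. -/
theorem osc_eq_fst (f : 𝓢(E n × E n, ℂ)) (N : ℕ) :
    osc f = osc (fun p => ((japInv p.2 : ℝ) : ℂ) ^ N * (bessel basisFst)^[N] f p) := by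
  have hslice : ∀ w : E n, ∫ z, oscChar (z, w) * f (z, w) =
      ∫ z, oscChar (z, w) * (((japInv w : ℝ) : ℂ) ^ N * (bessel basisFst)^[N] f (z, w)) := by
    intro w
    have hg : (fun z : E n => (z, w)).HasTemperateGrowth := by
      have := (Function.HasTemperateGrowth.const (E := E n) ((0, w) : E n × E n)).add
        (ContinuousLinearMap.inl ℝ (E n) (E n)).hasTemperateGrowth
      convert! this using 1
      ext z <;> simp
    have ha : AntilipschitzWith 1 (fun z : E n => (z, w)) := by
      refine AntilipschitzWith.of_le_mul_dist fun x y => ?_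
      simp [Prod.dist_eq]
    let fw : 𝓢(E n, ℂ) := SchwartzMap.compCLMOfAntilipschitz ℂ hg ha f
    have h := fourier_besselS_iterate fw N w
    rw [SchwartzMap.fourier_coe, SchwartzMap.fourier_coe, coe_besselS_iterate] at h
    have h2 : ∀ z, (bessel basisVec)^[N] fw z = (bessel basisFst)^[N] f (z, w) := fun z =>
      bessel_basisFst (f.smooth ⊤) N z w
    have h1 : ((1 + ‖w‖ ^ 2 : ℝ) : ℂ) ≠ 0 := by rw [Complex.ofReal_ne_zero]; positivity
    calc ∫ z, oscChar (z, w) * f (z, w) = 𝓕 (⇑fw) w := rfl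
      _ = ((japInv w : ℝ) : ℂ) ^ N * 𝓕 ((bessel basisVec)^[N] ⇑fw) w := by
        rw [h, japInv, Complex.ofReal_inv, inv_pow, inv_mul_cancel_left₀ (pow_ne_zero _ h1)]
      _ = _ := by
        rw [fourier_eq_integral_oscChar, ← integral_const_mul]
        refine integral_congr_ae (Filter.Eventually.of_forall fun z => ?_)
        beta_reduce; rw [h2]; ring
  have hint : Integrable (fun p : E n × E n => ((japInv p.2 : ℝ) : ℂ) ^ N * (bessel basisFst)^[N] f p) := by
    rw [← coe_besselS_iterate]
    have hb := (bddSmooth_japInv_pow (n := n) N).comp_clm (ContinuousLinearMap.snd ℝ (E n) (E n))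
    obtain ⟨C, hC⟩ := hb.exists_norm_le
    exact ((besselS basisFst)^[N] f).integrable.bdd_mul (c := C)
      hb.contDiff.continuous.aestronglyMeasurable (Filter.Eventually.of_forall hC)
  unfold osc
  rw [Measure.volume_eq_prod, integral_prod_symm, integral_prod_symm]
  · exact integral_congr_ae (Filter.Eventually.of_forall hslice)
  · exact integrable_oscChar_mul hint
  · exact integrable_oscChar_mul f.integrable

theorem osc_eq_snd (f : 𝓢(E n × E n, ℂ)) (N : ℕ) :
    osc f = osc (fun p => ((japInv p.1 : ℝ) : ℂ) ^ N * (bessel basisSnd)^[N] f p) := by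
  let fs : 𝓢(E n × E n, ℂ) := SchwartzMap.compCLMOfContinuousLinearEquiv ℂ
    (ContinuousLinearEquiv.prodComm ℝ (E n) (E n)) f
  have h1 : osc f = osc fs := (osc_swap f).symm
  rw [h1, osc_eq_fst fs N, ← osc_swap]
  congr 1
  ext p
  have := congrFun (bessel_iterate_comp_affine (f.smooth ⊤)
    (ContinuousLinearEquiv.prodComm ℝ (E n) (E n)).toContinuousLinearMap 0 basisFst N) p.swap
  simp only [zero_add] at this
  congr 1

/-- The regularisation of an oscillatory integrand by integration by parts in both variables. -/
def oscReg (f : E n × E n → ℂ) (p : E n × E n) : ℂ :=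
  ((japInv p.1 : ℝ) : ℂ) ^ (n + 1) * (bessel basisSnd)^[n + 1]
    (fun p => ((japInv p.2 : ℝ) : ℂ) ^ (n + 1) * (bessel basisFst)^[n + 1] f p) p

theorem contDiff_japInv_snd_mul {f : E n × E n → ℂ} (hf : ContDiff ℝ ∞ f) :
    ContDiff ℝ ∞ (fun p : E n × E n => ((japInv p.2 : ℝ) : ℂ) ^ (n + 1) * (bessel basisFst)^[n + 1] f p) :=
  ((bddSmooth_japInv_pow (n := n) (n + 1)).comp_clm
    (ContinuousLinearMap.snd ℝ (E n) (E n))).contDiff.mul (contDiff_bessel_iterate hf _ _)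

/-- The point is that the right-hand side still converges absolutely when the integrand is merely
bounded with all its derivatives. -/
theorem osc_eq_oscReg (f : 𝓢(E n × E n, ℂ)) : osc f = osc (oscReg f) := by
  have hg := ((bddSmooth_japInv_pow (n := n) (n + 1)).comp_clm
    (ContinuousLinearMap.snd ℝ (E n) (E n))).hasTemperateGrowth
  let f1 : 𝓢(E n × E n, ℂ) := SchwartzMap.smulLeftCLM ℂ
    (fun p : E n × E n => ((japInv p.2 : ℝ) : ℂ) ^ (n + 1)) ((besselS basisFst)^[n + 1] f)
  have h1 : (f1 : E n × E n → ℂ) = fun p => ((japInv p.2 : ℝ) : ℂ) ^ (n + 1) *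
      (bessel basisFst)^[n + 1] f p := by
    ext p
    rw [← coe_besselS_iterate]
    exact SchwartzMap.smulLeftCLM_apply_apply hg _ p
  rw [osc_eq_fst f (n + 1), ← h1, osc_eq_snd f1 (n + 1), h1]
  rfl

theorem oscReg_add_const_mul {f g : E n × E n → ℂ} (hf : ContDiff ℝ ∞ f) (hg : ContDiff ℝ ∞ g)
    (c : ℂ) : oscReg (fun p => f p + c * g p) = fun p => oscReg f p + c * oscReg g p := by
  ext p
  unfold oscReg
  rw [bessel_iterate_add_const_mul hf hg]
  simp only [mul_add, mul_left_comm _ c]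
  rw [bessel_iterate_add_const_mul (contDiff_japInv_snd_mul hf) (contDiff_japInv_snd_mul hg)]
  ring

theorem germBound_oscReg {ι : Type*} {z : ι → E n × E n} {W : ι → ℝ} {f : ι → E n × E n → ℂ}
    (hW : ∀ p, 0 ≤ W p) (hf : GermBound z (fun _ => 1) W f) :
    GermBound z (fun _ => 1)
      (fun p => W p * (japInv (z p).1 ^ (n + 1) * japInv (z p).2 ^ (n + 1))) (fun p => oscReg (f p)) := by
  have hj : ∀ w : E n, 0 ≤ japInv w ^ (n + 1) := fun w => by have := japInv_pos w; positivity
  have h1 := (hf.bessel_iterate basisFst (fun _ => le_rfl) hW (n + 1))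
  have hw : ∀ L : E n × E n →L[ℝ] E n, ‖L‖ ≤ 1 → GermBound z (fun _ => 1)
      (fun p => japInv (L (z p)) ^ (n + 1)) (fun _ p => ((japInv (L p) : ℝ) : ℂ) ^ (n + 1)) := by
    intro L hL
    have := ((germBound_japInv_pow (ι := Unit) (n := n) (n + 1)).reindex (fun p : ι => ((), 0 + L (z p)))).comp_affine
      (fun _ => 0) (fun _ => L) (z := z)
    simp only [zero_add, Function.comp_def, one_mul] at this
    exact this.mono (by simp) (fun p => hj _) 1 1 (by simp) (fun _ => by simpa using hL)
  have h2 := (hw (ContinuousLinearMap.snd ℝ _ _) (ContinuousLinearMap.norm_snd_le ..)).mul h1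
    (by simp) (fun p => hj _) (fun p => by simpa using hW p)
  have h3 := h2.bessel_iterate basisSnd (fun _ => le_rfl) (fun p => by
    have := hW p; have := hj (z p).2; simpa using mul_nonneg this (hW p)) (n + 1)
  have h4 := (hw (ContinuousLinearMap.fst ℝ _ _) (ContinuousLinearMap.norm_fst_le ..)).mul h3
    (by simp) (fun p => hj _) (fun p => by
    have := hW p; have := hj (z p).2; simpa using mul_nonneg this (hW p))
  refine h4.mono (by simp) (fun p => ?_) 1 1 (fun p => le_of_eq ?_) (by simp)
  · have := hW p; have := hj (z p).2; have := hj (z p).1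
    simp only [ContinuousLinearMap.coe_fst', ContinuousLinearMap.coe_snd', one_pow]; positivity
  · simp only [ContinuousLinearMap.coe_fst', ContinuousLinearMap.coe_snd', one_pow]; ring

/-- The spare factor `1 + ‖p‖` pays for the estimate `κ(δp) - κ(0) = O(δ(1 + ‖p‖))`. After it, the
weights still leave `(1+|z|)^{-(n+1)}` in each variable. -/
theorem integrable_japInv_prod : Integrable (fun p : E n × E n =>
    (1 + ‖p‖) * (japInv p.1 ^ (n + 1) * japInv p.2 ^ (n + 1))) := by
  have h := (integrable_one_add_norm_inv (n := n)).mul_prod (integrable_one_add_norm_inv (n := n))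
  have h1 : ∀ z : E n, (1 + ‖z‖) * japInv z ^ (n + 1) ≤ 2 ^ (n + 1) * ((1 + ‖z‖) ^ (n + 1))⁻¹ := by
    intro z
    have hz : (1 : ℝ) ≤ 1 + ‖z‖ := by simp
    calc (1 + ‖z‖) * japInv z ^ (n + 1) ≤ (1 + ‖z‖) ^ (n + 1) * (2 * ((1 + ‖z‖) ^ 2)⁻¹) ^ (n + 1) := by
          have := japInv_pos z
          gcongr
          · exact le_self_pow₀ hz (by omega)
          · exact japInv_le z
      _ = _ := by
          rw [mul_pow, inv_pow, ← pow_mul, two_mul, pow_add, mul_inv]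
          field_simp
          ring
  refine (h.const_mul (2 ^ (n + 1) * 2 ^ (n + 1))).mono' ?_ (Filter.Eventually.of_forall fun p => ?_)
  · refine Continuous.aestronglyMeasurable ?_
    have : ∀ w : E n, 1 + ‖w‖ ^ 2 ≠ 0 := fun w => by positivity
    unfold japInv
    fun_prop (disch := intro; positivity)
  · have hp1 := japInv_pos p.1
    have hp2 := japInv_pos p.2
    rw [Real.norm_of_nonneg (by positivity)]
    have h3 : 1 + ‖p‖ ≤ (1 + ‖p.1‖) * (1 + ‖p.2‖) := by
      have : ‖p‖ ≤ ‖p.1‖ + ‖p.2‖ := max_le_add_of_nonneg (norm_nonneg _) (norm_nonneg _)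
      nlinarith [norm_nonneg p.1, norm_nonneg p.2]
    calc (1 + ‖p‖) * (japInv p.1 ^ (n + 1) * japInv p.2 ^ (n + 1))
        ≤ ((1 + ‖p.1‖) * (1 + ‖p.2‖)) * (japInv p.1 ^ (n + 1) * japInv p.2 ^ (n + 1)) := by gcongr
      _ = ((1 + ‖p.1‖) * japInv p.1 ^ (n + 1)) * ((1 + ‖p.2‖) * japInv p.2 ^ (n + 1)) := by ring
      _ ≤ (2 ^ (n + 1) * ((1 + ‖p.1‖) ^ (n + 1))⁻¹) * (2 ^ (n + 1) * ((1 + ‖p.2‖) ^ (n + 1))⁻¹) := by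
          have := h1 p.1
          have := h1 p.2
          exact mul_le_mul (h1 p.1) (h1 p.2) (by positivity) (by positivity)
      _ = _ := by ring

end Oscillatory
end FourierIntOp
end

noncomputable section
namespace FourierIntOp

open MeasureTheory FourierTransform

/-! ### Independence of the oscillatory integral from the cut-off. -/

section Limit

variable {n : ℕ}

theorem BddSmooth.tensor {b q : E n → ℂ} (hb : BddSmooth b) (hq : BddSmooth q) :
    BddSmooth (fun p : E n × E n => b p.1 * q p.2) :=
  (hb.comp_clm (ContinuousLinearMap.fst ℝ (E n) (E n))).mul
    (hq.comp_clm (ContinuousLinearMap.snd ℝ (E n) (E n)))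

theorem BddSmooth.germBound_regSymbol {q : E n → ℂ} (hq : BddSmooth q) :
    GermBound (fun w : E n => w) (fun _ => 1) (fun w => japInv w ^ (n + 1)) (fun _ => regSymbol q) := by
  have := (FourierIntOp.germBound_regSymbol (ι := Unit) (A := fun _ => 1) (q := fun _ => q) (by simp)
    (hq.reindex (fun p : Unit × E n => p.2))).reindex (fun w : E n => ((), w))
  simpa [Function.comp_def] using this

theorem BddSmooth.norm_oscReg_le {F : E n × E n → ℂ} (hF : BddSmooth F) :
    ∃ C, 0 ≤ C ∧ ∀ p, ‖oscReg F p‖ ≤ C * (japInv p.1 ^ (n + 1) * japInv p.2 ^ (n + 1)) := by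
  obtain ⟨C, h1, hC⟩ := (germBound_oscReg (by simp) hF).bound (by simp) (fun p => by
    have := japInv_pos p.1; have := japInv_pos p.2; positivity) 0
  exact ⟨C, by linarith, fun p => by simpa using hC 0 le_rfl p⟩

theorem BddSmooth.contDiff_oscReg {F : E n × E n → ℂ} (hF : BddSmooth F) :
    ContDiff ℝ ∞ (oscReg F) :=
  contDiff_iff_contDiffAt.2 (germBound_oscReg (by simp) hF).1

theorem BddSmooth.integrable_oscReg {F : E n × E n → ℂ} (hF : BddSmooth F) :
    Integrable (oscReg F) := by
  obtain ⟨C, h0, hC⟩ := hF.norm_oscReg_le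
  refine (integrable_japInv_prod.const_mul C).mono' hF.contDiff_oscReg.continuous.aestronglyMeasurable
    (Filter.Eventually.of_forall fun p => (hC p).trans ?_)
  have := japInv_pos p.1; have := japInv_pos p.2
  refine mul_le_mul_of_nonneg_left (le_mul_of_one_le_left (by positivity) (by simp)) h0

/-- On a product the two regularisations separate. The `w`-integral is the Fourier transform of the
Bessel iterates of `regSymbol q`, and the factor `(1 + |z|²)^{n+1}` it yields cancels the weight in
`z`. -/
theorem osc_oscReg_tensor {b q : E n → ℂ} (hb : BddSmooth b) (hq : BddSmooth q) :
    osc (oscReg (fun p => b p.1 * q p.2)) = opT q b := by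
  have hreg := hq.germBound_regSymbol
  have hrc : ContDiff ℝ ∞ (regSymbol q) := contDiff_iff_contDiffAt.2 hreg.1
  have h1 : ∀ z w, oscReg (fun p => b p.1 * q p.2) (z, w) =
      ((japInv z : ℝ) : ℂ) ^ (n + 1) * (bessel basisVec)^[n + 1] b z *
        (bessel basisVec)^[n + 1] (regSymbol q) w := by
    intro z w
    have h2 : ∀ p : E n × E n, (bessel basisFst)^[n + 1] (fun p => b p.1 * q p.2) p =
        (bessel basisVec)^[n + 1] b p.1 * q p.2 := fun p => by
      rw [← bessel_basisFst (hb.tensor hq).contDiff (n + 1) p.1 p.2]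
      simp only [mul_comm _ (q p.2)]
      rw [bessel_iterate_const_mul hb.contDiff]
    have h3 : (fun p : E n × E n => ((japInv p.2 : ℝ) : ℂ) ^ (n + 1) *
        (bessel basisFst)^[n + 1] (fun p => b p.1 * q p.2) p) =
        fun p => (bessel basisVec)^[n + 1] b p.1 * regSymbol q p.2 := by
      ext p; rw [h2, regSymbol]; ring
    have h4 : ContDiff ℝ ∞ (fun p : E n × E n => (bessel basisVec)^[n + 1] b p.1 * regSymbol q p.2) :=
      ((contDiff_bessel_iterate hb.contDiff _ _).comp contDiff_fst).mul (hrc.comp contDiff_snd)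
    unfold oscReg
    rw [h3, ← bessel_basisSnd h4 (n + 1) z w]
    dsimp only
    rw [bessel_iterate_const_mul hrc]
    ring
  unfold osc
  rw [Measure.volume_eq_prod, integral_prod _ (integrable_oscChar_mul (hb.tensor hq).integrable_oscReg)]
  unfold opT
  refine integral_congr_ae (Filter.Eventually.of_forall fun z => ?_)
  have h5 := fourier_bessel_iterate hreg (n + 1) z
  rw [fourier_eq_integral_oscChar] at h5
  have hc : ((1 + ‖z‖ ^ 2 : ℝ) : ℂ) ≠ 0 := by rw [Complex.ofReal_ne_zero]; positivity
  have h6 : ∫ w, oscChar (z, w) * (bessel basisVec)^[n + 1] (regSymbol q) w =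
      ((1 + ‖z‖ ^ 2 : ℝ) : ℂ) ^ (n + 1) * 𝓕 (regSymbol q) z := by
    rw [← h5]
    refine integral_congr_ae (Filter.Eventually.of_forall fun w => ?_)
    simp [oscChar, real_inner_comm]
  calc ∫ w, oscChar (z, w) * oscReg (fun p => b p.1 * q p.2) (z, w)
      = ((japInv z : ℝ) : ℂ) ^ (n + 1) * (bessel basisVec)^[n + 1] b z *
        ∫ w, oscChar (z, w) * (bessel basisVec)^[n + 1] (regSymbol q) w := by
        rw [← integral_const_mul]
        refine integral_congr_ae (Filter.Eventually.of_forall fun w => ?_)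
        beta_reduce; rw [h1]; ring
    _ = _ := by
        rw [h6, japInv, Complex.ofReal_inv, inv_pow]
        field_simp

/-- The value is controlled by the mean value inequality, and a derivative of order `i ≥ 1` brings
`δ^i ≤ δ`. The factor `δ` is thus gained at every order, at the price of linear growth. -/
theorem _root_.SchwartzMap.norm_dilate_sub_le {V : Type*} [NormedAddCommGroup V] [NormedSpace ℝ V]
    (κ : 𝓢(V, ℂ)) :
    GermBound (fun p : Set.Ioc (0 : ℝ) 1 × V => p.2) (fun _ => 1) (fun p => p.1.1 * (1 + ‖p.2‖))
      (fun p y => κ (p.1.1 • y) + -κ 0) := by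
  have hκ : BddSmooth (fun y => κ y + -κ 0) := by
    simpa using GermBound.add κ.bddSmooth (bddSmooth_const (V := V) (-κ 0))
  have hsm : ∀ p : Set.Ioc (0 : ℝ) 1 × V, ContDiffAt ℝ ∞ (fun y => κ (p.1.1 • y) + -κ 0) p.2 :=
    fun p => (((κ.smooth ⊤).comp (contDiff_const_smul _)).add contDiff_const).contDiffAt
  refine ⟨hsm, fun i => ?_⟩
  have hδ : ∀ p : Set.Ioc (0 : ℝ) 1 × V, 0 < p.1.1 ∧ p.1.1 ≤ 1 := fun p => p.1.2
  rcases Nat.eq_zero_or_pos i with rfl | hi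
  · obtain ⟨C, hC⟩ := κ.bddSmooth.2 1
    refine ⟨C, fun p => ?_⟩
    have h := Convex.norm_image_sub_le_of_norm_fderiv_le (𝕜 := ℝ) (f := κ) (C := C) (s := Set.univ)
      (x := 0) (y := p.1.1 • p.2) (fun x _ => (κ.differentiable).differentiableAt)
      (fun x _ => by
        have := hC x
        rw [← norm_iteratedFDeriv_one]; simpa using this)
      convex_univ trivial trivial
    have hC0 : 0 ≤ C := (norm_nonneg _).trans ((hC 0).trans (by simp))
    have h0 := (hδ p).1
    beta_reduce
    rw [norm_iteratedFDeriv_zero, ← sub_eq_add_neg, pow_zero, mul_one]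
    refine h.trans ?_
    rw [sub_zero, norm_smul, Real.norm_of_nonneg h0.le]
    gcongr
    simp
  · obtain ⟨C, hC⟩ := hκ.2 i
    refine ⟨C, fun p => ?_⟩
    have hC0 : 0 ≤ C := (norm_nonneg _).trans ((hC 0).trans (by simp))
    obtain ⟨h0, h1⟩ := hδ p
    have h := (hκ.contDiff.contDiffAt (x := 0 + (p.1.1 • ContinuousLinearMap.id ℝ V) p.2)).norm_iteratedFDeriv_comp_affine_le
      0 (p.1.1 • ContinuousLinearMap.id ℝ V) i
    simp only [zero_add, smul_apply, ContinuousLinearMap.id_apply] at h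
    refine h.trans ?_
    have h2 : ‖p.1.1 • ContinuousLinearMap.id ℝ V‖ ≤ p.1.1 := by
      rw [norm_smul, Real.norm_of_nonneg h0.le]
      exact mul_le_of_le_one_right h0.le ContinuousLinearMap.norm_id_le
    have h3 := hC (p.1.1 • p.2)
    simp only [one_pow, mul_one] at h3
    calc _ ≤ C * p.1.1 ^ i := by gcongr
      _ ≤ C * (p.1.1 * (1 + ‖p.2‖)) := by
        gcongr
        exact (pow_le_of_le_one h0.le h1 hi.ne').trans (le_mul_of_one_le_right h0.le (by simp))
      _ = _ := by simp

/-- Schwartz functions `κ(δ ·)`. -/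
def dilateS {V : Type*} [NormedAddCommGroup V] [NormedSpace ℝ V] (κ : 𝓢(V, ℂ)) (δ : ℝ)
    (hδ : δ ≠ 0) : 𝓢(V, ℂ) :=
  SchwartzMap.compCLMOfContinuousLinearEquiv ℂ (ContinuousLinearEquiv.smulLeft (Units.mk0 δ hδ)) κ

theorem integrable_schwartz_mul {κ : 𝓢(E n × E n, ℂ)} {F : E n × E n → ℂ} (hF : Continuous F)
    {C : ℝ} (hC : ∀ p, ‖F p‖ ≤ C) {δ : ℝ} (hδ : 0 < δ) : Integrable (fun p => κ (δ • p) * F p) := by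
  have := (dilateS κ δ hδ.ne').integrable (μ := volume)
  exact this.mul_bdd (c := C) hF.aestronglyMeasurable (Filter.Eventually.of_forall hC)

/-- After regularisation, the integrand with cut-off differs from its limit by at most `δ` times a
fixed integrable function, by `SchwartzMap.norm_dilate_sub_le`; the limit is attained at rate
`O(δ)`. -/
theorem tendsto_osc {b q : E n → ℂ} (hb : BddSmooth b) (hq : BddSmooth q) (κ : 𝓢(E n × E n, ℂ)) :
    Filter.Tendsto (fun δ : ℝ => osc (fun p => κ (δ • p) * (b p.1 * q p.2))) (𝓝[>] 0)
      (𝓝 (κ 0 * opT q b)) := by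
  have hB := hb.tensor hq
  set B : E n × E n → ℂ := fun p => b p.1 * q p.2 with hBdef
  have hW : ∀ p : Set.Ioc (0 : ℝ) 1 × (E n × E n), 0 ≤ p.1.1 * (1 + ‖p.2‖) := fun p => by
    have := p.1.2.1; positivity
  have hG := germBound_oscReg (n := n) hW (by
    simpa using κ.norm_dilate_sub_le.mul (hB.reindex (fun p : Set.Ioc (0 : ℝ) 1 × (E n × E n) => p.2))
      (by simp) hW (by simp))
  obtain ⟨C, hC⟩ := hG.2 0
  simp only [norm_iteratedFDeriv_zero, pow_zero, mul_one] at hC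
  set D := C * ∫ p : E n × E n, (1 + ‖p‖) * (japInv p.1 ^ (n + 1) * japInv p.2 ^ (n + 1)) with hD
  have key : ∀ δ ∈ Set.Ioc (0 : ℝ) 1, ‖osc (fun p => κ (δ • p) * B p) - κ 0 * opT q b‖ ≤ δ * D := by
    intro δ hδ
    let f : 𝓢(E n × E n, ℂ) := SchwartzMap.smulLeftCLM ℂ B (dilateS κ δ hδ.1.ne')
    have hf : (f : E n × E n → ℂ) = fun p => κ (δ • p) * B p := by
      ext p
      rw [SchwartzMap.smulLeftCLM_apply_apply hB.hasTemperateGrowth, smul_eq_mul, mul_comm]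
      rfl
    have hh : ContDiff ℝ ∞ (fun p => (κ (δ • p) + -κ 0) * B p) :=
      (((κ.smooth ⊤).comp (contDiff_const_smul _)).add contDiff_const).mul hB.contDiff
    have h1 : oscReg f = fun p => oscReg (fun p => (κ (δ • p) + -κ 0) * B p) p +
        κ 0 * oscReg B p := by
      rw [← oscReg_add_const_mul hh hB.contDiff, hf]
      congr 1; ext p; ring
    have hint : Integrable (oscReg f) := f.bddSmooth.integrable_oscReg
    rw [← osc_oscReg_tensor hb hq, ← hf, osc_eq_oscReg]
    unfold osc
    rw [← integral_const_mul, ← integral_sub (integrable_oscChar_mul hint)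
      ((integrable_oscChar_mul hB.integrable_oscReg).const_mul _)]
    refine (norm_integral_le_of_norm_le ((integrable_japInv_prod (n := n)).const_mul (δ * C))
      (Filter.Eventually.of_forall fun p => ?_)).trans (le_of_eq ?_)
    · have h2 : oscChar p * oscReg f p - κ 0 * (oscChar p * oscReg B p) =
          oscChar p * oscReg (fun p => (κ (δ • p) + -κ 0) * B p) p := by rw [h1]; ring
      rw [h2, norm_mul, norm_oscChar, one_mul]
      have h3 := hC (⟨δ, hδ⟩, p)
      simp only at h3
      calc _ ≤ C * (δ * (1 + ‖p‖) * (japInv p.1 ^ (n + 1) * japInv p.2 ^ (n + 1))) := h3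
        _ = δ * C * ((1 + ‖p‖) * (japInv p.1 ^ (n + 1) * japInv p.2 ^ (n + 1))) := by ring
    · rw [integral_const_mul, hD]; ring
  rw [tendsto_iff_norm_sub_tendsto_zero]
  have hmem : ∀ᶠ δ : ℝ in 𝓝[>] 0, δ ∈ Set.Ioc (0 : ℝ) 1 := Ioc_mem_nhdsGT one_pos
  refine squeeze_zero' (Filter.Eventually.of_forall fun _ => norm_nonneg _) (hmem.mono key) ?_
  have : Filter.Tendsto (fun δ : ℝ => δ * D) (𝓝 0) (𝓝 (0 * D)) := Filter.tendsto_id.mul_const D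
  rw [zero_mul] at this
  exact this.mono_left nhdsWithin_le_nhds

theorem fourier_mul_char (f : E n → ℂ) (x z : E n) :
    𝓕 (fun w => f w * ((Real.fourierChar (inner ℝ x w) : Circle) : ℂ)) z = 𝓕 f (z - x) := by
  rw [fourier_eq_integral_oscChar, fourier_eq_integral_oscChar]
  refine integral_congr_ae (Filter.Eventually.of_forall fun w => ?_)
  simp only [oscChar]
  rw [mul_comm (f w), ← mul_assoc, ← Circle.coe_mul, ← AddChar.map_add_eq_mul]
  congr 4
  rw [inner_sub_right, real_inner_comm x w]; ring

/-- Modulating the symbol translates its kernel, and translation invariance of the integral moves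
the shift to the amplitude. -/
theorem opT_mul_char (q : E n → ℂ) {b : E n → ℂ} (hb : ContDiff ℝ ∞ b) (x : E n) :
    opT (fun w => q w * ((Real.fourierChar (inner ℝ x w) : Circle) : ℂ)) b =
      opT q (fun z => b (x + z)) := by
  have h1 : regSymbol (fun w => q w * ((Real.fourierChar (inner ℝ x w) : Circle) : ℂ)) =
      fun w => regSymbol q w * ((Real.fourierChar (inner ℝ x w) : Circle) : ℂ) := by
    ext w; simp only [regSymbol]; ring
  have h2 : (bessel basisVec)^[n + 1] (fun z => b (x + z)) =
      fun z => (bessel basisVec)^[n + 1] b (x + z) := by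
    simpa using bessel_iterate_comp_affine hb (ContinuousLinearMap.id ℝ (E n)) x basisVec (n + 1)
  unfold opT
  rw [h1, h2, ← integral_add_left_eq_self _ x]
  simp only [fourier_mul_char, add_sub_cancel_left]

end Limit
end FourierIntOp
end

noncomputable section
namespace FourierIntOp

open MeasureTheory FourierTransform

/-! ### Existence of the oscillatory integral and the composition formula. -/

section Composition

variable {n : ℕ}

/-- The substitution `η = 2πw` absorbs `(2π)^{-n}` and produces the kernel `oscChar`. The remaining
character `e^{2πi x·w}` belongs to the symbol and becomes a translation of `b`. -/
theorem hasOscIntegral_of_bddSmooth {b r : E n → ℂ} (hb : BddSmooth b) (hr : BddSmooth r) (x : E n) :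
    HasOscIntegral (fun y η => ((2 * Real.pi : ℝ) : ℂ)⁻¹ ^ n *
      (b y * r η * Complex.exp (Complex.I * (inner ℝ (x - y) η : ℝ))))
      (opT (fun w => r ((2 * Real.pi) • w)) (fun z => b (x + z))) := by
  intro κ hκ
  have hpi : (0 : ℝ) < 2 * Real.pi := by positivity
  have hr' : BddSmooth (fun w => r ((2 * Real.pi) • w)) :=
    hr.comp_clm ((2 * Real.pi) • ContinuousLinearMap.id ℝ (E n))
  have hq := hr'.mul (bddSmooth_of_smul_char x)
  set F : E n × E n → ℂ := fun p => ((2 * Real.pi : ℝ) : ℂ)⁻¹ ^ n *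
      (b p.1 * r p.2 * Complex.exp (Complex.I * (inner ℝ (x - p.1) p.2 : ℝ))) with hF
  have hFint : ∀ δ : ℝ, 0 < δ → Integrable (fun p => κ (δ • p) * F p) := by
    intro δ hδ
    obtain ⟨C, hC⟩ := (hb.tensor hr).exists_norm_le
    have hbc := hb.contDiff.continuous
    have hrc := hr.contDiff.continuous
    refine integrable_schwartz_mul (by fun_prop) (C := ‖((2 * Real.pi : ℝ) : ℂ)⁻¹ ^ n‖ * C) (fun p => ?_) hδ
    rw [norm_mul, norm_mul, mul_comm Complex.I, Complex.norm_exp_ofReal_mul_I, mul_one]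
    exact mul_le_mul_of_nonneg_left (hC p) (norm_nonneg _)
  refine ⟨hFint, ?_⟩
  -- The cut-off in the variables `(y, w)` with `η = 2πw`; it still equals 1 at the origin.
  let κ' : 𝓢(E n × E n, ℂ) := SchwartzMap.compCLMOfContinuousLinearEquiv ℂ
    ((ContinuousLinearEquiv.refl ℝ (E n)).prodCongr
      (ContinuousLinearEquiv.smulLeft (Units.mk0 (2 * Real.pi) hpi.ne'))) κ
  have hκ' : ∀ y w : E n, κ' (y, w) = κ (y, (2 * Real.pi) • w) := fun y w => rfl
  have h0 : κ' 0 = 1 := by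
    rw [← hκ, show (0 : E n × E n) = ((0 : E n), (0 : E n)) from rfl, hκ', smul_zero]
  have hlim := tendsto_osc hb hq κ'
  rw [h0, one_mul, opT_mul_char _ hb.contDiff] at hlim
  refine hlim.congr' ?_
  filter_upwards [self_mem_nhdsWithin] with δ hδ
  have hδ' : (0 : ℝ) < δ := hδ
  obtain ⟨C, hC⟩ := (hb.tensor hq).exists_norm_le
  unfold osc
  rw [Measure.volume_eq_prod, integral_prod, integral_prod]
  · refine integral_congr_ae (Filter.Eventually.of_forall fun y => ?_)
    have h := Measure.integral_comp_smul_of_nonneg (volume : Measure (E n))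
      (fun η => κ (δ • (y, η)) * F (y, η)) (2 * Real.pi) (hR := hpi.le)
    simp only [finrank_euclideanSpace, Fintype.card_fin] at h
    have hne : (2 * Real.pi) ^ n ≠ 0 := by positivity
    beta_reduce
    rw [eq_inv_smul_iff₀ hne] at h
    rw [← h, Complex.real_smul, ← integral_const_mul]
    refine integral_congr_ae (Filter.Eventually.of_forall fun w => ?_)
    have h1 : δ • (2 * Real.pi) • w = (2 * Real.pi) • δ • w := smul_comm _ _ _
    have hne' : ((2 * Real.pi : ℝ) : ℂ) ^ n ≠ 0 := by exact_mod_cast hne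
    have h2 : Complex.exp (Complex.I * (inner ℝ (x - y) ((2 * Real.pi) • w) : ℝ)) =
        oscChar (y, w) * ((Real.fourierChar (inner ℝ x w) : Circle) : ℂ) := by
      rw [oscChar, Real.fourierChar_apply, Real.fourierChar_apply, ← Complex.exp_add,
        inner_smul_right, inner_sub_left]
      congr 1; push_cast; ring
    simp only [hF, Prod.smul_mk, h1, hκ', h2, Complex.ofReal_pow, inv_pow]
    field_simp
  · exact hFint δ hδ'
  · exact integrable_oscChar_mul (integrable_schwartz_mul (hb.tensor hq).contDiff.continuous hC hδ')

/-- Parseval's identity, used twice, moves the multiplier from the test function to `g`. -/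
theorem integral_schwartz_mul_fourier {q : E n → ℂ} (hq : BddSmooth q) (g ψ : 𝓢(E n, ℂ)) :
    ∫ y, g y * 𝓕 (SchwartzMap.smulLeftCLM ℂ q (𝓕⁻ ψ)) y =
      ∫ x, opT (fun w => q w * ((Real.fourierChar (inner ℝ x w) : Circle) : ℂ)) g * ψ x := by
  rw [← SchwartzMap.integral_fourier_mul_eq]
  have h1 : ∀ w, 𝓕 g w * SchwartzMap.smulLeftCLM ℂ q (𝓕⁻ ψ) w =
      SchwartzMap.smulLeftCLM ℂ q (𝓕 g) w * 𝓕⁻ ψ w := fun w => by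
    rw [SchwartzMap.smulLeftCLM_apply_apply hq.hasTemperateGrowth,
      SchwartzMap.smulLeftCLM_apply_apply hq.hasTemperateGrowth]
    simp only [smul_eq_mul]; ring
  simp only [h1]
  rw [← SchwartzMap.integral_fourierInv_mul_eq]
  refine integral_congr_ae (Filter.Eventually.of_forall fun x => ?_)
  beta_reduce
  rw [opT_schwartz (hq.mul (bddSmooth_of_smul_char x)), SchwartzMap.fourierInv_coe, Real.fourierInv_eq]
  congr 1
  refine integral_congr_ae (Filter.Eventually.of_forall fun w => ?_)
  beta_reduce
  rw [SchwartzMap.smulLeftCLM_apply_apply hq.hasTemperateGrowth, Circle.smul_def,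
    SchwartzMap.fourier_coe, real_inner_comm]
  simp only [smul_eq_mul]; ring

/-- A cut-off reduces the claim to Schwartz functions. Both sides pass to the limit by dominated
convergence: on the left the amplitudes are uniformly bounded, on the right `norm_opT_le` is uniform
in `δ` and `x`. -/
theorem integral_mul_fourier_eq_opT {b q : E n → ℂ} (hb : BddSmooth b) (hq : BddSmooth q)
    (ψ : 𝓢(E n, ℂ)) :
    ∫ y, b y * 𝓕 (SchwartzMap.smulLeftCLM ℂ q (𝓕⁻ ψ)) y =
      ∫ x, opT q (fun z => b (x + z)) * ψ x := by
  set Θ := 𝓕 (SchwartzMap.smulLeftCLM ℂ q (𝓕⁻ ψ))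
  set bδ : ℝ → E n → ℂ := fun δ y => cutoff (δ • y) * b y with hbδ
  have hsm : ∀ δ, ContDiff ℝ ∞ (bδ δ) := fun δ =>
    (contDiff_cutoff.comp (contDiff_const_smul δ)).mul hb.contDiff
  have hgerm : GermBound (fun p : Set.Ioc (0 : ℝ) 1 × E n => p.2) (fun _ => 1) (fun _ => 1)
      (fun p => bδ p.1) :=
    (hb.reindex (fun p : Set.Ioc (0 : ℝ) 1 × E n => p.2)).cutoff_mul (by simp) (by simp)
      (δ := fun p => p.1.1) (fun p => by rw [abs_of_pos p.1.2.1]; exact p.1.2.2)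
  obtain ⟨C0, hC0⟩ := hgerm.2 0
  obtain ⟨C1, hC1⟩ := (hgerm.bessel_iterate basisVec (by simp) (by simp) (n + 1)).2 0
  simp only [norm_iteratedFDeriv_zero, one_pow, mul_one] at hC0 hC1
  have hshift : ∀ x δ, (bessel basisVec)^[n + 1] (fun z => bδ δ (x + z)) =
      fun z => (bessel basisVec)^[n + 1] (bδ δ) (x + z) := fun x δ => by
    simpa using bessel_iterate_comp_affine (hsm δ) (ContinuousLinearMap.id ℝ (E n)) x basisVec (n + 1)
  obtain ⟨C2, -, hC2⟩ := norm_opT_le (ι := Set.Ioc (0 : ℝ) 1 × E n) (A := fun _ => 1) (B := fun _ => C1)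
    (q := fun _ => q) (b := fun p z => bδ p.1 (p.2 + z)) (by simp)
    (hq.reindex (fun p : (Set.Ioc (0 : ℝ) 1 × E n) × E n => p.2)) 0 (fun p z => by
      rw [hshift, pow_zero, mul_one]; exact hC1 (p.1, p.2 + z))
  have hmem : ∀ᶠ δ : ℝ in 𝓝[>] 0, δ ∈ Set.Ioc (0 : ℝ) 1 := Ioc_mem_nhdsGT one_pos
  have h1 : Filter.Tendsto (fun δ => ∫ y, bδ δ y * Θ y) (𝓝[>] 0) (𝓝 (∫ y, b y * Θ y)) := by
    refine tendsto_integral_filter_of_dominated_convergence (fun y => C0 * ‖Θ y‖) ?_ ?_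
      (Θ.integrable.norm.const_mul _) ?_
    · exact Filter.Eventually.of_forall fun δ =>
        ((hsm δ).continuous.mul Θ.continuous).aestronglyMeasurable
    · filter_upwards [hmem] with δ hδ
      refine Filter.Eventually.of_forall fun y => ?_
      rw [norm_mul]
      exact mul_le_mul_of_nonneg_right (hC0 (⟨δ, hδ⟩, y)) (norm_nonneg _)
    · refine Filter.Eventually.of_forall fun y => Filter.Tendsto.mul_const _ ?_
      have h2 : Filter.Tendsto (fun δ : ℝ => cutoff (δ • y) * b y) (𝓝 0) (𝓝 (cutoff ((0 : ℝ) • y) * b y)) := by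
        have : Continuous (fun δ : ℝ => cutoff (δ • y) * b y) := by
          have := (contDiff_cutoff (n := n)).continuous
          fun_prop
        exact this.tendsto 0
      rw [zero_smul, cutoff_eq_one (by simp), one_mul] at h2
      exact h2.mono_left nhdsWithin_le_nhds
  have hS : ∀ δ : ℝ, 0 < δ → HasCompactSupport (bδ δ) := fun δ hδ =>
    (hasCompactSupport_cutoff.comp_smul hδ.ne').mul_right
  have h3 : ∀ (δ : ℝ) (hδ : 0 < δ), ∀ x,
      opT (fun w => q w * ((Real.fourierChar (inner ℝ x w) : Circle) : ℂ)) (bδ δ) =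
        𝓕⁻ (SchwartzMap.smulLeftCLM ℂ q (𝓕 ((hS δ hδ).toSchwartzMap (hsm δ)))) x := by
    intro δ hδ x
    have h := opT_schwartz (hq.mul (bddSmooth_of_smul_char x)) ((hS δ hδ).toSchwartzMap (hsm δ))
    refine Eq.trans (by rfl) (h.trans ?_)
    rw [SchwartzMap.fourierInv_coe, Real.fourierInv_eq]
    refine integral_congr_ae (Filter.Eventually.of_forall fun w => ?_)
    beta_reduce
    rw [SchwartzMap.smulLeftCLM_apply_apply hq.hasTemperateGrowth, Circle.smul_def,
      SchwartzMap.fourier_coe, real_inner_comm]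
    simp only [smul_eq_mul]; ring
  have h4 : Filter.Tendsto (fun δ => ∫ x, opT (fun w => q w * ((Real.fourierChar (inner ℝ x w) : Circle) : ℂ)) (bδ δ) * ψ x)
      (𝓝[>] 0) (𝓝 (∫ x, opT q (fun z => b (x + z)) * ψ x)) := by
    refine tendsto_integral_filter_of_dominated_convergence (fun y => C2 * (1 * C1) * ‖ψ y‖) ?_ ?_
      (ψ.integrable.norm.const_mul _) ?_
    · filter_upwards [hmem] with δ hδ
      simp only [h3 δ hδ.1]
      exact ((SchwartzMap.continuous _).mul ψ.continuous).aestronglyMeasurable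
    · filter_upwards [hmem] with δ hδ
      refine Filter.Eventually.of_forall fun y => ?_
      rw [norm_mul, opT_mul_char _ (hsm δ)]
      exact mul_le_mul_of_nonneg_right (hC2 (⟨δ, hδ⟩, y)) (norm_nonneg _)
    · refine Filter.Eventually.of_forall fun x => Filter.Tendsto.mul_const _ ?_
      rw [← opT_mul_char _ hb.contDiff]
      exact tendsto_opT_cutoff (B := C1) (P := 0) (hq.mul (bddSmooth_of_smul_char x))
        (fun δ hδ z => by rw [pow_zero, mul_one]; exact hC1 (⟨δ, hδ⟩, z)) hb.contDiff
  refine tendsto_nhds_unique (h1.congr' ?_) h4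
  filter_upwards [hmem] with δ hδ
  exact integral_schwartz_mul_fourier hq ((hS δ hδ.1).toSchwartzMap (hsm δ)) ψ

/-- The function `fourierT f` as a Schwartz function. -/
def fourierTS (f : 𝓢(E n, ℂ)) : 𝓢(E n, ℂ) := dilateS (𝓕 f) (2 * Real.pi)⁻¹ (by positivity)

theorem coe_fourierTS (f : 𝓢(E n, ℂ)) (ξ : E n) : fourierTS f ξ = fourierT f ξ := by
  change 𝓕 f ((2 * Real.pi)⁻¹ • ξ) = _
  rw [SchwartzMap.fourier_coe, Real.fourier_eq', fourierT]
  refine integral_congr_ae (Filter.Eventually.of_forall fun x => ?_)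
  beta_reduce
  rw [smul_eq_mul, mul_comm, inner_smul_right]
  congr 2
  push_cast
  have : (Real.pi : ℂ) ≠ 0 := by exact_mod_cast Real.pi_ne_zero
  field_simp

theorem memLp_fio {φ : E n → E n → ℝ} {a : E n → E n → ℂ}
    (hm : Measurable (fun p : E n × E n => a p.1 p.2 * Complex.exp (Complex.I * (φ p.1 p.2 : ℝ))))
    {C : ℝ} (hC : ∀ x ξ, ‖a x ξ * Complex.exp (Complex.I * (φ x ξ : ℝ))‖ ≤ C) (f : 𝓢(E n, ℂ)) :
    MemLp (fio φ a f) ⊤ := by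
  have h1 : ∀ x ξ, a x ξ * fourierT f ξ * Complex.exp (Complex.I * (φ x ξ : ℝ)) =
      (a x ξ * Complex.exp (Complex.I * (φ x ξ : ℝ))) * fourierTS f ξ := fun x ξ => by
    rw [coe_fourierTS]; ring
  have hm2 : StronglyMeasurable (fun p : E n × E n =>
      (a p.1 p.2 * Complex.exp (Complex.I * (φ p.1 p.2 : ℝ))) * fourierTS f p.2) :=
    (hm.mul ((fourierTS f).continuous.measurable.comp measurable_snd)).stronglyMeasurable
  refine memLp_top_of_bound (C := ‖((2 * Real.pi : ℝ) : ℂ)⁻¹ ^ n‖ * (C * ∫ ξ, ‖fourierTS f ξ‖)) ?_ ?_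
  · unfold fio
    simp only [h1]
    exact (hm2.integral_prod_right'.const_mul _).aestronglyMeasurable
  · refine Filter.Eventually.of_forall fun x => ?_
    rw [fio, norm_mul, ← integral_const_mul C]
    refine mul_le_mul_of_nonneg_left (norm_integral_le_of_norm_le
      ((fourierTS f).integrable.norm.const_mul _) (Filter.Eventually.of_forall fun ξ => ?_)) (norm_nonneg _)
    rw [h1, norm_mul]
    exact mul_le_mul_of_nonneg_right (hC x ξ) (norm_nonneg _)

theorem integral_fio_mul {φ : E n → E n → ℝ} {a : E n → E n → ℂ}
    (hm : Measurable (fun p : E n × E n => a p.1 p.2 * Complex.exp (Complex.I * (φ p.1 p.2 : ℝ))))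
    {C : ℝ} (hC : ∀ x ξ, ‖a x ξ * Complex.exp (Complex.I * (φ x ξ : ℝ))‖ ≤ C) (f ψ : 𝓢(E n, ℂ)) :
    ∫ x, ψ x * fio φ a f x = ((2 * Real.pi : ℝ) : ℂ)⁻¹ ^ n *
      ∫ ξ, fourierTS f ξ * ∫ x, (a x ξ * Complex.exp (Complex.I * (φ x ξ : ℝ))) * ψ x := by
  have hint : Integrable (fun p : E n × E n => (a p.1 p.2 * Complex.exp (Complex.I * (φ p.1 p.2 : ℝ))) *
      (ψ p.1 * fourierTS f p.2)) (volume.prod volume) :=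
    (ψ.integrable.mul_prod (fourierTS f).integrable).bdd_mul (c := C) hm.aestronglyMeasurable
      (Filter.Eventually.of_forall fun p => hC p.1 p.2)
  calc ∫ x, ψ x * fio φ a f x = ((2 * Real.pi : ℝ) : ℂ)⁻¹ ^ n * ∫ x, ∫ ξ,
        (a x ξ * Complex.exp (Complex.I * (φ x ξ : ℝ))) * (ψ x * fourierTS f ξ) := by
        rw [← integral_const_mul]
        refine integral_congr_ae (Filter.Eventually.of_forall fun x => ?_)
        beta_reduce
        rw [fio, mul_left_comm, ← integral_const_mul]
        congr 1
        refine integral_congr_ae (Filter.Eventually.of_forall fun ξ => ?_)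
        beta_reduce
        rw [coe_fourierTS]; ring
    _ = _ := by
        rw [integral_integral_swap hint]
        congr 1
        refine integral_congr_ae (Filter.Eventually.of_forall fun ξ => ?_)
        beta_reduce
        rw [← integral_const_mul]
        refine integral_congr_ae (Filter.Eventually.of_forall fun x => ?_)
        beta_reduce; ring

/-- Testing against a Schwartz function and applying Fubini's theorem turns both sides into
integrals over `ξ`; for fixed `ξ` the claim is `integral_mul_fourier_eq_opT`. -/
theorem multiplierEq_fio {φ : E n → E n → ℝ} {a σ : E n → E n → ℂ} {p : E n → ℂ}
    (hp : BddSmooth (fun ξ : E n => p ((2 * Real.pi) • ξ)))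
    (ha : ∀ ξ, BddSmooth (fun y => a y ξ * Complex.exp (Complex.I * (φ y ξ : ℝ))))
    (hσ : ∀ x ξ, σ x ξ * Complex.exp (Complex.I * (φ x ξ : ℝ)) =
      opT (fun ξ : E n => p ((2 * Real.pi) • ξ))
        (fun z => a (x + z) ξ * Complex.exp (Complex.I * (φ (x + z) ξ : ℝ))))
    (ham : Measurable (fun p : E n × E n => a p.1 p.2 * Complex.exp (Complex.I * (φ p.1 p.2 : ℝ))))
    (hσm : Measurable (fun p : E n × E n => σ p.1 p.2 * Complex.exp (Complex.I * (φ p.1 p.2 : ℝ))))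
    {C C' : ℝ} (hC : ∀ x ξ, ‖a x ξ * Complex.exp (Complex.I * (φ x ξ : ℝ))‖ ≤ C)
    (hC' : ∀ x ξ, ‖σ x ξ * Complex.exp (Complex.I * (φ x ξ : ℝ))‖ ≤ C') (f : 𝓢(E n, ℂ)) :
    MultiplierEq p (fio φ a f) (fio φ σ f) := by
  refine ⟨memLp_fio ham hC f, memLp_fio hσm hC' f, ?_⟩
  ext ψ
  rw [TemperedDistribution.fourierMultiplierCLM_apply_apply, Lp.toTemperedDistribution_apply,
    Lp.toTemperedDistribution_apply]
  have key : ∀ {g : E n → ℂ} (hg : MemLp g ⊤ volume) (χ : 𝓢(E n, ℂ)),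
      ∫ x, χ x • hg.toLp g x = ∫ x, χ x * g x := fun hg χ =>
    integral_congr_ae (hg.coeFn_toLp.mono fun x hx => by beta_reduce; rw [hx, smul_eq_mul])
  rw [key, key,
    integral_fio_mul ham hC, integral_fio_mul hσm hC']
  congr 1
  refine integral_congr_ae (Filter.Eventually.of_forall fun ξ => ?_)
  beta_reduce
  rw [integral_mul_fourier_eq_opT (ha ξ) hp]
  simp only [hσ]

end Composition
end FourierIntOp
end

noncomputable section
namespace FourierIntOp

open MeasureTheory FourierTransform

/-! ### Taylor's formula for the symbol, transported to the pairing. -/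

section Taylor

variable {n : ℕ} {ι V F : Type*} [NormedAddCommGroup V] [NormedSpace ℝ V]
  [NormedAddCommGroup F] [NormedSpace ℝ F]

theorem taylor_line [CompleteSpace F] {f : V → F} {x v : V}
    (hf : ∀ s : ℝ, ContDiffAt ℝ ∞ f (x + s • v)) (N : ℕ) :
    f (x + v) = ∑ k ∈ Finset.range (N + 1),
        ((k.factorial : ℝ)⁻¹) • iteratedFDeriv ℝ k f x (fun _ => v) +
      ∫ s in Set.Icc (0 : ℝ) 1, ((1 - s) ^ N / (N.factorial : ℝ)) •
        iteratedFDeriv ℝ (N + 1) f (x + s • v) (fun _ => v) := by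
  have hL : ∀ s : ℝ, ContDiffAt ℝ ∞ f (x + (ContinuousLinearMap.toSpanSingleton ℝ v) s) := by
    simpa using hf
  set h : ℝ → F := fun s => f (x + (ContinuousLinearMap.toSpanSingleton ℝ v) s) with hh
  have hc : ∀ s, ContDiffAt ℝ ∞ h s := fun s =>
    ContDiffAt.comp s (hL s) (contDiffAt_const.add (ContinuousLinearMap.contDiff _).contDiffAt)
  have hder : ∀ k s, iteratedDeriv k h s = iteratedFDeriv ℝ k f (x + s • v) (fun _ => v) := by
    intro k s
    rw [iteratedDeriv_eq_iteratedFDeriv, hh, (hL s).iteratedFDeriv_comp_affine]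
    simp
  have huniq : UniqueDiffOn ℝ (Set.uIcc (0 : ℝ) 1) := uniqueDiffOn_uIcc zero_ne_one
  have hder' : ∀ k, ∀ s ∈ Set.uIcc (0 : ℝ) 1, iteratedDerivWithin k h (Set.uIcc 0 1) s =
      iteratedFDeriv ℝ k f (x + s • v) (fun _ => v) := fun k s hs => by
    rw [iteratedDerivWithin_eq_iteratedDeriv huniq ((hc s).of_le (by exact_mod_cast le_top)) hs, hder]
  have ht := taylor_integral_remainder (f := h) (x := 1) (x₀ := 0) (n := N)
    (fun s _ => ((hc s).of_le (by exact_mod_cast le_top)).contDiffWithinAt)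
  rw [taylor_within_apply, sub_eq_iff_eq_add] at ht
  have h1 : h 1 = f (x + v) := by simp [hh]
  rw [← h1, ht, add_comm]
  congr 1
  · refine Finset.sum_congr rfl fun k _ => ?_
    rw [hder' k 0 (by simp)]; simp
  · rw [intervalIntegral.integral_of_le zero_le_one, ← integral_Icc_eq_integral_Ioc]
    refine setIntegral_congr_fun measurableSet_Icc fun s hs => ?_
    rw [hder' _ s (by rwa [Set.uIcc_of_le zero_le_one])]

theorem GermBound.integral_Icc [CompleteSpace F] [FiniteDimensional ℝ V] {z : ι → V} {s W : ι → ℝ}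
    {f : ι → ℝ → V → F}
    (hU : ∀ p, ∃ U : Set V, IsOpen U ∧ z p ∈ U ∧ ∀ a, ∀ y ∈ U,
      ContDiffAt ℝ ∞ (fun q : ℝ × V => f p q.1 q.2) (a, y))
    (hb : GermBound (fun p : ι × Set.Icc (0 : ℝ) 1 => z p.1) (fun p => s p.1) (fun p => W p.1)
      (fun p => f p.1 p.2)) :
    GermBound z s W (fun p y => ∫ a in Set.Icc (0 : ℝ) 1, f p a y) := by
  choose U hUo hzU hUf using hU
  have h := fun p => hasFTaylorSeriesUpToOn_integral_Icc (hUo p) (hUf p)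
  refine ⟨fun p => (h p).contDiffAt_infty (hUo p) (hzU p), fun i => ?_⟩
  obtain ⟨C, hC⟩ := hb.2 i
  refine ⟨C, fun p => ?_⟩
  rw [(h p).iteratedFDeriv_eq (hUo p) (hzU p)]
  refine (norm_setIntegral_le_of_norm_le_const (C := C * (W p * s p ^ i)) (by simp)
    fun a ha => hC (p, ⟨a, ha⟩)).trans ?_
  simp

theorem GermBound.dirDerivs {z : ι → V} {s W : ι → ℝ} {f : ι → V → F} (hf : GermBound z s W f)
    (hs : ∀ p, 0 ≤ s p) (hW : ∀ p, 0 ≤ W p) (l : List V) :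
    GermBound z s (fun p => W p * s p ^ l.length) (fun p => FourierIntOp.dirDerivs l (f p)) := by
  induction l with
  | nil => simpa [FourierIntOp.dirDerivs] using hf
  | cons v l ih =>
    have := ih.dirDeriv v hs (fun p => by have := hs p; have := hW p; positivity)
    simpa [FourierIntOp.dirDerivs, pow_succ, mul_assoc] using this

theorem contDiff_dirDerivs {f : V → F} (hf : ContDiff ℝ ∞ f) (l : List V) :
    ContDiff ℝ ∞ (dirDerivs l f) := by
  induction l with
  | nil => exact hf
  | cons v l ih => exact contDiff_dirDeriv ih v

/-- The directions `e_{r(0)}, …, e_{r(k-1)}`. -/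
def dirs {k : ℕ} (r : Fin k → Fin n) : List (E n) := List.ofFn fun i => basisVec (r i)

theorem length_dirs {k : ℕ} (r : Fin k → Fin n) : (dirs r).length = k := by simp [dirs]

theorem sum_smul_basisVec (v : E n) : ∑ j, v j • (basisVec j : E n) = v := by
  ext i
  simp [basisVec, Finset.sum_apply, Pi.single_apply]

theorem iteratedFDeriv_diag {f : E n → F} {x : E n} (hf : ContDiffAt ℝ ∞ f x) (k : ℕ) (v : E n) :
    iteratedFDeriv ℝ k f x (fun _ => v) =
      ∑ r : Fin k → Fin n, (∏ i, v (r i)) • dirDerivs (dirs r) f x := by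
  conv_lhs => rw [← sum_smul_basisVec v]
  rw [ContinuousMultilinearMap.map_sum]
  refine Finset.sum_congr rfl fun r _ => ?_
  rw [ContinuousMultilinearMap.map_smul_univ, iteratedFDeriv_eq_dirDerivs _
    (hf.of_le (by exact_mod_cast le_top)), dirs]

/-- The coefficients of the integral remainder in Taylor's formula at the origin. -/
def taylorRem (N : ℕ) (r : Fin (N + 1) → Fin n) (q : E n → ℂ) (w : E n) : ℂ :=
  ∫ s in Set.Icc (0 : ℝ) 1, ((1 - s) ^ N / (N.factorial : ℝ)) • dirDerivs (dirs r) q (s • w)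

/-- Evaluating at `s • w` with `s ∈ [0, 1]` does not increase the scale, which is the same at all
points. The `N + 1` derivatives account for the factor `S^{N+1}`. -/
theorem GermBound.taylorRem {S W : ι → ℝ} {q : ι → E n → ℂ} (hS : ∀ p, 0 ≤ S p) (hW : ∀ p, 0 ≤ W p)
    (hq : GermBound (fun p : ι × E n => p.2) (fun p => S p.1) (fun p => W p.1) (fun p => q p.1))
    (N : ℕ) (r : Fin (N + 1) → Fin n) :
    GermBound (fun p : ι × E n => p.2) (fun p => S p.1) (fun p => W p.1 * S p.1 ^ (N + 1))
      (fun p => FourierIntOp.taylorRem N r (q p.1)) := by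
  refine GermBound.integral_Icc (f := fun (p : ι × E n) s w =>
    ((1 - s) ^ N / (N.factorial : ℝ)) • FourierIntOp.dirDerivs (dirs r) (q p.1) (s • w)) (fun p => ?_) ?_
  · refine ⟨Set.univ, isOpen_univ, trivial, fun a y _ => ContDiff.contDiffAt ?_⟩
    have h1 := contDiff_dirDerivs (contDiff_of_germBound (q := q) hq p.1) (dirs r)
    have h2 : ContDiff ℝ ∞ (fun y : ℝ × E n => (1 - y.1) ^ N / (N.factorial : ℝ)) := by fun_prop
    have h3 : ContDiff ℝ ∞ (fun y : ℝ × E n => y.1 • y.2) := by fun_prop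
    exact h2.smul (h1.comp h3)
  · have h1 := (GermBound.dirDerivs hq (fun p => hS p.1) (fun p => hW p.1) (dirs r)).reindex
      (fun p : (ι × E n) × Set.Icc (0 : ℝ) 1 => (p.1.1, (0 : E n) +
        (p.2.1 • ContinuousLinearMap.id ℝ (E n)) p.1.2))
    have h2 := (GermBound.comp_affine (fun _ => 0)
      (fun p : (ι × E n) × Set.Icc (0 : ℝ) 1 => p.2.1 • ContinuousLinearMap.id ℝ (E n))
      (z := fun p : (ι × E n) × Set.Icc (0 : ℝ) 1 => p.1.2) h1).const_smul
      (c := fun p : (ι × E n) × Set.Icc (0 : ℝ) 1 => (1 - p.2.1) ^ N / (N.factorial : ℝ))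
    refine (h2.congr fun p => Filter.Eventually.of_forall fun w => ?_).mono
      (fun p => ?_) (fun p => ?_) 1 1 (fun p => ?_) (fun p => ?_)
    · simp
    · have := hS p.1.1; simp only [Function.comp_apply]; positivity
    · have := hS p.1.1; have := hW p.1.1; simp only [Function.comp_apply]; positivity
    · have h3 := hS p.1.1
      have h4 := hW p.1.1
      have h5 := p.2.2.1
      have h6 := p.2.2.2
      simp only [Function.comp_apply, length_dirs, one_mul]
      refine mul_le_of_le_one_left (by positivity) ?_
      rw [abs_of_nonneg (div_nonneg (pow_nonneg (by linarith) _) (by positivity)),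
        div_le_one (by positivity)]
      exact (pow_le_one₀ (by linarith) (by linarith)).trans (by exact_mod_cast Nat.factorial_pos N)
    · have h3 := hS p.1.1
      simp only [Function.comp_apply, one_mul, norm_smul, Real.norm_eq_abs, abs_of_nonneg p.2.2.1]
      exact mul_le_of_le_one_right h3 (mul_le_one₀ p.2.2.2 (norm_nonneg _) ContinuousLinearMap.norm_id_le)

theorem taylor_formula {q : E n → ℂ} (hq : BddSmooth q) (N : ℕ) (w : E n) :
    q w = ∑ k ∈ Finset.range (N + 1), ((k.factorial : ℝ)⁻¹) •
        ∑ r : Fin k → Fin n, (∏ i, w (r i)) • dirDerivs (dirs r) q 0 +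
      ∑ r : Fin (N + 1) → Fin n, (∏ i, w (r i)) • taylorRem N r q w := by
  have h := taylor_line (f := q) (x := 0) (v := w) (fun s => hq.contDiff.contDiffAt) N
  simp only [zero_add, iteratedFDeriv_diag hq.contDiff.contDiffAt] at h
  rw [h]
  congr 1
  unfold taylorRem
  simp only [← integral_smul]
  rw [← integral_finsetSum]
  · refine setIntegral_congr_fun measurableSet_Icc fun s _ => ?_
    simp only [Finset.smul_sum]
    refine Finset.sum_congr rfl fun r _ => smul_comm _ _ _
  · intro r _
    have := (contDiff_dirDerivs hq.contDiff (dirs r)).continuous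
    refine (Continuous.integrableOn_Icc ?_)
    fun_prop

/-- Iterated line derivatives of Schwartz functions along the basis directions. -/
def lineDerivs (l : List (E n)) (g : 𝓢(E n, ℂ)) : 𝓢(E n, ℂ) :=
  l.foldr (fun v h => LineDeriv.lineDerivOp v h) g

theorem coe_lineDerivs (l : List (E n)) (g : 𝓢(E n, ℂ)) :
    (lineDerivs l g : E n → ℂ) = dirDerivs l g := by
  induction l with
  | nil => rfl
  | cons v l ih =>
    change ((LineDeriv.lineDerivOp v (lineDerivs l g) : 𝓢(E n, ℂ)) : E n → ℂ) = _
    rw [coe_lineDerivOp, ih]; rfl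

theorem fourier_lineDerivs {k : ℕ} (r : Fin k → Fin n) (g : 𝓢(E n, ℂ)) (w : E n) :
    𝓕 (lineDerivs (dirs r) g) w = (2 * Real.pi * Complex.I) ^ k * (∏ i, (w (r i) : ℂ)) * 𝓕 g w := by
  induction k with
  | zero => simp [lineDerivs, dirs]
  | succ k ih =>
    have h1 : lineDerivs (dirs r) g = LineDeriv.lineDerivOp (basisVec (r 0))
        (lineDerivs (dirs fun i : Fin k => r i.succ) g) := by
      simp [lineDerivs, dirs, List.ofFn_succ]
    have h : (inner ℝ · (basisVec (r 0) : E n)).HasTemperateGrowth := by fun_prop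
    rw [h1, SchwartzMap.fourier_lineDerivOp_eq, smul_apply,
      SchwartzMap.smulLeftCLM_apply_apply h, ih, Fin.prod_univ_succ, pow_succ]
    simp only [basisVec, EuclideanSpace.inner_single_right, smul_eq_mul, Complex.real_smul]
    simp
    ring

theorem integral_fourier_schwartz (g : 𝓢(E n, ℂ)) : ∫ w, 𝓕 g w = g 0 := by
  have h : 𝓕⁻ (𝓕 g) 0 = g 0 := by rw [FourierTransform.fourierInv_fourier_eq]
  rw [← h, SchwartzMap.fourierInv_coe, Real.fourierInv_eq]
  simp

/-- A monomial in `w` times `𝓕 g` is, up to powers of `2πi`, the Fourier transform of a derivative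
of `g`, and `∫ 𝓕 h = h 0`. So the polynomial part only involves derivatives at the origin. -/
theorem integral_mul_fourier_taylor {q : E n → ℂ} (hq : BddSmooth q) (g : 𝓢(E n, ℂ)) (N : ℕ) :
    ∫ w, q w * 𝓕 (g : E n → ℂ) w = ∑ k ∈ Finset.range (N + 1), ((k.factorial : ℝ) : ℂ)⁻¹ *
        ∑ r : Fin k → Fin n, (2 * Real.pi * Complex.I)⁻¹ ^ k *
          (dirDerivs (dirs r) q 0 * dirDerivs (dirs r) g 0) +
      ∑ r : Fin (N + 1) → Fin n, (2 * Real.pi * Complex.I)⁻¹ ^ (N + 1) *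
        ∫ w, taylorRem N r q w * 𝓕 (dirDerivs (dirs r) g) w := by
  have hpi : (2 * Real.pi * Complex.I : ℂ) ≠ 0 := by
    simp [Real.pi_ne_zero]
  have hpr : ∀ {k : ℕ} (r : Fin k → Fin n) (w : E n), (∏ i, (w (r i) : ℂ)) * 𝓕 (g : E n → ℂ) w =
      (2 * Real.pi * Complex.I)⁻¹ ^ k * 𝓕 (lineDerivs (dirs r) g) w := fun {k} r w => by
    rw [fourier_lineDerivs, inv_pow, SchwartzMap.fourier_coe, mul_assoc (_ ^ k),
      inv_mul_cancel_left₀ (pow_ne_zero _ hpi)]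
  have hrem : ∀ r : Fin (N + 1) → Fin n, BddSmooth (taylorRem N r q) := fun r => by
    have := GermBound.taylorRem (ι := Unit) (S := fun _ => 1) (W := fun _ => 1) (q := fun _ => q)
      (by simp) (by simp) (hq.reindex (fun p : Unit × E n => p.2)) N r
    simpa [Function.comp_def] using this.reindex (fun w : E n => ((), w))
  have hi : ∀ {k : ℕ} (r : Fin k → Fin n), Integrable (fun w => 𝓕 (lineDerivs (dirs r) g) w) :=
    fun r => (𝓕 (lineDerivs (dirs r) g)).integrable
  have hi2 : ∀ r : Fin (N + 1) → Fin n, Integrable (fun w => taylorRem N r q w * 𝓕 (lineDerivs (dirs r) g) w) :=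
    fun r => by
      obtain ⟨C, hC⟩ := (hrem r).exists_norm_le
      exact (hi r).bdd_mul (c := C) (hrem r).contDiff.continuous.aestronglyMeasurable
        (Filter.Eventually.of_forall hC)
  have hpt : ∀ w, q w * 𝓕 (g : E n → ℂ) w = ∑ k ∈ Finset.range (N + 1), ((k.factorial : ℝ) : ℂ)⁻¹ *
        ∑ r : Fin k → Fin n, (2 * Real.pi * Complex.I)⁻¹ ^ k *
          (dirDerivs (dirs r) q 0 * 𝓕 (lineDerivs (dirs r) g) w) +
      ∑ r : Fin (N + 1) → Fin n, (2 * Real.pi * Complex.I)⁻¹ ^ (N + 1) *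
        (taylorRem N r q w * 𝓕 (lineDerivs (dirs r) g) w) := by
    intro w
    rw [taylor_formula hq N w, add_mul, Finset.sum_mul, Finset.sum_mul]
    congr 1
    · refine Finset.sum_congr rfl fun k _ => ?_
      rw [Complex.real_smul, mul_assoc, Finset.sum_mul, Complex.ofReal_inv]
      congr 1
      refine Finset.sum_congr rfl fun r _ => ?_
      rw [Complex.real_smul, mul_left_comm, ← hpr]; push_cast; ring
    · refine Finset.sum_congr rfl fun r _ => ?_
      rw [Complex.real_smul, mul_left_comm, ← hpr]; push_cast; ring
  simp only [hpt]
  rw [integral_add, integral_finsetSum, integral_finsetSum]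
  · congr 1
    · refine Finset.sum_congr rfl fun k _ => ?_
      rw [integral_const_mul, integral_finsetSum]
      · congr 1
        refine Finset.sum_congr rfl fun r _ => ?_
        rw [integral_const_mul, integral_const_mul, integral_fourier_schwartz, coe_lineDerivs]
      · exact fun r _ => ((hi r).const_mul _).const_mul _
    · refine Finset.sum_congr rfl fun r _ => ?_
      rw [integral_const_mul, SchwartzMap.fourier_coe, coe_lineDerivs]
  · exact fun r _ => (hi2 r).const_mul _
  · exact fun k _ => (integrable_finsetSum _ fun r _ => ((hi r).const_mul _).const_mul _).const_mul _
  · exact integrable_finsetSum _ fun k _ => (integrable_finsetSum _ fun r _ => ((hi r).const_mul _).const_mul _).const_mul _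
  · exact integrable_finsetSum _ fun r _ => (hi2 r).const_mul _

end Taylor
end FourierIntOp
end

noncomputable section
namespace FourierIntOp

open MeasureTheory FourierTransform

/-! ### Uniform bounds for the rescaled phase and its Taylor remainders. -/

section Phase

variable {n : ℕ} {m : ℝ} {a : ℝ → E n → E n → ℂ} {ρ : E n → ℂ} {φ : E n → E n → ℝ}

/-- The hypotheses on the amplitude `a`, the multiplier `ρ` and the phase `φ`. -/
structure Admissible (m : ℝ) (a : ℝ → E n → E n → ℂ) (ρ : E n → ℂ) (φ : E n → E n → ℝ) : Prop where
  nonpos : m ≤ 0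
  symb : IsUniformSymbol m 1 0 a
  supp : ∀ t ∈ Set.Ioo (0 : ℝ) 1, tsupport (fun p : E n × E n => a t p.1 p.2) ⊆ highFreq n
  mult : IsSymbol 0 1 0 (fun _ ξ : E n => ρ ξ)
  smooth : ContDiffOn ℝ ∞ (fun p : E n × E n => φ p.1 p.2) (highFreq n)
  grad : ∃ C₁ > (0 : ℝ), ∃ C₂ > (0 : ℝ), ∀ x ξ : E n, (x, ξ) ∈ highFreq n →
    C₁ * ‖ξ‖ ≤ ‖gradient (fun y => φ y ξ) x‖ ∧ ‖gradient (fun y => φ y ξ) x‖ ≤ C₂ * ‖ξ‖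
  derivX : ∀ α : Fin n → ℕ, 1 ≤ order α → ∃ C : ℝ, ∀ x ξ : E n, (x, ξ) ∈ highFreq n →
    |multiDeriv α (fun y => φ y ξ) x| ≤ C * bracket ξ
  derivXξ : ∀ α β : Fin n → ℕ, 1 ≤ order α → 1 ≤ order β →
    ∃ C : ℝ, ∀ x ξ : E n, (x, ξ) ∈ highFreq n →
      |mixedDeriv α β φ x ξ| ≤ C * ‖ξ‖ ^ (1 - (order α : ℝ))

theorem one_le_bracket (ξ : E n) : 1 ≤ bracket ξ := by
  rw [bracket, Real.one_le_sqrt]; nlinarith [sq_nonneg ‖ξ‖]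

theorem bracket_pos (ξ : E n) : 0 < bracket ξ := zero_lt_one.trans_le (one_le_bracket ξ)

theorem norm_le_bracket (ξ : E n) : ‖ξ‖ ≤ bracket ξ :=
  Real.le_sqrt_of_sq_le (by linarith)

theorem bracket_le_two_mul {ξ : E n} (hξ : 1 < ‖ξ‖) : bracket ξ ≤ 2 * ‖ξ‖ := by
  rw [bracket, Real.sqrt_le_left (by positivity)]; nlinarith

theorem isOpen_highFreq : IsOpen (highFreq n) :=
  isOpen_lt continuous_const continuous_snd.norm

theorem Admissible.contDiffAt (h : Admissible m a ρ φ) {x ξ : E n} (hξ : 1 < ‖ξ‖) :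
    ContDiffAt ℝ ∞ (fun p : E n × E n => φ p.1 p.2) (x, ξ) :=
  (h.smooth (x, ξ) hξ).contDiffAt (isOpen_highFreq.mem_nhds hξ)

/-- Phase space points of high frequency. -/
abbrev Freq (n : ℕ) := {q : E n × E n // 1 < ‖q.2‖}

/-- The size `⟨ξ⟩` of the frequency. -/
def Freq.lam (q : Freq n) : ℝ := bracket q.1.2

/-- The phase space point with rescaled frequency. -/
def Freq.pt (q : Freq n) : E n × E n := (q.1.1, q.lam⁻¹ • q.1.2)

theorem Freq.one_le_lam (q : Freq n) : 1 ≤ q.lam := one_le_bracket _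

theorem Freq.lam_pos (q : Freq n) : 0 < q.lam := bracket_pos _

theorem Freq.lam_smul_pt (q : Freq n) : q.lam • q.pt.2 = q.1.2 := by
  simp [Freq.pt, q.lam_pos.ne']

/-- The phase with rescaled frequency. -/
def scaledPhase (φ : E n → E n → ℝ) (lam : ℝ) (y : E n × E n) : ℝ := φ y.1 (lam • y.2)

/-- The directions `(e_i, 0)`. -/
def dirX (i : Fin n) : E n × E n := (basisVec i, 0)

theorem Admissible.contDiffAt_scaledPhase (h : Admissible m a ρ φ) {lam : ℝ} {y : E n × E n}
    (hy : 1 < ‖lam • y.2‖) : ContDiffAt ℝ ∞ (scaledPhase φ lam) y :=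
  ContDiffAt.comp (g := fun p : E n × E n => φ p.1 p.2) (f := fun y : E n × E n => (y.1, lam • y.2)) y
    (h.contDiffAt hy) (by fun_prop)

theorem eventually_one_lt {lam : ℝ} {y : E n × E n} (hy : 1 < ‖lam • y.2‖) :
    ∀ᶠ y' in 𝓝 y, 1 < ‖lam • y'.2‖ :=
  continuousAt_const.eventually_lt (by fun_prop) hy

theorem Freq.one_lt_pt (q : Freq n) : 1 < ‖q.lam • q.pt.2‖ := by
  rw [q.lam_smul_pt]; exact q.2

theorem dirDeriv_scaledPhase (h : Admissible m a ρ φ) {lam : ℝ} {y : E n × E n}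
    (hy : 1 < ‖lam • y.2‖) (j : Fin n) :
    dirDeriv (dirX j) (fun p : E n × E n => φ p.1 p.2) (y.1, lam • y.2) =
      dirDeriv (dirX j) (scaledPhase φ lam) y := by
  have := dirDerivs_comp_affine [dirX j] (dilate lam) (0 : E n × E n) (y := y)
    (f := fun p : E n × E n => φ p.1 p.2)
    (by simpa [dilate] using! (h.contDiffAt hy).of_le (by exact_mod_cast le_top))
  simp only [zero_add] at this
  refine Eq.symm (Eq.trans (by rfl) (this.trans ?_))
  simp [dilate, dirDerivs, dirX]
  rfl

/-- Derivatives without and with a `ξ`-derivative come from the two bounds in assumption (ii); `|ξ|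
> 1` makes `|ξ|` comparable to `⟨ξ⟩`, so both have size `lam` after rescaling. -/
theorem Admissible.germ_dirX (h : Admissible m a ρ φ) (j : Fin n) :
    GermBound (fun q : Freq n => q.pt) (fun _ => 1) (fun q => q.lam)
      (fun q => dirDeriv (dirX j) (scaledPhase φ q.lam)) := by
  have := germBound_of_mixedDeriv (n := n) (ι := Freq n)
    (a := fun _ x ξ => dirDeriv (dirX j) (fun p : E n × E n => φ p.1 p.2) (x, ξ))
    (x := fun q => q.1.1) (ξ := fun q => q.1.2) (lam := fun q => q.lam) (W := fun q => q.lam)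
    (fun q => q.lam_pos) (fun q => (h.contDiffAt q.2).dirDeriv _) ?_
  · refine this.congr fun q => ?_
    filter_upwards [eventually_one_lt q.one_lt_pt] with y hy
    exact (dirDeriv_scaledPhase h hy j).symm
  · intro γ β
    have hβ : order (β + Pi.single j 1) = order β + 1 := by
      simp [order, Finset.sum_add_distrib, Finset.sum_pi_single']
    rcases Nat.eq_zero_or_pos (order γ) with hγ | hγ
    · obtain ⟨C, hC⟩ := h.derivX (β + Pi.single j 1) (by omega)
      refine ⟨C, fun q => ?_⟩
      have hγ0 : γ = 0 := by
        ext i; simpa using (Finset.sum_eq_zero_iff.1 hγ) i (Finset.mem_univ i)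
      rw [dirX, mixedDeriv_dirDeriv γ β j (h.contDiffAt q.2), hγ, pow_zero, mul_one, hγ0, mixedDeriv,
        multiDeriv_zero]
      exact hC _ _ q.2
    · obtain ⟨C, hC⟩ := h.derivXξ γ (β + Pi.single j 1) hγ (by omega)
      refine ⟨max C 0 * 2 ^ (order γ), fun q => ?_⟩
      rw [dirX, mixedDeriv_dirDeriv γ β j (h.contDiffAt q.2)]
      refine (hC _ _ q.2).trans ?_
      have h0 : 0 < ‖q.1.2‖ := zero_lt_one.trans q.2
      have h1 : q.lam ≤ 2 * ‖q.1.2‖ := bracket_le_two_mul q.2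
      have hl := q.lam_pos
      have h2 : ‖q.1.2‖ ^ (1 - (order γ : ℝ)) = ‖q.1.2‖ * ((‖q.1.2‖)⁻¹) ^ order γ := by
        rw [Real.rpow_sub h0, Real.rpow_one, Real.rpow_natCast, inv_pow, div_eq_mul_inv]
      have h3 : (‖q.1.2‖)⁻¹ ≤ 2 * q.lam⁻¹ := by
        rw [← div_eq_mul_inv, inv_eq_one_div, div_le_div_iff₀ h0 hl]; linarith
      rw [h2]
      calc C * (‖q.1.2‖ * (‖q.1.2‖)⁻¹ ^ order γ) ≤ max C 0 * (q.lam * (2 * q.lam⁻¹) ^ order γ) := by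
            gcongr
            · exact le_max_left _ _
            · exact norm_le_bracket _
        _ = _ := by rw [mul_pow]; ring

theorem Admissible.germ_dirsX (h : Admissible m a ρ φ) (l : List (Fin n)) (hl : l ≠ []) :
    GermBound (fun q : Freq n => q.pt) (fun _ => 1) (fun q => q.lam)
      (fun q => dirDerivs (l.map dirX) (scaledPhase φ q.lam)) := by
  obtain ⟨l', j, rfl⟩ := List.eq_nil_or_concat' l |>.resolve_left hl
  have := (h.germ_dirX j).dirDerivs (by simp) (fun q => q.lam_pos.le) (l'.map dirX)
  simp only [one_pow, mul_one] at this
  convert! this using 2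
  rw [List.map_append, dirDerivs_append]
  rfl

theorem dirs_eq_map {k : ℕ} (r : Fin k → Fin n) : dirs r = (List.ofFn r).map basisVec := by
  simp [dirs, List.map_ofFn, Function.comp_def]

theorem Admissible.dirDerivs_slice (h : Admissible m a ρ φ) {lam : ℝ} {x w : E n}
    (hw : 1 < ‖lam • w‖) (l : List (Fin n)) :
    dirDerivs (l.map basisVec) (fun y => φ y (lam • w)) x =
      dirDerivs (l.map dirX) (scaledPhase φ lam) (x, w) := by
  have := dirDerivs_comp_affine (l.map basisVec) (ContinuousLinearMap.inl ℝ (E n) (E n))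
    ((0, w) : E n × E n) (y := x) (f := scaledPhase φ lam)
    (by simpa using! (h.contDiffAt_scaledPhase (y := (x, w)) hw).of_le (by exact_mod_cast le_top))
  refine Eq.trans ?_ (this.trans ?_)
  · simp [scaledPhase]
  · simp [List.map_map, Function.comp_def]
    rfl

theorem GermBound.mul_real {ι V : Type*} [NormedAddCommGroup V] [NormedSpace ℝ V] {z : ι → V}
    {s W W' : ι → ℝ} {f g : ι → V → ℝ} (hf : GermBound z s W f) (hg : GermBound z s W' g)
    (hs : ∀ p, 0 ≤ s p) (hW : ∀ p, 0 ≤ W p) (hW' : ∀ p, 0 ≤ W' p) :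
    GermBound z s (fun p => W p * W' p) (fun p y => f p y * g p y) :=
  hf.bilin (ContinuousLinearMap.mul ℝ ℝ) hg hs hW hW'

theorem GermBound.prod_const {ι κ V : Type*} [NormedAddCommGroup V] [NormedSpace ℝ V] {z : ι → V}
    {s W : ι → ℝ} (hs : ∀ p, 0 ≤ s p) (hW : ∀ p, 0 ≤ W p) {f : κ → ι → V → ℝ} (t : Finset κ)
    (hf : ∀ i, GermBound z s W (f i)) :
    GermBound z s (fun p => W p ^ t.card) (fun p y => ∏ i ∈ t, f i p y) := by
  classical
  induction t using Finset.induction_on with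
  | empty => simpa using GermBound.const (fun _ : ι => (1 : ℝ)) hs (by simp) 1 (by simp)
  | insert i t hi ih =>
    have := (hf i).mul_real ih hs hW (fun p => pow_nonneg (hW p) _)
    simp only [Finset.prod_insert hi, Finset.card_insert_of_notMem hi, pow_succ']
    exact this

/-- The integral remainder of the phase in Taylor's formula of order `N` in `x`. -/
def phaseIntegral (φ : E n → E n → ℝ) (N : ℕ) (lam c : ℝ) (q : (E n × E n) × E n) : ℝ :=
  ∫ s in Set.Icc (0 : ℝ) 1, ((1 - s) ^ N / (N.factorial : ℝ)) • ∑ r : Fin (N + 1) → Fin n,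
    (∏ i, (c • q.2) (r i)) • dirDerivs ((List.ofFn r).map dirX) (scaledPhase φ lam)
      (q.1 + s • (c • q.2, 0))

theorem Admissible.taylor_phase (h : Admissible m a ρ φ) {lam c : ℝ} {x w v : E n}
    (hw : 1 < ‖lam • w‖) (N : ℕ) :
    φ (x + c • v) (lam • w) = ∑ k ∈ Finset.range (N + 1), ((k.factorial : ℝ)⁻¹) •
        iteratedFDeriv ℝ k (fun y => φ y (lam • w)) x (fun _ => c • v) +
      phaseIntegral φ N lam c ((x, w), v) := by
  have hc : ∀ y, ContDiffAt ℝ ∞ (fun y => φ y (lam • w)) y := fun y =>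
    ContDiffAt.comp (g := fun p : E n × E n => φ p.1 p.2) (f := fun y => (y, lam • w)) y
      (h.contDiffAt hw) (by fun_prop)
  rw [taylor_line (f := fun y => φ y (lam • w)) (x := x) (v := c • v) (fun s => hc _) N, phaseIntegral]
  congr 1
  refine setIntegral_congr_fun measurableSet_Icc fun s _ => ?_
  beta_reduce
  rw [iteratedFDeriv_diag (hc _)]
  congr 1
  refine Finset.sum_congr rfl fun r _ => ?_
  rw [dirs_eq_map, h.dirDerivs_slice hw]
  simp

/-- The integrand has degree `N + 1` in the displacement `c • v` and contains `x`-derivatives of the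
phase, of size `lam`. Since `c ≤ 1`, everything is at unit scale jointly in `x`, the rescaled
frequency and `v`. -/
theorem Admissible.germ_phaseIntegral (h : Admissible m a ρ φ) (N : ℕ) {c : Freq n → ℝ}
    (hc : ∀ q, 0 ≤ c q) (hc1 : ∀ q, c q ≤ 1) :
    GermBound (fun p : Freq n × E n => (p.1.pt, p.2)) (fun _ => 1)
      (fun p => p.1.lam * (c p.1 * (1 + ‖p.2‖)) ^ (N + 1))
      (fun p => phaseIntegral φ N p.1.lam (c p.1)) := by
  refine GermBound.integral_Icc (f := fun (p : Freq n × E n) s (q : (E n × E n) × E n) =>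
    ((1 - s) ^ N / (N.factorial : ℝ)) • ∑ r : Fin (N + 1) → Fin n,
    (∏ i, (c p.1 • q.2) (r i)) • FourierIntOp.dirDerivs ((List.ofFn r).map dirX) (scaledPhase φ p.1.lam)
      (q.1 + s • (c p.1 • q.2, 0))) (fun p => ?_) ?_
  · refine ⟨{q | 1 < ‖p.1.lam • q.1.2‖}, isOpen_lt continuous_const (by fun_prop), p.1.one_lt_pt,
      fun s q hq => ?_⟩
    have h1 : ContDiff ℝ ∞ (fun y : ℝ × ((E n × E n) × E n) => (1 - y.1) ^ N / (N.factorial : ℝ)) := by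
      fun_prop
    refine h1.contDiffAt.smul (ContDiffAt.sum fun r _ => ContDiffAt.mul ?_ ?_)
    · refine ContDiff.contDiffAt (contDiff_prod fun i _ => ?_)
      have : ContDiff ℝ ∞ (fun y : ℝ × ((E n × E n) × E n) => c p.1 • y.2.2) := by fun_prop
      exact (contDiff_euclidean.1 this) (r i)
    · have hq' : 1 < ‖p.1.lam • (q.1 + s • (c p.1 • q.2, (0 : E n))).2‖ := by simpa using hq
      refine ContDiffAt.comp (g := FourierIntOp.dirDerivs ((List.ofFn r).map dirX) (scaledPhase φ p.1.lam))
        (f := fun y : ℝ × ((E n × E n) × E n) => y.2.1 + y.1 • (c p.1 • y.2.2, (0 : E n))) (s, q)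
        (contDiffAt_infty_dirDerivs _ (h.contDiffAt_scaledPhase hq')) (by fun_prop)
  · have hW : ∀ p : (Freq n × E n) × Set.Icc (0 : ℝ) 1, 0 ≤ c p.1.1 * (1 + ‖p.1.2‖) := fun p => by
      have := hc p.1.1; positivity
    have h1 : ∀ j : Fin n, GermBound (fun p : (Freq n × E n) × Set.Icc (0 : ℝ) 1 => (p.1.1.pt, p.1.2))
        (fun _ => 1) (fun p => c p.1.1 * (1 + ‖p.1.2‖)) (fun p q => (c p.1.1 • q.2) j) := by
      intro j
      have := GermBound.clm (z := fun p : (Freq n × E n) × Set.Icc (0 : ℝ) 1 => (p.1.1.pt, p.1.2))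
        (s := fun _ => 1) (W := fun p => c p.1.1 * (1 + ‖p.1.2‖))
        (fun p => c p.1.1 • ((EuclideanSpace.proj j : E n →L[ℝ] ℝ).comp
          (ContinuousLinearMap.snd ℝ (E n × E n) (E n)))) (by simp) hW 1 (fun p => ?_) (fun p => ?_)
      · simpa using this
      · simp only [smul_apply, ContinuousLinearMap.comp_apply, norm_smul,
          Real.norm_of_nonneg (hc p.1.1), one_mul]
        refine mul_le_mul_of_nonneg_left ?_ (hc p.1.1)
        exact (PiLp.norm_apply_le p.1.2 j).trans (by simp)
      · rw [norm_smul, Real.norm_of_nonneg (hc p.1.1), one_mul, mul_one]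
        refine mul_le_mul_of_nonneg_left ?_ (hc p.1.1)
        refine (ContinuousLinearMap.opNorm_le_bound _ zero_le_one fun q => ?_).trans
          (le_add_of_nonneg_right (norm_nonneg _))
        rw [one_mul]
        exact (PiLp.norm_apply_le q.2 j).trans (le_max_right _ _)
    have h2 : ∀ r : Fin (N + 1) → Fin n, GermBound
        (fun p : (Freq n × E n) × Set.Icc (0 : ℝ) 1 => (p.1.1.pt, p.1.2)) (fun _ => 1) (fun p => p.1.1.lam)
        (fun p q => FourierIntOp.dirDerivs ((List.ofFn r).map dirX) (scaledPhase φ p.1.1.lam)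
          (q.1 + p.2.1 • (c p.1.1 • q.2, 0))) := by
      intro r
      let L : (Freq n × E n) × Set.Icc (0 : ℝ) 1 → ((E n × E n) × E n →L[ℝ] E n × E n) := fun p =>
        ContinuousLinearMap.fst ℝ (E n × E n) (E n) + (p.2.1 * c p.1.1) •
          (ContinuousLinearMap.inl ℝ (E n) (E n)).comp (ContinuousLinearMap.snd ℝ (E n × E n) (E n))
      have hLa : ∀ p q, L p q = q.1 + p.2.1 • (c p.1.1 • q.2, 0) := fun p q => by
        simp [L, mul_smul]
      have hL : ∀ p, ‖L p‖ ≤ 2 := fun p => by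
        refine ContinuousLinearMap.opNorm_le_bound _ zero_le_two fun q => ?_
        rw [hLa]
        have e1 : ‖q.1‖ ≤ ‖q‖ := le_max_left _ _
        have e2 : ‖p.2.1 • (c p.1.1 • q.2, (0 : E n))‖ ≤ ‖q‖ := by
          rw [norm_smul, Prod.norm_mk, norm_zero, max_eq_left (norm_nonneg _), norm_smul,
            Real.norm_of_nonneg p.2.2.1, Real.norm_of_nonneg (hc p.1.1), ← mul_assoc]
          exact (mul_le_of_le_one_left (norm_nonneg _) (mul_le_one₀ p.2.2.2 (hc _) (hc1 _))).trans
            (le_max_right _ _)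
        linarith [norm_add_le q.1 (p.2.1 • (c p.1.1 • q.2, (0 : E n)))]
      -- The phase is evaluated at a displaced point with the same frequency, so `lam` does not
      -- change and the bounds, uniform in `x`, apply there.
      have h3 := (h.germ_dirsX (List.ofFn r) (by simp)).reindex
        (fun p : (Freq n × E n) × Set.Icc (0 : ℝ) 1 =>
          (⟨(p.1.1.1.1 + p.2.1 • c p.1.1 • p.1.2, p.1.1.1.2), p.1.1.2⟩ : Freq n))
      have h4 := GermBound.comp_affine (z := fun p : (Freq n × E n) × Set.Icc (0 : ℝ) 1 => (p.1.1.pt, p.1.2))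
        (fun _ => 0) L (f := fun p => FourierIntOp.dirDerivs ((List.ofFn r).map dirX) (scaledPhase φ p.1.1.lam))
        (s := fun _ => 1) (W := fun p => p.1.1.lam) (by
          convert! h3 using 2 with p
          rw [hLa]
          simp [Freq.pt, Freq.lam])
      refine (h4.congr fun p => Filter.Eventually.of_forall fun q => ?_).mono (fun p => ?_)
        (fun p => p.1.1.lam_pos.le) 1 2 (by simp) (fun p => by simpa using hL p)
      · beta_reduce
        rw [hLa, zero_add]
      · simp
    have h3 := fun r : Fin (N + 1) → Fin n => (GermBound.prod_const (by simp) hW Finset.univ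
      (fun i => h1 (r i))).mul_real (h2 r) (by simp) (fun p => pow_nonneg (hW p) _) (fun p => p.1.1.lam_pos.le)
    have h4 := (GermBound.sum Finset.univ fun r _ => h3 r).const_smul
      (c := fun p : (Freq n × E n) × Set.Icc (0 : ℝ) 1 => (1 - p.2.1) ^ N / (N.factorial : ℝ))
    refine h4.mono (by simp) (fun p => ?_) 1 1 (fun p => ?_) (by simp)
    · have := hW p; have := p.1.1.lam_pos; positivity
    · have h5 := hW p
      have h6 := p.1.1.lam_pos
      have h7 := p.2.2.1
      have h8 := p.2.2.2
      simp only [Finset.card_univ, Fintype.card_fin, one_mul]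
      rw [mul_comm (p.1.1.lam)]
      refine mul_le_of_le_one_left (by positivity) ?_
      rw [abs_of_nonneg (div_nonneg (pow_nonneg (by linarith) _) (by positivity)),
        div_le_one (by positivity)]
      exact (pow_le_one₀ (by linarith) (by linarith)).trans (by exact_mod_cast Nat.factorial_pos N)

end Phase
end FourierIntOp
end

noncomputable section
namespace FourierIntOp

open MeasureTheory FourierTransform

/-! ### Uniform bounds for the full and the reduced amplitude. -/

section Amplitude

variable {n : ℕ} {m : ℝ} {a : ℝ → E n → E n → ℂ} {ρ : E n → ℂ} {φ : E n → E n → ℝ}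

/-- Times and phase space points of high frequency. -/
abbrev Par (n : ℕ) := Set.Ioo (0 : ℝ) 1 × Freq n

theorem Admissible.germ_symb (h : Admissible m a ρ φ) :
    GermBound (fun p : Set.Ioo (0 : ℝ) 1 × (E n × E n) => (p.2.1, (bracket p.2.2)⁻¹ • p.2.2))
      (fun _ => 1) (fun p => bracket p.2.2 ^ m) (fun p q => a p.1 q.1 (bracket p.2.2 • q.2)) := by
  refine germBound_of_mixedDeriv (a := fun p : Set.Ioo (0 : ℝ) 1 × (E n × E n) => a p.1)
    (fun p => bracket_pos _) (fun p => (h.symb.smooth p.1 p.1.2).contDiffAt) fun γ β => ?_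
  obtain ⟨C, hC⟩ := h.symb.bound γ β
  refine ⟨C, fun p => (hC p.1 p.1.2 _ _).trans (le_of_eq ?_)⟩
  rw [one_mul, zero_mul, add_zero, Real.rpow_sub (bracket_pos _), Real.rpow_natCast, inv_pow,
    div_eq_mul_inv]

theorem Admissible.germ_mult (h : Admissible m a ρ φ) :
    GermBound (fun η : E n => η) (fun η => (bracket η)⁻¹) (fun _ => 1) (fun _ => ρ) := by
  have h1 := germBound_of_mixedDeriv (ι := E n) (a := fun _ _ ξ => ρ ξ) (x := fun _ => (0 : E n))
    (ξ := fun η => η) (lam := fun η => bracket η) (W := fun _ => 1) (fun p => bracket_pos _)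
    (fun p => h.mult.smooth.contDiffAt) (fun γ β => by
      obtain ⟨C, hC⟩ := h.mult.bound γ β
      refine ⟨C, fun p => (hC 0 p).trans (le_of_eq ?_)⟩
      rw [one_mul, zero_mul, add_zero, zero_sub, Real.rpow_neg (bracket_pos _).le, Real.rpow_natCast,
        inv_pow, one_mul])
  have h2 := GermBound.comp_affine (z := fun η : E n => η) (fun _ => (0 : E n × E n))
    (fun η : E n => (bracket η)⁻¹ • ContinuousLinearMap.inr ℝ (E n) (E n)) (s := fun _ => 1)
    (W := fun _ => 1) (f := fun η (q : E n × E n) => ρ (bracket η • q.2)) (by simpa using! h1)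
  refine (h2.congr fun η => Filter.Eventually.of_forall fun y => ?_).mono (fun η => ?_) (by simp) 1 1
    (by simp) (fun η => ?_)
  · simp [(bracket_pos η).ne']
  · positivity
  · have := bracket_pos η
    rw [one_mul, one_mul, norm_smul, Real.norm_of_nonneg (by positivity)]
    refine mul_le_of_le_one_right (by positivity) (ContinuousLinearMap.norm_inr_le_one ..)

theorem Admissible.bddSmooth_mult (h : Admissible m a ρ φ) : BddSmooth ρ :=
  h.germ_mult.mono (fun η => by have := bracket_pos η; positivity) (by simp) 1 1 (by simp)
    (fun η => by simpa using inv_le_one_of_one_le₀ (one_le_bracket η))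

theorem rpow_le_one_of_nonpos {x m : ℝ} (hx : 1 ≤ x) (hm : m ≤ 0) : x ^ m ≤ 1 :=
  Real.rpow_le_one_of_one_le_of_nonpos hx hm

/-- The rescaled amplitude with the exponential of the remainder of the phase. -/
def scaledAmp (φ : E n → E n → ℝ) (a : ℝ → E n → E n → ℂ) (N : ℕ) (t lam c : ℝ)
    (q : (E n × E n) × E n) : ℂ :=
  a t (q.1.1 + c • q.2) (lam • q.1.2) * Complex.exp (Complex.I * (phaseIntegral φ N lam c q : ℝ))

/-- The quantity in `hX` bounds the remainder of the phase with all its derivatives. Being at least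
1, it is at most its own `i`-th power for `i ≥ 1`, so it can serve as the scale of the exponential.
-/
theorem Admissible.germ_scaledAmp (h : Admissible m a ρ φ) (N : ℕ) {c : Freq n → ℝ}
    (hc : ∀ q, 0 ≤ c q) (hc1 : ∀ q, c q ≤ 1)
    (hX : ∀ q v, 1 ≤ q.lam * (c q * (1 + ‖(v : E n)‖)) ^ (N + 1)) :
    GermBound (fun p : Par n × E n => (p.1.2.pt, p.2))
      (fun p => p.1.2.lam * (c p.1.2 * (1 + ‖p.2‖)) ^ (N + 1)) (fun p => p.1.2.lam ^ m)
      (fun p => scaledAmp φ a N p.1.1 p.1.2.lam (c p.1.2)) := by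
  let L : Freq n → ((E n × E n) × E n →L[ℝ] E n × E n) := fun p =>
    ContinuousLinearMap.fst ℝ (E n × E n) (E n) + c p •
      (ContinuousLinearMap.inl ℝ (E n) (E n)).comp (ContinuousLinearMap.snd ℝ (E n × E n) (E n))
  have hLa : ∀ p q, L p q = (q.1.1 + c p • q.2, q.1.2) := fun p q => by
    simp [L, Prod.ext_iff]
  have hL : ∀ p, ‖L p‖ ≤ 2 := fun p => by
    refine ContinuousLinearMap.opNorm_le_bound _ zero_le_two fun q => ?_
    rw [hLa]
    have e1 : ‖q.1.1‖ ≤ ‖q‖ := (norm_fst_le _).trans (norm_fst_le _)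
    have e2 : ‖c p • q.2‖ ≤ ‖q‖ := by
      rw [norm_smul, Real.norm_of_nonneg (hc p)]
      exact (mul_le_of_le_one_left (norm_nonneg _) (hc1 _)).trans (norm_snd_le _)
    have e3 : ‖q.1.2‖ ≤ ‖q‖ := (norm_snd_le _).trans (norm_fst_le _)
    refine max_le (by linarith [norm_add_le q.1.1 (c p • q.2)]) (by linarith [norm_nonneg q])
  have h1 := h.germ_symb.reindex (fun p : Par n × E n => (p.1.1, (p.1.2.1.1 + c p.1.2 • p.2, p.1.2.1.2)))
  have h2 := GermBound.comp_affine (z := fun p : Par n × E n => (p.1.2.pt, p.2))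
    (fun _ => 0) (fun p => L p.1.2) (f := fun p (q : E n × E n) => a p.1.1 q.1 (p.1.2.lam • q.2))
    (s := fun _ => 1) (W := fun p => p.1.2.lam ^ m) (by
      convert! h1 using 2 with p
      rw [hLa]
      simp [Freq.pt, Freq.lam])
  have hX' : ∀ p : Par n × E n, 1 ≤ p.1.2.lam * (c p.1.2 * (1 + ‖p.2‖)) ^ (N + 1) := fun p => hX _ _
  have hX0 : ∀ p : Par n × E n, 0 ≤ p.1.2.lam * (c p.1.2 * (1 + ‖p.2‖)) ^ (N + 1) := fun p =>
    zero_le_one.trans (hX _ _)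
  have hm : ∀ p : Par n × E n, 0 ≤ p.1.2.lam ^ m := fun p => Real.rpow_nonneg p.1.2.lam_pos.le _
  have h3 : GermBound (fun p : Par n × E n => (p.1.2.pt, p.2))
      (fun p => p.1.2.lam * (c p.1.2 * (1 + ‖p.2‖)) ^ (N + 1)) (fun p => p.1.2.lam ^ m)
      (fun p q => a p.1.1 (q.1.1 + c p.1.2 • q.2) (p.1.2.lam • q.1.2)) := by
    refine (h2.congr fun p => Filter.Eventually.of_forall fun q => ?_).mono (fun p => by simp) hm
      1 2 (by simp) (fun p => ?_)
    · beta_reduce; rw [zero_add, hLa]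
    · rw [one_mul]; linarith [hL p.1.2, hX' p]
  have h4 := (h.germ_phaseIntegral N hc hc1).reindex (fun p : Par n × E n => (p.1.2, p.2))
  have h5 := GermBound.cexp_I (z := fun p : Par n × E n => (p.1.2.pt, p.2)) hX0 h4.1 (fun i hi => by
    obtain ⟨C, hC1, hC⟩ := h4.bound (by simp) (fun p => hX0 p) i
    refine ⟨C, fun p => (hC i le_rfl p).trans ?_⟩
    simp only [Function.comp_apply, one_pow, mul_one]
    exact mul_le_mul_of_nonneg_left (le_self_pow₀ (hX' p) (by omega)) (by linarith))
  have h6 := h3.mul h5 hX0 hm (by simp)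
  simpa only [mul_one] using! h6

/-- The amplitude `a(x + z, ξ) e^{i(φ(x + z, ξ) - φ(x, ξ))}`. -/
def fullAmp (φ : E n → E n → ℝ) (a : ℝ → E n → E n → ℂ) (t : ℝ) (x ξ z : E n) : ℂ :=
  a t (x + z) ξ * Complex.exp (Complex.I * (φ (x + z) ξ - φ x ξ : ℝ))

/-- The amplitude `a(x + z, ξ) e^{i(φ(x + z, ξ) - φ(x, ξ) - ∇φ(x, ξ)·z)}`. -/
def redAmp (φ : E n → E n → ℝ) (a : ℝ → E n → E n → ℂ) (t : ℝ) (x ξ z : E n) : ℂ :=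
  a t (x + z) ξ * Complex.exp (Complex.I *
    (φ (x + z) ξ - φ x ξ - inner ℝ (gradient (fun y => φ y ξ) x) z : ℝ))

theorem Admissible.contDiff_slice (h : Admissible m a ρ φ) {ξ : E n} (hξ : 1 < ‖ξ‖) :
    ContDiff ℝ ∞ (fun y => φ y ξ) :=
  contDiff_iff_contDiffAt.2 fun y =>
    ContDiffAt.comp (g := fun p : E n × E n => φ p.1 p.2) (f := fun y => (y, ξ)) y
      (h.contDiffAt hξ) (by fun_prop)

theorem inner_gradient {f : E n → ℝ} (x z : E n) : inner ℝ (gradient f x) z = fderiv ℝ f x z := by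
  simp [gradient]

theorem Admissible.scaledAmp_zero (h : Admissible m a ρ φ) {t lam c : ℝ} {q : (E n × E n) × E n}
    (hq : 1 < ‖lam • q.1.2‖) :
    scaledAmp φ a 0 t lam c q = fullAmp φ a t q.1.1 (lam • q.1.2) (c • q.2) := by
  have h1 := h.taylor_phase (x := q.1.1) (v := q.2) (c := c) hq 0
  simp at h1
  rw [scaledAmp, fullAmp, h1]
  simp

theorem Admissible.scaledAmp_one (h : Admissible m a ρ φ) {t lam c : ℝ} {q : (E n × E n) × E n}
    (hq : 1 < ‖lam • q.1.2‖) :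
    scaledAmp φ a 1 t lam c q = redAmp φ a t q.1.1 (lam • q.1.2) (c • q.2) := by
  have h1 := h.taylor_phase (x := q.1.1) (v := q.2) (c := c) hq 1
  simp only [Finset.sum_range_succ, Finset.range_zero, Finset.sum_empty, Nat.factorial, zero_add,
    iteratedFDeriv_zero_apply, iteratedFDeriv_one_apply, Nat.cast_one, inv_one, one_smul, mul_one] at h1
  rw [scaledAmp, redAmp, h1, inner_gradient]
  congr 4
  ring

theorem Admissible.eventually_amp_eq_zero (h : Admissible m a ρ φ) {t : ℝ} (ht : t ∈ Set.Ioo (0 : ℝ) 1)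
    {x ξ : E n} (hξ : ‖ξ‖ ≤ 1) : ∀ᶠ y in 𝓝 (x, ξ), a t y.1 y.2 = 0 := by
  have h1 : (x, ξ) ∉ tsupport (fun p : E n × E n => a t p.1 p.2) := fun hm =>
    absurd (h.supp t ht hm) (not_lt.2 hξ)
  have := notMem_tsupport_iff_eventuallyEq.1 h1
  exact this

theorem Admissible.amp_eq_zero (h : Admissible m a ρ φ) {t : ℝ} (ht : t ∈ Set.Ioo (0 : ℝ) 1)
    {x ξ : E n} (hξ : ‖ξ‖ ≤ 1) : a t x ξ = 0 :=
  (h.eventually_amp_eq_zero ht hξ (x := x)).self_of_nhds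

/-- This is Taylor order zero with `c = 1`. The closed support of the amplitude lies in `|ξ| > 1`,
so near the other points everything vanishes and the values of `φ` there do not matter. -/
theorem Admissible.germ_fullAmp (h : Admissible m a ρ φ) :
    GermBound (fun p : Set.Ioo (0 : ℝ) 1 × ((E n × E n) × E n) => p.2)
      (fun p => bracket p.2.1.2 * (1 + ‖p.2.2‖)) (fun _ => 1)
      (fun p q => fullAmp φ a p.1 q.1.1 q.1.2 q.2) := by
  have h1 := h.germ_scaledAmp 0 (c := fun _ => 1) (by simp) (by simp) (fun q v => by
    have h1 := q.one_le_lam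
    have h2 := norm_nonneg v
    simp only [one_mul, zero_add, pow_one]
    exact one_le_mul_of_one_le_of_one_le h1 (by linarith))
  let L : Freq n → ((E n × E n) × E n →L[ℝ] (E n × E n) × E n) := fun q =>
    ((dilate q.lam⁻¹).comp (ContinuousLinearMap.fst ℝ (E n × E n) (E n))).prod
      (ContinuousLinearMap.snd ℝ (E n × E n) (E n))
  have hLa : ∀ p q, L p q = ((q.1.1, p.lam⁻¹ • q.1.2), q.2) := fun p q => by
    simp [L, dilate]
    rfl
  have hL : ∀ p, ‖L p‖ ≤ 1 := fun p => by
    refine ContinuousLinearMap.opNorm_le_bound _ zero_le_one fun q => ?_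
    rw [hLa, one_mul]
    have e1 : ‖q.1.1‖ ≤ ‖q‖ := (norm_fst_le _).trans (norm_fst_le _)
    have e2 : ‖p.lam⁻¹ • q.1.2‖ ≤ ‖q‖ := by
      rw [norm_smul, Real.norm_of_nonneg (inv_nonneg.2 p.lam_pos.le)]
      exact (mul_le_of_le_one_left (norm_nonneg _) (inv_le_one_of_one_le₀ p.one_le_lam)).trans
        ((norm_snd_le _).trans (norm_fst_le _))
    exact max_le (max_le e1 e2) (norm_snd_le q)
  have h2 := GermBound.comp_affine (z := fun p : Par n × E n => (p.1.2.1, p.2)) (fun _ => 0)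
    (fun p => L p.1.2) (f := fun p => scaledAmp φ a 0 p.1.1 p.1.2.lam 1) (by
      convert! h1 using 2 with p
      rw [hLa]; simp [Freq.pt])
  have hpos : ∀ p : Set.Ioo (0 : ℝ) 1 × ((E n × E n) × E n), 0 ≤ bracket p.2.1.2 * (1 + ‖p.2.2‖) :=
    fun p => by have := bracket_pos p.2.1.2; positivity
  have h3 : GermBound (fun p : Par n × E n => (p.1.2.1, p.2))
      (fun p => p.1.2.lam * (1 + ‖p.2‖)) (fun _ => 1)
      (fun p q => fullAmp φ a p.1.1 q.1.1 q.1.2 q.2) := by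
    refine (h2.congr fun p => ?_).mono (fun p => ?_) (fun p => ?_) 1 1 (fun p => ?_) (fun p => ?_)
    · have : ∀ᶠ q in 𝓝 (p.1.2.1, p.2), 1 < ‖q.1.2‖ :=
        continuousAt_const.eventually_lt (by fun_prop) p.1.2.2
      filter_upwards [this] with q hq
      have hl := p.1.2.lam_pos.ne'
      rw [zero_add, hLa, h.scaledAmp_zero (by simpa [hl] using hq)]
      simp [hl]
    · have := p.1.2.lam_pos; positivity
    · exact Real.rpow_nonneg p.1.2.lam_pos.le _
    · simpa using rpow_le_one_of_nonpos p.1.2.one_le_lam h.nonpos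
    · have := p.1.2.lam_pos
      simp only [one_mul, zero_add, pow_one]
      exact mul_le_of_le_one_right (by positivity) (hL _)
  have hzero : ∀ p : Set.Ioo (0 : ℝ) 1 × ((E n × E n) × E n), ‖p.2.1.2‖ ≤ 1 →
      (fun q : (E n × E n) × E n => fullAmp φ a p.1 q.1.1 q.1.2 q.2) =ᶠ[𝓝 p.2] fun _ => 0 := by
    intro p hp
    have hcont : Filter.Tendsto (fun q : (E n × E n) × E n => (q.1.1 + q.2, q.1.2)) (𝓝 p.2)
        (𝓝 (p.2.1.1 + p.2.2, p.2.1.2)) :=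
      Continuous.tendsto (by fun_prop) p.2
    filter_upwards [hcont.eventually (h.eventually_amp_eq_zero p.1.2 hp)] with q hq
    simp [fullAmp, hq]
  refine ⟨fun p => ?_, fun i => ?_⟩
  · rcases lt_or_ge 1 ‖p.2.1.2‖ with hp | hp
    · exact h3.1 ((p.1, ⟨p.2.1, hp⟩), p.2.2)
    · exact contDiffAt_const.congr_of_eventuallyEq (hzero p hp)
  · obtain ⟨C, hC1, hC⟩ := h3.bound (fun p => by have := p.1.2.lam_pos; positivity) (by simp) i
    refine ⟨C, fun p => ?_⟩
    rcases lt_or_ge 1 ‖p.2.1.2‖ with hp | hp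
    · exact hC i le_rfl ((p.1, ⟨p.2.1, hp⟩), p.2.2)
    · rw [((hzero p hp).iteratedFDeriv ℝ i).eq_of_nhds]
      have := hpos p
      have e : iteratedFDeriv ℝ i (fun _ : (E n × E n) × E n => (0 : ℂ)) p.2 = 0 := by
        simp
      beta_reduce
      rw [e, norm_zero]
      positivity

/-- The remainder of the phase is now quadratic, and `λ^{-1/2}` is its natural length: for `z =
λ^{-1/2}v` the scale is `(1+|v|)²`, free of `λ`. Returning to `z` costs `√λ` per derivative. -/
theorem Admissible.germ_redAmp (h : Admissible m a ρ φ) :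
    GermBound (fun p : Par n × E n => p.2)
      (fun p => √p.1.2.lam * (1 + √p.1.2.lam * ‖p.2‖) ^ 2) (fun _ => 1)
      (fun p z => redAmp φ a p.1.1 p.1.2.1.1 p.1.2.1.2 z) := by
  have hs : ∀ q : Freq n, 0 < √q.lam := fun q => Real.sqrt_pos.2 q.lam_pos
  have hsq : ∀ q : Freq n, √q.lam * √q.lam = q.lam := fun q => Real.mul_self_sqrt q.lam_pos.le
  have hs1 : ∀ q : Freq n, 1 ≤ √q.lam := fun q => Real.one_le_sqrt.2 q.one_le_lam
  have hw : ∀ (q : Freq n) (v : E n), q.lam * ((√q.lam)⁻¹ * (1 + ‖v‖)) ^ (1 + 1) = (1 + ‖v‖) ^ 2 :=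
    fun q v => by
      rw [mul_pow, inv_pow, ← mul_assoc, one_add_one_eq_two, Real.sq_sqrt q.lam_pos.le,
        mul_inv_cancel₀ q.lam_pos.ne', one_mul]
  have h1 := h.germ_scaledAmp 1 (c := fun q => (√q.lam)⁻¹) (fun q => (inv_pos.2 (hs q)).le)
    (fun q => inv_le_one_of_one_le₀ (hs1 q)) (fun q v => by
      rw [hw]; exact one_le_pow₀ (by linarith [norm_nonneg v]))
  simp only [hw] at h1
  have h2 := h1.reindex (fun p : Par n × E n => (p.1, √p.1.2.lam • p.2))
  have h3 := GermBound.comp_affine (z := fun p : Par n × E n => p.2) (fun p => (p.1.2.pt, 0))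
    (fun p => √p.1.2.lam • ContinuousLinearMap.inr ℝ (E n × E n) (E n))
    (s := fun p => (1 + ‖√p.1.2.lam • p.2‖) ^ 2) (W := fun p => p.1.2.lam ^ m)
    (f := fun p => scaledAmp φ a 1 p.1.1 p.1.2.lam (√p.1.2.lam)⁻¹) (by
      convert! h2 using 2 with p
      simp)
  refine (h3.congr fun p => Filter.Eventually.of_forall fun z => ?_).mono (fun p => ?_) (fun p => ?_)
    1 1 (fun p => ?_) (fun p => ?_)
  · have hl := p.1.2.lam_pos.ne'
    have e : (p.1.2.pt, (0 : E n)) + (√p.1.2.lam • ContinuousLinearMap.inr ℝ (E n × E n) (E n)) z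
        = (p.1.2.pt, √p.1.2.lam • z) := by simp
    beta_reduce
    rw [e, h.scaledAmp_one (by simpa [Freq.pt, hl] using! p.1.2.2)]
    simp [Freq.pt, hl, smul_smul, (hs p.1.2).ne']
  · positivity
  · exact Real.rpow_nonneg p.1.2.lam_pos.le _
  · simpa using rpow_le_one_of_nonpos p.1.2.one_le_lam h.nonpos
  · have := hs p.1.2
    rw [norm_smul, norm_smul, Real.norm_of_nonneg this.le, one_mul, mul_comm]
    exact mul_le_mul_of_nonneg_right (mul_le_of_le_one_right this.le
      (ContinuousLinearMap.norm_inr_le_one ..)) (by positivity)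

end Amplitude
end FourierIntOp
end

noncomputable section
namespace FourierIntOp

open MeasureTheory FourierTransform

/-! ### Size of the terms of the expansion. -/

section Coefficients

variable {n : ℕ} {m : ℝ} {a : ℝ → E n → E n → ℂ} {ρ : E n → ℂ} {φ : E n → E n → ℝ}

/-- Passes from `|ξ| > 1` to all frequencies, where the functions vanish near the remaining points.
-/
theorem GermBound.extend {ι V F : Type*} [NormedAddCommGroup V] [NormedSpace ℝ V]
    [NormedAddCommGroup F] [NormedSpace ℝ F] {z : ι → V} {s W : ι → ℝ} {f : ι → V → F} {S : Set ι}
    (h : GermBound (fun p : S => z p) (fun p => s p) (fun p => W p) (fun p => f p))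
    (h0 : ∀ p, p ∉ S → f p =ᶠ[𝓝 (z p)] fun _ => 0) (hs : ∀ p, 0 ≤ s p) (hW : ∀ p, 0 ≤ W p) :
    GermBound z s W f := by
  refine ⟨fun p => ?_, fun i => ?_⟩
  · by_cases hp : p ∈ S
    · exact h.1 ⟨p, hp⟩
    · exact contDiffAt_const.congr_of_eventuallyEq (h0 p hp)
  · obtain ⟨C, hC1, hC⟩ := h.bound (fun p => hs p) (fun p => hW p) i
    refine ⟨C, fun p => ?_⟩
    by_cases hp : p ∈ S
    · exact hC i le_rfl ⟨p, hp⟩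
    · have e : iteratedFDeriv ℝ i (fun _ : V => (0 : F)) (z p) = 0 := by simp
      rw [((h0 p hp).iteratedFDeriv ℝ i).eq_of_nhds, e, norm_zero]
      have := hs p
      have := hW p
      positivity

theorem dirDerivs_map_smul {V F : Type*} [NormedAddCommGroup V] [NormedSpace ℝ V]
    [NormedAddCommGroup F] [NormedSpace ℝ F] (l : List V) (c : ℝ) {f : V → F} (hf : ContDiff ℝ ∞ f)
    (x : V) : dirDerivs (l.map (c • ·)) f x = c ^ l.length • dirDerivs l f x := by
  induction l generalizing x with
  | nil => simp [dirDerivs]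
  | cons v l ih =>
    have e : dirDerivs (l.map (c • ·)) f = fun y => c ^ l.length • dirDerivs l f y := funext ih
    have hd := ((contDiff_dirDerivs hf l).differentiable (by simp)) x
    change fderiv ℝ (dirDerivs (l.map (c • ·)) f) x (c • v) = _ • fderiv ℝ (dirDerivs l f) x v
    rw [e, fderiv_fun_const_smul hd]
    simp [pow_succ, smul_smul, mul_comm]

theorem contDiff_redAmp (h : Admissible m a ρ φ) {t : ℝ} (ht : t ∈ Set.Ioo (0 : ℝ) 1) {x ξ : E n}
    (hξ : 1 < ‖ξ‖) : ContDiff ℝ ∞ (redAmp φ a t x ξ) :=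
  contDiff_of_germBound (q := fun (p : Par n) z => redAmp φ a p.1 p.2.1.1 p.2.1.2 z)
    h.germ_redAmp (⟨t, ht⟩, ⟨(x, ξ), hξ⟩)

theorem Admissible.dirDerivs_redAmp_zero (h : Admissible m a ρ φ) {t : ℝ} (ht : t ∈ Set.Ioo (0 : ℝ) 1)
    {lam c : ℝ} (hc : c ≠ 0) {q : E n × E n} (hq : 1 < ‖lam • q.2‖) {k : ℕ} (r : Fin k → Fin n)
    (hcd : ContDiffAt ℝ k (scaledAmp φ a 1 t lam c) (q, (0 : E n))) :
    dirDerivs (dirs r) (redAmp φ a t q.1 (lam • q.2)) 0 =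
      c⁻¹ ^ k • dirDerivs ((dirs r).map (ContinuousLinearMap.inr ℝ (E n × E n) (E n)))
        (scaledAmp φ a 1 t lam c) (q, 0) := by
  have hred := contDiff_redAmp h ht (x := q.1) hq
  have e1 := dirDerivs_comp_affine (dirs r) (ContinuousLinearMap.inr ℝ (E n × E n) (E n))
    (q, (0 : E n)) (y := 0) (f := scaledAmp φ a 1 t lam c)
    (by rw [map_zero, add_zero, length_dirs]; exact hcd)
  have e2 : (fun v : E n => scaledAmp φ a 1 t lam c ((q, (0 : E n)) +
      ContinuousLinearMap.inr ℝ (E n × E n) (E n) v)) =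
      fun v => redAmp φ a t q.1 (lam • q.2) (0 + (c • ContinuousLinearMap.id ℝ (E n)) v) := by
    ext v
    have : (q, (0 : E n)) + ContinuousLinearMap.inr ℝ (E n × E n) (E n) v = (q, v) := by simp
    rw [this, h.scaledAmp_one (q := (q, v)) hq]
    simp
  have e3 := dirDerivs_comp_affine (dirs r) (c • ContinuousLinearMap.id ℝ (E n))
    (0 : E n) (y := 0) (f := redAmp φ a t q.1 (lam • q.2))
    (hred.contDiffAt.of_le (by exact_mod_cast le_top))
  have e4 := dirDerivs_map_smul (dirs r) c hred 0
  have e5 : (⇑(c • ContinuousLinearMap.id ℝ (E n)) : E n → E n) = fun v => c • v := by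
    ext v; simp
  rw [e2, e3, map_zero, map_zero, add_zero, add_zero, e5, e4, length_dirs] at e1
  rw [← e1, smul_smul, ← mul_pow, inv_mul_cancel₀ hc, one_pow, one_smul]

theorem Admissible.germ_scaledAmp_zero (h : Admissible m a ρ φ) :
    GermBound (fun p : Par n => (p.2.pt, (0 : E n))) (fun _ => 1) (fun p => p.2.lam ^ m)
      (fun p => scaledAmp φ a 1 p.1 p.2.lam (√p.2.lam)⁻¹) := by
  have hs : ∀ q : Freq n, 0 < √q.lam := fun q => Real.sqrt_pos.2 q.lam_pos
  have hs1 : ∀ q : Freq n, 1 ≤ √q.lam := fun q => Real.one_le_sqrt.2 q.one_le_lam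
  have hw : ∀ (q : Freq n) (v : E n), q.lam * ((√q.lam)⁻¹ * (1 + ‖v‖)) ^ (1 + 1) = (1 + ‖v‖) ^ 2 :=
    fun q v => by
      rw [mul_pow, inv_pow, ← mul_assoc, one_add_one_eq_two, Real.sq_sqrt q.lam_pos.le,
        mul_inv_cancel₀ q.lam_pos.ne', one_mul]
  have h1 := h.germ_scaledAmp 1 (c := fun q => (√q.lam)⁻¹) (fun q => (inv_pos.2 (hs q)).le)
    (fun q => inv_le_one_of_one_le₀ (hs1 q)) (fun q v => by
      rw [hw]; exact one_le_pow₀ (by linarith [norm_nonneg v]))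
  have h2 := h1.reindex (fun p : Par n => (p, (0 : E n)))
  refine h2.mono (fun p => ?_) (fun p => Real.rpow_nonneg p.2.lam_pos.le _) 1 1 (fun p => by simp)
    (fun p => ?_)
  · simp only [Function.comp_apply, hw]; positivity
  · simp only [Function.comp_apply, hw]; simp

/-- At `v = 0`, with `z = λ^{-1/2}v`, the amplitude is at unit scale jointly in `v` and the rescaled
phase space variables; each of the `k` derivatives in `z` then brings a factor `√λ`. -/
theorem Admissible.germ_redAmp_zero (h : Admissible m a ρ φ) {k : ℕ} (r : Fin k → Fin n) :
    GermBound (fun p : Par n => p.2.pt) (fun _ => 1) (fun p => p.2.lam ^ m * √p.2.lam ^ k)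
      (fun p q => dirDerivs (dirs r) (redAmp φ a p.1 q.1 (p.2.lam • q.2)) 0) := by
  have hs : ∀ q : Freq n, 0 < √q.lam := fun q => Real.sqrt_pos.2 q.lam_pos
  have hm : ∀ p : Par n, 0 ≤ p.2.lam ^ m := fun p => Real.rpow_nonneg p.2.lam_pos.le _
  have h2 := h.germ_scaledAmp_zero
  have h3 := GermBound.dirDerivs h2 (by simp) hm
    ((dirs r).map (ContinuousLinearMap.inr ℝ (E n × E n) (E n)))
  have h4 := GermBound.comp_affine (z := fun p : Par n => p.2.pt) (fun _ => 0)
    (fun _ => ContinuousLinearMap.inl ℝ (E n × E n) (E n)) (s := fun _ => 1)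
    (W := fun p => p.2.lam ^ m) (f := fun p => FourierIntOp.dirDerivs
      ((dirs r).map (ContinuousLinearMap.inr ℝ (E n × E n) (E n)))
      (scaledAmp φ a 1 p.1 p.2.lam (√p.2.lam)⁻¹)) (by
      convert! h3 using 2 with p
      · simp
      · simp)
  have h5 := h4.const_smul (c := fun p : Par n => √p.2.lam ^ k)
  refine (h5.congr fun p => ?_).mono (by simp) (fun p => by have := hm p; positivity) 1 1
    (fun p => ?_) (fun p => ?_)
  · have hcd : ∀ᶠ q in 𝓝 p.2.pt, ContDiffAt ℝ k (scaledAmp φ a 1 p.1 p.2.lam (√p.2.lam)⁻¹)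
        (q, (0 : E n)) := by
      have := ((h2.1 p).of_le (m := (k : ℕ∞ω)) (by exact_mod_cast le_top)).eventually_nat
      have hc : Filter.Tendsto (fun q : E n × E n => (q, (0 : E n))) (𝓝 p.2.pt) (𝓝 (p.2.pt, 0)) :=
        Continuous.tendsto (by fun_prop) _
      exact hc.eventually this
    filter_upwards [hcd, eventually_one_lt p.2.one_lt_pt] with q hq hq1
    rw [h.dirDerivs_redAmp_zero p.1.2 (inv_ne_zero (hs p.2).ne') hq1 r hq, zero_add, inv_inv]
    rfl
  · rw [abs_of_nonneg (by have := hs p.2; positivity), one_mul, mul_comm]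
  · simpa using ContinuousLinearMap.norm_inl_le_one ℝ (E n × E n) (E n)

/-- The gradient of the phase in `x`, with the frequency rescaled. -/
def scaledGrad (φ : E n → E n → ℝ) (lam : ℝ) (q : E n × E n) : E n :=
  ∑ j, (lam⁻¹ * dirDeriv (dirX j) (scaledPhase φ lam) q) • basisVec j

theorem Admissible.smul_scaledGrad (h : Admissible m a ρ φ) {lam : ℝ} (hl : lam ≠ 0) {q : E n × E n}
    (hq : 1 < ‖lam • q.2‖) :
    lam • scaledGrad φ lam q = gradient (fun y => φ y (lam • q.2)) q.1 := by
  rw [scaledGrad, Finset.smul_sum]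
  refine Eq.trans (Finset.sum_congr rfl fun j _ => ?_) (sum_smul_basisVec _)
  rw [smul_smul, ← mul_assoc, mul_inv_cancel₀ hl, one_mul]
  congr 1
  have e := h.dirDerivs_slice (x := q.1) hq [j]
  have e2 : gradient (fun y => φ y (lam • q.2)) q.1 j =
      inner ℝ (gradient (fun y => φ y (lam • q.2)) q.1) (basisVec j) := by
    rw [real_inner_comm, EuclideanSpace.inner_single_left]; simp
  rw [e2, inner_gradient]
  exact e.symm

theorem Admissible.germ_scaledGrad (h : Admissible m a ρ φ) :
    GermBound (fun q : Freq n => q.pt) (fun _ => 1) (fun _ => 1)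
      (fun q => scaledGrad φ q.lam) := by
  refine GermBound.sum _ fun j _ => ?_
  have h1 := ((h.germ_dirX j).const_smul (c := fun q => q.lam⁻¹)).clm_comp
    (fun _ => (ContinuousLinearMap.toSpanSingleton ℝ (basisVec j : E n)))
  refine h1.mono (by simp) (fun q => by have := q.lam_pos; positivity) 
    ‖ContinuousLinearMap.toSpanSingleton ℝ (basisVec j : E n)‖ 1 (fun q => ?_) (by simp)
  rw [abs_of_nonneg (inv_nonneg.2 q.lam_pos.le), inv_mul_cancel₀ q.lam_pos.ne']

/-- The lower bound in assumption (i), with `|ξ| ≥ λ/2`. It governs the decay of `ρ` at `t∇_xφ`, the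
position of the Taylor point and the nonstationary phase argument. -/
theorem Admissible.exists_le_norm_scaledGrad (h : Admissible m a ρ φ) :
    ∃ c > 0, ∀ q : Freq n, c ≤ ‖scaledGrad φ q.lam q.pt‖ := by
  obtain ⟨C₁, h1, C₂, h2, hC⟩ := h.grad
  refine ⟨C₁ / 2, by positivity, fun q => ?_⟩
  have e := h.smul_scaledGrad q.lam_pos.ne' q.one_lt_pt
  have h3 := (hC q.1.1 q.1.2 q.2).1
  have h4 : ‖q.lam • scaledGrad φ q.lam q.pt‖ = ‖gradient (fun y => φ y q.1.2) q.1.1‖ := by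
    rw [e, q.lam_smul_pt]; rfl
  rw [norm_smul, Real.norm_of_nonneg q.lam_pos.le] at h4
  rw [← h4] at h3
  have h5 : q.lam ≤ 2 * ‖q.1.2‖ := bracket_le_two_mul q.2
  have := q.lam_pos
  by_contra! h6
  nlinarith

/-- A derivative of order `k` of `ρ` decays like `⟨μv⟩^{-k}`; only the power `κ ≤ k` is kept, and
`⟨μv⟩ ≥ cμ`. Each further derivative in `v` costs `μ/⟨μv⟩ ≤ c⁻¹`, whence the unit scale. -/
theorem Admissible.germ_mult_smul (h : Admissible m a ρ φ) {k : ℕ} (r : Fin k → Fin n) {κ : ℝ}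
    (hκ : 0 ≤ κ) (hκk : κ ≤ k) {ι : Type*} {μ : ι → ℝ} (hμ : ∀ p, 0 < μ p) {v : ι → E n} {c : ℝ}
    (hc : 0 < c) (hv : ∀ p, c ≤ ‖v p‖) :
    GermBound v (fun _ => 1) (fun p => μ p ^ (-κ)) (fun p v => dirDerivs (dirs r) ρ (μ p • v)) := by
  have hb0 : ∀ η : E n, 0 ≤ (bracket η)⁻¹ := fun η => (inv_pos.2 (bracket_pos η)).le
  have h1 := (h.germ_mult.dirDerivs hb0 (by simp) (dirs r)).reindex (fun p : ι => μ p • v p)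
  have h2 := GermBound.comp_affine (z := v) (fun _ => 0)
    (fun p => μ p • ContinuousLinearMap.id ℝ (E n))
    (f := fun _ => FourierIntOp.dirDerivs (dirs r) ρ) (by
      convert! h1 using 2 with p
      simp)
  have hbr : ∀ p : ι, c * μ p ≤ bracket (μ p • v p) := fun p => by
    refine le_trans ?_ (norm_le_bracket _)
    rw [norm_smul, Real.norm_of_nonneg (hμ p).le, mul_comm]
    exact mul_le_mul_of_nonneg_left (hv _) (hμ p).le
  refine (h2.congr fun p => Filter.Eventually.of_forall fun y => ?_).mono (fun p => ?_) (fun p => ?_)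
    (c ^ (-κ)) c⁻¹ (fun p => ?_) (fun p => ?_)
  · simp
  · exact mul_nonneg (hb0 _) (norm_nonneg _)
  · simp only [Function.comp_apply, one_mul]; exact pow_nonneg (hb0 _) _
  · simp only [Function.comp_apply, one_mul, length_dirs]
    have hβ1 := one_le_bracket (μ p • v p)
    calc (bracket (μ p • v p))⁻¹ ^ k = bracket (μ p • v p) ^ (-(k : ℝ)) := by
          rw [Real.rpow_neg (by linarith), Real.rpow_natCast, inv_pow]
      _ ≤ bracket (μ p • v p) ^ (-κ) := Real.rpow_le_rpow_of_exponent_le hβ1 (by linarith)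
      _ ≤ (c * μ p) ^ (-κ) :=
          Real.rpow_le_rpow_of_nonpos (mul_pos hc (hμ p)) (hbr p) (by linarith)
      _ = _ := Real.mul_rpow hc.le (hμ p).le
  · simp only [Function.comp_apply, mul_one]
    rw [norm_smul, Real.norm_of_nonneg (hμ p).le, inv_mul_le_iff₀ (bracket_pos _)]
    calc _ ≤ μ p := mul_le_of_le_one_right (hμ p).le ContinuousLinearMap.norm_id_le
      _ = (c * μ p) * c⁻¹ := by field_simp
      _ ≤ _ := mul_le_mul_of_nonneg_right (hbr p) (by positivity)

/-- Here `t∇_xφ = μv` with `μ = tλ` and `v = ∇_xφ/λ`, a family at unit scale that stays away from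
zero. -/
theorem Admissible.germ_mult_grad (h : Admissible m a ρ φ) {k : ℕ} (r : Fin k → Fin n) {κ : ℝ}
    (hκ : 0 ≤ κ) (hκk : κ ≤ k) :
    GermBound (fun p : Par n => p.2.pt) (fun _ => 1) (fun p => (p.1 * p.2.lam) ^ (-κ))
      (fun p q => dirDerivs (dirs r) ρ ((p.1 : ℝ) • gradient (fun y => φ y (p.2.lam • q.2)) q.1)) := by
  obtain ⟨c, hc, hcb⟩ := h.exists_le_norm_scaledGrad
  have htl : ∀ p : Par n, 0 < (p.1 : ℝ) * p.2.lam := fun p => mul_pos p.1.2.1 p.2.lam_pos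
  have h3 := h.germ_mult_smul r hκ hκk htl (v := fun p => scaledGrad φ p.2.lam p.2.pt) hc
    (fun p => hcb p.2)
  have hg := h.germ_scaledGrad.reindex (fun p : Par n => p.2)
  have h4 := GermBound.comp (f := fun p : Par n => scaledGrad φ p.2.lam) (z := fun p => p.2.pt)
    (g := fun p v => FourierIntOp.dirDerivs (dirs r) ρ (((p.1 : ℝ) * p.2.lam) • v))
    (s := fun _ => 1) (W := fun p => ((p.1 : ℝ) * p.2.lam) ^ (-κ)) h3 (fun p => hg.1 p) (fun _ => zero_le_one)
    (fun p => Real.rpow_nonneg (htl p).le _) (fun i _ => by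
      obtain ⟨C, hC⟩ := hg.2 i
      refine ⟨C, fun p => (hC p).trans (le_of_eq ?_)⟩
      simp only [Function.comp_apply, one_mul])
  refine h4.congr fun p => ?_
  filter_upwards [eventually_one_lt p.2.one_lt_pt] with q hq
  rw [← h.smul_scaledGrad p.2.lam_pos.ne' hq, mul_smul]

/-- The products of derivatives of the multiplier and of the reduced amplitude in the asymptotic
expansion. -/
def expTerm (φ : E n → E n → ℝ) (a : ℝ → E n → E n → ℂ) (ρ : E n → ℂ) (t : ℝ) (x ξ : E n) {k : ℕ}
    (r : Fin k → Fin n) : ℂ :=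
  dirDerivs (dirs r) ρ (t • gradient (fun y => φ y ξ) x) * dirDerivs (dirs r) (redAmp φ a t x ξ) 0

theorem Admissible.eventually_expTerm_eq_zero (h : Admissible m a ρ φ) {t : ℝ}
    (ht : t ∈ Set.Ioo (0 : ℝ) 1) {x ξ : E n} (hξ : ‖ξ‖ ≤ 1) {k : ℕ} (r : Fin k → Fin n) :
    ∀ᶠ q in 𝓝 (x, ξ), expTerm φ a ρ t q.1 q.2 r = 0 := by
  filter_upwards [(h.eventually_amp_eq_zero ht hξ (x := x)).eventually_nhds] with q hq
  have hc : Filter.Tendsto (fun z : E n => (q.1 + z, q.2)) (𝓝 0) (𝓝 q) := by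
    have : Continuous (fun z : E n => (q.1 + z, q.2)) := by fun_prop
    simpa using this.tendsto 0
  have h1 : redAmp φ a t q.1 q.2 =ᶠ[𝓝 0] fun _ => 0 := by
    filter_upwards [hc.eventually hq] with z hz
    simp [redAmp, hz]
  have h2 : ∀ l : List (E n), dirDerivs l (fun _ : E n => (0 : ℂ)) = fun _ => 0 := fun l => by
    induction l with
    | nil => rfl
    | cons v l ih =>
      ext y
      change fderiv ℝ (dirDerivs l fun _ : E n => (0 : ℂ)) y v = 0
      rw [ih]; simp
  rw [expTerm, (dirDerivs_congr h1 _).eq_of_nhds, h2, mul_zero]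

/-- Times and phase space points. -/
abbrev TPt (n : ℕ) := Set.Ioo (0 : ℝ) 1 × (E n × E n)

/-- The phase space point with rescaled frequency. -/
def rescale (q : E n × E n) : E n × E n := (q.1, (bracket q.2)⁻¹ • q.2)

theorem Admissible.germ_expTerm (h : Admissible m a ρ φ) {k : ℕ} (r : Fin k → Fin n) {ε : ℝ}
    (hε : 0 < ε) (hε' : ε < 1 / 2) :
    GermBound (fun p : TPt n => rescale p.2) (fun _ => 1)
      (fun p => p.1 ^ ((k : ℝ) * (ε - 1)) * bracket p.2.2 ^ (m - k * (1 / 2 - ε)))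
      (fun p q => expTerm φ a ρ p.1 q.1 (bracket p.2.2 • q.2) r) := by
  -- The exponent `κ = k(1-ε)` gives `(tλ)^{-k(1-ε)}λ^{m+k/2} = t^{k(ε-1)}λ^{m-k(1/2-ε)}`.
  have h1 := (h.germ_mult_grad r (κ := k * (1 - ε)) (by have : 0 ≤ 1 - ε := by linarith
                                                        positivity)
    (mul_le_of_le_one_right (by positivity) (by linarith))).mul (h.germ_redAmp_zero r) (by simp)
    (fun p => Real.rpow_nonneg (mul_nonneg p.1.2.1.le p.2.lam_pos.le) _)
    (fun p => mul_nonneg (Real.rpow_nonneg p.2.lam_pos.le _) (by positivity))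
  refine GermBound.extend (S := {p | 1 < ‖p.2.2‖}) ?_ (fun p hp => ?_) (by simp) (fun p => ?_)
  · have h2 := h1.reindex (fun p : {p : TPt n | 1 < ‖p.2.2‖} => ((p.1.1, ⟨p.1.2, p.2⟩) : Par n))
    refine h2.mono (by simp) (fun p => ?_) 1 1 (fun p => ?_) (by simp)
    · simp only [Function.comp_apply]
      have := p.1.1.2.1
      have := bracket_pos p.1.2.2
      unfold Freq.lam
      positivity
    · have ht : 0 < (p.1.1 : ℝ) := p.1.1.2.1
      have hl := bracket_pos p.1.2.2
      simp only [Function.comp_apply, Freq.lam, one_mul]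
      rw [Real.mul_rpow ht.le hl.le, mul_assoc, Real.sqrt_eq_rpow, ← Real.rpow_natCast,
        ← Real.rpow_mul hl.le, ← Real.rpow_add hl, ← Real.rpow_add hl]
      refine le_of_eq ?_
      congr 2 <;> ring
  · have hc : Filter.Tendsto (fun q : E n × E n => (q.1, bracket p.2.2 • q.2)) (𝓝 (rescale p.2))
        (𝓝 p.2) := by
      have : Continuous (fun q : E n × E n => (q.1, bracket p.2.2 • q.2)) := by fun_prop
      simpa [rescale, (bracket_pos p.2.2).ne'] using this.tendsto (rescale p.2)
    exact hc.eventually (h.eventually_expTerm_eq_zero p.1.2 (not_lt.1 hp) r)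
  · have := p.1.2.1
    have := bracket_pos p.2.2
    positivity

theorem contDiff_of_germ_rescale {f : ℝ → E n → E n → ℂ} {s W : TPt n → ℝ}
    (hf : GermBound (fun p : TPt n => rescale p.2) s W
      (fun p q => f p.1 q.1 (bracket p.2.2 • q.2))) {t : ℝ} (ht : t ∈ Set.Ioo (0 : ℝ) 1) :
    ContDiff ℝ ∞ (fun q : E n × E n => f t q.1 q.2) := by
  refine contDiff_iff_contDiffAt.2 fun q => ?_
  have h1 := ContDiffAt.comp (x := q) (g := fun y : E n × E n => f t y.1 (bracket q.2 • y.2))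
    (f := fun y : E n × E n => (y.1, (bracket q.2)⁻¹ • y.2)) (n := ∞) (𝕜 := ℝ)
    (hf.1 (⟨t, ht⟩, q)) (by fun_prop)
  simpa [Function.comp_def, (bracket_pos q.2).ne'] using! h1

theorem mixedDeriv_le_of_germ_rescale {f : ℝ → E n → E n → ℂ} {W : TPt n → ℝ}
    (hf : GermBound (fun p : TPt n => rescale p.2) (fun _ => 1) W
      (fun p q => f p.1 q.1 (bracket p.2.2 • q.2))) (γ β : Fin n → ℕ) :
    ∃ C : ℝ, ∀ p : TPt n, ‖mixedDeriv γ β (f p.1) p.2.1 p.2.2‖ ≤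
      C * (W p * (bracket p.2.2)⁻¹ ^ order γ) := by
  obtain ⟨C, hC⟩ := hf.2 (order γ + order β)
  refine ⟨C, fun p => (norm_mixedDeriv_le γ β (bracket_pos p.2.2)
    (contDiff_of_germ_rescale hf p.1.2).contDiffAt).trans ?_⟩
  rw [← mul_assoc]
  refine mul_le_mul_of_nonneg_right ((hC p).trans (by simp)) ?_
  have := bracket_pos p.2.2
  positivity

end Coefficients
end FourierIntOp
end

noncomputable section
namespace FourierIntOp

open MeasureTheory FourierTransform

/-! ### The composed amplitude and its a priori bounds. -/

section Sigma

variable {n : ℕ} {m : ℝ} {a : ℝ → E n → E n → ℂ} {ρ : E n → ℂ} {φ : E n → E n → ℝ}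

/-- The symbol of the multiplier `ρ(tD)` for the kernel `e^{-2πi x·ξ}`. -/
def multSymbol (ρ : E n → ℂ) (t : ℝ) (w : E n) : ℂ := ρ (t • ((2 * Real.pi) • w))

/-- The amplitude of the composition of `ρ(tD)` and the Fourier integral operator. -/
def compAmp (φ : E n → E n → ℝ) (a : ℝ → E n → E n → ℂ) (ρ : E n → ℂ) (t : ℝ) (x ξ : E n) : ℂ :=
  opT (multSymbol ρ t) (fullAmp φ a t x ξ)

theorem Admissible.germ_multSymbol (h : Admissible m a ρ φ) :
    GermBound (fun p : Set.Ioo (0 : ℝ) 1 × E n => p.2) (fun p => p.1) (fun _ => 1)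
      (fun p => multSymbol ρ p.1) := by
  have h1 := GermBound.reindex h.bddSmooth_mult
    (fun p : Set.Ioo (0 : ℝ) 1 × E n => (p.1 : ℝ) • ((2 * Real.pi) • p.2))
  have h2 := GermBound.comp_affine (z := fun p : Set.Ioo (0 : ℝ) 1 × E n => p.2) (fun _ => 0)
    (fun p => ((p.1 : ℝ) * (2 * Real.pi)) • ContinuousLinearMap.id ℝ (E n)) (s := fun _ => 1)
    (W := fun _ => 1) (f := fun _ => ρ) (by
      convert! h1 using 2 with p
      simp [mul_smul])
  refine (h2.congr fun p => Filter.Eventually.of_forall fun y => ?_).mono (fun p => ?_) (by simp)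
    1 (2 * Real.pi) (by simp) (fun p => ?_)
  · simp [multSymbol, mul_smul]
  · positivity
  · have := p.1.2.1
    rw [one_mul, norm_smul, Real.norm_of_nonneg (by positivity), mul_comm (2 * Real.pi)]
    exact mul_le_of_le_one_right (by positivity) ContinuousLinearMap.norm_id_le

theorem Admissible.germ_multSymbol_one (h : Admissible m a ρ φ) :
    GermBound (fun p : Set.Ioo (0 : ℝ) 1 × E n => p.2) (fun _ => 1) (fun _ => 1)
      (fun p => multSymbol ρ p.1) :=
  h.germ_multSymbol.mono (fun p => p.1.2.1.le) (by simp) 1 1 (by simp) (fun p => by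
    simpa using p.1.2.2.le)

theorem Admissible.bddSmooth_multSymbol (h : Admissible m a ρ φ) {t : ℝ} (ht : t ∈ Set.Ioo (0 : ℝ) 1) :
    BddSmooth (multSymbol ρ t) :=
  GermBound.slice (q := fun t : Set.Ioo (0 : ℝ) 1 => multSymbol ρ t) (A := fun _ => 1) (by simp)
    h.germ_multSymbol_one ⟨t, ht⟩

theorem Admissible.contDiff_fullAmp (h : Admissible m a ρ φ) {t : ℝ} (ht : t ∈ Set.Ioo (0 : ℝ) 1) :
    ContDiff ℝ ∞ (fun q : (E n × E n) × E n => fullAmp φ a t q.1.1 q.1.2 q.2) :=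
  contDiff_of_germBound (q := fun (t : Set.Ioo (0 : ℝ) 1) (q : (E n × E n) × E n) =>
    fullAmp φ a t q.1.1 q.1.2 q.2) h.germ_fullAmp ⟨t, ht⟩

theorem Admissible.contDiff_fullAmp_slice (h : Admissible m a ρ φ) {t : ℝ}
    (ht : t ∈ Set.Ioo (0 : ℝ) 1) (x ξ : E n) : ContDiff ℝ ∞ (fullAmp φ a t x ξ) :=
  (h.contDiff_fullAmp ht).comp (f := fun z => ((x, ξ), z)) (by fun_prop)

theorem fullAmp_eq_zero (h : Admissible m a ρ φ) {t : ℝ} (ht : t ∈ Set.Ioo (0 : ℝ) 1) {x ξ : E n}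
    (hξ : ‖ξ‖ ≤ 1) : fullAmp φ a t x ξ = fun _ => 0 := by
  ext z
  rw [fullAmp, h.amp_eq_zero ht hξ, zero_mul]

theorem compAmp_eq_zero (h : Admissible m a ρ φ) {t : ℝ} (ht : t ∈ Set.Ioo (0 : ℝ) 1) {x ξ : E n}
    (hξ : ‖ξ‖ ≤ 1) : compAmp φ a ρ t x ξ = 0 := by
  simp [compAmp, fullAmp_eq_zero h ht hξ, opT, bessel_iterate_zero]

theorem opT_const_mul (q : E n → ℂ) {b : E n → ℂ} (hb : ContDiff ℝ ∞ b) (c : ℂ) :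
    opT q (fun z => c * b z) = c * opT q b := by
  simp_rw [opT, bessel_iterate_const_mul hb]
  rw [← integral_const_mul]
  congr 1
  ext z
  ring

theorem fullAmp_sub (t : ℝ) (x y ξ : E n) :
    a t y ξ * Complex.exp (Complex.I * (φ y ξ : ℝ)) =
      Complex.exp (Complex.I * (φ x ξ : ℝ)) * fullAmp φ a t x ξ (-x + y) := by
  rw [fullAmp, add_neg_cancel_left, mul_left_comm, ← Complex.exp_add]
  congr 3
  push_cast
  ring

/-- Near each `y` the function is a unimodular constant times `fullAmp` based at `y`, taken near `z
= 0`, where its scale is `⟨ξ⟩`; the size of the phase never enters. -/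
theorem Admissible.bddSmooth_amp_exp (h : Admissible m a ρ φ) {t : ℝ} (ht : t ∈ Set.Ioo (0 : ℝ) 1)
    (ξ : E n) : BddSmooth (fun y => a t y ξ * Complex.exp (Complex.I * (φ y ξ : ℝ))) := by
  have h1 := h.germ_fullAmp.reindex (fun y : E n => ((⟨t, ht⟩, ((y, ξ), 0)) :
    Set.Ioo (0 : ℝ) 1 × ((E n × E n) × E n)))
  have h2 := GermBound.comp_affine (z := fun y : E n => y) (fun y => ((y, ξ), -y))
    (fun _ => ContinuousLinearMap.inr ℝ (E n × E n) (E n)) (s := fun _ => bracket ξ)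
    (W := fun _ => 1) (f := fun _ (q : (E n × E n) × E n) => fullAmp φ a t q.1.1 q.1.2 q.2) (by
      convert! h1 using 2 with y
      · simp
      · simp)
  refine ((h2.const_mul (fun y => Complex.exp (Complex.I * (φ y ξ : ℝ)))).congr fun y =>
    Filter.Eventually.of_forall fun z => ?_).mono (fun y => ?_) (fun y => by positivity) 1
      (bracket ξ * ‖ContinuousLinearMap.inr ℝ (E n × E n) (E n)‖) (fun y => ?_) (fun y => ?_)
  · beta_reduce
    rw [fullAmp_sub t y z ξ]
    simp
  · have := bracket_pos ξ
    positivity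
  · rw [mul_comm Complex.I, Complex.norm_exp_ofReal_mul_I]
  · simp

theorem Admissible.hasOscIntegral_compAmp (h : Admissible m a ρ φ) {t : ℝ}
    (ht : t ∈ Set.Ioo (0 : ℝ) 1) (x ξ : E n) :
    HasOscIntegral (compositionIntegrand φ (a t) ρ t x ξ) (compAmp φ a ρ t x ξ) := by
  have hb := (h.bddSmooth_amp_exp ht ξ).mul
    (bddSmooth_const (Complex.exp (Complex.I * (-φ x ξ : ℝ))))
  have hr : BddSmooth (fun η : E n => ρ (t • η)) := by
    simpa using! h.bddSmooth_mult.comp_clm (t • ContinuousLinearMap.id ℝ (E n))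
  convert! hasOscIntegral_of_bddSmooth hb hr x using 1
  · ext y η
    have e : Complex.exp (Complex.I * ((inner ℝ (x - y) η + φ y ξ - φ x ξ : ℝ) : ℂ)) =
        Complex.exp (Complex.I * (φ y ξ : ℝ)) * Complex.exp (Complex.I * (-φ x ξ : ℝ)) *
          Complex.exp (Complex.I * (inner ℝ (x - y) η : ℝ)) := by
      rw [← Complex.exp_add, ← Complex.exp_add]
      congr 1
      push_cast
      ring
    rw [compositionIntegrand, e]
    ring
  · rw [compAmp]
    congr 1
    ext z
    rw [fullAmp, mul_assoc, ← Complex.exp_add]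
    congr 2
    push_cast
    ring

/-- Nothing is known about `φ` where `|ξ| ≤ 1`, but the product vanishes there. -/
theorem measurable_amp_exp {c : E n → E n → ℂ} (hφ : ContDiffOn ℝ ∞ (fun p : E n × E n => φ p.1 p.2)
    (highFreq n)) (hc : Continuous (fun p : E n × E n => c p.1 p.2))
    (h0 : ∀ x ξ, ‖ξ‖ ≤ 1 → c x ξ = 0) :
    Measurable (fun p : E n × E n => c p.1 p.2 * Complex.exp (Complex.I * (φ p.1 p.2 : ℝ))) := by
  classical
  have h1 : ContinuousOn (fun p : E n × E n => c p.1 p.2 * Complex.exp (Complex.I * (φ p.1 p.2 : ℝ)))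
      (highFreq n) := by
    refine hc.continuousOn.mul (Complex.continuous_exp.comp_continuousOn
      (continuousOn_const.mul (Complex.continuous_ofReal.comp_continuousOn hφ.continuousOn)))
  have h2 := ContinuousOn.measurable_piecewise (g := fun _ => (0 : ℂ)) h1 continuousOn_const
    isOpen_highFreq.measurableSet
  convert h2 using 1
  ext p
  by_cases hp : p ∈ highFreq n
  · simp [Set.piecewise, hp]
  · have : ‖p.2‖ ≤ 1 := not_lt.1 hp
    simp [Set.piecewise, hp, h0 _ _ this]

theorem Admissible.multiplierEq_compAmp (h : Admissible m a ρ φ) {t : ℝ} (ht : t ∈ Set.Ioo (0 : ℝ) 1)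
    (hc : Continuous (fun p : E n × E n => compAmp φ a ρ t p.1 p.2)) {C : ℝ}
    (hC : ∀ x ξ, ‖compAmp φ a ρ t x ξ‖ ≤ C) (f : 𝓢(E n, ℂ)) :
    MultiplierEq (fun ξ => ρ (t • ξ)) (fio φ (a t) f) (fio φ (compAmp φ a ρ t) f) := by
  have hexp : ∀ (c : ℂ) (s : ℝ), ‖c * Complex.exp (Complex.I * (s : ℝ))‖ = ‖c‖ := fun c s => by
    rw [norm_mul, mul_comm Complex.I, Complex.norm_exp_ofReal_mul_I, mul_one]
  obtain ⟨Ca, hCa⟩ := h.germ_symb.2 0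
  refine multiplierEq_fio (C := max Ca 0) (C' := C) (h.bddSmooth_multSymbol ht)
    (h.bddSmooth_amp_exp ht) (fun x ξ => ?_)
    (measurable_amp_exp h.smooth (h.symb.smooth t ht).continuous fun x ξ hξ => h.amp_eq_zero ht hξ)
    (measurable_amp_exp h.smooth hc fun x ξ hξ => compAmp_eq_zero h ht hξ)
    (fun x ξ => ?_) (fun x ξ => (hexp _ _).trans_le (hC x ξ)) f
  · rw [compAmp, mul_comm, ← opT_const_mul _ (h.contDiff_fullAmp_slice ht x ξ)]
    congr 1
    ext z
    rw [fullAmp_sub t x (x + z), neg_add_cancel_left]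
  · rw [hexp]
    have h1 := hCa (⟨t, ht⟩, (x, ξ))
    simp only [norm_iteratedFDeriv_zero, pow_zero, mul_one] at h1
    rw [smul_smul, mul_inv_cancel₀ (bracket_pos ξ).ne', one_smul] at h1
    refine h1.trans ((mul_le_mul_of_nonneg_right (le_max_left _ 0)
      (Real.rpow_nonneg (bracket_pos _).le _)).trans ?_)
    exact mul_le_of_le_one_right (le_max_right _ _)
      (rpow_le_one_of_nonpos (one_le_bracket _) h.nonpos)

/-- The integrand of `compAmp` besides the kernel. -/
def besselAmp (φ : E n → E n → ℝ) (a : ℝ → E n → E n → ℂ) (t : ℝ) : (E n × E n) × E n → ℂ :=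
  (bessel fun j => ((0 : E n × E n), (basisVec j : E n)))^[n + 1]
    (fun q => fullAmp φ a t q.1.1 q.1.2 q.2)

theorem compAmp_eq_integral (h : Admissible m a ρ φ) {t : ℝ} (ht : t ∈ Set.Ioo (0 : ℝ) 1)
    (x ξ : E n) : compAmp φ a ρ t x ξ =
      ∫ z, 𝓕 (regSymbol (multSymbol ρ t)) z * besselAmp φ a t ((x, ξ), z) := by
  have := bessel_iterate_comp_affine (h.contDiff_fullAmp ht) (ContinuousLinearMap.inr ℝ (E n × E n) (E n))
    ((x, ξ), 0) basisVec (n + 1)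
  rw [compAmp, opT]
  congr 1
  ext z
  congr 1
  have h2 := congrFun this z
  simpa using! h2

theorem Admissible.germ_besselAmp (h : Admissible m a ρ φ) :
    GermBound (fun p : Set.Ioo (0 : ℝ) 1 × ((E n × E n) × E n) => p.2)
      (fun p => bracket p.2.1.2 * (1 + ‖p.2.2‖))
      (fun p => (bracket p.2.1.2 * (1 + ‖p.2.2‖)) ^ (2 * (n + 1)))
      (fun p => besselAmp φ a p.1) := by
  have := h.germ_fullAmp.bessel_iterate (fun j => ((0 : E n × E n), (basisVec j : E n))) (fun p =>
    one_le_mul_of_one_le_of_one_le (one_le_bracket _) (by linarith [norm_nonneg p.2.2]))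
    (by simp) (n + 1)
  simpa using! this

theorem continuous_bracket : Continuous (bracket : E n → ℝ) := by
  unfold bracket; fun_prop

/-- Differentiation under the integral of the regularised pairing. The polynomial loss is harmless:
what matters later is that it does not depend on the order of the expansion. -/
theorem Admissible.germ_compAmp (h : Admissible m a ρ φ) :
    GermBound (fun p : TPt n => p.2) (fun p => bracket p.2.2)
      (fun p => bracket p.2.2 ^ (2 * (n + 1))) (fun p q => compAmp φ a ρ p.1 q.1 q.2) := by
  have hd := fun I => kernel_decay (ι := Set.Ioo (0 : ℝ) 1) (A := fun _ => 1) (by simp)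
    (q := fun t => multSymbol ρ t) h.germ_multSymbol_one I
  have hb : ∀ k : ℕ, ∃ C : ℝ, 0 ≤ C ∧ ∀ (t : Set.Ioo (0 : ℝ) 1) (q : E n × E n) (z : E n),
      ‖iteratedFDeriv ℝ k (fun q => besselAmp φ a t (q, z)) q‖ ≤
        C * (bracket q.2 * (1 + ‖z‖)) ^ (2 * (n + 1) + k) := by
    intro k
    obtain ⟨C, hC1, hC⟩ := h.germ_besselAmp.bound (fun p => by have := bracket_pos p.2.1.2; positivity)
      (fun p => by have := bracket_pos p.2.1.2; positivity) k
    refine ⟨C, by linarith, fun t q z => ?_⟩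
    have h1 := (h.germ_besselAmp.1 (t, (q, z)))
    have h2 := ContDiffAt.norm_iteratedFDeriv_comp_affine_le ((0 : E n × E n), z)
      (ContinuousLinearMap.inl ℝ (E n × E n) (E n)) (x := q) (f := besselAmp φ a t)
      (by simpa using! h1) k
    have h3 := hC k le_rfl (t, (q, z))
    simp only [ContinuousLinearMap.inl_apply, Prod.mk_add_mk, zero_add, add_zero] at h2
    refine h2.trans ((mul_le_of_le_one_right (norm_nonneg _) (pow_le_one₀ (norm_nonneg _)
      (ContinuousLinearMap.norm_inl_le_one ..))).trans (h3.trans (le_of_eq ?_)))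
    rw [pow_add]
  choose C hC0 hC using hb
  choose D hD0 hD using hd
  have hcont : ∀ t : Set.Ioo (0 : ℝ) 1, Continuous (𝓕 (regSymbol (multSymbol ρ t))) := fun t =>
    continuous_fourier (integrable_regSymbol (h.bddSmooth_multSymbol t.2))
  have hker : ∀ (t : Set.Ioo (0 : ℝ) 1) (b : ℝ) (P : ℕ) (z : E n), 0 ≤ b → 
      ‖𝓕 (regSymbol (multSymbol ρ t)) z‖ * (b * (1 + ‖z‖)) ^ P ≤
        b ^ P * D (P + (n + 1)) * ((1 + ‖z‖) ^ (n + 1))⁻¹ := by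
    intro t b P z hb
    have h1 := hD (P + (n + 1)) t z
    have h2 : 0 < (1 + ‖z‖) ^ (n + 1) := by positivity
    rw [← div_eq_mul_inv, le_div_iff₀ h2, mul_pow]
    calc _ = b ^ P * ((1 + ‖z‖) ^ (P + (n + 1)) * ‖𝓕 (regSymbol (multSymbol ρ t)) z‖) := by
          rw [pow_add]; ring
      _ ≤ _ := mul_le_mul_of_nonneg_left (by simpa using h1) (pow_nonneg hb _)
  have hts : ∀ t : Set.Ioo (0 : ℝ) 1, HasFTaylorSeriesUpToOn ∞
      (fun q => ∫ z, 𝓕 (regSymbol (multSymbol ρ t)) z * besselAmp φ a t (q, z))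
      (fun q k => ∫ z, 𝓕 (regSymbol (multSymbol ρ t)) z •
        iteratedFDeriv ℝ k (fun q => besselAmp φ a t (q, z)) q) Set.univ := by
    intro t
    refine hasFTaylorSeriesUpToOn_integral_mul (f := fun z q => besselAmp φ a t (q, z))
      (hcont t).aestronglyMeasurable ?_ fun k p => ?_
    · exact (contDiff_of_germBound (q := fun t : Set.Ioo (0 : ℝ) 1 => besselAmp φ a t)
        h.germ_besselAmp t).comp (f := fun y : E n × (E n × E n) => (y.2, y.1)) (by fun_prop)
    -- While `⟨ξ⟩` grows by less than one the bound is uniform, and the decay of the kernel absorbs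
    -- the powers of `1 + ‖z‖`.
    · refine ⟨{q | bracket q.2 < bracket p.2 + 1}, ?_, fun z =>
        C k * ((bracket p.2 + 1) * (1 + ‖z‖)) ^ (2 * (n + 1) + k), ?_, fun z q hq => ?_⟩
      · exact (isOpen_lt (continuous_bracket.comp continuous_snd) continuous_const).mem_nhds
          (by simp)
      · refine ((integrable_one_add_norm_inv (n := n)).const_mul (C k * ((bracket p.2 + 1) ^ (2 * (n + 1) + k)
          * D (2 * (n + 1) + k + (n + 1))))).mono' ?_ (Filter.Eventually.of_forall fun z => ?_)
        · exact ((hcont t).norm.mul (by fun_prop)).aestronglyMeasurable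
        · have h0 := bracket_pos p.2
          have := hker t (bracket p.2 + 1) (2 * (n + 1) + k) z (by positivity)
          have := hC0 k
          rw [Real.norm_of_nonneg (by positivity)]
          calc _ = C k * (‖𝓕 (regSymbol (multSymbol ρ t)) z‖ *
                ((bracket p.2 + 1) * (1 + ‖z‖)) ^ (2 * (n + 1) + k)) := by ring
            _ ≤ _ := mul_le_mul_of_nonneg_left ‹_› (hC0 k)
            _ = _ := by ring
      · refine (hC k t q z).trans (mul_le_mul_of_nonneg_left ?_ (hC0 k))
        have h0 := bracket_pos q.2
        have h1 : bracket q.2 < bracket p.2 + 1 := hq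
        gcongr
  have heq : ∀ t : Set.Ioo (0 : ℝ) 1, (fun q : E n × E n => compAmp φ a ρ t q.1 q.2) =
      fun q => ∫ z, 𝓕 (regSymbol (multSymbol ρ t)) z * besselAmp φ a t (q, z) := fun t => by
    ext q
    exact compAmp_eq_integral h t.2 q.1 q.2
  refine ⟨fun p => ?_, fun k => ⟨C k * D (2 * (n + 1) + k + (n + 1)) *
    ∫ z : E n, ((1 + ‖z‖) ^ (n + 1))⁻¹, fun p => ?_⟩⟩
  · beta_reduce
    rw [heq p.1]
    exact (hts p.1).contDiffAt_infty isOpen_univ (Set.mem_univ _)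
  · beta_reduce
    rw [heq p.1, (hts p.1).iteratedFDeriv_eq isOpen_univ (Set.mem_univ _) k]
    have hbd := bracket_pos p.2.2
    refine (norm_integral_le_of_norm_le ((integrable_one_add_norm_inv (n := n)).const_mul
      (C k * (bracket p.2.2 ^ (2 * (n + 1) + k) * D (2 * (n + 1) + k + (n + 1)))))
      (Filter.Eventually.of_forall fun z => ?_)).trans (le_of_eq ?_)
    · rw [norm_smul]
      have h1 := hker p.1 (bracket p.2.2) (2 * (n + 1) + k) z hbd.le
      calc _ ≤ ‖𝓕 (regSymbol (multSymbol ρ p.1)) z‖ *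
            (C k * (bracket p.2.2 * (1 + ‖z‖)) ^ (2 * (n + 1) + k)) :=
            mul_le_mul_of_nonneg_left (hC k p.1 p.2 z) (norm_nonneg _)
        _ = C k * (‖𝓕 (regSymbol (multSymbol ρ p.1)) z‖ *
            (bracket p.2.2 * (1 + ‖z‖)) ^ (2 * (n + 1) + k)) := by ring
        _ ≤ _ := mul_le_mul_of_nonneg_left h1 (hC0 k)
        _ = _ := by ring
    · rw [integral_const_mul, pow_add]
      ring

end Sigma
end FourierIntOp
end

noncomputable section
namespace FourierIntOp

open MeasureTheory FourierTransform

/-! ### Estimates for Taylor remainders of the pairing. -/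

section Remainders

variable {n : ℕ} {ι : Type*}

theorem fourier_char_mul (g : E n → ℂ) (θ w : E n) :
    𝓕 (fun z => Complex.exp (Complex.I * (inner ℝ ((2 * Real.pi) • θ) z : ℝ)) * g z) w =
      𝓕 g (w - θ) := by
  rw [Real.fourier_eq, Real.fourier_eq]
  congr 1
  ext z
  rw [Circle.smul_def, Circle.smul_def, Real.fourierChar_apply, Real.fourierChar_apply, smul_eq_mul,
    smul_eq_mul, ← mul_assoc, ← Complex.exp_add, inner_sub_right, real_inner_smul_left,
    real_inner_comm z θ]
  congr 2
  push_cast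
  ring

/-- This is how the linear part of the phase becomes a translation of the multiplier. -/
theorem integral_mul_fourier_char_mul (q g : E n → ℂ) (θ : E n) :
    ∫ w, q w * 𝓕 (fun z => Complex.exp (Complex.I * (inner ℝ ((2 * Real.pi) • θ) z : ℝ)) * g z) w =
      ∫ w, q (θ + w) * 𝓕 g w := by
  rw [← integral_add_left_eq_self _ θ]
  congr 1
  ext w
  rw [fourier_char_mul, add_sub_cancel_left]

/-- The Taylor polynomial of `q` at `0`, as a functional on the Fourier transform of `g`. -/
def taylorSum (N : ℕ) (q g : E n → ℂ) : ℂ :=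
  ∑ k ∈ Finset.range N, ((k.factorial : ℝ) : ℂ)⁻¹ * ∑ r : Fin k → Fin n,
    (2 * Real.pi * Complex.I)⁻¹ ^ k * (dirDerivs (dirs r) q 0 * dirDerivs (dirs r) g 0)

theorem GermBound.bddSmooth {A B : ι → ℝ} {q : ι → E n → ℂ} (hB : ∀ p, 0 ≤ B p) (hA : ∀ p, 0 ≤ A p)
    (hq : GermBound (fun p : ι × E n => p.2) (fun p => B p.1) (fun p => A p.1) (fun p => q p.1))
    (p : ι) : BddSmooth (q p) :=
  (hq.reindex (fun w : E n => (p, w))).mono (fun _ => hB p) (fun _ => hA p) (A p) (B p)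
    (fun _ => (mul_one _).ge) (fun _ => (mul_one _).ge)

theorem _root_.HasCompactSupport.dirDerivs {V F : Type*} [NormedAddCommGroup V] [NormedSpace ℝ V]
    [NormedAddCommGroup F] [NormedSpace ℝ F] {g : V → F} (hg : HasCompactSupport g) (l : List V) :
    HasCompactSupport (dirDerivs l g) := by
  induction l with
  | nil => exact hg
  | cons v l ih => exact HasCompactSupport.fderiv_apply ℝ ih v

/-- The remainder pairs functions of size `σ^{N+1}` with derivatives of size `R^{N+1}`, up to
polynomial growth. By `norm_integral_mul_fourier_le` every order gains `σR`, against the loss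
`S^{2(n+1)}`, whose exponent is independent of `N`. -/
theorem norm_integral_sub_taylorSum_le {Λ σ R S : ι → ℝ} {q g : ι → E n → ℂ} (hΛ : ∀ p, 0 < Λ p)
    (hσ : ∀ p, 0 ≤ σ p) (hσΛ : ∀ p, σ p ≤ (Λ p)⁻¹) (hS : ∀ p, 1 ≤ S p) (hR : ∀ p, 0 ≤ R p)
    (hRS : ∀ p, R p ≤ S p * Λ p) (P' : ℕ)
    (hq : GermBound (fun p : ι × E n => p.2) (fun p => σ p.1) (fun _ => 1) (fun p => q p.1))
    (hg : GermBound (fun p : ι × E n => p.2) (fun p => R p.1 * (1 + Λ p.1 * ‖p.2‖) ^ P')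
      (fun _ => 1) (fun p => g p.1))
    (hs : ∀ p, HasCompactSupport (g p)) (N : ℕ) :
    ∃ C : ℝ, 0 ≤ C ∧ ∀ p, ‖(∫ w, q p w * 𝓕 (g p) w) - taylorSum (N + 1) (q p) (g p)‖ ≤
      C * ((σ p * R p) ^ (N + 1) * S p ^ (2 * (n + 1))) := by
  have hpos : ∀ p : ι × E n, 0 ≤ R p.1 * (1 + Λ p.1 * ‖p.2‖) ^ P' := fun p => by
    have := hR p.1; have := hΛ p.1; positivity
  have hc : ∀ p, ContDiff ℝ ∞ (g p) := fun p => contDiff_of_germBound (q := g) hg p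
  have hterm : ∀ r : Fin (N + 1) → Fin n, ∃ C : ℝ, 0 ≤ C ∧ ∀ p,
      ‖∫ w, taylorRem N r (q p) w * 𝓕 (dirDerivs (dirs r) (g p)) w‖ ≤
        C * (σ p ^ (N + 1) * R p ^ (N + 1) * S p ^ (2 * (n + 1))) := by
    intro r
    refine norm_integral_mul_fourier_le (Λ := Λ) (A := fun p => σ p ^ (N + 1))
      (B := fun p => R p ^ (N + 1)) (S := S) hΛ (fun p => pow_nonneg (hσ p) _)
      (fun p => pow_nonneg (hR p) _) hS (P' * (N + 1)) P' ?_ ?_ (fun p => ?_)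
    · refine (GermBound.taylorRem (W := fun _ => 1) hσ (by simp) hq N r).mono (fun p => hσ _)
        (fun p => mul_nonneg zero_le_one (pow_nonneg (hσ _) _)) 1 1 (fun p => by simp)
        (fun p => by simpa using hσΛ p.1)
    · refine (hg.dirDerivs hpos (by simp) (dirs r)).mono hpos (fun p => ?_) 1 1 (fun p => ?_)
        (fun p => ?_)
      · have := hpos p; positivity
      · rw [length_dirs, one_mul, one_mul, mul_pow, ← pow_mul]
      · rw [one_mul]
        have := hΛ p.1
        exact mul_le_mul_of_nonneg_right (hRS p.1) (by positivity)
    · exact (hs p).dirDerivs _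
  choose C hC0 hC using hterm
  refine ⟨∑ r, ‖(2 * Real.pi * Complex.I : ℂ)⁻¹ ^ (N + 1)‖ * C r,
    Finset.sum_nonneg fun r _ => by have := hC0 r; positivity, fun p => ?_⟩
  have h1 := integral_mul_fourier_taylor (GermBound.bddSmooth (A := fun _ => 1) hσ (fun _ => zero_le_one) hq p) ((hs p).toSchwartzMap (hc p)) N
  have h2 : (∫ w, q p w * 𝓕 (g p) w) - taylorSum (N + 1) (q p) (g p) =
      ∑ r : Fin (N + 1) → Fin n, (2 * Real.pi * Complex.I)⁻¹ ^ (N + 1) *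
        ∫ w, taylorRem N r (q p) w * 𝓕 (dirDerivs (dirs r) (g p)) w := by
    rw [taylorSum, sub_eq_iff_eq_add']
    exact h1
  rw [h2, Finset.sum_mul]
  refine (norm_sum_le _ _).trans (Finset.sum_le_sum fun r _ => ?_)
  have h3 := mul_le_mul_of_nonneg_left (hC r p)
    (norm_nonneg ((2 * Real.pi * Complex.I : ℂ)⁻¹ ^ (N + 1)))
  rw [norm_mul]
  refine h3.trans (le_of_eq ?_)
  rw [mul_pow (σ p)]
  ring

theorem GermBound.inv_real {V : Type*} [NormedAddCommGroup V] [NormedSpace ℝ V] {z : ι → V}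
    {s : ι → ℝ} {f : ι → V → ℝ} (hf : GermBound z s (fun _ => 1) f) (hs : ∀ p, 0 ≤ s p) {c : ℝ}
    (hc : 0 < c) (hfc : ∀ p, c ≤ f p (z p)) :
    GermBound z s (fun _ => 1) (fun p y => (f p y)⁻¹) := by
  refine GermBound.comp (g := fun (_ : ι) (x : ℝ) => (x : ℝ)⁻¹) (W := fun _ => 1) ?_ hf.1 hs (by simp)
    (fun i _ => hf.higher i (by simp) (by simp) hs)
  have h0 : ∀ p, 0 < f p (z p) := fun p => hc.trans_le (hfc p)
  refine ⟨fun p => contDiffAt_inv ℝ (h0 p).ne', fun i => ?_⟩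
  refine ⟨i.factorial * (c⁻¹) ^ (i + 1), fun p => ?_⟩
  have e : ‖iteratedDeriv i (fun x : ℝ => x⁻¹) (f p (z p))‖ =
      i.factorial * ((f p (z p))⁻¹) ^ (i + 1) := by
    rw [iteratedDeriv_eq_iterate, iter_deriv_inv']
    have : (f p (z p)) ^ (-1 - (i : ℤ)) = ((f p (z p))⁻¹) ^ (i + 1) := by
      rw [inv_pow, ← zpow_natCast, ← zpow_neg]
      congr 1
      push_cast
      ring
    beta_reduce
    rw [this, norm_mul, norm_mul, norm_pow, norm_neg, norm_one, one_pow, one_mul, Real.norm_natCast,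
      Real.norm_of_nonneg (by have := h0 p; positivity)]
  rw [norm_iteratedFDeriv_eq_norm_iteratedDeriv, e, one_pow, mul_one, mul_one]
  have := h0 p
  gcongr
  exact hfc p

theorem integrable_mul_fourier {q : E n → ℂ} (hq : BddSmooth q) (g : 𝓢(E n, ℂ)) :
    Integrable (fun w => q w * 𝓕 (g : E n → ℂ) w) := by
  obtain ⟨C, hC⟩ := hq.exists_norm_le
  have := (𝓕 g).integrable (μ := volume)
  rw [SchwartzMap.fourier_coe] at this
  exact this.bdd_mul hq.contDiff.continuous.aestronglyMeasurable (Filter.Eventually.of_forall hC)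

theorem fourier_dirDeriv_basisVec {g : E n → ℂ} (hg : ContDiff ℝ ∞ g) (hs : HasCompactSupport g)
    (j : Fin n) (w : E n) :
    𝓕 (dirDeriv (basisVec j) g) w = (2 * Real.pi * Complex.I) * (w j : ℂ) * 𝓕 g w := by
  have h := fourier_lineDerivs (fun _ : Fin 1 => j) (hs.toSchwartzMap hg) w
  simp only [pow_one, Finset.univ_unique, Finset.prod_singleton] at h
  rw [SchwartzMap.fourier_coe, SchwartzMap.fourier_coe, coe_lineDerivs] at h
  simpa [dirs] using! h

end Remainders
end FourierIntOp
end

noncomputable section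
namespace FourierIntOp

open MeasureTheory FourierTransform

/-! ### Nonstationary phase for multipliers concentrated at low frequency. -/

section NonstationaryPhase

variable {n : ℕ} {ι : Type*}

/-- Families of smooth functions concentrated in the balls of radius `Λ p`. -/
def RapidFamily (Λ : ι → ℝ) (q : ι → E n → ℂ) : Prop :=
  ∀ M : ℕ, GermBound (fun p : ι × E n => p.2) (fun _ => 1)
    (fun p => ((1 + ‖p.2‖ / Λ p.1) ^ M)⁻¹) (fun p => q p.1)

/-- One of `M + 1` powers of decay pays for `|w_j|/Λ`; the lower bound on `Λ` keeps the derivative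
of the linear factor bounded. -/
theorem RapidFamily.mul_coord {Λ : ι → ℝ} {q : ι → E n → ℂ} (hq : RapidFamily Λ q) {c : ℝ}
    (hc : 0 < c) (hΛ : ∀ p, c ≤ Λ p) (j : Fin n) :
    RapidFamily Λ (fun p w => q p w * ((w j / Λ p : ℝ) : ℂ)) := by
  intro M
  have h0 : ∀ p, 0 < Λ p := fun p => hc.trans_le (hΛ p)
  have hW : ∀ (M : ℕ) (p : ι × E n), 0 ≤ ((1 + ‖p.2‖ / Λ p.1) ^ M)⁻¹ := fun M p => by
    have := h0 p.1; positivity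
  have h1 := GermBound.clm (z := fun p : ι × E n => p.2) (s := fun _ => 1)
    (W := fun p => 1 + ‖p.2‖ / Λ p.1)
    (fun p => (Λ p.1)⁻¹ • (Complex.ofRealCLM.comp (EuclideanSpace.proj j : E n →L[ℝ] ℝ))) (by simp)
    (fun p => by have := h0 p.1; positivity) (1 + c⁻¹) (fun p => ?_) (fun p => ?_)
  · refine ((hq (M + 1)).mul h1 (by simp) (hW _) (fun p => by have := h0 p.1; positivity)).congr
      (fun p => Filter.Eventually.of_forall fun w => ?_) |>.mono (by simp) (fun p => ?_) 1 1 (fun p => ?_)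
      (by simp)
    · simp [div_eq_inv_mul]
    · have := hW (M + 1) p
      have := h0 p.1
      positivity
    · have : (1 + ‖p.2‖ / Λ p.1) ≠ 0 := by have := h0 p.1; positivity
      rw [pow_succ, mul_inv, one_mul, inv_mul_cancel_right₀ this]
  · have h2 := h0 p.1
    have h3 : ‖p.2 j‖ ≤ ‖p.2‖ := PiLp.norm_apply_le p.2 j
    have h4 : ‖((Λ p.1)⁻¹ • (Complex.ofRealCLM.comp (EuclideanSpace.proj j : E n →L[ℝ] ℝ))) p.2‖ =
        ‖p.2 j‖ / Λ p.1 := by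
      simp [abs_of_pos h2, div_eq_inv_mul]
    rw [h4]
    calc ‖p.2 j‖ / Λ p.1 ≤ ‖p.2‖ / Λ p.1 := by gcongr
      _ ≤ 1 * (1 + ‖p.2‖ / Λ p.1) := by linarith
      _ ≤ _ := by gcongr; simp [hc.le]
  · have h2 := h0 p.1
    have h3 : ‖Complex.ofRealCLM.comp (EuclideanSpace.proj j : E n →L[ℝ] ℝ)‖ ≤ 1 :=
      ContinuousLinearMap.opNorm_le_bound _ zero_le_one fun w => by
        simpa using PiLp.norm_apply_le w j
    have h4 : (Λ p.1)⁻¹ ≤ c⁻¹ := inv_anti₀ hc (hΛ p.1)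
    rw [norm_smul, Real.norm_of_nonneg (inv_nonneg.2 h2.le), mul_one]
    calc (Λ p.1)⁻¹ * _ ≤ (Λ p.1)⁻¹ * 1 := by gcongr
      _ ≤ 1 + c⁻¹ := by linarith
      _ ≤ _ := le_mul_of_one_le_right (by positivity) (by simp; positivity)

theorem mul_dirDeriv_sub {f e : E n → ℂ} (hf : ContDiff ℝ ∞ f) (he : ContDiff ℝ ∞ e) (v z : E n) :
    f z * dirDeriv v e z = dirDeriv v (fun y => f y * e y) z - dirDeriv v f z * e z := by
  simp only [dirDeriv]
  rw [fderiv_fun_mul (hf.differentiable (by simp) z) (he.differentiable (by simp) z)]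
  simp
  ring

/-- By the product rule `lam f e` is the sum of `∂_j(f v_j e) - ∂_j(f v_j) e`, and the first
derivative becomes a factor `2πi w_j` on the Fourier side. -/
theorem fourier_mul_exp_eq {f e : E n → ℂ} {v : Fin n → E n → ℂ} {lam : ℝ} (hf : ContDiff ℝ ∞ f)
    (hs : HasCompactSupport f) (he : ContDiff ℝ ∞ e) (hv : ∀ j, ContDiff ℝ ∞ (v j))
    (hev : ∀ z, (lam : ℂ) * e z = ∑ j, v j z * dirDeriv (basisVec j) e z) (w : E n) :
    (lam : ℂ) * 𝓕 (fun z => f z * e z) w =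
      ∑ j, ((2 * Real.pi * Complex.I) * (w j : ℂ) * 𝓕 (fun z => f z * v j z * e z) w -
        𝓕 (fun z => dirDeriv (basisVec j) (fun y => f y * v j y) z * e z) w) := by
  have hfv : ∀ j, ContDiff ℝ ∞ (fun y => f y * v j y) := fun j => hf.mul (hv j)
  have hsv : ∀ j, HasCompactSupport (fun y => f y * v j y) := fun j => hs.mul_right
  have hfe : ∀ j, ContDiff ℝ ∞ (fun y => f y * v j y * e y) := fun j => (hfv j).mul he
  have hse : ∀ j, HasCompactSupport (fun y => f y * v j y * e y) := fun j => (hsv j).mul_right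
  have hd1 : ∀ j, ContDiff ℝ ∞ (dirDeriv (basisVec j) (fun y => f y * v j y * e y)) := fun j =>
    contDiff_dirDeriv (hfe j) _
  have hd2 : ∀ j, ContDiff ℝ ∞ (fun z => dirDeriv (basisVec j) (fun y => f y * v j y) z * e z) := fun j =>
    (contDiff_dirDeriv (hfv j) _).mul he
  have hs1 : ∀ j, HasCompactSupport (dirDeriv (basisVec j) (fun y => f y * v j y * e y)) := fun j =>
    (hse j).dirDerivs [basisVec j]
  have hs2 : ∀ j, HasCompactSupport
      (fun z => dirDeriv (basisVec j) (fun y => f y * v j y) z * e z) := fun j =>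
    HasCompactSupport.mul_right ((hsv j).dirDerivs [basisVec j])
  have key : ∀ z, (lam : ℂ) * (f z * e z) = ∑ j,
      (dirDeriv (basisVec j) (fun y => f y * v j y * e y) z -
        dirDeriv (basisVec j) (fun y => f y * v j y) z * e z) := fun z => by
    rw [mul_left_comm, hev, Finset.mul_sum]
    refine Finset.sum_congr rfl fun j _ => ?_
    rw [← mul_dirDeriv_sub (hfv j) he]
    ring
  have hint : ∀ (g : E n → ℂ), ContDiff ℝ ∞ g → HasCompactSupport g →
      Integrable (fun z => Real.fourierChar (-inner ℝ z w) • g z) := fun g h1 h2 => by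
    have := (Real.fourierIntegral_convergent_iff (V := E n) (f := g) (μ := volume) w).2
      (h1.continuous.integrable_of_hasCompactSupport h2)
    exact this
  simp_rw [← fourier_dirDeriv_basisVec (hfe _) (hse _)]
  simp only [Real.fourier_eq]
  rw [← integral_const_mul]
  simp_rw [← integral_sub (hint _ (hd1 _) (hs1 _)) (hint _ (hd2 _) (hs2 _))]
  refine Eq.trans ?_ (integral_finsetSum _ fun j _ =>
    (hint _ (hd1 j) (hs1 j)).sub (hint _ (hd2 j) (hs2 j)))
  congr 1
  ext z
  simp only [Circle.smul_def, smul_eq_mul]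
  rw [mul_left_comm, key, Finset.mul_sum]
  refine Finset.sum_congr rfl fun j _ => ?_
  ring

/-- An integration by parts trades a factor `lam` either for a frequency `w_j`, of size `Λ` on `q`,
or for a derivative of the amplitude, of size one. Both are at most `κ lam` up to constants, so each
step gains `κ`. The induction runs over all `q` and `A`, since both change at each step. -/
theorem norm_integral_mul_fourier_exp_le {Λ lam κ : ι → ℝ} {c : ℝ} (hc : 0 < c) (hΛ : ∀ p, c ≤ Λ p)
    (hlam : ∀ p, 1 ≤ lam p) (hκ : ∀ p, Λ p ≤ κ p * lam p) (hκ1 : ∀ p, 1 ≤ κ p * lam p)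
    {e : ι → E n → ℂ}
    (he : GermBound (fun p : ι × E n => p.2) (fun p => lam p.1) (fun _ => 1) (fun p => e p.1))
    {v : ι → Fin n → E n → ℂ}
    (hv : ∀ j, GermBound (fun p : ι × E n => p.2) (fun _ => 1) (fun _ => 1) (fun p => v p.1 j))
    (hev : ∀ p z, (lam p : ℂ) * e p z = ∑ j, v p j z * dirDeriv (basisVec j) (e p) z) (K : ℕ)
    {q A : ι → E n → ℂ} (hq : RapidFamily Λ q)
    (hA : GermBound (fun p : ι × E n => p.2) (fun _ => 1) (fun _ => 1) (fun p => A p.1))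
    (hs : ∀ p, HasCompactSupport (A p)) :
    ∃ C : ℝ, 0 ≤ C ∧ ∀ p, ‖∫ w, q p w * 𝓕 (fun z => A p z * e p z) w‖ ≤
      C * (κ p ^ K * lam p ^ (2 * (n + 1))) := by
  have hl0 : ∀ p, 0 < lam p := fun p => zero_lt_one.trans_le (hlam p)
  induction K generalizing q A with
  | zero =>
    obtain ⟨C, hC0, hC⟩ := norm_integral_mul_fourier_le (Λ := fun _ : ι => 1) (A := fun _ => 1)
      (B := fun _ => 1) (S := lam) (q := q) (g := fun p z => A p z * e p z) (by simp) (by simp) (by simp)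
      hlam 0 0 (by simpa using! hq 0)
      (by
        have h1 : GermBound (fun p : ι × E n => p.2) (fun p => lam p.1) (fun _ => 1) (fun p => A p.1) :=
          hA.mono (by simp) (by simp) 1 1 (by simp) (fun p => by simpa using hlam p.1)
        simpa using! h1.mul he (fun p => (hl0 _).le) (by simp) (by simp))
      (fun p => (hs p).mul_right)
    exact ⟨C, hC0, fun p => by simpa using hC p⟩
  | succ K ih =>
    have hAc := contDiff_of_germBound (q := A) hA
    have hec := contDiff_of_germBound (q := e) he
    have hvc := fun j => contDiff_of_germBound (q := fun p => v p j) (hv j)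
    have hAv := fun j => hA.mul (hv j) (by simp) (by simp) (by simp)
    have hAv' : ∀ j, GermBound (fun p : ι × E n => p.2) (fun _ => 1) (fun _ => 1)
        (fun p z => A p.1 z * v p.1 j z) := fun j => by simpa using! hAv j
    have hd : ∀ j, GermBound (fun p : ι × E n => p.2) (fun _ => 1) (fun _ => 1)
        (fun p => dirDeriv (basisVec j) (fun z => A p.1 z * v p.1 j z)) := fun j => by
      simpa using! (hAv' j).dirDeriv (basisVec j) (by simp) (by simp)
    have h1 := fun j => ih (hq.mul_coord hc hΛ j) (A := fun p z => A p z * v p j z) (hAv' j)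
      (fun p => (hs p).mul_right)
    have h2 := fun j => ih hq (A := fun p => dirDeriv (basisVec j) (fun z => A p z * v p j z)) (hd j)
      (fun p => HasCompactSupport.dirDerivs (hs p).mul_right [basisVec j])
    choose C hC0 hC using h1
    choose D hD0 hD using h2
    refine ⟨∑ j, (2 * Real.pi * C j + D j), Finset.sum_nonneg fun j _ => ?_, fun p => ?_⟩
    · have := hC0 j; have := hD0 j; have := Real.pi_pos; positivity
    have hΛ0 : 0 < Λ p := hc.trans_le (hΛ p)
    have hqb : BddSmooth (q p) := by
      have := (hq 0).reindex (fun w : E n => (p, w))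
      simpa using! this
    have hint : ∀ g : E n → ℂ, ContDiff ℝ ∞ g → HasCompactSupport g →
        Integrable (fun w => q p w * 𝓕 g w) := fun g hg hgs =>
      integrable_mul_fourier hqb (hgs.toSchwartzMap hg)
    have hqb' : ∀ j, BddSmooth (fun w => q p w * ((w j / Λ p : ℝ) : ℂ)) := fun j => by
      have := (hq.mul_coord hc hΛ j 0).reindex (fun w : E n => (p, w))
      simpa using! this
    have hint' : ∀ j, ∀ g : E n → ℂ, ContDiff ℝ ∞ g → HasCompactSupport g →
        Integrable (fun w => q p w * ((w j / Λ p : ℝ) : ℂ) * 𝓕 g w) := fun j g hg hgs =>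
      integrable_mul_fourier (hqb' j) (hgs.toSchwartzMap hg)
    have c1 : ∀ j, ContDiff ℝ ∞ (fun z => A p z * v p j z * e p z) := fun j =>
      ((hAc p).mul (hvc j p)).mul (hec p)
    have s1 : ∀ j, HasCompactSupport (fun z => A p z * v p j z * e p z) := fun j =>
      HasCompactSupport.mul_right (hs p).mul_right
    have c2 : ∀ j, ContDiff ℝ ∞
        (fun z => dirDeriv (basisVec j) (fun y => A p y * v p j y) z * e p z) := fun j =>
      (contDiff_dirDeriv ((hAc p).mul (hvc j p)) _).mul (hec p)
    have s2 : ∀ j, HasCompactSupport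
        (fun z => dirDeriv (basisVec j) (fun y => A p y * v p j y) z * e p z) := fun j =>
      HasCompactSupport.mul_right (HasCompactSupport.dirDerivs (hs p).mul_right [basisVec j])
    have key : (lam p : ℂ) * ∫ w, q p w * 𝓕 (fun z => A p z * e p z) w =
        ∑ j, ((2 * Real.pi * Complex.I * (Λ p : ℂ)) *
          (∫ w, q p w * ((w j / Λ p : ℝ) : ℂ) * 𝓕 (fun z => A p z * v p j z * e p z) w) -
          ∫ w, q p w * 𝓕 (fun z => dirDeriv (basisVec j) (fun y => A p y * v p j y) z * e p z) w) := by
      rw [← integral_const_mul]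
      simp_rw [← integral_const_mul]
      have hsub : ∀ j, (∫ w, 2 * Real.pi * Complex.I * (Λ p : ℂ) * (q p w * ((w j / Λ p : ℝ) : ℂ) *
            𝓕 (fun z => A p z * v p j z * e p z) w)) -
          ∫ w, q p w * 𝓕 (fun z => dirDeriv (basisVec j) (fun y => A p y * v p j y) z * e p z) w =
          ∫ w, (2 * Real.pi * Complex.I * (Λ p : ℂ) * (q p w * ((w j / Λ p : ℝ) : ℂ) *
            𝓕 (fun z => A p z * v p j z * e p z) w) -
          q p w * 𝓕 (fun z => dirDeriv (basisVec j) (fun y => A p y * v p j y) z * e p z) w) := fun j =>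
        (integral_sub ((hint' j _ (c1 j) (s1 j)).const_mul _) (hint _ (c2 j) (s2 j))).symm
      simp_rw [hsub]
      refine Eq.trans ?_ (integral_finsetSum _ fun j _ =>
        ((hint' j _ (c1 j) (s1 j)).const_mul _).sub (hint _ (c2 j) (s2 j)))
      congr 1
      ext w
      rw [mul_left_comm, fourier_mul_exp_eq (hAc p) (hs p) (hec p) (fun j => hvc j p) (hev p) w,
        Finset.mul_sum]
      refine Finset.sum_congr rfl fun j _ => ?_
      have : (Λ p : ℂ) ≠ 0 := by exact_mod_cast hΛ0.ne'
      push_cast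
      field_simp
    have hκ0 : 0 ≤ κ p := by
      by_contra! h
      nlinarith [hκ1 p, hl0 p]
    set X := κ p ^ K * lam p ^ (2 * (n + 1)) with hX
    have hX0 : 0 ≤ X := by have := hl0 p; positivity
    have h3 : lam p * ‖∫ w, q p w * 𝓕 (fun z => A p z * e p z) w‖ ≤
        lam p * ((∑ j, (2 * Real.pi * C j + D j)) * (κ p * X)) := by
      have h4 : lam p * ‖∫ w, q p w * 𝓕 (fun z => A p z * e p z) w‖ =
          ‖(lam p : ℂ) * ∫ w, q p w * 𝓕 (fun z => A p z * e p z) w‖ := by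
        rw [norm_mul, Complex.norm_real, Real.norm_of_nonneg (hl0 p).le]
      rw [h4, key, Finset.sum_mul, Finset.mul_sum]
      refine (norm_sum_le _ _).trans (Finset.sum_le_sum fun j _ => (norm_sub_le _ _).trans ?_)
      have h5 : ‖(2 * Real.pi * Complex.I * (Λ p : ℂ))‖ = 2 * Real.pi * Λ p := by
        rw [norm_mul, norm_mul, norm_mul, Complex.norm_I, Complex.norm_real, Complex.norm_real,
          Real.norm_of_nonneg hΛ0.le, Real.norm_of_nonneg Real.pi_pos.le]
        simp
      rw [norm_mul, h5]
      have h6 := hC j p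
      have h7 := hD j p
      have := hC0 j
      have := hD0 j
      have := Real.pi_pos
      calc _ ≤ 2 * Real.pi * Λ p * (C j * X) + D j * X := by gcongr
        _ ≤ 2 * Real.pi * (κ p * lam p) * (C j * X) + (κ p * lam p) * (D j * X) := by
            refine add_le_add ?_ (le_mul_of_one_le_left (by positivity) (hκ1 p))
            exact mul_le_mul_of_nonneg_right (mul_le_mul_of_nonneg_left (hκ p) (by positivity))
              (by positivity)
        _ = _ := by ring
    have h8 := le_of_mul_le_mul_left h3 (hl0 p)
    rw [pow_succ']
    calc _ ≤ _ := h8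
      _ = _ := by rw [hX]; ring

end NonstationaryPhase
end FourierIntOp
end

noncomputable section
namespace FourierIntOp

open MeasureTheory FourierTransform

/-! ### Splitting of the multiplier, and the vector field adapted to the phase. -/

section Localization

variable {n : ℕ} {m : ℝ} {a : ℝ → E n → E n → ℂ} {ρ : E n → ℂ} {φ : E n → E n → ℝ} {ι : Type*}

theorem germBound_cutoff (M : ℕ) : GermBound (fun w : E n => w) (fun _ => 1)
    (fun w => ((1 + ‖w‖) ^ M)⁻¹) (fun _ => (cutoff : E n → ℂ)) := by
  have h1 := germBound_of_hasCompactSupport (contDiff_cutoff (n := n)) hasCompactSupport_cutoff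
  refine GermBound.extend (S := {w | ‖w‖ ≤ 2}) ?_ (fun w hw => ?_) (by simp) (fun w => by positivity)
  · refine (h1.reindex (fun w : {w : E n | ‖w‖ ≤ 2} => (w : E n))).mono (by simp) (by simp) (3 ^ M) 1
      (fun w => ?_) (by simp)
    have : ‖(w : E n)‖ ≤ 2 := w.2
    simp only [Function.comp_apply]
    rw [← div_eq_mul_inv, one_le_div (by positivity)]
    gcongr
    linarith
  · have h2 : 2 < ‖w‖ := not_le.1 hw
    filter_upwards [continuousAt_const.eventually_lt continuous_norm.continuousAt h2] with y hy
    exact cutoff_eq_zero hy.le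

theorem germBound_cutoff_inv_smul {Λ : ι → ℝ} (hΛ : ∀ p, 0 < Λ p) (M : ℕ) :
    GermBound (fun p : ι × E n => p.2) (fun p => (Λ p.1)⁻¹) (fun p => ((1 + ‖p.2‖ / Λ p.1) ^ M)⁻¹)
      (fun p w => cutoff ((Λ p.1)⁻¹ • w)) := by
  have h1 := (germBound_cutoff (n := n) M).reindex (fun p : ι × E n => (Λ p.1)⁻¹ • p.2)
  have h2 := GermBound.comp_affine (z := fun p : ι × E n => p.2) (fun _ => 0)
    (fun p => (Λ p.1)⁻¹ • ContinuousLinearMap.id ℝ (E n)) (f := fun _ => (cutoff : E n → ℂ)) (by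
      convert! h1 using 2 with p
      simp)
  have h0 : ∀ p : ι × E n, ‖(Λ p.1)⁻¹ • p.2‖ = ‖p.2‖ / Λ p.1 := fun p => by
    rw [norm_smul, Real.norm_of_nonneg (inv_nonneg.2 (hΛ _).le), div_eq_inv_mul]
  refine (h2.congr fun p => Filter.Eventually.of_forall fun w => ?_).mono (fun p => ?_) (fun p => ?_)
    1 1 (fun p => ?_) (fun p => ?_)
  · simp
  · simp only [Function.comp_apply]; positivity
  · simp only [Function.comp_apply]; positivity
  · simp only [Function.comp_apply, h0, one_mul, le_refl]
  · simp only [Function.comp_apply, one_mul]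
    rw [norm_smul, Real.norm_of_nonneg (inv_nonneg.2 (hΛ _).le)]
    exact mul_le_of_le_one_right (inv_nonneg.2 (hΛ _).le) ContinuousLinearMap.norm_id_le

/-- The low frequency part of the multiplier. -/
def lowSymbol (ρ : E n → ℂ) (t Λ : ℝ) (w : E n) : ℂ := multSymbol ρ t w * cutoff (Λ⁻¹ • w)

/-- The high frequency part of the multiplier. -/
def highSymbol (ρ : E n → ℂ) (t Λ : ℝ) (w : E n) : ℂ := multSymbol ρ t w * (1 - cutoff (Λ⁻¹ • w))

theorem lowSymbol_add_highSymbol (t Λ : ℝ) (w : E n) :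
    lowSymbol ρ t Λ w + highSymbol ρ t Λ w = multSymbol ρ t w := by
  rw [lowSymbol, highSymbol]; ring

theorem Admissible.rapidFamily_lowSymbol (h : Admissible m a ρ φ) (t : ι → Set.Ioo (0 : ℝ) 1)
    {Λ : ι → ℝ} {c : ℝ} (hc : 0 < c) (hΛ : ∀ p, c ≤ Λ p) :
    RapidFamily Λ (fun p => lowSymbol ρ (t p) (Λ p)) := by
  intro M
  have h0 : ∀ p, 0 < Λ p := fun p => hc.trans_le (hΛ p)
  have h1 := h.germ_multSymbol_one.reindex (fun p : ι × E n => (t p.1, p.2))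
  have h2 : GermBound (fun p : ι × E n => p.2) (fun _ => 1) (fun p => ((1 + ‖p.2‖ / Λ p.1) ^ M)⁻¹)
      (fun p w => cutoff ((Λ p.1)⁻¹ • w)) :=
    (germBound_cutoff_inv_smul h0 M).mono (fun p => (inv_pos.2 (h0 _)).le)
      (fun p => by have := h0 p.1; positivity) 1 c⁻¹ (by simp)
      (fun p => by rw [mul_one]; exact inv_anti₀ hc (hΛ _))
  have h3 := GermBound.mul (W := fun _ => 1) (s := fun _ => 1) h1 h2 (by simp) (by simp)
    (fun p => by have := h0 p.1; positivity)
  simpa using! h3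

/-- For `|w| ≥ Λ` a derivative of `ρ(2πtw)` costs `2πt/⟨2πtw⟩ ≤ 1/|w| ≤ 1/Λ`, uniformly in `t`. For
`|w| < Λ` the function vanishes near the point. -/
theorem Admissible.germ_highSymbol (h : Admissible m a ρ φ) (t : ι → Set.Ioo (0 : ℝ) 1)
    {Λ : ι → ℝ} (hΛ : ∀ p, 0 < Λ p) :
    GermBound (fun p : ι × E n => p.2) (fun p => (Λ p.1)⁻¹) (fun _ => 1)
      (fun p => highSymbol ρ (t p.1) (Λ p.1)) := by
  have hi : ∀ p, 0 ≤ (Λ p)⁻¹ := fun p => (inv_pos.2 (hΛ p)).le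
  refine GermBound.extend (S := {p | Λ p.1 ≤ ‖p.2‖}) ?_ (fun p hp => ?_) (fun p => hi _) (by simp)
  · have h1 : GermBound (fun p : {p : ι × E n | Λ p.1 ≤ ‖p.2‖} => p.1.2) (fun p => (Λ p.1.1)⁻¹)
        (fun _ => 1) (fun p => multSymbol ρ (t p.1.1)) := by
      have h2 := h.germ_mult.reindex (fun p : {p : ι × E n | Λ p.1 ≤ ‖p.2‖} =>
        (t p.1.1 : ℝ) • ((2 * Real.pi) • p.1.2))
      have h3 := GermBound.comp_affine (z := fun p : {p : ι × E n | Λ p.1 ≤ ‖p.2‖} => p.1.2) (fun _ => 0)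
        (fun p => ((t p.1.1 : ℝ) * (2 * Real.pi)) • ContinuousLinearMap.id ℝ (E n)) (f := fun _ => ρ) (by
          convert! h2 using 2 with p
          simp [mul_smul])
      refine (h3.congr fun p => Filter.Eventually.of_forall fun w => ?_).mono (fun p => ?_) (by simp)
        1 1 (by simp) (fun p => ?_)
      · simp [multSymbol, mul_smul]
      · exact mul_nonneg (inv_nonneg.2 (bracket_pos _).le) (norm_nonneg _)
      · have ht : 0 < (t p.1.1 : ℝ) := (t p.1.1).2.1
        have hp := Real.pi_pos
        have h4 : Λ p.1.1 ≤ ‖p.1.2‖ := p.2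
        have h5 := norm_le_bracket ((t p.1.1 : ℝ) • ((2 * Real.pi) • p.1.2))
        rw [← mul_smul, norm_smul, Real.norm_of_nonneg (by positivity), mul_smul] at h5
        simp only [Function.comp_apply, one_mul]
        rw [inv_mul_le_iff₀ (bracket_pos _), norm_smul, Real.norm_of_nonneg (by positivity),
          ← div_eq_mul_inv, le_div_iff₀ (hΛ _)]
        calc _ ≤ (t p.1.1 : ℝ) * (2 * Real.pi) * 1 * ‖p.1.2‖ := by
              refine mul_le_mul le_rfl h4 (hΛ _).le (by positivity) |>.trans' ?_
              exact mul_le_mul_of_nonneg_right (mul_le_mul_of_nonneg_left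
                ContinuousLinearMap.norm_id_le (by positivity)) (hΛ _).le
          _ ≤ _ := by rw [mul_one]; exact h5
    have h2 := ((germBound_cutoff_inv_smul (n := n) hΛ 0).reindex
      (fun p : {p : ι × E n | Λ p.1 ≤ ‖p.2‖} => p.1)).const_mul' (-1)
    have h3 : GermBound (fun p : {p : ι × E n | Λ p.1 ≤ ‖p.2‖} => p.1.2) (fun p => (Λ p.1.1)⁻¹)
        (fun _ => 1) (fun p w => 1 - cutoff ((Λ p.1.1)⁻¹ • w)) := by
      have h4 := GermBound.const (z := fun p : {p : ι × E n | Λ p.1 ≤ ‖p.2‖} => p.1.2)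
        (s := fun p => (Λ p.1.1)⁻¹) (W := fun _ => 1) (fun _ => (1 : ℂ)) (fun p => hi _) (by simp) 1
        (by simp)
      have h5 : GermBound (fun p : {p : ι × E n | Λ p.1 ≤ ‖p.2‖} => p.1.2) (fun p => (Λ p.1.1)⁻¹)
        (fun _ => 1) (fun p w => -1 * cutoff ((Λ p.1.1)⁻¹ • w)) := by simpa using! h2
      refine (h4.add h5).congr fun p => Filter.Eventually.of_forall fun w => ?_
      beta_reduce
      ring
    have h4 := h1.mul h3 (fun p => hi _) (by simp) (by simp)
    simpa using! h4
  · have h1 : ‖(Λ p.1)⁻¹ • p.2‖ < 1 := by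
      rw [norm_smul, Real.norm_of_nonneg (hi _), inv_mul_lt_iff₀ (hΛ _), mul_one]
      exact not_le.1 hp
    filter_upwards [(continuous_const_smul ((Λ p.1)⁻¹)).norm.continuousAt.eventually_lt
      continuousAt_const h1] with w hw
    rw [highSymbol, cutoff_eq_one hw.le, sub_self, mul_zero]

/-- It ensures that truncation does not alter the Taylor coefficients of the multiplier at `θ`. -/
theorem highSymbol_eventuallyEq {t Λ : ℝ} (hΛ : 0 < Λ) {θ : E n} (hθ : 2 * Λ < ‖θ‖) :
    (fun w => highSymbol ρ t Λ (θ + w)) =ᶠ[𝓝 0] fun w => multSymbol ρ t (θ + w) := by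
  have h1 : 2 < ‖Λ⁻¹ • (θ + 0)‖ := by
    rw [add_zero, norm_smul, Real.norm_of_nonneg (inv_pos.2 hΛ).le, lt_inv_mul_iff₀ hΛ, mul_comm]
    exact hθ
  have h2 : ∀ᶠ w in 𝓝 (0 : E n), 2 < ‖Λ⁻¹ • (θ + w)‖ :=
    continuousAt_const.eventually_lt (by fun_prop) h1
  filter_upwards [h2] with w hw
  rw [highSymbol, cutoff_eq_zero hw.le, sub_zero, mul_one]

/-- The exponential of the phase difference. -/
def phaseExp (φ : E n → E n → ℝ) (x ξ z : E n) : ℂ :=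
  Complex.exp (Complex.I * (φ (x + z) ξ - φ x ξ : ℝ))

theorem phaseExp_add (x ξ z y : E n) :
    phaseExp φ x ξ y = phaseExp φ x ξ z * phaseExp φ (x + z) ξ (-z + y) := by
  rw [phaseExp, phaseExp, phaseExp, ← Complex.exp_add, add_assoc x z, add_neg_cancel_left]
  congr 1
  push_cast
  ring

theorem Admissible.phaseIntegral_zero (h : Admissible m a ρ φ) {lam : ℝ} {x w v : E n}
    (hw : 1 < ‖lam • w‖) :
    phaseIntegral φ 0 lam 1 ((x, w), v) = φ (x + v) (lam • w) - φ x (lam • w) := by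
  have h1 := h.taylor_phase (x := x) (v := v) (c := 1) hw 0
  simp at h1
  linarith

/-- The phase is expanded about `x + z` itself, so that only a unimodular factor remembers `x`. The
scale is then `λ` without growth in `z`, in contrast to `fullAmp`. -/
theorem Admissible.germ_phaseExp (h : Admissible m a ρ φ) :
    GermBound (fun p : Freq n × E n => p.2) (fun p => p.1.lam) (fun _ => 1)
      (fun p => phaseExp φ p.1.1.1 p.1.1.2) := by
  have h1 := (h.germ_phaseIntegral 0 (c := fun _ => 1) (by simp) (by simp)).reindex
    (fun p : Freq n × E n => ((⟨(p.1.1.1 + p.2, p.1.1.2), p.1.2⟩, 0) : Freq n × E n))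
  have h2 := GermBound.comp_affine (z := fun p : Freq n × E n => p.2)
    (fun p => ((p.1.1.1 + p.2, p.1.lam⁻¹ • p.1.1.2), -p.2))
    (fun _ => ContinuousLinearMap.inr ℝ (E n × E n) (E n)) (s := fun _ => 1) (W := fun p => p.1.lam)
    (f := fun p => phaseIntegral φ 0 p.1.lam 1) (by
      convert! h1 using 2 with p
      · simp [Freq.pt, Freq.lam]
      · simp [Freq.lam])
  have hl := fun p : Freq n × E n => p.1.lam_pos
  have h3 := GermBound.cexp_I (s := fun p : Freq n × E n => p.1.lam) (fun p => (hl p).le) h2.1 (fun i hi => by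
    obtain ⟨C, hC1, hC⟩ := h2.bound (fun p => by positivity) (fun p => (hl p).le) i
    refine ⟨C, fun p => (hC i le_rfl p).trans ?_⟩
    rw [one_mul]
    have h5 : ‖ContinuousLinearMap.inr ℝ (E n × E n) (E n)‖ ^ i ≤ 1 :=
      pow_le_one₀ (norm_nonneg _) (ContinuousLinearMap.norm_inr_le_one ..)
    have h6 : p.1.lam ≤ p.1.lam ^ i := le_self_pow₀ p.1.one_le_lam (by omega)
    refine mul_le_mul_of_nonneg_left ?_ (by linarith)
    exact (mul_le_of_le_one_right (hl p).le h5).trans h6)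
  refine ((h3.const_mul (fun p => phaseExp φ p.1.1.1 p.1.1.2 p.2)).congr fun p =>
    Filter.Eventually.of_forall fun y => ?_).mono (fun p => (hl p).le) (fun p => by positivity) 1 1
    (fun p => ?_) (by simp)
  · beta_reduce
    rw [phaseExp_add _ _ p.2 y]
    congr 1
    rw [phaseExp, ContinuousLinearMap.inr_apply, Prod.mk_add_mk, add_zero, h.phaseIntegral_zero]
    · simp [(hl p).ne']
    · simpa [(hl p).ne'] using p.1.2
  · rw [phaseExp, mul_comm Complex.I, Complex.norm_exp_ofReal_mul_I]

/-- The coefficients of the vector field which reproduces `phaseExp`. -/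
def phaseField (φ : E n → E n → ℝ) (q : Freq n) (j : Fin n) (z : E n) : ℂ :=
  -Complex.I * ((scaledGrad φ q.lam (q.1.1 + z, q.lam⁻¹ • q.1.2) j *
    (‖scaledGrad φ q.lam (q.1.1 + z, q.lam⁻¹ • q.1.2)‖ ^ 2)⁻¹ : ℝ) : ℂ)

theorem Admissible.germ_scaledGrad_shift (h : Admissible m a ρ φ) :
    GermBound (fun p : Freq n × E n => p.2) (fun _ => 1) (fun _ => 1)
      (fun p z => scaledGrad φ p.1.lam (p.1.1.1 + z, p.1.lam⁻¹ • p.1.1.2)) := by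
  have h1 := h.germ_scaledGrad.reindex
    (fun p : Freq n × E n => (⟨(p.1.1.1 + p.2, p.1.1.2), p.1.2⟩ : Freq n))
  have h2 := GermBound.comp_affine (z := fun p : Freq n × E n => p.2)
    (fun p => (p.1.1.1, p.1.lam⁻¹ • p.1.1.2)) (fun _ => ContinuousLinearMap.inl ℝ (E n) (E n))
    (s := fun _ => 1) (W := fun _ => 1) (f := fun p => scaledGrad φ p.1.lam) (by
      convert! h1 using 2 with p
      simp [Freq.pt, Freq.lam])
  refine (h2.congr fun p => Filter.Eventually.of_forall fun y => ?_).mono (by simp) (by simp) 1 1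
    (by simp) (fun p => by simpa using ContinuousLinearMap.norm_inl_le_one ℝ (E n) (E n))
  simp

theorem Admissible.germ_phaseField (h : Admissible m a ρ φ) (j : Fin n) :
    GermBound (fun p : Freq n × E n => p.2) (fun _ => 1) (fun _ => 1)
      (fun p => phaseField φ p.1 j) := by
  have h1 := h.germ_scaledGrad_shift
  obtain ⟨c, hc, hcb⟩ := h.exists_le_norm_scaledGrad
  have h2 := h1.bilin (innerSL ℝ) h1 (by simp) (by simp) (by simp)
  have h3 : GermBound (fun p : Freq n × E n => p.2) (fun _ => 1) (fun _ => 1)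
      (fun p z => ‖scaledGrad φ p.1.lam (p.1.1.1 + z, p.1.lam⁻¹ • p.1.1.2)‖ ^ 2) := by
    refine (h2.congr fun p => Filter.Eventually.of_forall fun y => ?_).mono (by simp) (by simp) 1 1
      (by simp) (by simp)
    simp only [innerSL_apply_apply ℝ, real_inner_self_eq_norm_sq]
  have h4 := h3.inv_real (by simp) (c := c ^ 2) (by positivity) (fun p => by
    have := hcb (⟨(p.1.1.1 + p.2, p.1.1.2), p.1.2⟩ : Freq n)
    beta_reduce
    gcongr
    exact this)
  have h5 := (h1.clm_comp (fun _ => (EuclideanSpace.proj j : E n →L[ℝ] ℝ))).mono (W' := fun _ => 1)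
    (s' := fun _ => 1) (by simp) (fun p => by positivity) ‖(EuclideanSpace.proj j : E n →L[ℝ] ℝ)‖ 1
    (by simp) (by simp)
  have h6 := (h5.mul_real h4 (by simp) (by simp) (by simp)).clm_comp (fun _ => Complex.ofRealCLM)
  have h7 := h6.const_mul' (-Complex.I)
  refine (h7.congr fun p => Filter.Eventually.of_forall fun y => ?_).mono (by simp)
    (fun p => by simp) 1 1 (by simp) (by simp)
  simp [phaseField]

/-- With `G = ∇_xφ(x+z, ξ)/λ` one has `∂_j e = iλG_j e`, and the field is `-iG_j/|G|²`. -/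
theorem Admissible.lam_mul_phaseExp (h : Admissible m a ρ φ) (q : Freq n) (z : E n) :
    (q.lam : ℂ) * phaseExp φ q.1.1 q.1.2 z =
      ∑ j, phaseField φ q j z * dirDeriv (basisVec j) (phaseExp φ q.1.1 q.1.2) z := by
  have hd := (h.contDiff_slice q.2).differentiable (by simp)
  have hq : 1 < ‖q.lam • (q.1.1 + z, q.lam⁻¹ • q.1.2).2‖ := by
    simpa [q.lam_pos.ne'] using q.2
  obtain ⟨c, hc, hcb⟩ := h.exists_le_norm_scaledGrad
  have h0 : 0 < ‖scaledGrad φ q.lam (q.1.1 + z, q.lam⁻¹ • q.1.2)‖ :=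
    hc.trans_le (hcb (⟨(q.1.1 + z, q.1.2), q.2⟩ : Freq n))
  have hg := h.smul_scaledGrad q.lam_pos.ne' hq
  set G := scaledGrad φ q.lam (q.1.1 + z, q.lam⁻¹ • q.1.2) with hG
  have hd1 : ∀ j, dirDeriv (basisVec j) (phaseExp φ q.1.1 q.1.2) z =
      Complex.I * (q.lam * G j : ℝ) * phaseExp φ q.1.1 q.1.2 z := fun j => by
    have e1 : HasFDerivAt (fun z => φ (q.1.1 + z) q.1.2 - φ q.1.1 q.1.2)
        (fderiv ℝ (fun y => φ y q.1.2) (q.1.1 + z)) z := by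
      have := (hd (q.1.1 + z)).hasFDerivAt.comp z ((hasFDerivAt_id z).const_add q.1.1)
      exact this.sub_const _
    have e2 : HasFDerivAt (phaseExp φ q.1.1 q.1.2) _ z :=
      ((Complex.ofRealCLM.hasFDerivAt.comp z e1).const_mul Complex.I).cexp
    rw [dirDeriv, e2.fderiv]
    have e3 : fderiv ℝ (fun y => φ y q.1.2) (q.1.1 + z) (basisVec j) = q.lam * G j := by
      have e4 : (q.lam • G) j = q.lam * G j := by simp
      rw [← e4, hg, ← inner_gradient, real_inner_comm, EuclideanSpace.inner_single_left]
      simp [q.lam_pos.ne']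
    simp [e3, phaseExp]
    ring
  simp_rw [hd1, phaseField, ← hG]
  have hsum : ∑ j, G j * G j = ‖G‖ ^ 2 := by
    rw [EuclideanSpace.norm_sq_eq]
    exact Finset.sum_congr rfl fun j _ => by rw [Real.norm_eq_abs, sq_abs, sq]
  have : ∀ j, -Complex.I * ((G j * (‖G‖ ^ 2)⁻¹ : ℝ) : ℂ) * (Complex.I * (q.lam * G j : ℝ) *
      phaseExp φ q.1.1 q.1.2 z) = ((G j * G j : ℝ) : ℂ) * (((‖G‖ ^ 2)⁻¹ * q.lam : ℝ) *
        phaseExp φ q.1.1 q.1.2 z) := fun j => by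
    push_cast
    linear_combination (-(G j : ℂ) * ((‖G‖ : ℂ) ^ 2)⁻¹ * (q.lam : ℂ) * (G j : ℂ) *
      phaseExp φ q.1.1 q.1.2 z) * Complex.I_mul_I
  simp_rw [this]
  rw [← Finset.sum_mul, ← Complex.ofReal_sum, hsum, ← mul_assoc, ← Complex.ofReal_mul,
    mul_inv_cancel_left₀ (by positivity)]

end Localization
end FourierIntOp
end

noncomputable section
namespace FourierIntOp

open MeasureTheory FourierTransform

/-! ### The expansion sum and the crude remainder bound. -/

section SupBounds

variable {n : ℕ} {m : ℝ} {a : ℝ → E n → E n → ℂ} {ρ : E n → ℂ} {φ : E n → E n → ℝ}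

/-- A cut-off in `z` makes the amplitude a Schwartz function and the pairing a genuine integral; a
bound uniform in `δ` survives in the limit. -/
theorem Admissible.norm_compAmp_sub_le (h : Admissible m a ρ φ) {t : ℝ} (ht : t ∈ Set.Ioo (0 : ℝ) 1)
    {x ξ : E n} {T : ℂ} {B : ℝ} (hB : ∀ δ ∈ Set.Ioc (0 : ℝ) 1,
      ‖(∫ w, multSymbol ρ t w * 𝓕 (fun z => cutoff (δ • z) * fullAmp φ a t x ξ z) w) - T‖ ≤ B) :
    ‖compAmp φ a ρ t x ξ - T‖ ≤ B := by
  have hbr := bracket_pos ξ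
  have h1 : GermBound (fun p : Set.Ioc (0 : ℝ) 1 × E n => p.2) (fun p => bracket ξ * (1 + ‖p.2‖))
      (fun _ => 1) (fun _ => fullAmp φ a t x ξ) := by
    have h2 := h.germ_fullAmp.reindex (fun p : Set.Ioc (0 : ℝ) 1 × E n =>
      ((⟨t, ht⟩, ((x, ξ), p.2)) : Set.Ioo (0 : ℝ) 1 × ((E n × E n) × E n)))
    have h3 := GermBound.comp_affine (z := fun p : Set.Ioc (0 : ℝ) 1 × E n => p.2)
      (fun _ => ((x, ξ), 0)) (fun _ => ContinuousLinearMap.inr ℝ (E n × E n) (E n))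
      (s := fun p => bracket ξ * (1 + ‖p.2‖)) (W := fun _ => 1)
      (f := fun _ (q : (E n × E n) × E n) => fullAmp φ a t q.1.1 q.1.2 q.2) (by
        convert! h2 using 2 with p
        simp)
    refine (h3.congr fun p => Filter.Eventually.of_forall fun z => ?_).mono (fun p => by positivity)
      (by simp) 1 1 (by simp) (fun p => ?_)
    · simp
    · rw [one_mul]
      exact mul_le_of_le_one_right (by positivity) (ContinuousLinearMap.norm_inr_le_one ..)
  have h1s : ∀ p : Set.Ioc (0 : ℝ) 1 × E n, 1 ≤ bracket ξ * (1 + ‖p.2‖) := fun p =>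
    one_le_mul_of_one_le_of_one_le (one_le_bracket _) (by linarith [norm_nonneg p.2])
  have h2 := (h1.cutoff_mul h1s (by simp) (δ := fun p => p.1) (fun p => by
    rw [abs_of_pos p.1.2.1]; exact p.1.2.2)).bessel_iterate basisVec h1s (by simp) (n + 1)
  obtain ⟨C, hC⟩ := h2.2 0
  have h3 := tendsto_opT_cutoff (h.bddSmooth_multSymbol ht) (b := fullAmp φ a t x ξ)
    (B := C * bracket ξ ^ (2 * (n + 1))) (P := 2 * (n + 1)) (fun δ hδ z => by
      have := hC (⟨δ, hδ⟩, z)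
      rw [norm_iteratedFDeriv_zero] at this
      refine this.trans (le_of_eq ?_)
      beta_reduce
      rw [pow_zero, one_mul, mul_one, mul_pow, mul_assoc]) (h.contDiff_fullAmp_slice ht x ξ)
  refine le_of_tendsto (h3.sub_const T).norm ?_
  filter_upwards [Ioc_mem_nhdsGT one_pos] with δ hδ
  have hsm : ContDiff ℝ ∞ (fun z : E n => cutoff (δ • z) * fullAmp φ a t x ξ z) :=
    (contDiff_cutoff.comp (contDiff_const_smul δ)).mul (h.contDiff_fullAmp_slice ht x ξ)
  have hcs : HasCompactSupport (fun z : E n => cutoff (δ • z) * fullAmp φ a t x ξ z) :=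
    HasCompactSupport.mul_right (hasCompactSupport_cutoff.comp_smul hδ.1.ne')
  have h4 := opT_schwartz (h.bddSmooth_multSymbol ht) (hcs.toSchwartzMap hsm)
  have h5 := hB δ hδ
  exact (congrArg (fun c => ‖c - T‖) h4).le.trans h5

/-- The `k`-th term of the asymptotic expansion. -/
def expSum (φ : E n → E n → ℝ) (a : ℝ → E n → E n → ℂ) (ρ : E n → ℂ) (t : ℝ) (x ξ : E n) (k : ℕ) : ℂ :=
  ((k.factorial : ℝ) : ℂ)⁻¹ * ∑ r : Fin k → Fin n, (-Complex.I * (t : ℂ)) ^ k * expTerm φ a ρ t x ξ r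

/-- Only germs at the origin matter, so neither the cut-off in `z` nor the truncation of the
multiplier is visible. The constants combine as `(2πi)^{-k}(2πt)^k = (-it)^k`. -/
theorem taylorSum_eq_sum_expSum (h : Admissible m a ρ φ) {t : ℝ} {x ξ : E n} {q g : E n → ℂ}
    (hq : q =ᶠ[𝓝 0] fun w => multSymbol ρ t ((2 * Real.pi)⁻¹ • gradient (fun y => φ y ξ) x + w))
    (hg : g =ᶠ[𝓝 0] redAmp φ a t x ξ) (N : ℕ) :
    taylorSum N q g = ∑ k ∈ Finset.range N, expSum φ a ρ t x ξ k := by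
  refine Finset.sum_congr rfl fun k _ => ?_
  rw [expSum]
  congr 1
  refine Finset.sum_congr rfl fun r _ => ?_
  rw [(dirDerivs_congr hq _).eq_of_nhds, (dirDerivs_congr hg _).eq_of_nhds, expTerm]
  have hρ : ContDiff ℝ ∞ ρ := h.bddSmooth_mult.contDiff
  have hpi : (2 * Real.pi : ℝ) ≠ 0 := by positivity
  have e1 := dirDerivs_comp_affine (dirs r) ((t * (2 * Real.pi)) • ContinuousLinearMap.id ℝ (E n))
    (t • gradient (fun y => φ y ξ) x) (y := 0) (f := ρ)
    (hρ.contDiffAt.of_le (by exact_mod_cast le_top))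
  have e2 := dirDerivs_map_smul (dirs r) (t * (2 * Real.pi)) hρ (t • gradient (fun y => φ y ξ) x)
  have e3 : (⇑((t * (2 * Real.pi)) • ContinuousLinearMap.id ℝ (E n)) : E n → E n) =
      fun v => (t * (2 * Real.pi)) • v := by ext v; simp
  rw [map_zero, add_zero, e3, e2, length_dirs] at e1
  have e4 : (fun w => multSymbol ρ t ((2 * Real.pi)⁻¹ • gradient (fun y => φ y ξ) x + w)) =
      fun w => ρ (t • gradient (fun y => φ y ξ) x + (t * (2 * Real.pi)) • w) := by
    ext w
    rw [multSymbol, smul_add, smul_smul (2 * Real.pi), mul_inv_cancel₀ hpi, one_smul, smul_add,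
      smul_smul]
  rw [e4, e1, Complex.real_smul]
  have e5 : (2 * Real.pi * Complex.I : ℂ)⁻¹ ^ k * ((t * (2 * Real.pi)) ^ k : ℝ) =
      (-Complex.I * (t : ℂ)) ^ k := by
    push_cast
    rw [← mul_pow]
    congr 1
    have : (Real.pi : ℂ) ≠ 0 := by exact_mod_cast Real.pi_ne_zero
    rw [mul_inv, Complex.inv_I]
    field_simp
  rw [← e5]
  ring

theorem fullAmp_eq (t : ℝ) (x ξ z : E n) :
    fullAmp φ a t x ξ z = Complex.exp (Complex.I * (inner ℝ ((2 * Real.pi) • ((2 * Real.pi)⁻¹ •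
      gradient (fun y => φ y ξ) x)) z : ℝ)) * redAmp φ a t x ξ z := by
  rw [smul_smul, mul_inv_cancel₀ (by positivity : (2 * Real.pi : ℝ) ≠ 0), one_smul, fullAmp, redAmp,
    mul_left_comm, ← Complex.exp_add]
  congr 2
  push_cast
  ring

theorem cutoff_mul_eventuallyEq {δ : ℝ} (f : E n → ℂ) :
    (fun z => cutoff (δ • z) * f z) =ᶠ[𝓝 0] f := by
  have h2 : ∀ᶠ z in 𝓝 (0 : E n), ‖δ • z‖ < 1 :=
    ContinuousAt.eventually_lt (by fun_prop) continuousAt_const (by simp)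
  filter_upwards [h2] with z hz
  rw [cutoff_eq_one hz.le, one_mul]

theorem integral_mul_fourier_cutoff_fullAmp (q : E n → ℂ) (δ t : ℝ) (x ξ : E n) :
    ∫ w, q w * 𝓕 (fun z => cutoff (δ • z) * fullAmp φ a t x ξ z) w =
      ∫ w, q ((2 * Real.pi)⁻¹ • gradient (fun y => φ y ξ) x + w) *
        𝓕 (fun z => cutoff (δ • z) * redAmp φ a t x ξ z) w := by
  rw [← integral_mul_fourier_char_mul]
  simp_rw [fullAmp_eq, mul_left_comm]

theorem Admissible.germ_cutoff_redAmp (h : Admissible m a ρ φ) :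
    GermBound (fun p : (Par n × Set.Ioc (0 : ℝ) 1) × E n => p.2)
      (fun p => √p.1.1.2.lam * (1 + √p.1.1.2.lam * ‖p.2‖) ^ 2) (fun _ => 1)
      (fun p z => cutoff ((p.1.2 : ℝ) • z) * redAmp φ a p.1.1.1 p.1.1.2.1.1 p.1.1.2.1.2 z) := by
  have h1 := h.germ_redAmp.reindex (fun p : (Par n × Set.Ioc (0 : ℝ) 1) × E n => (p.1.1, p.2))
  refine GermBound.cutoff_mul (δ := fun p : (Par n × Set.Ioc (0 : ℝ) 1) × E n => (p.1.2 : ℝ)) h1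
    (fun p => ?_) (by simp) (fun p => ?_)
  · have h2 : 1 ≤ √p.1.1.2.lam := Real.one_le_sqrt.2 p.1.1.2.one_le_lam
    exact one_le_mul_of_one_le_of_one_le h2 (one_le_pow₀ (by
      have := norm_nonneg p.2
      simp only [le_add_iff_nonneg_right]
      positivity))
  · rw [abs_of_pos p.1.2.2.1]; exact p.1.2.2.2

theorem hasCompactSupport_cutoff_mul {δ : ℝ} (hδ : 0 < δ) (f : E n → ℂ) :
    HasCompactSupport (fun z : E n => cutoff (δ • z) * f z) :=
  HasCompactSupport.mul_right (hasCompactSupport_cutoff.comp_smul hδ.ne')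

/-- The multiplier has scale `t` up to a constant, and the scale `√λ(1+√λ|z|)²` of the reduced
amplitude is at most `λ²(1+|z|)²`. Each order gains `tλ²`, which helps when `t` is below a power of
`λ⁻¹`. -/
theorem Admissible.norm_compAmp_sub_expSum_le_crude (h : Admissible m a ρ φ) (N : ℕ) :
    ∃ C : ℝ, 0 ≤ C ∧ ∀ p : Par n, ‖compAmp φ a ρ p.1 p.2.1.1 p.2.1.2 -
        ∑ k ∈ Finset.range (N + 1), expSum φ a ρ p.1 p.2.1.1 p.2.1.2 k‖ ≤
      C * ((p.1 * p.2.lam ^ 2) ^ (N + 1) * p.2.lam ^ (4 * (n + 1))) := by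
  have hl1 : ∀ p : Par n × Set.Ioc (0 : ℝ) 1, 1 ≤ p.1.2.lam := fun p => p.1.2.one_le_lam
  have hl0 : ∀ p : Par n × Set.Ioc (0 : ℝ) 1, 0 < p.1.2.lam := fun p => p.1.2.lam_pos
  obtain ⟨C, hC0, hC⟩ := norm_integral_sub_taylorSum_le (ι := Par n × Set.Ioc (0 : ℝ) 1)
    (Λ := fun _ => 1) (σ := fun p => p.1.1) (R := fun p => p.1.2.lam ^ 2) (S := fun p => p.1.2.lam ^ 2)
    (q := fun p w => multSymbol ρ p.1.1
      ((2 * Real.pi)⁻¹ • gradient (fun y => φ y p.1.2.1.2) p.1.2.1.1 + w))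
    (g := fun p z => cutoff ((p.2 : ℝ) • z) * redAmp φ a p.1.1 p.1.2.1.1 p.1.2.1.2 z)
    (by simp) (fun p => p.1.1.2.1.le) (fun p => by simpa using p.1.1.2.2.le)
    (fun p => one_le_pow₀ (hl1 p)) (fun p => by have := hl0 p; positivity) (fun p => by simp) 2
    (by
      have h1 := h.germ_multSymbol.reindex (fun p : (Par n × Set.Ioc (0 : ℝ) 1) × E n =>
        (p.1.1.1, (2 * Real.pi)⁻¹ • gradient (fun y => φ y p.1.1.2.1.2) p.1.1.2.1.1 + p.2))
      have h2 := GermBound.comp_affine (z := fun p : (Par n × Set.Ioc (0 : ℝ) 1) × E n => p.2)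
        (fun p => (2 * Real.pi)⁻¹ • gradient (fun y => φ y p.1.1.2.1.2) p.1.1.2.1.1)
        (fun _ => ContinuousLinearMap.id ℝ (E n)) (f := fun p => multSymbol ρ p.1.1.1)
        (s := fun p => p.1.1.1) (W := fun _ => 1) (by simpa using! h1)
      refine h2.mono (fun p => mul_nonneg p.1.1.1.2.1.le (norm_nonneg _)) (by simp) 1 1 (by simp)
        (fun p => ?_)
      rw [one_mul]
      exact mul_le_of_le_one_right p.1.1.1.2.1.le ContinuousLinearMap.norm_id_le)
    (by
      refine h.germ_cutoff_redAmp.mono (fun p => by positivity) (by simp) 1 1 (by simp) (fun p => ?_)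
      have h1 : 1 ≤ √p.1.1.2.lam := Real.one_le_sqrt.2 (hl1 p.1)
      have h2 : √p.1.1.2.lam ^ 2 = p.1.1.2.lam := Real.sq_sqrt (hl0 p.1).le
      rw [one_mul, one_mul]
      calc √p.1.1.2.lam * (1 + √p.1.1.2.lam * ‖p.2‖) ^ 2
          ≤ √p.1.1.2.lam * (√p.1.1.2.lam + √p.1.1.2.lam * ‖p.2‖) ^ 2 := by gcongr
        _ = √p.1.1.2.lam ^ 3 * (1 + ‖p.2‖) ^ 2 := by ring
        _ ≤ √p.1.1.2.lam ^ 4 * (1 + ‖p.2‖) ^ 2 := by gcongr; simp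
        _ = _ := by rw [show (4 : ℕ) = 2 * 2 from rfl, pow_mul, h2])
    (fun p => hasCompactSupport_cutoff_mul p.2.2.1 _) N
  refine ⟨C, hC0, fun p => h.norm_compAmp_sub_le p.1.2 fun δ hδ => ?_⟩
  have h1 := hC (p, ⟨δ, hδ⟩)
  rw [taylorSum_eq_sum_expSum h (t := p.1) (x := p.2.1.1) (ξ := p.2.1.2) Filter.EventuallyEq.rfl
    (cutoff_mul_eventuallyEq _)] at h1
  rw [integral_mul_fourier_cutoff_fullAmp]
  refine h1.trans (le_of_eq ?_)
  rw [← pow_mul]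
  congr 3
  ring

end SupBounds
end FourierIntOp
end

noncomputable section
namespace FourierIntOp

open MeasureTheory FourierTransform

/-! ### The fine remainder bound and decay in `t/⟨ξ⟩`. -/

section FineBounds

variable {n : ℕ} {m : ℝ} {a : ℝ → E n → E n → ℂ} {ρ : E n → ℂ} {φ : E n → E n → ℝ}

theorem Admissible.germ_cutoff_amp (h : Admissible m a ρ φ) :
    GermBound (fun p : (Par n × Set.Ioc (0 : ℝ) 1) × E n => p.2) (fun _ => 1) (fun _ => 1)
      (fun p z => cutoff ((p.1.2 : ℝ) • z) * a p.1.1.1 (p.1.1.2.1.1 + z) p.1.1.2.1.2) := by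
  refine GermBound.cutoff_mul (δ := fun p : (Par n × Set.Ioc (0 : ℝ) 1) × E n => (p.1.2 : ℝ)) ?_
    (by simp) (by simp) (fun p => by rw [abs_of_pos p.1.2.2.1]; exact p.1.2.2.2)
  have h1 := h.germ_symb.reindex (fun p : (Par n × Set.Ioc (0 : ℝ) 1) × E n =>
    (p.1.1.1, (p.1.1.2.1.1 + p.2, p.1.1.2.1.2)))
  have h2 := GermBound.comp_affine (z := fun p : (Par n × Set.Ioc (0 : ℝ) 1) × E n => p.2)
    (fun p => (p.1.1.2.1.1, p.1.1.2.lam⁻¹ • p.1.1.2.1.2))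
    (fun _ => ContinuousLinearMap.inl ℝ (E n) (E n)) (s := fun _ => 1)
    (W := fun p => p.1.1.2.lam ^ m)
    (f := fun p (q : E n × E n) => a p.1.1.1 q.1 (p.1.1.2.lam • q.2)) (by
      convert! h1 using 2 with p
      simp [Freq.lam])
  refine (h2.congr fun p => Filter.Eventually.of_forall fun z => ?_).mono (fun p => by simp)
    (fun p => Real.rpow_nonneg p.1.1.2.lam_pos.le _) 1 1
    (fun p => by simpa using rpow_le_one_of_nonpos p.1.1.2.one_le_lam h.nonpos)
    (fun p => by simpa using ContinuousLinearMap.norm_inl_le_one ℝ (E n) (E n))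
  simp [p.1.1.2.lam_pos.ne']

/-- The fourth root of the size of the frequency. -/
def Freq.nu (q : Freq n) : ℝ := √√q.lam

theorem Freq.one_le_nu (q : Freq n) : 1 ≤ q.nu :=
  Real.one_le_sqrt.2 (Real.one_le_sqrt.2 q.one_le_lam)

theorem Freq.nu_pos (q : Freq n) : 0 < q.nu := zero_lt_one.trans_le q.one_le_nu

theorem Freq.nu_sq (q : Freq n) : q.nu ^ 2 = √q.lam := Real.sq_sqrt (Real.sqrt_nonneg _)

theorem Freq.nu_pow_four (q : Freq n) : q.nu ^ 4 = q.lam := by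
  rw [show (4 : ℕ) = 2 * 2 from rfl, pow_mul, q.nu_sq, Real.sq_sqrt q.lam_pos.le]

/-- As `ν³ ≤ ν⁴ = λ` and `|∇_xφ|` is at least a multiple of `λ`, a small `c` puts the Taylor point
outside the support of the low frequency cut-off. -/
theorem Admissible.exists_lt_norm_gradient (h : Admissible m a ρ φ) :
    ∃ c : ℝ, 0 < c ∧ c ≤ 1 ∧ ∀ q : Freq n,
      2 * (c * q.nu ^ 3) < ‖(2 * Real.pi)⁻¹ • gradient (fun y => φ y q.1.2) q.1.1‖ := by
  obtain ⟨c, hc, hcb⟩ := h.exists_le_norm_scaledGrad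
  have hpi := Real.pi_pos
  refine ⟨min 1 (c / (8 * Real.pi)), by positivity, min_le_left _ _, fun q => ?_⟩
  have hl := q.lam_pos
  have e := h.smul_scaledGrad q.lam_pos.ne' q.one_lt_pt
  have h4 : ‖q.lam • scaledGrad φ q.lam q.pt‖ = ‖gradient (fun y => φ y q.1.2) q.1.1‖ := by
    rw [e, q.lam_smul_pt]; rfl
  rw [norm_smul, Real.norm_of_nonneg (by positivity), ← h4, norm_smul, Real.norm_of_nonneg hl.le]
  have h5 : q.nu ^ 3 ≤ q.lam := by
    rw [← q.nu_pow_four]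
    exact pow_le_pow_right₀ q.one_le_nu (by norm_num)
  calc 2 * (min 1 (c / (8 * Real.pi)) * q.nu ^ 3) ≤ 2 * (c / (8 * Real.pi) * q.lam) := by
        have := q.nu_pos
        have := min_le_right 1 (c / (8 * Real.pi))
        gcongr
    _ = (2 * Real.pi)⁻¹ * (q.lam * c) / 2 := by field_simp; ring
    _ < (2 * Real.pi)⁻¹ * (q.lam * c) := half_lt_self (by positivity)
    _ ≤ _ := by
        have := hcb q
        gcongr

/-- A derivative of the high part costs `(cν³)⁻¹`, one of the reduced amplitude `ν² = √λ`; each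
order gains `ν⁻¹`. The threshold `λ^{3/4}` lies between `λ^{1/2}`, which has to be beaten here, and
`λ`, which has to be avoided in `Admissible.norm_low_le`. -/
theorem Admissible.norm_high_sub_le (h : Admissible m a ρ φ) {c : ℝ} (hc : 0 < c) (hc1 : c ≤ 1)
    (hcθ : ∀ q : Freq n,
      2 * (c * q.nu ^ 3) < ‖(2 * Real.pi)⁻¹ • gradient (fun y => φ y q.1.2) q.1.1‖) (N : ℕ) :
    ∃ C : ℝ, 0 ≤ C ∧ ∀ p : Par n × Set.Ioc (0 : ℝ) 1,
      ‖(∫ w, highSymbol ρ p.1.1 (c * p.1.2.nu ^ 3) w *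
        𝓕 (fun z => cutoff ((p.2 : ℝ) • z) * fullAmp φ a p.1.1 p.1.2.1.1 p.1.2.1.2 z) w) -
        ∑ k ∈ Finset.range (N + 1), expSum φ a ρ p.1.1 p.1.2.1.1 p.1.2.1.2 k‖ ≤
      C * (p.1.2.nu⁻¹) ^ (N + 1) := by
  have hΛ : ∀ p : Par n × Set.Ioc (0 : ℝ) 1, 0 < c * p.1.2.nu ^ 3 := fun p => by
    have := p.1.2.nu_pos; positivity
  obtain ⟨C, hC0, hC⟩ := norm_integral_sub_taylorSum_le (ι := Par n × Set.Ioc (0 : ℝ) 1)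
    (Λ := fun p => c * p.1.2.nu ^ 3) (σ := fun p => (c * p.1.2.nu ^ 3)⁻¹)
    (R := fun p => p.1.2.nu ^ 2) (S := fun p => c⁻¹)
    (q := fun p w => highSymbol ρ p.1.1 (c * p.1.2.nu ^ 3)
      ((2 * Real.pi)⁻¹ • gradient (fun y => φ y p.1.2.1.2) p.1.2.1.1 + w))
    (g := fun p z => cutoff ((p.2 : ℝ) • z) * redAmp φ a p.1.1 p.1.2.1.1 p.1.2.1.2 z)
    hΛ (fun p => (inv_pos.2 (hΛ p)).le) (fun p => le_rfl) (fun p => (one_le_inv₀ hc).2 hc1)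
    (fun p => by positivity) (fun p => by
      rw [inv_mul_cancel_left₀ hc.ne']
      exact pow_le_pow_right₀ p.1.2.one_le_nu (by norm_num)) 2
    (by
      have h1 := (h.germ_highSymbol (fun p : Par n × Set.Ioc (0 : ℝ) 1 => p.1.1) hΛ).reindex
        (fun p : (Par n × Set.Ioc (0 : ℝ) 1) × E n =>
          (p.1, (2 * Real.pi)⁻¹ • gradient (fun y => φ y p.1.1.2.1.2) p.1.1.2.1.1 + p.2))
      have h2 := GermBound.comp_affine (z := fun p : (Par n × Set.Ioc (0 : ℝ) 1) × E n => p.2)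
        (fun p => (2 * Real.pi)⁻¹ • gradient (fun y => φ y p.1.1.2.1.2) p.1.1.2.1.1)
        (fun _ => ContinuousLinearMap.id ℝ (E n))
        (f := fun p => highSymbol ρ p.1.1.1 (c * p.1.1.2.nu ^ 3))
        (s := fun p => (c * p.1.1.2.nu ^ 3)⁻¹) (W := fun _ => 1) (by simpa using! h1)
      refine h2.mono (fun p => mul_nonneg (inv_pos.2 (hΛ p.1)).le (norm_nonneg _)) (by simp) 1 1
        (by simp) (fun p => ?_)
      rw [one_mul]
      exact mul_le_of_le_one_right (inv_pos.2 (hΛ p.1)).le ContinuousLinearMap.norm_id_le)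
    (by
      refine h.germ_cutoff_redAmp.mono (fun p => by positivity) (by simp) 1 (c⁻¹ ^ 2) (by simp)
        (fun p => ?_)
      have h1 := p.1.1.2.one_le_nu
      have h0 := p.1.1.2.nu_pos
      have h2 : 1 + p.1.1.2.nu ^ 2 * ‖p.2‖ ≤ c⁻¹ * (1 + c * p.1.1.2.nu ^ 3 * ‖p.2‖) := by
        have e : c⁻¹ * (1 + c * p.1.1.2.nu ^ 3 * ‖p.2‖) = c⁻¹ + p.1.1.2.nu ^ 3 * ‖p.2‖ := by
          field_simp
        rw [e]
        have h3 : p.1.1.2.nu ^ 2 ≤ p.1.1.2.nu ^ 3 := pow_le_pow_right₀ h1 (by norm_num)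
        exact add_le_add ((one_le_inv₀ hc).2 hc1) (mul_le_mul_of_nonneg_right h3 (norm_nonneg _))
      rw [← p.1.1.2.nu_sq]
      calc _ ≤ p.1.1.2.nu ^ 2 * (c⁻¹ * (1 + c * p.1.1.2.nu ^ 3 * ‖p.2‖)) ^ 2 := by gcongr
        _ = _ := by ring)
    (fun p => hasCompactSupport_cutoff_mul p.2.2.1 _) N
  refine ⟨C * (c⁻¹ ^ (N + 1) * c⁻¹ ^ (2 * (n + 1))), by positivity, fun p => ?_⟩
  have h1 := hC p
  rw [taylorSum_eq_sum_expSum h (t := p.1.1) (x := p.1.2.1.1) (ξ := p.1.2.1.2)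
    (highSymbol_eventuallyEq (hΛ p) (hcθ p.1.2)) (cutoff_mul_eventuallyEq _)] at h1
  rw [integral_mul_fourier_cutoff_fullAmp]
  refine h1.trans (le_of_eq ?_)
  have e : (c * p.1.2.nu ^ 3)⁻¹ * p.1.2.nu ^ 2 = c⁻¹ * p.1.2.nu⁻¹ := by
    have := p.1.2.nu_pos
    field_simp
  rw [e, mul_pow]
  ring

/-- Frequencies up to order `ν³` cannot resonate with a phase of gradient comparable to `λ = ν⁴`:
each integration by parts gains `ν⁻¹`. -/
theorem Admissible.norm_low_le (h : Admissible m a ρ φ) {c : ℝ} (hc : 0 < c) (hc1 : c ≤ 1) (K : ℕ) :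
    ∃ C : ℝ, 0 ≤ C ∧ ∀ p : Par n × Set.Ioc (0 : ℝ) 1,
      ‖∫ w, lowSymbol ρ p.1.1 (c * p.1.2.nu ^ 3) w *
        𝓕 (fun z => cutoff ((p.2 : ℝ) • z) * fullAmp φ a p.1.1 p.1.2.1.1 p.1.2.1.2 z) w‖ ≤
      C * ((p.1.2.nu⁻¹) ^ K * p.1.2.lam ^ (2 * (n + 1))) := by
  have hΛ : ∀ p : Par n × Set.Ioc (0 : ℝ) 1, c ≤ c * p.1.2.nu ^ 3 := fun p =>
    le_mul_of_one_le_right hc.le (one_le_pow₀ p.1.2.one_le_nu)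
  have hl : ∀ p : Par n × Set.Ioc (0 : ℝ) 1, p.1.2.nu⁻¹ * p.1.2.lam = p.1.2.nu ^ 3 := fun p => by
    have := p.1.2.nu_pos
    rw [← p.1.2.nu_pow_four]
    field_simp
  obtain ⟨C, hC0, hC⟩ := norm_integral_mul_fourier_exp_le (ι := Par n × Set.Ioc (0 : ℝ) 1)
    (Λ := fun p => c * p.1.2.nu ^ 3) (lam := fun p => p.1.2.lam) (κ := fun p => p.1.2.nu⁻¹) hc hΛ
    (fun p => p.1.2.one_le_lam)
    (fun p => by
      rw [hl]
      exact mul_le_of_le_one_left (by have := p.1.2.nu_pos; positivity) hc1)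
    (fun p => by rw [hl]; exact one_le_pow₀ p.1.2.one_le_nu)
    (e := fun p => phaseExp φ p.1.2.1.1 p.1.2.1.2)
    (h.germ_phaseExp.reindex (fun p : (Par n × Set.Ioc (0 : ℝ) 1) × E n => (p.1.1.2, p.2)))
    (v := fun p => phaseField φ p.1.2)
    (fun j => (h.germ_phaseField j).reindex
      (fun p : (Par n × Set.Ioc (0 : ℝ) 1) × E n => (p.1.1.2, p.2)))
    (fun p z => h.lam_mul_phaseExp p.1.2 z) K
    (h.rapidFamily_lowSymbol (fun p : Par n × Set.Ioc (0 : ℝ) 1 => p.1.1) hc hΛ)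
    (A := fun p z => cutoff ((p.2 : ℝ) • z) * a p.1.1 (p.1.2.1.1 + z) p.1.2.1.2)
    h.germ_cutoff_amp (fun p => hasCompactSupport_cutoff_mul p.2.2.1 _)
  refine ⟨C, hC0, fun p => ?_⟩
  have h1 := hC p
  simp_rw [mul_assoc, phaseExp] at h1
  simp_rw [fullAmp]
  exact h1

theorem Admissible.norm_compAmp_sub_expSum_le_fine (h : Admissible m a ρ φ) (N : ℕ) :
    ∃ C : ℝ, 0 ≤ C ∧ ∀ p : Par n, ‖compAmp φ a ρ p.1 p.2.1.1 p.2.1.2 -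
        ∑ k ∈ Finset.range (N + 1), expSum φ a ρ p.1 p.2.1.1 p.2.1.2 k‖ ≤
      C * ((p.2.nu⁻¹) ^ (N + 1) * p.2.lam ^ (2 * (n + 1))) := by
  obtain ⟨c, hc, hc1, hcθ⟩ := h.exists_lt_norm_gradient
  obtain ⟨C, hC0, hC⟩ := h.norm_high_sub_le hc hc1 hcθ N
  obtain ⟨D, hD0, hD⟩ := h.norm_low_le hc hc1 (N + 1)
  refine ⟨C + D, by positivity, fun p => h.norm_compAmp_sub_le p.1.2 fun δ hδ => ?_⟩
  have h1 := hC (p, ⟨δ, hδ⟩)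
  have h2 := hD (p, ⟨δ, hδ⟩)
  have hΛ : 0 < c * p.2.nu ^ 3 := by have := p.2.nu_pos; positivity
  have hsm : ContDiff ℝ ∞ (fun z : E n => cutoff (δ • z) * fullAmp φ a p.1 p.2.1.1 p.2.1.2 z) :=
    (contDiff_cutoff.comp (contDiff_const_smul δ)).mul (h.contDiff_fullAmp_slice p.1.2 _ _)
  have hcs := hasCompactSupport_cutoff_mul hδ.1 (fullAmp φ a p.1 p.2.1.1 p.2.1.2)
  have hlow : BddSmooth (lowSymbol ρ p.1 (c * p.2.nu ^ 3)) := by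
    have := (h.rapidFamily_lowSymbol (ι := Unit) (fun _ => p.1) (Λ := fun _ => c * p.2.nu ^ 3) hΛ
      (fun _ => le_rfl) 0).reindex (fun w : E n => ((), w))
    simpa using! this
  have hhigh : BddSmooth (highSymbol ρ p.1 (c * p.2.nu ^ 3)) :=
    GermBound.bddSmooth (B := fun _ => (c * p.2.nu ^ 3)⁻¹) (A := fun _ => 1)
      (q := fun _ => highSymbol ρ p.1 (c * p.2.nu ^ 3)) (fun _ => (inv_pos.2 hΛ).le) (by simp)
      (h.germ_highSymbol (ι := Unit) (fun _ => p.1) (Λ := fun _ => c * p.2.nu ^ 3) (fun _ => hΛ)) ()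
  have key : (∫ w, multSymbol ρ p.1 w *
      𝓕 (fun z => cutoff (δ • z) * fullAmp φ a p.1 p.2.1.1 p.2.1.2 z) w) =
      (∫ w, lowSymbol ρ p.1 (c * p.2.nu ^ 3) w *
        𝓕 (fun z => cutoff (δ • z) * fullAmp φ a p.1 p.2.1.1 p.2.1.2 z) w) +
      ∫ w, highSymbol ρ p.1 (c * p.2.nu ^ 3) w *
        𝓕 (fun z => cutoff (δ • z) * fullAmp φ a p.1 p.2.1.1 p.2.1.2 z) w := by
    refine Eq.trans ?_ (integral_add (integrable_mul_fourier hlow (hcs.toSchwartzMap hsm))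
      (integrable_mul_fourier hhigh (hcs.toSchwartzMap hsm)))
    congr 1
    ext w
    rw [← lowSymbol_add_highSymbol p.1 (c * p.2.nu ^ 3) w, add_mul]
  rw [key, add_sub_assoc, add_mul, add_comm (C * _)]
  refine (norm_add_le _ _).trans (add_le_add h2 (h1.trans ?_))
  refine mul_le_mul_of_nonneg_left (le_mul_of_one_le_right ?_ (one_le_pow₀ p.2.one_le_lam)) hC0
  have := p.2.nu_pos
  positivity

/-- The remainder of the asymptotic expansion. -/
def expRem (φ : E n → E n → ℝ) (a : ℝ → E n → E n → ℂ) (ρ : E n → ℂ) (N : ℕ) (t : ℝ) (x ξ : E n) : ℂ :=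
  compAmp φ a ρ t x ξ - ∑ k ∈ Finset.range N, expSum φ a ρ t x ξ k

theorem Admissible.norm_expRem_le (h : Admissible m a ρ φ) (K : ℕ) :
    ∃ N₀ : ℕ, ∀ N ≥ N₀, ∃ C : ℝ, 0 ≤ C ∧ ∀ p : TPt n,
      ‖expRem φ a ρ N p.1 p.2.1 p.2.2‖ ≤ C * ((p.1 / bracket p.2.2) ^ K) := by
  -- The crude case below uses `4K + 2(n+1)` factors, the fine case `20K + 8(n+1)`; their sum covers
  -- both, and the final 1 makes `N` positive.
  refine ⟨20 * K + 8 * (n + 1) + 4 * K + 2 * (n + 1) + 1, fun N hN => ?_⟩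
  obtain ⟨N, rfl⟩ : ∃ N', N = N' + 1 := ⟨N - 1, by omega⟩
  obtain ⟨C, hC0, hC⟩ := h.norm_compAmp_sub_expSum_le_crude N
  obtain ⟨D, hD0, hD⟩ := h.norm_compAmp_sub_expSum_le_fine N
  refine ⟨max C D, le_max_of_le_left hC0, fun p => ?_⟩
  have ht := p.1.2.1
  have ht1 := p.1.2.2
  have hb := bracket_pos p.2.2
  rcases le_or_gt ‖p.2.2‖ 1 with hξ | hξ
  · have h1 : expRem φ a ρ (N + 1) p.1 p.2.1 p.2.2 = 0 := by
      rw [expRem, compAmp_eq_zero h p.1.2 hξ, zero_sub, neg_eq_zero]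
      refine Finset.sum_eq_zero fun k _ => ?_
      rw [expSum, Finset.sum_eq_zero fun r _ => by
        rw [(h.eventually_expTerm_eq_zero p.1.2 hξ r (x := p.2.1)).self_of_nhds, mul_zero], mul_zero]
    rw [h1, norm_zero]
    have := le_max_of_le_left (c := D) hC0
    positivity
  · have h1 := hC (p.1, ⟨p.2, hξ⟩)
    have h2 := hD (p.1, ⟨p.2, hξ⟩)
    set q : Freq n := ⟨p.2, hξ⟩ with hq
    change _ ≤ _ * ((p.1 / q.lam) ^ K)
    change ‖expRem φ a ρ (N + 1) p.1 p.2.1 p.2.2‖ ≤ C * (((p.1 : ℝ) * q.lam ^ 2) ^ (N + 1) *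
      q.lam ^ (4 * (n + 1))) at h1
    change ‖expRem φ a ρ (N + 1) p.1 p.2.1 p.2.2‖ ≤ D * ((q.nu⁻¹) ^ (N + 1) *
      q.lam ^ (2 * (n + 1))) at h2
    have hl := q.lam_pos
    have hl1 := q.one_le_lam
    have hν := q.nu_pos
    have hν1 := q.one_le_nu
    -- For `tλ⁴ ≤ 1` one has `(tλ²)² ≤ t` and `t² ≤ t/λ`, so the crude bound suffices. Otherwise `t
    -- > λ^{-4}`, so every power of `t/λ` dominates a power of `ν⁻¹`.
    rcases le_or_gt ((p.1 : ℝ) * q.lam ^ 4) 1 with hcase | hcase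
    · refine h1.trans (mul_le_mul (le_max_left _ _) ?_ (by positivity) (le_max_of_le_left hC0))
      have e1 : ((p.1 : ℝ) * q.lam ^ 2) ^ 2 ≤ p.1 := by
        calc _ = (p.1 : ℝ) * (p.1 * q.lam ^ 4) := by ring
          _ ≤ p.1 * 1 := by gcongr
          _ = _ := mul_one _
      have e2 : (p.1 : ℝ) * q.lam ^ 2 ≤ 1 := by
        refine le_trans ?_ hcase
        have := pow_le_pow_right₀ hl1 (show 2 ≤ 4 by norm_num)
        gcongr
      have e3 : (p.1 : ℝ) ^ 2 ≤ p.1 / q.lam := by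
        rw [le_div_iff₀ hl]
        have e4 : q.lam ≤ q.lam ^ 4 := le_self_pow₀ hl1 (by norm_num)
        calc (p.1 : ℝ) ^ 2 * q.lam ≤ p.1 ^ 2 * q.lam ^ 4 := by gcongr
          _ = (p.1 : ℝ) * (p.1 * q.lam ^ 4) := by ring
          _ ≤ p.1 * 1 := by gcongr
          _ = _ := mul_one _
      calc ((p.1 : ℝ) * q.lam ^ 2) ^ (N + 1) * q.lam ^ (4 * (n + 1))
          ≤ ((p.1 : ℝ) * q.lam ^ 2) ^ (2 * (2 * K + (n + 1))) * q.lam ^ (4 * (n + 1)) := by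
            refine mul_le_mul_of_nonneg_right
              (pow_le_pow_of_le_one (by positivity) e2 (by omega)) (by positivity)
        _ = (((p.1 : ℝ) * q.lam ^ 2) ^ 2) ^ (2 * K + (n + 1)) * (q.lam ^ 4) ^ (n + 1) := by
            rw [pow_mul, pow_mul]
        _ ≤ (p.1 : ℝ) ^ (2 * K + (n + 1)) * (q.lam ^ 4) ^ (n + 1) := by gcongr
        _ = ((p.1 : ℝ) ^ 2) ^ K * (p.1 * q.lam ^ 4) ^ (n + 1) := by
            rw [pow_add, pow_mul, mul_pow]; ring
        _ ≤ ((p.1 : ℝ) / q.lam) ^ K * 1 := by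
            gcongr
            exact pow_le_one₀ (by positivity) hcase
        _ = _ := mul_one _
    · refine h2.trans (mul_le_mul (le_max_right _ _) ?_ (by positivity) (le_max_of_le_right hD0))
      -- The number 20 comes from `ν^{20} = λ⁵` and `λ^{-5} < t/λ`.
      have e1 : (q.nu⁻¹) ^ 20 ≤ p.1 / q.lam := by
        rw [le_div_iff₀ hl, inv_pow, inv_mul_le_iff₀ (by positivity)]
        have e2 : q.nu ^ 20 = q.lam ^ 4 * q.lam := by
          rw [← q.nu_pow_four]; ring
        rw [e2]
        calc q.lam = 1 * q.lam := (one_mul _).symm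
          _ ≤ (p.1 * q.lam ^ 4) * q.lam := by gcongr
          _ = _ := by ring
      have e3 : q.nu⁻¹ ≤ 1 := inv_le_one_of_one_le₀ hν1
      calc (q.nu⁻¹) ^ (N + 1) * q.lam ^ (2 * (n + 1))
          ≤ (q.nu⁻¹) ^ (20 * K + 8 * (n + 1)) * q.lam ^ (2 * (n + 1)) := by
            refine mul_le_mul_of_nonneg_right
              (pow_le_pow_of_le_one (by positivity) e3 (by omega)) (by positivity)
        _ = ((q.nu⁻¹) ^ 20) ^ K := by
            rw [pow_add, pow_mul, ← q.nu_pow_four, ← pow_mul (q.nu), mul_assoc,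
              show 4 * (2 * (n + 1)) = 8 * (n + 1) by ring, ← mul_pow, inv_mul_cancel₀ hν.ne',
              one_pow, mul_one]
        _ ≤ _ := by gcongr

end FineBounds
end FourierIntOp
end

noncomputable section
namespace FourierIntOp

open MeasureTheory FourierTransform

/-! ### Interpolation of derivatives. -/

section Interpolation

variable {V F : Type*} [NormedAddCommGroup V] [NormedSpace ℝ V] [NormedAddCommGroup F]
  [NormedSpace ℝ F]

/-- Landau's inequality: a difference over length `r` is at most `2A`, and on the ball the
derivative varies by at most `Br`. -/
theorem norm_iteratedFDeriv_succ_le {f : V → F} (hf : ContDiff ℝ ∞ f) (j : ℕ) {z : V} {r A B : ℝ}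
    (hr : 0 < r) (hA : ∀ z' ∈ Metric.closedBall z r, ‖iteratedFDeriv ℝ j f z'‖ ≤ A)
    (hB : ∀ z' ∈ Metric.closedBall z r, ‖iteratedFDeriv ℝ (j + 2) f z'‖ ≤ B) :
    ‖iteratedFDeriv ℝ (j + 1) f z‖ ≤ 2 * A / r + B * r := by
  have hd : ∀ k : ℕ, Differentiable ℝ (iteratedFDeriv ℝ k f) := fun k =>
    hf.differentiable_iteratedFDeriv (by exact_mod_cast WithTop.coe_lt_top _)
  have hz : z ∈ Metric.closedBall z r := Metric.mem_closedBall_self hr.le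
  have hB0 : 0 ≤ B := (norm_nonneg _).trans (hB z hz)
  have hA0 : 0 ≤ A := (norm_nonneg _).trans (hA z hz)
  have hconv := convex_closedBall z r
  have h1 : ∀ z' ∈ Metric.closedBall z r, ‖fderiv ℝ (iteratedFDeriv ℝ j f) z' -
      fderiv ℝ (iteratedFDeriv ℝ j f) z‖ ≤ B * r := fun z' hz' => by
    have h2 := hconv.norm_image_sub_le_of_norm_fderiv_le (𝕜 := ℝ) (fun y _ => hd (j + 1) y)
      (C := B) (fun y hy => by rw [norm_fderiv_iteratedFDeriv]; exact hB y hy) hz hz'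
    have h3 := (continuousMultilinearCurryLeftEquiv ℝ (fun _ : Fin (j + 1) => V) F).dist_map
      (iteratedFDeriv ℝ (j + 1) f z') (iteratedFDeriv ℝ (j + 1) f z)
    rw [dist_eq_norm (iteratedFDeriv ℝ (j + 1) f z')] at h3
    rw [fderiv_iteratedFDeriv]
    refine ((dist_eq_norm _ _).symm.trans h3).trans_le ?_
    exact h2.trans (mul_le_mul_of_nonneg_left (by simpa [dist_eq_norm] using hz') hB0)
  rw [← norm_fderiv_iteratedFDeriv]
  refine ContinuousLinearMap.opNorm_le_bound _ (by positivity) fun v => ?_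
  rcases eq_or_ne v 0 with rfl | hv
  · simp
  have hv0 : 0 < ‖v‖ := norm_pos_iff.2 hv
  have hmem : z + (r / ‖v‖) • v ∈ Metric.closedBall z r := by
    simp [norm_smul, abs_of_pos hr, hv0.ne']
  have h3 := hconv.norm_image_sub_le_of_norm_fderiv_le' (𝕜 := ℝ) (fun y _ => hd j y) h1 hz hmem
  rw [add_sub_cancel_left, map_smul, norm_smul, Real.norm_of_nonneg (by positivity),
    div_mul_cancel₀ _ hv0.ne'] at h3
  have h4 : ‖(r / ‖v‖) • fderiv ℝ (iteratedFDeriv ℝ j f) z v‖ ≤ 2 * A + B * r * r := by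
    have h5 := hA _ hmem
    have h6 := hA _ hz
    calc _ = ‖(iteratedFDeriv ℝ j f (z + (r / ‖v‖) • v) - iteratedFDeriv ℝ j f z) -
          (iteratedFDeriv ℝ j f (z + (r / ‖v‖) • v) - iteratedFDeriv ℝ j f z -
            (r / ‖v‖) • fderiv ℝ (iteratedFDeriv ℝ j f) z v)‖ := by rw [sub_sub_cancel]
      _ ≤ _ := (norm_sub_le _ _).trans (add_le_add ((norm_sub_le _ _).trans (by linarith)) h3)
  rw [norm_smul, Real.norm_of_nonneg (by positivity), div_mul_eq_mul_div, div_le_iff₀ hv0] at h4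
  have e : (2 * A / r + B * r) * ‖v‖ = ((2 * A + B * r * r) * ‖v‖) / r := by field_simp
  rw [e, le_div_iff₀ hr, mul_comm]
  exact h4

/-- Induction on the order of differentiation: a strong decay at order `j` and a fixed loss at order
`j + 2` give decay at order `j + 1`. The loss `c` must not depend on `N`, because `N` is chosen
after it. -/
theorem norm_iteratedFDeriv_le_of_interpolation {ι : Type*} {f : ℕ → ι → V → F} {u : ι → V → ℝ}
    (hu0 : ∀ p z, 0 < u p z) (hu1 : ∀ p z, u p z ≤ 1)
    (hu : ∀ p z z', ‖z' - z‖ ≤ 1 → u p z ≤ 3 * u p z') (hf : ∀ N p, ContDiff ℝ ∞ (f N p))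
    (h0 : ∀ K : ℕ, ∃ N₀ : ℕ, ∀ N ≥ N₀, ∃ C : ℝ, 0 ≤ C ∧ ∀ p z, ‖f N p z‖ ≤ C * u p z ^ K)
    (h1 : ∀ j : ℕ, ∃ c : ℕ, ∀ N, ∃ C : ℝ, 0 ≤ C ∧ ∀ p z,
      ‖iteratedFDeriv ℝ j (f N p) z‖ ≤ C * (u p z)⁻¹ ^ c) (j : ℕ) :
    ∀ K : ℕ, ∃ N₀ : ℕ, ∀ N ≥ N₀, ∃ C : ℝ, 0 ≤ C ∧ ∀ p z,
      ‖iteratedFDeriv ℝ j (f N p) z‖ ≤ C * u p z ^ K := by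
  induction j with
  | zero => simpa using h0
  | succ j ih =>
    intro K
    obtain ⟨c, hc⟩ := h1 (j + 2)
    obtain ⟨N₀, hN₀⟩ := ih (2 * K + c)
    refine ⟨N₀, fun N hN => ?_⟩
    obtain ⟨C, hC0, hC⟩ := hN₀ N hN
    obtain ⟨D, hD0, hD⟩ := hc N
    refine ⟨2 * (C * 3 ^ (2 * K + c)) + D * 3 ^ c, by positivity, fun p z => ?_⟩
    have hz0 := hu0 p z
    -- The radius `u^{K+c}` balances the two terms: `u^{2K+c}/u^{K+c}` and `u^{-c}u^{K+c}` both
    -- equal `u^K`. As it is at most 1, `u` is comparable to its value at the centre on the whole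
    -- ball.
    have hr : 0 < u p z ^ (K + c) := by positivity
    have hr1 : u p z ^ (K + c) ≤ 1 := pow_le_one₀ hz0.le (hu1 p z)
    have h2 := norm_iteratedFDeriv_succ_le (hf N p) j (z := z) hr
      (A := C * (3 * u p z) ^ (2 * K + c)) (B := D * (3 * (u p z)⁻¹) ^ c) (fun z' hz' => ?_)
      (fun z' hz' => ?_)
    · refine h2.trans (le_of_eq ?_)
      rw [mul_pow, mul_pow, inv_pow, add_mul]
      congr 1
      · rw [div_eq_iff hr.ne', two_mul K, pow_add, pow_add, pow_add]
        ring
      · rw [pow_add]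
        field_simp
    · have h3 : ‖z - z'‖ ≤ 1 := by
        rw [mem_closedBall_iff_norm'] at hz'
        exact hz'.trans hr1
      refine (hC p z').trans ?_
      have := hu p z' z h3
      have := hu0 p z'
      gcongr
    · have h3 : ‖z' - z‖ ≤ 1 := by
        rw [mem_closedBall_iff_norm] at hz'
        exact hz'.trans hr1
      refine (hD p z').trans ?_
      have h4 := hu p z z' h3
      have h5 := hu0 p z'
      have h6 : (u p z')⁻¹ ≤ 3 * (u p z)⁻¹ := by
        rw [← div_eq_mul_inv, inv_eq_one_div, div_le_div_iff₀ h5 hz0]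
        linarith
      gcongr

end Interpolation

/-! ### Symbol estimates for the expansion and its remainder. -/

section Symbols

variable {n : ℕ} {m ε : ℝ} {a : ℝ → E n → E n → ℂ} {ρ : E n → ℂ} {φ : E n → E n → ℝ}

theorem bracket_le_one_add (ξ : E n) : bracket ξ ≤ 1 + ‖ξ‖ := by
  rw [bracket, Real.sqrt_le_left (by positivity)]
  nlinarith [norm_nonneg ξ]

theorem bracket_le_of_norm_sub_le {ξ η : E n} (h : ‖ξ - η‖ ≤ 1) : bracket ξ ≤ 3 * bracket η := by
  have h1 := bracket_le_one_add ξ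
  have h2 := norm_le_bracket η
  have h3 := one_le_bracket η
  have h4 : ‖ξ‖ ≤ ‖ξ - η‖ + ‖η‖ := by simpa using norm_add_le (ξ - η) η
  linarith

theorem rescale_dilate (p : E n × E n) : dilate (bracket p.2)⁻¹ p = rescale p := rfl

theorem norm_dilate_le {lam : ℝ} {c : ℝ} (hc : 1 ≤ c) (h : |lam| ≤ c) :
    ‖(dilate lam : (E n × E n) →L[ℝ] (E n × E n))‖ ≤ c := by
  refine ContinuousLinearMap.opNorm_le_bound _ (by linarith) fun q => ?_
  have h1 : dilate lam q = (q.1, lam • q.2) := rfl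
  rw [h1]
  refine max_le ((norm_fst_le q).trans (le_mul_of_one_le_left (norm_nonneg _) hc)) ?_
  rw [norm_smul, Real.norm_eq_abs]
  exact mul_le_mul h (norm_snd_le q) (norm_nonneg _) (by linarith)

theorem GermBound.of_rescale {f : ℝ → E n → E n → ℂ} {W : TPt n → ℝ} (hW : ∀ p, 0 ≤ W p)
    (hf : GermBound (fun p : TPt n => rescale p.2) (fun _ => 1) W
      (fun p q => f p.1 q.1 (bracket p.2.2 • q.2))) :
    GermBound (fun p : TPt n => p.2) (fun _ => 1) W (fun p q => f p.1 q.1 q.2) := by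
  have h1 := GermBound.comp_affine (z := fun p : TPt n => p.2) (fun _ => 0)
    (fun p => dilate (bracket p.2.2)⁻¹) (s := fun _ => 1) (W := W)
    (f := fun p (q : E n × E n) => f p.1 q.1 (bracket p.2.2 • q.2)) (by
      simpa only [zero_add, rescale_dilate] using hf)
  refine (h1.congr fun p => Filter.Eventually.of_forall fun q => ?_).mono (by simp) hW 1 1 (by simp)
    (fun p => ?_)
  · have h2 : dilate (bracket p.2.2)⁻¹ q = (q.1, (bracket p.2.2)⁻¹ • q.2) := rfl
    simp [h2, (bracket_pos p.2.2).ne']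
  · have h2 := bracket_pos p.2.2
    simpa using norm_dilate_le le_rfl (by
      rw [abs_of_pos (inv_pos.2 h2)]; exact inv_le_one_of_one_le₀ (one_le_bracket p.2.2))

/-- The factor `(-it)^k` turns the weight `t^{k(ε-1)}` of the products into `t^{kε}`. -/
theorem Admissible.germ_expSum (h : Admissible m a ρ φ) (hε : 0 < ε) (hε' : ε < 1 / 2) (k : ℕ) :
    GermBound (fun p : TPt n => rescale p.2) (fun _ => 1)
      (fun p => (p.1 : ℝ) ^ ((k : ℝ) * ε) * bracket p.2.2 ^ (m - k * (1 / 2 - ε)))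
      (fun p q => expSum φ a ρ p.1 q.1 (bracket p.2.2 • q.2) k) := by
  refine GermBound.const_mul' _ (GermBound.sum _ fun r _ => ?_)
  have h1 := (h.germ_expTerm r hε hε').const_mul (fun p => (-Complex.I * ((p.1 : ℝ) : ℂ)) ^ k)
  refine h1.mono (by simp) (fun p => ?_) 1 1 (fun p => ?_) (by simp)
  · have := p.1.2.1
    have := bracket_pos p.2.2
    positivity
  · have ht := p.1.2.1
    have e : ‖(-Complex.I * ((p.1 : ℝ) : ℂ)) ^ k‖ = (p.1 : ℝ) ^ (k : ℝ) := by
      rw [norm_pow, norm_mul, norm_neg, Complex.norm_I, one_mul, Complex.norm_real,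
        Real.norm_of_nonneg ht.le, Real.rpow_natCast]
    rw [e, ← mul_assoc, ← Real.rpow_add ht, one_mul]
    refine le_of_eq ?_
    congr 2
    ring

theorem rpow_mul_rpow_le_one {t b x y : ℝ} (ht : 0 < t) (ht1 : t ≤ 1) (hb : 1 ≤ b) (hx : 0 ≤ x)
    (hy : y ≤ 0) : t ^ x * b ^ y ≤ 1 :=
  mul_le_one₀ (Real.rpow_le_one ht.le ht1 hx) (Real.rpow_nonneg (by linarith) _)
    (rpow_le_one_of_nonpos hb hy)

theorem Admissible.exponent_nonpos (h : Admissible m a ρ φ) (hε' : ε < 1 / 2) (k : ℕ) :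
    m - k * (1 / 2 - ε) ≤ 0 := by
  have h1 := h.nonpos
  have h2 : 0 ≤ (k : ℝ) * (1 / 2 - ε) := mul_nonneg (Nat.cast_nonneg k) (by linarith)
  linarith

/-- The terms of the expansion have bounded derivatives of all orders, so subtracting any number of
them does not worsen the loss in `Admissible.germ_compAmp`. -/
theorem Admissible.germ_expRem (h : Admissible m a ρ φ) (hε : 0 < ε) (hε' : ε < 1 / 2) (N : ℕ) :
    GermBound (fun p : TPt n => p.2) (fun p => bracket p.2.2)
      (fun p => bracket p.2.2 ^ (2 * (n + 1))) (fun p q => expRem φ a ρ N p.1 q.1 q.2) := by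
  have hb := fun p : TPt n => one_le_bracket p.2.2
  have hW : ∀ (k : ℕ) (p : TPt n), 0 ≤ (p.1 : ℝ) ^ ((k : ℝ) * ε) * bracket p.2.2 ^ (m - k * (1 / 2 - ε)) :=
    fun k p => by
      have := p.1.2.1
      have := bracket_pos p.2.2
      positivity
  have h1 := GermBound.sum (Finset.range N) fun k _ =>
    GermBound.of_rescale (f := fun t x ξ => expSum φ a ρ t x ξ k) (hW k) (h.germ_expSum hε hε' k) |>.mono
      (s' := fun p => bracket p.2.2) (W' := fun p => bracket p.2.2 ^ (2 * (n + 1)))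
      (by simp) (hW k) 1 1 (fun p => by
        rw [one_mul]
        exact (rpow_mul_rpow_le_one p.1.2.1 p.1.2.2.le (hb p) (by positivity)
          (h.exponent_nonpos hε' k)).trans (one_le_pow₀ (hb p)))
      (fun p => by simpa using hb p)
  refine (h.germ_compAmp.add (h1.const_mul' (-1))).congr fun p =>
    Filter.Eventually.of_forall fun q => ?_
  beta_reduce
  rw [expRem]
  ring

/-- Interpolation with `u = t/⟨ξ⟩`, which varies by a factor of at most 3 over unit distances; the
fixed loss is `2(n+1) + j`, because `⟨ξ⟩ ≤ u⁻¹`. -/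
theorem Admissible.iteratedFDeriv_expRem_le (h : Admissible m a ρ φ) (hε : 0 < ε) (hε' : ε < 1 / 2)
    (j K : ℕ) : ∃ N₀ : ℕ, ∀ N ≥ N₀, ∃ C : ℝ, 0 ≤ C ∧ ∀ p : TPt n,
      ‖iteratedFDeriv ℝ j (fun q : E n × E n => expRem φ a ρ N p.1 q.1 q.2) p.2‖ ≤
        C * ((p.1 : ℝ) / bracket p.2.2) ^ K := by
  have h1 := norm_iteratedFDeriv_le_of_interpolation (ι := Set.Ioo (0 : ℝ) 1)
    (f := fun N t (q : E n × E n) => expRem φ a ρ N t q.1 q.2)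
    (u := fun t q => (t : ℝ) / bracket q.2) (fun t q => div_pos t.2.1 (bracket_pos _))
    (fun t q => (div_le_one (bracket_pos _)).2 (t.2.2.le.trans (one_le_bracket _)))
    (fun t q q' hq => ?_) (fun N t => ?_) (fun K => ?_) (fun j => ?_) j K
  · obtain ⟨N₀, hN₀⟩ := h1
    refine ⟨N₀, fun N hN => ?_⟩
    obtain ⟨C, hC0, hC⟩ := hN₀ N hN
    exact ⟨C, hC0, fun p => hC p.1 p.2⟩
  · have h2 : ‖q'.2 - q.2‖ ≤ 1 := (norm_snd_le (q' - q)).trans hq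
    have h3 := bracket_le_of_norm_sub_le h2
    have := t.2.1
    rw [div_le_iff₀ (bracket_pos _), mul_assoc, div_mul_eq_mul_div, mul_div_assoc', le_div_iff₀ (bracket_pos _)]
    calc (t : ℝ) * bracket q'.2 ≤ t * (3 * bracket q.2) := by gcongr
      _ = _ := by ring
  · exact contDiff_of_germBound (q := fun t : Set.Ioo (0 : ℝ) 1 => fun q : E n × E n =>
      expRem φ a ρ N t q.1 q.2) (h.germ_expRem hε hε' N) t
  · obtain ⟨N₀, hN₀⟩ := h.norm_expRem_le K
    refine ⟨N₀, fun N hN => ?_⟩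
    obtain ⟨C, hC0, hC⟩ := hN₀ N hN
    exact ⟨C, hC0, fun t q => hC (t, q)⟩
  · refine ⟨2 * (n + 1) + j, fun N => ?_⟩
    obtain ⟨C, hC1, hC⟩ := (h.germ_expRem hε hε' N).bound (fun p => (bracket_pos _).le)
      (fun p => pow_nonneg (bracket_pos _).le _) j
    refine ⟨C, by linarith, fun t q => (hC j le_rfl (t, q)).trans ?_⟩
    have h2 := bracket_pos q.2
    rw [← pow_add, inv_div]
    have h3 : bracket q.2 ≤ bracket q.2 / t := by
      rw [le_div_iff₀ t.2.1]
      exact mul_le_of_le_one_right h2.le t.2.2.le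
    gcongr

/-- The remainder of order `M` is that of a far larger order plus the terms of index at least `M`,
and each of those already has the required size. -/
theorem Admissible.germ_expRem_rescale (h : Admissible m a ρ φ) (hε : 0 < ε) (hε' : ε < 1 / 2)
    (M : ℕ) : GermBound (fun p : TPt n => rescale p.2) (fun _ => 1)
      (fun p => (p.1 : ℝ) ^ ((M : ℝ) * ε) * bracket p.2.2 ^ (m - M * (1 / 2 - ε)))
      (fun p q => expRem φ a ρ M p.1 q.1 (bracket p.2.2 • q.2)) := by
  have hcd : ∀ (N : ℕ) (t : Set.Ioo (0 : ℝ) 1),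
      ContDiff ℝ ∞ (fun q : E n × E n => expRem φ a ρ N t q.1 q.2) := fun N t =>
    contDiff_of_germBound (q := fun t : Set.Ioo (0 : ℝ) 1 => fun q : E n × E n =>
      expRem φ a ρ N t q.1 q.2) (h.germ_expRem hε hε' N) t
  have hcdr : ∀ (N : ℕ) (t : Set.Ioo (0 : ℝ) 1) (lam : ℝ),
      ContDiff ℝ ∞ (fun q : E n × E n => expRem φ a ρ N t q.1 (lam • q.2)) := fun N t lam =>
    (hcd N t).comp (f := fun q : E n × E n => (q.1, lam • q.2)) (by fun_prop)
  refine ⟨fun p => (hcdr M p.1 _).contDiffAt, fun j => ?_⟩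
  -- Of these powers of `t/λ`, `j` compensate the factor `λ^j` from rescaling the frequency, `⌈-m⌉`
  -- give `λ^m`, and `M` cover both `t^{Mε}` and `λ^{-M(1/2-ε)}`.
  obtain ⟨N₀, hN₀⟩ := h.iteratedFDeriv_expRem_le hε hε' j (⌈-m⌉₊ + j + M)
  obtain ⟨C, hC0, hC⟩ := hN₀ (N₀ + M) (by omega)
  have hW : ∀ (k : ℕ) (p : TPt n), 0 ≤ (p.1 : ℝ) ^ ((k : ℝ) * ε) * bracket p.2.2 ^ (m - k * (1 / 2 - ε)) :=
    fun k p => by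
      have := p.1.2.1
      have := bracket_pos p.2.2
      positivity
  have hsum := GermBound.sum (Finset.Ico M (N₀ + M)) fun k hk =>
    (h.germ_expSum hε hε' k).mono (s' := fun _ => 1)
      (W' := fun p => (p.1 : ℝ) ^ ((M : ℝ) * ε) * bracket p.2.2 ^ (m - M * (1 / 2 - ε)))
      (by simp) (hW k) 1 1 (fun p => by
        have hMk : (M : ℝ) ≤ k := by exact_mod_cast (Finset.mem_Ico.1 hk).1
        have h2 := bracket_pos p.2.2
        rw [one_mul]
        refine mul_le_mul (Real.rpow_le_rpow_of_exponent_ge p.1.2.1 p.1.2.2.le ?_)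
          (Real.rpow_le_rpow_of_exponent_le (one_le_bracket _) ?_) (by positivity)
          (Real.rpow_nonneg p.1.2.1.le _)
        · gcongr
        · have : (M : ℝ) * (1 / 2 - ε) ≤ k * (1 / 2 - ε) :=
            mul_le_mul_of_nonneg_right hMk (by linarith)
          linarith) (by simp)
  obtain ⟨D, hD⟩ := hsum.2 j
  refine ⟨C + D, fun p => ?_⟩
  set lam := bracket p.2.2 with hlam
  have hl0 : 0 < lam := bracket_pos _
  have hl1 : 1 ≤ lam := one_le_bracket _
  have ht := p.1.2.1
  have ht1 := p.1.2.2
  have hsplit : (fun q : E n × E n => expRem φ a ρ M p.1 q.1 (lam • q.2)) =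
      (fun q : E n × E n => expRem φ a ρ (N₀ + M) p.1 q.1 (lam • q.2)) +
        fun q => ∑ k ∈ Finset.Ico M (N₀ + M), expSum φ a ρ p.1 q.1 (lam • q.2) k := by
    ext q
    have e := Finset.sum_range_add_sum_Ico (fun k => expSum φ a ρ p.1 q.1 (lam • q.2) k)
      (show M ≤ N₀ + M by omega)
    simp only [Pi.add_apply, expRem]
    rw [← e]
    ring
  beta_reduce
  rw [hsplit, iteratedFDeriv_add_apply ((hcdr _ p.1 lam).contDiffAt.of_le (by exact_mod_cast le_top))
    ((hsum.1 p).of_le (by exact_mod_cast le_top)), add_mul]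
  refine (norm_add_le _ _).trans (add_le_add ?_ (hD p))
  have h1 := ContDiffAt.norm_iteratedFDeriv_comp_affine_le (0 : E n × E n) (dilate lam)
    (x := rescale p.2) (f := fun q : E n × E n => expRem φ a ρ (N₀ + M) p.1 q.1 q.2)
    (hcd _ p.1).contDiffAt j
  have e1 : (0 : E n × E n) + dilate lam (rescale p.2) = p.2 := by
    have h2 : dilate lam (rescale p.2) = (p.2.1, lam • (bracket p.2.2)⁻¹ • p.2.2) := rfl
    rw [zero_add, h2, ← hlam, smul_smul, mul_inv_cancel₀ hl0.ne', one_smul]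
  have e2 : (fun y : E n × E n => expRem φ a ρ (N₀ + M) p.1 ((0 : E n × E n) + dilate lam y).1
      ((0 : E n × E n) + dilate lam y).2) =
      fun q : E n × E n => expRem φ a ρ (N₀ + M) p.1 q.1 (lam • q.2) := by
    ext y
    rw [zero_add]
    rfl
  rw [e1] at h1
  rw [e2] at h1
  refine h1.trans ?_
  have h2 : ‖(dilate lam : (E n × E n) →L[ℝ] (E n × E n))‖ ^ j ≤ lam ^ j :=
    pow_le_pow_left₀ (norm_nonneg _) (norm_dilate_le hl1 (abs_of_pos hl0).le) j
  refine (mul_le_mul (hC p) h2 (by positivity) (by positivity)).trans ?_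
  rw [mul_assoc, one_pow, mul_one]
  refine mul_le_mul_of_nonneg_left ?_ hC0
  have hceil : -m ≤ (⌈-m⌉₊ : ℝ) := Nat.le_ceil _
  have hM0 : (0 : ℝ) ≤ M := Nat.cast_nonneg M
  have e3 : ((p.1 : ℝ) / lam) ^ (⌈-m⌉₊ + j + M) * lam ^ j =
      (p.1 : ℝ) ^ (((⌈-m⌉₊ + j + M : ℕ) : ℝ)) * lam ^ (-((⌈-m⌉₊ + M : ℕ) : ℝ)) := by
    rw [Real.rpow_natCast, Real.rpow_neg hl0.le, Real.rpow_natCast, div_pow,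
      show ⌈-m⌉₊ + j + M = (⌈-m⌉₊ + M) + j by ring, pow_add lam]
    field_simp
  rw [e3]
  refine mul_le_mul (Real.rpow_le_rpow_of_exponent_ge ht ht1.le ?_)
    (Real.rpow_le_rpow_of_exponent_le hl1 ?_) (by positivity) (by positivity)
  · push_cast
    have : (0 : ℝ) ≤ (⌈-m⌉₊ : ℝ) := Nat.cast_nonneg _
    have : (0 : ℝ) ≤ j := Nat.cast_nonneg j
    nlinarith
  · push_cast
    nlinarith

/-- The remainder of order zero is `compAmp` itself; `1/4` is just one admissible value of `ε`. -/
theorem Admissible.exists_norm_compAmp_le (h : Admissible m a ρ φ) :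
    ∃ C : ℝ, ∀ t ∈ Set.Ioo (0 : ℝ) 1, ∀ x ξ : E n, ‖compAmp φ a ρ t x ξ‖ ≤ C := by
  obtain ⟨C, hC⟩ := (h.germ_expRem_rescale (ε := 1 / 4) (by norm_num) (by norm_num) 0).2 0
  refine ⟨max C 0, fun t ht x ξ => ?_⟩
  have h1 := hC (⟨t, ht⟩, (x, ξ))
  simp only [norm_iteratedFDeriv_zero, pow_zero, mul_one, rescale, smul_smul,
    mul_inv_cancel₀ (bracket_pos ξ).ne', one_smul, expRem, Finset.range_zero, Finset.sum_empty,
    sub_zero] at h1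
  refine h1.trans ((mul_le_mul_of_nonneg_right (le_max_left _ 0) ?_).trans
    (mul_le_of_le_one_right (le_max_right _ _) ?_))
  · have := bracket_pos ξ
    have := ht.1
    positivity
  · exact rpow_mul_rpow_le_one ht.1 ht.2.le (one_le_bracket ξ) (by simp)
      (h.exponent_nonpos (by norm_num) 0)

/-- The multi-index of a tuple of directions. -/
def tupleIndex {k : ℕ} (r : Fin k → Fin n) (i : Fin n) : ℕ := (Finset.univ.filter fun j => r j = i).card

theorem tupleIndex_mem {k : ℕ} (r : Fin k → Fin n) :
    tupleIndex r ∈ Finset.piAntidiag (Finset.univ : Finset (Fin n)) k := by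
  rw [Finset.mem_piAntidiag]
  refine ⟨?_, fun i _ => Finset.mem_univ i⟩
  have := Finset.card_eq_sum_card_fiberwise (f := r) (s := Finset.univ) (t := Finset.univ) (by simp)
  change ∑ i, (Finset.univ.filter fun j => r j = i).card = k
  simpa using this.symm

/-- The part of multi-index `α` of the `k`-th term of the asymptotic expansion. -/
def expPart (φ : E n → E n → ℝ) (a : ℝ → E n → E n → ℂ) (ρ : E n → ℂ) (k : ℕ) (α : Fin n → ℕ)
    (t : ℝ) (x ξ : E n) : ℂ :=
  (((multiFactorial α : ℝ) * (k.factorial : ℝ)⁻¹ : ℝ) : ℂ) *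
    ∑ r : Fin k → Fin n with tupleIndex r = α, (-Complex.I) ^ k * expTerm φ a ρ t x ξ r

/-- Tuples of directions are grouped by their multi-index; the factor `α!/k!` in `expPart` converts
the normalisation `1/α!` of the theorem into the `1/k!` of Taylor's formula. -/
theorem sum_expPart (t : ℝ) (x ξ : E n) (k : ℕ) :
    ∑ α ∈ Finset.piAntidiag (Finset.univ : Finset (Fin n)) k,
      ((t ^ order α / (multiFactorial α : ℝ) : ℝ) : ℂ) * expPart φ a ρ (order α) α t x ξ =
    expSum φ a ρ t x ξ k := by
  rw [expSum, ← Finset.sum_fiberwise_of_maps_to (g := tupleIndex) (fun r _ => tupleIndex_mem r),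
    Finset.mul_sum]
  refine Finset.sum_congr rfl fun α hα => ?_
  have hk : order α = k := by simpa [order] using (Finset.mem_piAntidiag.1 hα).1
  subst hk
  have h0 : (multiFactorial α : ℂ) ≠ 0 := by
    rw [Nat.cast_ne_zero, multiFactorial]
    exact Finset.prod_ne_zero_iff.2 fun i _ => Nat.factorial_ne_zero _
  rw [expPart, Finset.mul_sum, Finset.mul_sum, Finset.mul_sum]
  refine Finset.sum_congr rfl fun r _ => ?_
  push_cast
  rw [mul_pow]
  field_simp

theorem expSum_zero (t : ℝ) (x ξ : E n) :
    expSum φ a ρ t x ξ 0 = ρ (t • gradient (fun y => φ y ξ) x) * a t x ξ := by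
  simp [expSum, expTerm, dirs, dirDerivs, redAmp]

theorem Admissible.germ_expPart (h : Admissible m a ρ φ) (hε : 0 < ε) (hε' : ε < 1 / 2) (k : ℕ)
    (α : Fin n → ℕ) :
    GermBound (fun p : TPt n => rescale p.2) (fun _ => 1)
      (fun p => p.1 ^ ((k : ℝ) * (ε - 1)) * bracket p.2.2 ^ (m - k * (1 / 2 - ε)))
      (fun p q => expPart φ a ρ k α p.1 q.1 (bracket p.2.2 • q.2)) :=
  GermBound.const_mul' _ (GermBound.sum _ fun r _ => (h.germ_expTerm r hε hε').const_mul' _)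

end Symbols
end FourierIntOp
end

/-! ### The main theorem. -/

open FourierIntOp in
theorem mainTheorem3 (n : ℕ) (m ε : ℝ) (hm : m ≤ 0) (hε : 0 < ε) (hε' : ε < 1 / 2)
    (a : ℝ → E n → E n → ℂ) (ρ : E n → ℂ) (φ : E n → E n → ℝ)
    (ha : IsUniformSymbol m 1 0 a)
    (hasupp : ∀ t ∈ Set.Ioo (0 : ℝ) 1,
      tsupport (fun p : E n × E n => a t p.1 p.2) ⊆ highFreq n)
    (hρ : IsSymbol 0 1 0 (fun _ ξ : E n => ρ ξ))
    (hφ : ContDiffOn ℝ ∞ (fun p : E n × E n => φ p.1 p.2) (highFreq n))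
    (hgrad : ∃ C₁ > (0 : ℝ), ∃ C₂ > (0 : ℝ), ∀ x ξ : E n, (x, ξ) ∈ highFreq n →
      C₁ * ‖ξ‖ ≤ ‖gradient (fun y => φ y ξ) x‖ ∧ ‖gradient (fun y => φ y ξ) x‖ ≤ C₂ * ‖ξ‖)
    (hφx : ∀ α : Fin n → ℕ, 1 ≤ order α → ∃ C : ℝ, ∀ x ξ : E n, (x, ξ) ∈ highFreq n →
      |multiDeriv α (fun y => φ y ξ) x| ≤ C * bracket ξ)
    (hφxξ : ∀ α β : Fin n → ℕ, 1 ≤ order α → 1 ≤ order β →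
      ∃ C : ℝ, ∀ x ξ : E n, (x, ξ) ∈ highFreq n →
        |mixedDeriv α β φ x ξ| ≤ C * ‖ξ‖ ^ (1 - (order α : ℝ))) :
    ∃ σ : ℝ → E n → E n → ℂ,
      (∀ t ∈ Set.Ioo (0 : ℝ) 1, ∀ x ξ : E n,
        HasOscIntegral (compositionIntegrand φ (a t) ρ t x ξ) (σ t x ξ)) ∧
      (∀ t ∈ Set.Ioo (0 : ℝ) 1, ∀ f : 𝓢(E n, ℂ),
        MultiplierEq (fun ξ => ρ (t • ξ)) (fio φ (a t) f) (fio φ (σ t) f)) ∧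
      ∃ s : (Fin n → ℕ) → ℝ → E n → E n → ℂ,
        (∀ α : Fin n → ℕ, 0 < order α → ∀ t ∈ Set.Ioo (0 : ℝ) 1,
          ContDiff ℝ ∞ (fun p : E n × E n => s α t p.1 p.2)) ∧
        (∀ α : Fin n → ℕ, 0 < order α → ∀ β γ : Fin n → ℕ,
          ∃ C : ℝ, ∀ t ∈ Set.Ioo (0 : ℝ) 1, ∀ x ξ : E n,
            ‖mixedDeriv γ β (s α t) x ξ‖ ≤
              C * t ^ ((order α : ℝ) * (ε - 1)) *
                bracket ξ ^ (m - (order α : ℝ) * (1 / 2 - ε) - (order γ : ℝ))) ∧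
        ∀ M : ℕ, 1 ≤ M → ∃ r : ℝ → E n → E n → ℂ,
          IsUniformSymbol (m - (M : ℝ) * (1 / 2 - ε)) 1 0 r ∧
          ∀ t ∈ Set.Ioo (0 : ℝ) 1, ∀ x ξ : E n,
            σ t x ξ =
              ρ (t • gradient (fun y => φ y ξ) x) * a t x ξ +
              (∑ k ∈ Finset.Ico 1 M, ∑ α ∈ Finset.piAntidiag (Finset.univ : Finset (Fin n)) k,
                ((t ^ order α / (multiFactorial α : ℝ) : ℝ) : ℂ) * s α t x ξ) +
              ((t ^ ((M : ℝ) * ε) : ℝ) : ℂ) * r t x ξ := by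
  have h : Admissible m a ρ φ := ⟨hm, ha, hasupp, hρ, hφ, hgrad, hφx, hφxξ⟩
  obtain ⟨C, hC⟩ := h.exists_norm_compAmp_le
  refine ⟨compAmp φ a ρ, fun t ht x ξ => h.hasOscIntegral_compAmp ht x ξ, fun t ht f =>
    h.multiplierEq_compAmp ht ?_ (hC t ht) f, fun α => expPart φ a ρ (order α) α,
    fun α _ t ht => contDiff_of_germ_rescale (h.germ_expPart hε hε' (order α) α) ht,
    fun α _ β γ => ?_, fun M hM => ?_⟩
  · exact (contDiff_of_germBound (q := fun (t : Set.Ioo (0 : ℝ) 1) (q : E n × E n) =>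
      compAmp φ a ρ t q.1 q.2) h.germ_compAmp ⟨t, ht⟩).continuous
  · obtain ⟨C, hC⟩ := mixedDeriv_le_of_germ_rescale (h.germ_expPart hε hε' (order α) α) γ β
    refine ⟨C, fun t ht x ξ => (hC (⟨t, ht⟩, (x, ξ))).trans (le_of_eq ?_)⟩
    rw [Real.rpow_sub (bracket_pos ξ) _ (order γ : ℝ), Real.rpow_natCast, inv_pow]
    ring
  -- The symbol `r` is the remainder divided by `t^{Mε}`, the factor contained in the weight of
  -- `Admissible.germ_expRem_rescale`.
  · have hr := (h.germ_expRem_rescale hε hε' M).const_mul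
      (fun p => (((p.1 : ℝ) ^ ((M : ℝ) * ε) : ℝ) : ℂ)⁻¹)
    have hr' : GermBound (fun p : TPt n => rescale p.2) (fun _ => 1)
        (fun p => bracket p.2.2 ^ (m - M * (1 / 2 - ε)))
        (fun p q => (fun t x ξ => (((t : ℝ) ^ ((M : ℝ) * ε) : ℝ) : ℂ)⁻¹ * expRem φ a ρ M t x ξ)
          p.1 q.1 (bracket p.2.2 • q.2)) := by
      refine hr.mono (by simp) (fun p => ?_) 1 1 (fun p => ?_) (by simp)
      · have := p.1.2.1
        have := bracket_pos p.2.2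
        positivity
      · have h1 : 0 < (p.1 : ℝ) ^ ((M : ℝ) * ε) := Real.rpow_pos_of_pos p.1.2.1 _
        rw [norm_inv, Complex.norm_real, Real.norm_of_nonneg h1.le, inv_mul_cancel_left₀ h1.ne',
          one_mul]
    refine ⟨fun t x ξ => (((t : ℝ) ^ ((M : ℝ) * ε) : ℝ) : ℂ)⁻¹ * expRem φ a ρ M t x ξ,
      ⟨fun t ht => contDiff_of_germ_rescale (f := fun t x ξ =>
        (((t : ℝ) ^ ((M : ℝ) * ε) : ℝ) : ℂ)⁻¹ * expRem φ a ρ M t x ξ) hr' ht, fun γ β => ?_⟩, fun t ht x ξ => ?_⟩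
    · obtain ⟨C, hC⟩ := mixedDeriv_le_of_germ_rescale (f := fun t x ξ =>
        (((t : ℝ) ^ ((M : ℝ) * ε) : ℝ) : ℂ)⁻¹ * expRem φ a ρ M t x ξ) hr' γ β
      refine ⟨C, fun t ht x ξ => (hC (⟨t, ht⟩, (x, ξ))).trans (le_of_eq ?_)⟩
      rw [one_mul, zero_mul, add_zero, Real.rpow_sub (bracket_pos ξ) _ (order γ : ℝ),
        Real.rpow_natCast, inv_pow]
      ring
    · have h1 : ((t ^ ((M : ℝ) * ε) : ℝ) : ℂ) ≠ 0 := by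
        exact_mod_cast (Real.rpow_pos_of_pos ht.1 _).ne'
      simp_rw [sum_expPart]
      -- The term `k = 0` of the expansion is the leading term; splitting it off leaves the sum over
      -- `1 ≤ k < M`.
      rw [mul_inv_cancel_left₀ h1, expRem, ← expSum_zero, Finset.range_eq_Ico,
        Finset.sum_eq_sum_Ico_succ_bot (by omega : 0 < M)]
      ring
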